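/- **Setting.** Let $G\rightrightarrows X$ be a complex Lie groupoid (source $s$, target $t$, multiplication $m$; finite-dimensional Hausdorff second countable complex manifolds, holomorphic structure maps, $s,t$ submersions). Identify $T^{1,0}$ with the holomorphic tangent bundle. Let $H\subset T^{1,0}G$ be a multiplicative holomorphic contact structure: a holomorphic hyperplane distribution with non-degenerate curvature $(\xi,\eta)\mapsto[\xi,\eta]\bmod H$ which is a subgroupoid of $T^{1,0}G\rightrightarrows T^{1,0}X$ and satisfies $ds(H)=T^{1,0}X$. Then $(G,H)$ is called a holomorphic contact groupoid. Put $L_G=T^{1,0}G/H$, with the quotient groupoid structure over the zero bundle $0_X$, let $L\to X$ be its core (its restriction to the units), and let $L_G^*,L^*$ be the complex duals. The dual groupoid $L_G^*\rightrightarrows L^*$, with $\langle\varepsilon_1\varepsilon_2,v\cdot w\rangle=\langle\varepsilon_1,v\rangle+\langle\varepsilon_2,w\rangle$, restricts to a groupoid $\widetilde G=L_G^*\smallsetminus 0\rightrightarrows L^*\smallsetminus 0$ and descends to a groupoid $\widehat G\rightrightarrows\widehat M$, where $\widehat G$, $\widehat M$ are the bundles of real lines (real projective bundles) of $L_G^*$,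 $L^*$. Let $q:\widehat G\to G$ and $p:\widetilde G\to G$ be the projections, and let $\widehat L_G\to\widehat G$ be the dual of the tautological real line bundle. A section $\lambda$ of $\widehat L_G$ corresponds to the function $\widetilde\lambda(\varepsilon)=\langle\varepsilon,\lambda\rangle$ on $\widetilde G$, homogeneous of degree one under $\mathbb R^\times$. Let $D\widehat L_G$ be the gauge algebroid, whose fibre at $x$ consists of the derivations $\Delta:\Gamma(\widehat L_G)\to(\widehat L_G)_x$, and let $\sigma$ be the symbol map. An *Atiyah $(1,1)$-tensor* is a smooth vector bundle endomorphism of $D\widehat L_G$. A tangent vector $v$ at $\varepsilon\in\widetilde G$ induces the derivation $p_Tv$ with $\langle\varepsilon,(p_Tv)\lambda\rangle=v(\widetilde\lambda)$. Let $\widehat\jmath_G$ be the Atiyah $(1,1)$-tensor whose homogenization is the complex structure $j_{\widetilde G}$ of $\widetilde G$, i.e. $p_T\circ j_{\widetilde G}=\widehat\jmath_G\circ p_T$. Let $\widehat H=\ker\widehat\theta$, where $\widehat\theta$ is the $\widehat L_G$-valued one-form $\langle\varepsilon,\widehat\theta(v)\rangle=\operatorname{Re}\langle\varepsilon,dq(v)\bmod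 H\rangle$. Equivalently, $\widehat H$ is the contact structure whose symplectization is $\operatorname{Re}\Omega$, where $\Omega=d\widetilde\Theta$, $\widetilde\Theta_\varepsilon(v)=\langle\varepsilon,dp(v)\bmod H\rangle$, is the complex symplectic form of the symplectization $\widetilde G$ of $(G,H)$. **Groupoid structures and multiplicativity.** Let $\widehat G^{(2)}$ be the manifold of composable pairs and identify $m^*\widehat L_G$ with the pull-backs of $\widehat L_G$ along the two projections $\mathrm{pr}_i:\widehat G^{(2)}\to\widehat G$ by $\langle\varepsilon_1\varepsilon_2,\cdot\rangle\leftrightarrow\langle\varepsilon_i,\cdot\rangle$. Then $\Delta_1,\Delta_2$ in $D\widehat L_G$ are composable with product $\Delta$ if they are the images of a common derivation in $D(m^*\widehat L_G)$ under $\mathrm{pr}_1,\mathrm{pr}_2$ and $m$, respectively. In the first jet bundle $\mathfrak J^1\widehat L_G=\operatorname{Hom}(D\widehat L_G,\widehat L_G)$, $\psi_1,\psi_2$ are composable with product $\psi$ if $\langle\psi,\Delta_1\Delta_2\rangle=\langle\psi_1,\Delta_1\rangle\cdot\langle\psi_2,\Delta_2\rangle$ for all composable $\Delta_1,\Delta_2$;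 here the product in $\widehat L_G$ is $\langle\varepsilon_1\varepsilon_2,\ell_1\cdot\ell_2\rangle=\langle\varepsilon_1,\ell_1\rangle+\langle\varepsilon_2,\ell_2\rangle$. An Atiyah $(1,1)$-tensor $N$ is *multiplicative* if $(\Delta,\psi)\mapsto\langle\psi,N\Delta\rangle$ is a groupoid map $D\widehat L_G\times_{\widehat G}\mathfrak J^1\widehat L_G\to\widehat L_G$. **Contact-Nijenhuis.** Let $\omega=d_D(\widehat\theta\circ\sigma)$, where $d_D$ is the differential of $D\widehat L_G$ with coefficients in $\widehat L_G$. The pair $(\widehat H,N)$ is *contact-Nijenhuis* if $\widehat H$ is a contact structure, $\omega$ is non-degenerate with inverse $J$, $J$ is a Jacobi structure on $\widehat L_G$ (i.e. $\{\lambda,\mu\}=J(d_D\lambda,d_D\mu)$ is a Lie bracket), the Nijenhuis torsion of $N$ vanishes, and for all sections $\psi,\chi$ of $\mathfrak J^1\widehat L_G$ $$J(\psi,N^\dagger\chi)+J(\chi,N^\dagger\psi)=0,$$ $$\mathcal L_{J^\sharp\psi}N^\dagger\chi-\mathcal L_{J^\sharp\chi}N^\dagger\psi-d_DJ(N^\dagger\psi,\chi)=N^\dagger[\psi,\chi]_J,$$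 where $N^\dagger$ is the transpose of $N$, $J(\psi,\chi)=\langle\chi,J^\sharp\psi\rangle$ and $[\psi,\chi]_J=\mathcal L_{J^\sharp\psi}\chi-\mathcal L_{J^\sharp\chi}\psi-d_DJ(\psi,\chi)$. **Proposition.** There is a unique Atiyah $(1,1)$-tensor $\widehat\jmath_G$ on $\widehat L_G$ whose homogenization is $j_{\widetilde G}$. It satisfies $\widehat\jmath_G^{\,2}=-1$ and it is multiplicative. Moreover $(\widehat G,\widehat H,\widehat\jmath_G)$ is a contact-Nijenhuis groupoid: $\widehat G\rightrightarrows\widehat M$ is a (smooth, real) Lie groupoid, $(\widehat H,\widehat\jmath_G)$ is a contact-Nijenhuis structure, $\widehat H$ is multiplicative (a subgroupoid of $T\widehat G\rightrightarrows T\widehat M$ with $d\widehat s(\widehat H)=T\widehat M$, where $\widehat s$ is the source of $\widehat G$), and $\widehat\jmath_G$ is multiplicative. -/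

import Mathlib

open scoped Manifold ContDiff Topology LinearAlgebra.Projectivization
open Set

noncomputable section

/-- A holomorphic line bundle over a complex manifold `B`, given by its fibres `V b` (complex lines)
together with a family of local frames covering `B` whose mutual ratios are holomorphic. -/
structure HolLineBundle (E : Type*) [NormedAddCommGroup E] [NormedSpace ℂ E]
    {B : Type*} [TopologicalSpace B] [ChartedSpace E B]
    (V : B → Type*) [∀ b, AddCommGroup (V b)] [∀ b, Module ℂ (V b)] where
  /-- Pairs of an open set and a section of `V`, of which only the values on that set matter. -/
  frames : Set (Set B × (∀ b, V b))
  isOpen : ∀ φ ∈ frames, IsOpen φ.1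
  ne_zero : ∀ φ ∈ frames, ∀ b ∈ φ.1, φ.2 b ≠ 0
  exists_frame : ∀ b, ∃ φ ∈ frames, b ∈ φ.1
  smul_mem : ∀ φ ∈ frames, ∀ u : ℂ, u ≠ 0 → (φ.1, fun b => u • φ.2 b) ∈ frames
  rank_one : ∀ b, Module.finrank ℂ (V b) = 1
  transition : ∀ φ ∈ frames, ∀ ψ ∈ frames, ∃ c : B → ℂ,
    ContMDiffOn 𝓘(ℂ, E) 𝓘(ℂ) ω c (φ.1 ∩ ψ.1) ∧ ∀ b ∈ φ.1 ∩ ψ.1, φ.2 b = c b • ψ.2 b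

namespace HolLineBundle

variable {E : Type*} [NormedAddCommGroup E] [NormedSpace ℂ E]
  {B : Type*} [TopologicalSpace B] [ChartedSpace E B]
  {V : B → Type*} [∀ b, AddCommGroup (V b)] [∀ b, Module ℂ (V b)]

/-- The complement of the zero section in the total space of the line bundle. -/
@[ext] structure Slit (𝓛 : HolLineBundle E V) where
  base : B
  vec : V base
  ne_zero : vec ≠ 0

/-- The real projective bundle of the line bundle, regarded as a real vector bundle of rank two. -/
@[ext] structure RProj (𝓛 : HolLineBundle E V) where
  base : B
  line : ℙ ℝ (V base)

/-- The quotient of two vectors in a complex line: `v = ratio θ v • θ` whenever `θ ≠ 0`. -/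
def ratio {b : B} (θ v : V b) : ℂ := Classical.epsilon fun c => v = c • θ

/-- The slope of the real line spanned by `z` in the plane `ℂ`. -/
def slope (z : ℂ) : ℝ := z.im / z.re

theorem ratio_smul (𝓛 : HolLineBundle E V) {b : B} {θ : V b} (hθ : θ ≠ 0) (v : V b) : ratio θ v • θ = v := by
  have h : ∃ c : ℂ, v = c • θ := by
    obtain ⟨c, hc⟩ := (finrank_eq_one_iff_of_nonzero' θ hθ).1 (𝓛.rank_one b) v
    exact ⟨c, hc.symm⟩
  exact (Classical.epsilon_spec h).symm

theorem ratio_eq (𝓛 : HolLineBundle E V) {b : B} {θ v : V b} (hθ : θ ≠ 0) {c : ℂ} (h : v = c • θ) : ratio θ v = c := by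
  have h1 := 𝓛.ratio_smul hθ v
  rw [h] at h1
  rw [h]
  by_contra hne
  have : (ratio θ (c • θ) - c) • θ = 0 := by rw [sub_smul, h1, sub_self]
  rcases smul_eq_zero.1 this with h2 | h2
  · exact hne (sub_eq_zero.1 h2)
  · exact hθ h2

theorem exists_ne_zero (𝓛 : HolLineBundle E V) (b : B) : ∃ v : V b, v ≠ 0 := by
  obtain ⟨φ, hφ, hb⟩ := 𝓛.exists_frame b
  exact ⟨φ.2 b, 𝓛.ne_zero φ hφ b hb⟩

/-- An auxiliary nonzero vector in the fibre over `b`, used as a junk value. -/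
def someVec (𝓛 : HolLineBundle E V) (b : B) : V b := (𝓛.exists_ne_zero b).choose

theorem someVec_ne_zero (𝓛 : HolLineBundle E V) (b : B) : 𝓛.someVec b ≠ 0 := (𝓛.exists_ne_zero b).choose_spec

open Classical in
/-- `v` itself if it is nonzero, an arbitrary nonzero vector otherwise. -/
def fixVec (𝓛 : HolLineBundle E V) {b : B} (v : V b) : V b := if v = 0 then 𝓛.someVec b else v

theorem fixVec_ne_zero (𝓛 : HolLineBundle E V) {b : B} (v : V b) : 𝓛.fixVec v ≠ 0 := by
  unfold fixVec
  split_ifs with h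
  · exact 𝓛.someVec_ne_zero b
  · exact h

theorem fixVec_eq (𝓛 : HolLineBundle E V) {b : B} {v : V b} (h : v ≠ 0) : 𝓛.fixVec v = v := by
  simp [fixVec, h]

/-- The chart `(b, c • θ_b) ↦ (e b, c)` of the slit total space given by a chart `e` of the base and
a frame `θ`. -/
def slitChart (𝓛 : HolLineBundle E V) (e : OpenPartialHomeomorph B E) (φ : Set B × (∀ b, V b)) (hφ : φ ∈ 𝓛.frames) :
    PartialEquiv 𝓛.Slit (E × ℂ) where
  toFun ε := (e ε.base, ratio (φ.2 ε.base) ε.vec)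
  invFun p := ⟨e.symm p.1, 𝓛.fixVec (p.2 • φ.2 (e.symm p.1)), 𝓛.fixVec_ne_zero _⟩
  source := {ε | ε.base ∈ e.source ∧ ε.base ∈ φ.1}
  target := {p | p.1 ∈ e.target ∧ e.symm p.1 ∈ φ.1 ∧ p.2 ≠ 0}
  map_source' := by
    rintro ⟨b, v, hv⟩ ⟨h1, h2⟩
    simp only [mem_ofPred_eq] at h1 h2 ⊢
    refine ⟨e.map_source h1, by rwa [e.left_inv h1], fun h0 => hv ?_⟩
    rw [← 𝓛.ratio_smul (𝓛.ne_zero φ hφ b h2) v, h0, zero_smul]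
  map_target' := by
    rintro ⟨y, c⟩ ⟨h1, h2, h3⟩
    exact ⟨e.map_target h1, h2⟩
  left_inv' := by
    rintro ⟨b, v, hv⟩ ⟨h1, h2⟩
    have key : ∀ b' (hb : b' = b), 𝓛.fixVec (ratio (φ.2 b) v • φ.2 b') ≍ v := by
      rintro b' rfl
      rw [𝓛.ratio_smul (𝓛.ne_zero φ hφ _ h2) v, 𝓛.fixVec_eq hv]
    exact Slit.ext (e.left_inv h1) (key _ (e.left_inv h1))
  right_inv' := by
    rintro ⟨y, c⟩ ⟨h1, h2, h3⟩
    have h4 := 𝓛.ne_zero φ hφ _ h2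
    have h5 : 𝓛.fixVec (c • φ.2 (e.symm y)) = c • φ.2 (e.symm y) :=
      𝓛.fixVec_eq (smul_ne_zero h3 h4)
    exact Prod.ext (e.right_inv h1) (𝓛.ratio_eq h4 h5)

theorem slope_smul {r : ℝ} (hr : r ≠ 0) (z : ℂ) : slope (r * z) = slope z := by
  simp only [slope, Complex.re_ofReal_mul, Complex.im_ofReal_mul]
  exact mul_div_mul_left _ _ hr

theorem mk_eq_of_slope (𝓛 : HolLineBundle E V) {b : B} {θ v : V b} (hθ : θ ≠ 0) (hv : v ≠ 0)
    (hre : (ratio θ v).re ≠ 0) (h' : (1 + (slope (ratio θ v) : ℂ) * Complex.I) • θ ≠ 0) :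
    Projectivization.mk ℝ ((1 + (slope (ratio θ v) : ℂ) * Complex.I) • θ) h' =
      Projectivization.mk ℝ v hv := by
  rw [Projectivization.mk_eq_mk_iff']
  refine ⟨(ratio θ v).re⁻¹, ?_⟩
  have hz := 𝓛.ratio_smul hθ v
  generalize ratio θ v = z at *
  rw [← hz, ← Complex.coe_smul, smul_smul]
  congr 1
  apply Complex.ext
  · simp [slope, hre]
  · simp [slope]; field_simp

theorem one_add_smul_ne_zero {b : B} {θ : V b} (hθ : θ ≠ 0) (y : ℝ) :
    (1 + (y : ℂ) * Complex.I) • θ ≠ 0 := by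
  refine smul_ne_zero (fun h => ?_) hθ
  have := congrArg Complex.re h
  simp at this

/-- The ratio of representatives of a real line changes by a real factor. -/
theorem ratio_rep (𝓛 : HolLineBundle E V) {b : B} {θ v : V b} (hθ : θ ≠ 0) (hv : v ≠ 0) :
    ∃ r : ℝ, r ≠ 0 ∧ ratio θ (Projectivization.mk ℝ v hv).rep = r * ratio θ v := by
  obtain ⟨a, ha⟩ := Projectivization.exists_smul_eq_mk_rep ℝ v hv
  refine ⟨a, a.ne_zero, 𝓛.ratio_eq hθ ?_⟩
  rw [← ha, mul_smul, 𝓛.ratio_smul hθ v, Complex.coe_smul]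
  rfl

/-- The chart `(b, [(1 + i y) • θ_b]) ↦ (e b, y)` of the real projective bundle given by a chart `e`
of the base and a frame `θ`. -/
def projChart (𝓛 : HolLineBundle E V) (e : OpenPartialHomeomorph B E) (φ : Set B × (∀ b, V b)) (hφ : φ ∈ 𝓛.frames) :
    PartialEquiv 𝓛.RProj (E × ℝ) where
  toFun x := (e x.base, slope (ratio (φ.2 x.base) x.line.rep))
  invFun p := ⟨e.symm p.1, Projectivization.mk ℝ
    (𝓛.fixVec ((1 + (p.2 : ℂ) * Complex.I) • φ.2 (e.symm p.1))) (𝓛.fixVec_ne_zero _)⟩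
  source := {x | x.base ∈ e.source ∧ x.base ∈ φ.1 ∧ (ratio (φ.2 x.base) x.line.rep).re ≠ 0}
  target := {p | p.1 ∈ e.target ∧ e.symm p.1 ∈ φ.1}
  map_source' := by
    rintro ⟨b, l⟩ ⟨h1, h2, h3⟩
    exact ⟨e.map_source h1, by simpa [e.left_inv h1] using h2⟩
  map_target' := by
    rintro ⟨y, c⟩ ⟨h1, h2⟩
    refine ⟨e.map_target h1, h2, ?_⟩
    have h4 := 𝓛.ne_zero φ hφ _ h2
    obtain ⟨r, hr, h⟩ := 𝓛.ratio_rep h4 (𝓛.fixVec_ne_zero ((1 + (c : ℂ) * Complex.I) • φ.2 (e.symm y)))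
    have h6 := 𝓛.ratio_eq h4 (𝓛.fixVec_eq (one_add_smul_ne_zero h4 c))
    simp only at h ⊢
    rw [h, h6]
    simp [hr]
  left_inv' := by
    rintro ⟨b, l⟩ ⟨h1, h2, h3⟩
    have key : ∀ b' (hb : b' = b), Projectivization.mk ℝ
        (𝓛.fixVec ((1 + (slope (ratio (φ.2 b) l.rep) : ℂ) * Complex.I) • φ.2 b'))
          (𝓛.fixVec_ne_zero _) ≍ l := by
      rintro b' rfl
      have h4 := 𝓛.ne_zero φ hφ _ h2
      have h5 := one_add_smul_ne_zero h4 (slope (ratio (φ.2 b') l.rep))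
      have h6 := 𝓛.mk_eq_of_slope h4 l.rep_nonzero h3 h5
      rw [Projectivization.mk_rep] at h6
      refine heq_of_eq (Eq.trans ?_ h6)
      congr 1
      exact 𝓛.fixVec_eq h5
    exact RProj.ext (e.left_inv h1) (key _ (e.left_inv h1))
  right_inv' := by
    rintro ⟨y, c⟩ ⟨h1, h2⟩
    refine Prod.ext (e.right_inv h1) ?_
    have h4 := 𝓛.ne_zero φ hφ _ h2
    obtain ⟨r, hr, h⟩ := 𝓛.ratio_rep h4 (𝓛.fixVec_ne_zero ((1 + (c : ℂ) * Complex.I) • φ.2 (e.symm y)))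
    have h6 := 𝓛.ratio_eq h4 (𝓛.fixVec_eq (one_add_smul_ne_zero h4 c))
    simp only at h ⊢
    rw [h, h6, slope_smul hr]
    simp [slope]

/-! Change of charts. -/

section Transition

variable [IsManifold 𝓘(ℂ, E) ω B]

theorem contDiffOn_base {e e' : OpenPartialHomeomorph B E} (he : e ∈ atlas E B)
    (he' : e' ∈ atlas E B) :
    ContDiffOn ℂ ω (fun y => e' (e.symm y)) (e.target ∩ e.symm ⁻¹' e'.source) := by
  rw [← contMDiffOn_iff_contDiffOn]
  have h1 := contMDiffOn_of_mem_maximalAtlas (I := 𝓘(ℂ, E)) (n := ω)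
    (IsManifold.subset_maximalAtlas he')
  have h2 := contMDiffOn_symm_of_mem_maximalAtlas (I := 𝓘(ℂ, E)) (n := ω)
    (IsManifold.subset_maximalAtlas he)
  exact h1.comp (h2.mono inter_subset_left) (fun y hy => hy.2)

theorem contDiffOn_comp_symm {e : OpenPartialHomeomorph B E} (he : e ∈ atlas E B)
    {c : B → ℂ} {U : Set B} (hc : ContMDiffOn 𝓘(ℂ, E) 𝓘(ℂ) ω c U) :
    ContDiffOn ℂ ω (fun y => c (e.symm y)) (e.target ∩ e.symm ⁻¹' U) := by
  rw [← contMDiffOn_iff_contDiffOn]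
  have h2 := contMDiffOn_symm_of_mem_maximalAtlas (I := 𝓘(ℂ, E)) (n := ω)
    (IsManifold.subset_maximalAtlas he)
  exact hc.comp (h2.mono inter_subset_left) (fun y hy => hy.2)

theorem slit_open (𝓛 : HolLineBundle E V) {e e' : OpenPartialHomeomorph B E}
    {φ φ' : Set B × (∀ b, V b)} (hφ : φ ∈ 𝓛.frames) (hφ' : φ' ∈ 𝓛.frames) :
    IsOpen ((𝓛.slitChart e φ hφ).symm.trans (𝓛.slitChart e' φ' hφ')).source := by
  have : ((𝓛.slitChart e φ hφ).symm.trans (𝓛.slitChart e' φ' hφ')).source =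
      ((e.target ∩ e.symm ⁻¹' (φ.1 ∩ (e'.source ∩ φ'.1))) ×ˢ {c : ℂ | c ≠ 0}) := by
    ext ⟨y, c⟩
    simp [slitChart, PartialEquiv.trans_source]
    tauto
  rw [this]
  refine IsOpen.prod ?_ isOpen_ne
  exact e.symm.isOpen_inter_preimage
    ((𝓛.isOpen φ hφ).inter (e'.open_source.inter (𝓛.isOpen φ' hφ')))

theorem slit_contDiffOn (𝓛 : HolLineBundle E V) {e e' : OpenPartialHomeomorph B E}
    (he : e ∈ atlas E B) (he' : e' ∈ atlas E B)
    {φ φ' : Set B × (∀ b, V b)} (hφ : φ ∈ 𝓛.frames) (hφ' : φ' ∈ 𝓛.frames) :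
    ContDiffOn ℂ ω ((𝓛.slitChart e φ hφ).symm.trans (𝓛.slitChart e' φ' hφ'))
      ((𝓛.slitChart e φ hφ).symm.trans (𝓛.slitChart e' φ' hφ')).source := by
  obtain ⟨c, hc, hcφ⟩ := 𝓛.transition φ hφ φ' hφ'
  have h1 := contDiffOn_base he he'
  have h2 := contDiffOn_comp_symm he hc
  have h3 : ContDiffOn ℂ ω (fun p : E × ℂ => (e' (e.symm p.1), p.2 * c (e.symm p.1)))
      ((𝓛.slitChart e φ hφ).symm.trans (𝓛.slitChart e' φ' hφ')).source := by
    refine ContDiffOn.prodMk ?_ (contDiffOn_snd.mul ?_)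
    · refine h1.comp contDiffOn_fst ?_
      rintro ⟨y, z⟩ ⟨h, h'⟩
      exact ⟨h.1, h'.1⟩
    · refine h2.comp contDiffOn_fst ?_
      rintro ⟨y, z⟩ ⟨h, h'⟩
      exact ⟨h.1, h.2.1, h'.2⟩
  refine h3.congr ?_
  rintro ⟨y, z⟩ ⟨h, h'⟩
  refine Prod.ext rfl ?_
  have hy : e.symm y ∈ φ.1 := h.2.1
  have hy' : e.symm y ∈ φ'.1 := h'.2
  have hz : z ≠ 0 := h.2.2
  refine 𝓛.ratio_eq (𝓛.ne_zero φ' hφ' _ hy') ?_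
  change 𝓛.fixVec (z • φ.2 (e.symm y)) = _
  rw [𝓛.fixVec_eq (smul_ne_zero hz (𝓛.ne_zero φ hφ _ hy)), hcφ _ ⟨hy, hy'⟩, smul_smul]

theorem proj_trans_source (𝓛 : HolLineBundle E V) {e e' : OpenPartialHomeomorph B E}
    {φ φ' : Set B × (∀ b, V b)} (hφ : φ ∈ 𝓛.frames) (hφ' : φ' ∈ 𝓛.frames)
    {c : B → ℂ} (hcφ : ∀ b ∈ φ.1 ∩ φ'.1, φ.2 b = c b • φ'.2 b) {p : E × ℝ}
    (h1 : e.symm p.1 ∈ φ.1) (h2 : e.symm p.1 ∈ φ'.1) :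
    ∃ r : ℝ, r ≠ 0 ∧ ratio (φ'.2 (e.symm p.1)) ((𝓛.projChart e φ hφ).symm p).line.rep =
      r * ((1 + (p.2 : ℂ) * Complex.I) * c (e.symm p.1)) := by
  have h4 := 𝓛.ne_zero φ hφ _ h1
  have h5 := 𝓛.ne_zero φ' hφ' _ h2
  obtain ⟨r, hr, h⟩ := 𝓛.ratio_rep h5
    (𝓛.fixVec_ne_zero ((1 + (p.2 : ℂ) * Complex.I) • φ.2 (e.symm p.1)))
  refine ⟨r, hr, ?_⟩
  have h6 : ratio (φ'.2 (e.symm p.1)) (𝓛.fixVec ((1 + (p.2 : ℂ) * Complex.I) • φ.2 (e.symm p.1)))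
      = (1 + (p.2 : ℂ) * Complex.I) * c (e.symm p.1) := by
    refine 𝓛.ratio_eq h5 ?_
    rw [𝓛.fixVec_eq (one_add_smul_ne_zero h4 p.2), hcφ _ ⟨h1, h2⟩, smul_smul]
  rw [h6] at h
  exact h

theorem proj_source_eq (𝓛 : HolLineBundle E V) {e e' : OpenPartialHomeomorph B E}
    {φ φ' : Set B × (∀ b, V b)} (hφ : φ ∈ 𝓛.frames) (hφ' : φ' ∈ 𝓛.frames)
    {c : B → ℂ} (hcφ : ∀ b ∈ φ.1 ∩ φ'.1, φ.2 b = c b • φ'.2 b) :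
    ((𝓛.projChart e φ hφ).symm.trans (𝓛.projChart e' φ' hφ')).source =
      ((e.target ∩ e.symm ⁻¹' (φ.1 ∩ (e'.source ∩ φ'.1))) ×ˢ univ) ∩
        {p : E × ℝ | ((1 + (p.2 : ℂ) * Complex.I) * c (e.symm p.1)).re ≠ 0} := by
  ext p
  constructor
  · rintro ⟨⟨h1, h2⟩, h3, h4, h5⟩
    refine ⟨⟨⟨h1, h2, h3, h4⟩, mem_univ _⟩, ?_⟩
    obtain ⟨r, hr, h⟩ := 𝓛.proj_trans_source (e' := e') hφ hφ' hcφ (p := p) h2 h4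
    intro h0
    apply h5
    change (ratio (φ'.2 (e.symm p.1)) ((𝓛.projChart e φ hφ).symm p).line.rep).re = 0
    rw [h, Complex.re_ofReal_mul, h0, mul_zero]
  · rintro ⟨⟨⟨h1, h2, h3, h4⟩, -⟩, h5⟩
    refine ⟨⟨h1, h2⟩, h3, h4, ?_⟩
    obtain ⟨r, hr, h⟩ := 𝓛.proj_trans_source (e' := e') hφ hφ' hcφ (p := p) h2 h4
    change (ratio (φ'.2 (e.symm p.1)) ((𝓛.projChart e φ hφ).symm p).line.rep).re ≠ 0
    rw [h, Complex.re_ofReal_mul]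
    exact mul_ne_zero hr h5

theorem proj_contDiffOn_aux (𝓛 : HolLineBundle E V) {e e' : OpenPartialHomeomorph B E}
    (he : e ∈ atlas E B) {φ φ' : Set B × (∀ b, V b)}
    {c : B → ℂ} (hc : ContMDiffOn 𝓘(ℂ, E) 𝓘(ℂ) ω c (φ.1 ∩ φ'.1)) :
    ContDiffOn ℝ ∞ (fun p : E × ℝ => (1 + (p.2 : ℂ) * Complex.I) * c (e.symm p.1))
      ((e.target ∩ e.symm ⁻¹' (φ.1 ∩ (e'.source ∩ φ'.1))) ×ˢ univ) := by
  have h2 : ContDiffOn ℝ ∞ (fun y => c (e.symm y)) (e.target ∩ e.symm ⁻¹' (φ.1 ∩ φ'.1)) :=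
    ((contDiffOn_comp_symm he hc).restrict_scalars ℝ).of_le le_top
  refine ContDiffOn.mul ?_ (h2.comp contDiffOn_fst ?_)
  · refine ContDiff.contDiffOn ?_
    have : ContDiff ℝ ∞ (fun p : E × ℝ => (p.2 : ℂ)) :=
      Complex.ofRealCLM.contDiff.comp contDiff_snd
    fun_prop
  · rintro p ⟨⟨h1, h2, h3, h4⟩, -⟩
    exact ⟨h1, h2, h4⟩

theorem proj_open (𝓛 : HolLineBundle E V) {e e' : OpenPartialHomeomorph B E}
    (he : e ∈ atlas E B)
    {φ φ' : Set B × (∀ b, V b)} (hφ : φ ∈ 𝓛.frames) (hφ' : φ' ∈ 𝓛.frames) :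
    IsOpen ((𝓛.projChart e φ hφ).symm.trans (𝓛.projChart e' φ' hφ')).source := by
  obtain ⟨c, hc, hcφ⟩ := 𝓛.transition φ hφ φ' hφ'
  rw [𝓛.proj_source_eq hφ hφ' hcφ]
  have h := (𝓛.proj_contDiffOn_aux (e' := e') he hc).continuousOn
  have ho : IsOpen ((e.target ∩ e.symm ⁻¹' (φ.1 ∩ (e'.source ∩ φ'.1))) ×ˢ (univ : Set ℝ)) :=
    (e.symm.isOpen_inter_preimage
      ((𝓛.isOpen φ hφ).inter (e'.open_source.inter (𝓛.isOpen φ' hφ')))).prod isOpen_univ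
  exact (Complex.continuous_re.comp_continuousOn h).isOpen_inter_preimage ho isOpen_ne

theorem proj_contDiffOn (𝓛 : HolLineBundle E V) {e e' : OpenPartialHomeomorph B E}
    (he : e ∈ atlas E B) (he' : e' ∈ atlas E B)
    {φ φ' : Set B × (∀ b, V b)} (hφ : φ ∈ 𝓛.frames) (hφ' : φ' ∈ 𝓛.frames) :
    ContDiffOn ℝ ∞ ((𝓛.projChart e φ hφ).symm.trans (𝓛.projChart e' φ' hφ'))
      ((𝓛.projChart e φ hφ).symm.trans (𝓛.projChart e' φ' hφ')).source := by
  obtain ⟨c, hc, hcφ⟩ := 𝓛.transition φ hφ φ' hφ'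
  rw [𝓛.proj_source_eq hφ hφ' hcφ]
  have h1 : ContDiffOn ℝ ∞ (fun y => e' (e.symm y)) (e.target ∩ e.symm ⁻¹' e'.source) :=
    ((contDiffOn_base he he').restrict_scalars ℝ).of_le le_top
  have h2 := (𝓛.proj_contDiffOn_aux (e' := e') he hc).mono
    (inter_subset_left (t := {p : E × ℝ | ((1 + (p.2 : ℂ) * Complex.I) * c (e.symm p.1)).re ≠ 0}))
  have h3 : ContDiffOn ℝ ∞ (fun p : E × ℝ => (e' (e.symm p.1),
      slope ((1 + (p.2 : ℂ) * Complex.I) * c (e.symm p.1))))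
      (((e.target ∩ e.symm ⁻¹' (φ.1 ∩ (e'.source ∩ φ'.1))) ×ˢ univ) ∩
        {p : E × ℝ | ((1 + (p.2 : ℂ) * Complex.I) * c (e.symm p.1)).re ≠ 0}) := by
    refine ContDiffOn.prodMk ?_ ?_
    · refine h1.comp contDiffOn_fst ?_
      rintro p ⟨⟨⟨h1, h2, h3, h4⟩, -⟩, h5⟩
      exact ⟨h1, h3⟩
    · exact ContDiffOn.div (Complex.imCLM.contDiff.comp_contDiffOn h2)
        (Complex.reCLM.contDiff.comp_contDiffOn h2) (fun p hp => hp.2)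
  refine h3.congr ?_
  rintro p ⟨⟨⟨h1, h2, h3, h4⟩, -⟩, h5⟩
  refine Prod.ext rfl ?_
  obtain ⟨r, hr, h⟩ := 𝓛.proj_trans_source (e' := e') hφ hφ' hcφ (p := p) h2 h4
  change slope (ratio (φ'.2 (e.symm p.1)) ((𝓛.projChart e φ hφ).symm p).line.rep) = _
  rw [h, slope_smul hr]

end Transition

/-- A frame near `b`. -/
def frameAt (𝓛 : HolLineBundle E V) (b : B) : Set B × (∀ b, V b) := (𝓛.exists_frame b).choose

theorem frameAt_mem (𝓛 : HolLineBundle E V) (b : B) : 𝓛.frameAt b ∈ 𝓛.frames :=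
  (𝓛.exists_frame b).choose_spec.1

theorem mem_frameAt (𝓛 : HolLineBundle E V) (b : B) : b ∈ (𝓛.frameAt b).1 :=
  (𝓛.exists_frame b).choose_spec.2

theorem ratio_rep_ne_zero (𝓛 : HolLineBundle E V) (x : 𝓛.RProj) :
    ratio ((𝓛.frameAt x.base).2 x.base) x.line.rep ≠ 0 := by
  intro h
  have h1 := 𝓛.ratio_smul (𝓛.ne_zero _ (𝓛.frameAt_mem x.base) _ (𝓛.mem_frameAt x.base)) x.line.rep
  rw [h, zero_smul] at h1
  exact x.line.rep_nonzero h1.symm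

/-- A frame near the base point of `x` whose value there spans the real line `x`. -/
def frameAt' (𝓛 : HolLineBundle E V) (x : 𝓛.RProj) : Set B × (∀ b, V b) :=
  ((𝓛.frameAt x.base).1, fun b =>
    ratio ((𝓛.frameAt x.base).2 x.base) x.line.rep • (𝓛.frameAt x.base).2 b)

theorem frameAt'_mem (𝓛 : HolLineBundle E V) (x : 𝓛.RProj) : 𝓛.frameAt' x ∈ 𝓛.frames :=
  𝓛.smul_mem _ (𝓛.frameAt_mem x.base) _ (𝓛.ratio_rep_ne_zero x)

variable [IsManifold 𝓘(ℂ, E) ω B]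

/-- The atlas of the slit total space. -/
def slitCore (𝓛 : HolLineBundle E V) : ChartedSpaceCore (E × ℂ) 𝓛.Slit where
  atlas := {c | ∃ e ∈ atlas E B, ∃ φ, ∃ hφ : φ ∈ 𝓛.frames, c = 𝓛.slitChart e φ hφ}
  chartAt ε := 𝓛.slitChart (chartAt E ε.base) (𝓛.frameAt ε.base) (𝓛.frameAt_mem ε.base)
  mem_chart_source ε := ⟨mem_chart_source E ε.base, 𝓛.mem_frameAt ε.base⟩
  chart_mem_atlas ε := ⟨_, chart_mem_atlas E ε.base, _, _, rfl⟩
  open_source := by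
    rintro _ _ ⟨e, he, φ, hφ, rfl⟩ ⟨e', he', φ', hφ', rfl⟩
    exact 𝓛.slit_open hφ hφ'
  continuousOn_toFun := by
    rintro _ _ ⟨e, he, φ, hφ, rfl⟩ ⟨e', he', φ', hφ', rfl⟩
    exact (𝓛.slit_contDiffOn he he' hφ hφ').continuousOn

/-- The atlas of the real projective bundle. -/
def projCore (𝓛 : HolLineBundle E V) : ChartedSpaceCore (E × ℝ) 𝓛.RProj where
  atlas := {c | ∃ e ∈ atlas E B, ∃ φ, ∃ hφ : φ ∈ 𝓛.frames, c = 𝓛.projChart e φ hφ}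
  chartAt x := 𝓛.projChart (chartAt E x.base) (𝓛.frameAt' x) (𝓛.frameAt'_mem x)
  mem_chart_source x := by
    refine ⟨mem_chart_source E x.base, 𝓛.mem_frameAt x.base, ?_⟩
    have h := 𝓛.ne_zero _ (𝓛.frameAt_mem x.base) _ (𝓛.mem_frameAt x.base)
    have : ratio ((𝓛.frameAt' x).2 x.base) x.line.rep = 1 := by
      refine 𝓛.ratio_eq (smul_ne_zero (𝓛.ratio_rep_ne_zero x) h) ?_
      rw [one_smul]
      exact (𝓛.ratio_smul h x.line.rep).symm
    rw [this]
    simp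
  chart_mem_atlas x := ⟨_, chart_mem_atlas E x.base, _, _, rfl⟩
  open_source := by
    rintro _ _ ⟨e, he, φ, hφ, rfl⟩ ⟨e', he', φ', hφ', rfl⟩
    exact 𝓛.proj_open he hφ hφ'
  continuousOn_toFun := by
    rintro _ _ ⟨e, he, φ, hφ, rfl⟩ ⟨e', he', φ', hφ', rfl⟩
    exact (𝓛.proj_contDiffOn he he' hφ hφ').continuousOn

instance (𝓛 : HolLineBundle E V) : TopologicalSpace 𝓛.Slit := 𝓛.slitCore.toTopologicalSpace

instance (𝓛 : HolLineBundle E V) : ChartedSpace (E × ℂ) 𝓛.Slit := 𝓛.slitCore.toChartedSpace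

instance (𝓛 : HolLineBundle E V) : TopologicalSpace 𝓛.RProj := 𝓛.projCore.toTopologicalSpace

instance (𝓛 : HolLineBundle E V) : ChartedSpace (E × ℝ) 𝓛.RProj := 𝓛.projCore.toChartedSpace

instance (𝓛 : HolLineBundle E V) : IsManifold 𝓘(ℂ, E × ℂ) ω 𝓛.Slit := by
  refine isManifold_of_contDiffOn _ _ _ ?_
  intro f f' hf hf'
  obtain ⟨g, hg, rfl⟩ : ∃ g, ∃ hg : g ∈ 𝓛.slitCore.atlas,
    f = 𝓛.slitCore.openPartialHomeomorph g hg := by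
      have h : f ∈ ⋃ (g : PartialEquiv _ _) (hg : g ∈ 𝓛.slitCore.atlas),
        {𝓛.slitCore.openPartialHomeomorph g hg} := hf
      simpa only [mem_iUnion, mem_singleton_iff] using h
  obtain ⟨g', hg', rfl⟩ : ∃ g, ∃ hg : g ∈ 𝓛.slitCore.atlas,
    f' = 𝓛.slitCore.openPartialHomeomorph g hg := by
      have h : f' ∈ ⋃ (g : PartialEquiv _ _) (hg : g ∈ 𝓛.slitCore.atlas),
        {𝓛.slitCore.openPartialHomeomorph g hg} := hf'
      simpa only [mem_iUnion, mem_singleton_iff] using h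
  obtain ⟨e, he, φ, hφ, rfl⟩ := hg
  obtain ⟨e', he', φ', hφ', rfl⟩ := hg'
  exact (𝓛.slit_contDiffOn he he' hφ hφ').mono (fun p hp => hp.1)

instance (𝓛 : HolLineBundle E V) : IsManifold 𝓘(ℝ, E × ℝ) ∞ 𝓛.RProj := by
  refine isManifold_of_contDiffOn _ _ _ ?_
  intro f f' hf hf'
  obtain ⟨g, hg, rfl⟩ : ∃ g, ∃ hg : g ∈ 𝓛.projCore.atlas,
    f = 𝓛.projCore.openPartialHomeomorph g hg := by
      have h : f ∈ ⋃ (g : PartialEquiv _ _) (hg : g ∈ 𝓛.projCore.atlas),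
        {𝓛.projCore.openPartialHomeomorph g hg} := hf
      simpa only [mem_iUnion, mem_singleton_iff] using h
  obtain ⟨g', hg', rfl⟩ : ∃ g, ∃ hg : g ∈ 𝓛.projCore.atlas,
    f' = 𝓛.projCore.openPartialHomeomorph g hg := by
      have h : f' ∈ ⋃ (g : PartialEquiv _ _) (hg : g ∈ 𝓛.projCore.atlas),
        {𝓛.projCore.openPartialHomeomorph g hg} := hf'
      simpa only [mem_iUnion, mem_singleton_iff] using h
  obtain ⟨e, he, φ, hφ, rfl⟩ := hg
  obtain ⟨e', he', φ', hφ', rfl⟩ := hg'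
  exact (𝓛.proj_contDiffOn he he' hφ hφ').mono (fun p hp => hp.1)

end HolLineBundle

/-! ### Hyperplane fields and contact structures -/

section Contact

variable {𝕜 : Type*} [NontriviallyNormedField 𝕜]
  {E : Type*} [NormedAddCommGroup E] [NormedSpace 𝕜 E]
  {G : Type*} [TopologicalSpace G] [ChartedSpace E G]

/-- `α` is a one-form of class `C^n` on `U` which vanishes nowhere on `U` and whose kernel there is
the field of subspaces `H`. -/
structure IsDefiningForm (n : WithTop ℕ∞) [IsManifold 𝓘(𝕜, E) 1 G]
    (H : ∀ g : G, Submodule 𝕜 (TangentSpace 𝓘(𝕜, E) g)) (U : Set G)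
    (α : ∀ g : G, TangentSpace 𝓘(𝕜, E) g →L[𝕜] 𝕜) : Prop where
  isOpen : IsOpen U
  contMDiffOn : ContMDiffOn 𝓘(𝕜, E) (𝓘(𝕜, E).prod 𝓘(𝕜, E →L[𝕜] 𝕜)) n
    (fun g => Bundle.TotalSpace.mk' (E →L[𝕜] 𝕜)
      (E := fun g : G => TangentSpace 𝓘(𝕜, E) g →L[𝕜] Bundle.Trivial G 𝕜 g) g (α g)) U
  ne_zero : ∀ g ∈ U, α g ≠ 0
  mem_iff : ∀ g ∈ U, ∀ v, v ∈ H g ↔ α g v = 0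

/-- A distribution of hyperplanes of class `C^n`. -/
def IsHyperplaneField (n : WithTop ℕ∞) [IsManifold 𝓘(𝕜, E) 1 G]
    (H : ∀ g : G, Submodule 𝕜 (TangentSpace 𝓘(𝕜, E) g)) : Prop :=
  ∀ g : G, ∃ U α, g ∈ U ∧ IsDefiningForm n H U α

/-- A contact structure: a hyperplane distribution whose curvature `(X, Y) ↦ [X, Y] mod H` is
non-degenerate on `H` at each point. -/
structure IsContact (n : WithTop ℕ∞) [IsManifold 𝓘(𝕜, E) 1 G]
    (H : ∀ g : G, Submodule 𝕜 (TangentSpace 𝓘(𝕜, E) g)) : Prop where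
  hyperplane : IsHyperplaneField n H
  nondegenerate : ∀ (g : G), ∀ v ∈ H g,
    (∀ X Y : ∀ g : G, TangentSpace 𝓘(𝕜, E) g,
      ContMDiffAt 𝓘(𝕜, E) 𝓘(𝕜, E).tangent n
        (fun g => (⟨g, X g⟩ : TangentBundle 𝓘(𝕜, E) G)) g →
      ContMDiffAt 𝓘(𝕜, E) 𝓘(𝕜, E).tangent n
        (fun g => (⟨g, Y g⟩ : TangentBundle 𝓘(𝕜, E) G)) g →
      (∀ᶠ g' in 𝓝 g, X g' ∈ H g' ∧ Y g' ∈ H g') → X g = v →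
      VectorField.mlieBracket 𝓘(𝕜, E) X Y g ∈ H g) → v = 0

end Contact

/-! ### Groupoids -/

/-- The structure maps of a groupoid with set of arrows `G` and set of objects `X`. An arrow `g`
points from `src g` to `tgt g`; the value `mul g h` matters only if `src g = tgt h`. -/
structure GroupoidData (G X : Type*) where
  src : G → X
  tgt : G → X
  one : X → G
  inv : G → G
  mul : G → G → G

namespace GroupoidData

variable {G X : Type*}

/-- The set of composable pairs of arrows. -/
def composable (𝒢 : GroupoidData G X) : Set (G × G) := {p | 𝒢.src p.1 = 𝒢.tgt p.2}

/-- The groupoid axioms. -/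
structure IsGroupoid (𝒢 : GroupoidData G X) : Prop where
  src_mul : ∀ g h, 𝒢.src g = 𝒢.tgt h → 𝒢.src (𝒢.mul g h) = 𝒢.src h
  tgt_mul : ∀ g h, 𝒢.src g = 𝒢.tgt h → 𝒢.tgt (𝒢.mul g h) = 𝒢.tgt g
  mul_assoc : ∀ g h k, 𝒢.src g = 𝒢.tgt h → 𝒢.src h = 𝒢.tgt k →
    𝒢.mul (𝒢.mul g h) k = 𝒢.mul g (𝒢.mul h k)
  src_one : ∀ x, 𝒢.src (𝒢.one x) = x
  tgt_one : ∀ x, 𝒢.tgt (𝒢.one x) = x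
  one_mul : ∀ g, 𝒢.mul (𝒢.one (𝒢.tgt g)) g = g
  mul_one : ∀ g, 𝒢.mul g (𝒢.one (𝒢.src g)) = g
  src_inv : ∀ g, 𝒢.src (𝒢.inv g) = 𝒢.tgt g
  tgt_inv : ∀ g, 𝒢.tgt (𝒢.inv g) = 𝒢.src g
  mul_inv : ∀ g, 𝒢.mul g (𝒢.inv g) = 𝒢.one (𝒢.tgt g)
  inv_mul : ∀ g, 𝒢.mul (𝒢.inv g) g = 𝒢.one (𝒢.src g)

variable (𝕜 : Type*) [NontriviallyNormedField 𝕜]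
  {E : Type*} [NormedAddCommGroup E] [NormedSpace 𝕜 E]
  {F : Type*} [NormedAddCommGroup F] [NormedSpace 𝕜 F]
  [TopologicalSpace G] [ChartedSpace E G] [TopologicalSpace X] [ChartedSpace F X]

/-- A Lie groupoid of class `C^n` over `𝕜`. The composable pairs form an embedded submanifold of
`G × G`, because the source and the target are submersions, and a function on this submanifold is of
class `C^n` exactly when it is so as a function on a subset of `G × G`. -/
structure IsLieGroupoid (n : WithTop ℕ∞) (𝒢 : GroupoidData G X) : Prop where
  t2_arrows : T2Space G
  t2_objects : T2Space X
  secondCountable_arrows : SecondCountableTopology G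
  secondCountable_objects : SecondCountableTopology X
  isGroupoid : 𝒢.IsGroupoid
  contMDiff_src : ContMDiff 𝓘(𝕜, E) 𝓘(𝕜, F) n 𝒢.src
  contMDiff_tgt : ContMDiff 𝓘(𝕜, E) 𝓘(𝕜, F) n 𝒢.tgt
  contMDiff_one : ContMDiff 𝓘(𝕜, F) 𝓘(𝕜, E) n 𝒢.one
  contMDiff_inv : ContMDiff 𝓘(𝕜, E) 𝓘(𝕜, E) n 𝒢.inv
  contMDiffOn_mul : ContMDiffOn (𝓘(𝕜, E).prod 𝓘(𝕜, E)) 𝓘(𝕜, E) n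
    (fun p : G × G => 𝒢.mul p.1 p.2) 𝒢.composable
  submersion_src : ∀ g, Function.Surjective (mfderiv 𝓘(𝕜, E) 𝓘(𝕜, F) 𝒢.src g)
  submersion_tgt : ∀ g, Function.Surjective (mfderiv 𝓘(𝕜, E) 𝓘(𝕜, F) 𝒢.tgt g)

/-- The tangent groupoid. The tangent space of the submanifold of composable pairs consists of the
composable pairs of tangent vectors, and on these the derivative of the multiplication is determined
by its values on the submanifold. -/
def tangent (𝒢 : GroupoidData G X) :
    GroupoidData (TangentBundle 𝓘(𝕜, E) G) (TangentBundle 𝓘(𝕜, F) X) where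
  src := tangentMap 𝓘(𝕜, E) 𝓘(𝕜, F) 𝒢.src
  tgt := tangentMap 𝓘(𝕜, E) 𝓘(𝕜, F) 𝒢.tgt
  one := tangentMap 𝓘(𝕜, F) 𝓘(𝕜, E) 𝒢.one
  inv := tangentMap 𝓘(𝕜, E) 𝓘(𝕜, E) 𝒢.inv
  mul v w := ⟨𝒢.mul v.proj w.proj,
    mfderivWithin (𝓘(𝕜, E).prod 𝓘(𝕜, E)) 𝓘(𝕜, E) (fun p : G × G => 𝒢.mul p.1 p.2)
      𝒢.composable (v.proj, w.proj) (v.snd, w.snd)⟩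

/-- The distribution `H` on the manifold of arrows is multiplicative, that is, a subgroupoid of the
tangent groupoid, and it covers the whole tangent bundle of the manifold of objects. -/
structure IsMultiplicative (𝒢 : GroupoidData G X)
    (H : ∀ g : G, Submodule 𝕜 (TangentSpace 𝓘(𝕜, E) g)) : Prop where
  one_mem : ∀ v : TangentBundle 𝓘(𝕜, F) X,
    ((𝒢.tangent 𝕜).one v : TangentBundle 𝓘(𝕜, E) G).snd ∈ H ((𝒢.tangent 𝕜).one v).proj
  inv_mem : ∀ v : TangentBundle 𝓘(𝕜, E) G, v.snd ∈ H v.proj →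
    ((𝒢.tangent 𝕜 (F := F)).inv v).snd ∈ H ((𝒢.tangent 𝕜 (F := F)).inv v).proj
  mul_mem : ∀ v w : TangentBundle 𝓘(𝕜, E) G,
    (𝒢.tangent 𝕜 (F := F)).src v = (𝒢.tangent 𝕜).tgt w → v.snd ∈ H v.proj → w.snd ∈ H w.proj →
    ((𝒢.tangent 𝕜 (F := F)).mul v w).snd ∈ H ((𝒢.tangent 𝕜 (F := F)).mul v w).proj
  covers : ∀ g, ∀ u : TangentSpace 𝓘(𝕜, F) (𝒢.src g),
    ∃ v ∈ H g, mfderiv 𝓘(𝕜, E) 𝓘(𝕜, F) 𝒢.src g v = u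

end GroupoidData

/-! ### The real line bundle over the real projective bundle and its gauge algebroid

The complement of the zero section of the tautological real line bundle over `𝓛.RProj` is `𝓛.Slit`.
The dual of the tautological line bundle has fibre `HatFiber x` over a real line `x`, and its sections
`λ` correspond to the functions `ε ↦ ⟨ε, λ⟩` on `𝓛.Slit` homogeneous of degree one under multiplication
by nonzero real numbers. -/

namespace HolLineBundle

variable {E : Type*} [NormedAddCommGroup E] [NormedSpace ℂ E]
  {B : Type*} [TopologicalSpace B] [ChartedSpace E B]
  {V : B → Type*} [∀ b, AddCommGroup (V b)] [∀ b, Module ℂ (V b)]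

/-- The real line spanned by a nonzero vector. -/
def toProj (𝓛 : HolLineBundle E V) (ε : 𝓛.Slit) : 𝓛.RProj :=
  ⟨ε.base, Projectivization.mk ℝ ε.vec ε.ne_zero⟩

/-- A nonzero vector on a real line. -/
def rep (𝓛 : HolLineBundle E V) (x : 𝓛.RProj) : 𝓛.Slit := ⟨x.base, x.line.rep, x.line.rep_nonzero⟩

/-- Multiplication of a nonzero vector by a nonzero real number. -/
def rescale (𝓛 : HolLineBundle E V) (r : ℝˣ) (ε : 𝓛.Slit) : 𝓛.Slit :=
  ⟨ε.base, (r : ℝ) • ε.vec, smul_ne_zero r.ne_zero ε.ne_zero⟩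

/-- The real line `x`, as a subspace of the fibre of the line bundle. -/
def realLine (𝓛 : HolLineBundle E V) (x : 𝓛.RProj) : Submodule ℝ (V x.base) := x.line.submodule

/-- The dual of the real line `x`. -/
def HatFiber (𝓛 : HolLineBundle E V) (x : 𝓛.RProj) : Type _ := 𝓛.realLine x →ₗ[ℝ] ℝ

instance (𝓛 : HolLineBundle E V) (x : 𝓛.RProj) : AddCommGroup (𝓛.HatFiber x) :=
  inferInstanceAs (AddCommGroup (𝓛.realLine x →ₗ[ℝ] ℝ))

instance (𝓛 : HolLineBundle E V) (x : 𝓛.RProj) : Module ℝ (𝓛.HatFiber x) :=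
  inferInstanceAs (Module ℝ (𝓛.realLine x →ₗ[ℝ] ℝ))

theorem vec_mem (𝓛 : HolLineBundle E V) (ε : 𝓛.Slit) :
    ε.vec ∈ 𝓛.realLine (𝓛.toProj ε) := by
  change ε.vec ∈ (Projectivization.mk ℝ ε.vec ε.ne_zero).submodule
  rw [Projectivization.submodule_mk]
  exact Submodule.mem_span_singleton_self _

/-- The value of an element of the dual of the line spanned by `ε` on `ε`. -/
def pairing (𝓛 : HolLineBundle E V) (ε : 𝓛.Slit) : 𝓛.HatFiber (𝓛.toProj ε) →ₗ[ℝ] ℝ :=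
  (LinearMap.applyₗ (⟨ε.vec, 𝓛.vec_mem ε⟩ : 𝓛.realLine (𝓛.toProj ε)) :
    (𝓛.realLine (𝓛.toProj ε) →ₗ[ℝ] ℝ) →ₗ[ℝ] ℝ)

/-- The homogeneous function on the slit total space corresponding to a section. -/
def homogenize (𝓛 : HolLineBundle E V) (s : ∀ x, 𝓛.HatFiber x) (ε : 𝓛.Slit) : ℝ :=
  𝓛.pairing ε (s (𝓛.toProj ε))

variable [IsManifold 𝓘(ℂ, E) ω B]

/-- The smooth sections of the dual of the tautological line bundle. -/
def Sections (𝓛 : HolLineBundle E V) : Submodule ℝ (∀ x, 𝓛.HatFiber x) where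
  carrier := {s | ContMDiff 𝓘(ℝ, E × ℂ) 𝓘(ℝ, ℝ) ∞ (𝓛.homogenize s)}
  zero_mem' := by
    have : 𝓛.homogenize 0 = fun _ => 0 := by
      funext ε
      exact map_zero (𝓛.pairing ε)
    change ContMDiff 𝓘(ℝ, E × ℂ) 𝓘(ℝ, ℝ) ∞ (𝓛.homogenize 0)
    rw [this]
    exact contMDiff_const
  add_mem' := by
    intro s t hs ht
    have : 𝓛.homogenize (s + t) = 𝓛.homogenize s + 𝓛.homogenize t := by
      funext ε
      exact map_add (𝓛.pairing ε) _ _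
    change ContMDiff 𝓘(ℝ, E × ℂ) 𝓘(ℝ, ℝ) ∞ (𝓛.homogenize (s + t))
    rw [this]
    exact ContMDiff.add hs ht
  smul_mem' := by
    intro r s hs
    have : 𝓛.homogenize (r • s) = fun ε => r • 𝓛.homogenize s ε := by
      funext ε
      exact map_smul (𝓛.pairing ε) _ _
    change ContMDiff 𝓘(ℝ, E × ℂ) 𝓘(ℝ, ℝ) ∞ (𝓛.homogenize (r • s))
    rw [this]
    have hr : ContMDiff 𝓘(ℝ, E × ℂ) 𝓘(ℝ, ℝ) ∞ (fun _ : 𝓛.Slit => r) := contMDiff_const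
    exact hr.smul hs

/-- The derivative of the real function `f` at `y` along the tangent vector `v`. -/
def derivAlong {D : Type*} [NormedAddCommGroup D] [NormedSpace ℝ D] {Y : Type*} [TopologicalSpace Y]
    [ChartedSpace D Y] (f : Y → ℝ) (y : Y) : TangentSpace 𝓘(ℝ, D) y →ₗ[ℝ] ℝ :=
  (mfderiv 𝓘(ℝ, D) 𝓘(ℝ, ℝ) f y).toLinearMap

/-- `Δ`, mapping sections to elements of the fibre over `x`, is a derivation with symbol `v`. -/
def IsSymbol (𝓛 : HolLineBundle E V) {x : 𝓛.RProj} (Δ : 𝓛.Sections →ₗ[ℝ] 𝓛.HatFiber x)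
    (v : TangentSpace 𝓘(ℝ, E × ℝ) x) : Prop :=
  ∀ (f : 𝓛.RProj → ℝ), ContMDiff 𝓘(ℝ, E × ℝ) 𝓘(ℝ, ℝ) ∞ f → ∀ s s' : 𝓛.Sections,
    (∀ y, s'.1 y = f y • s.1 y) →
    Δ s' = derivAlong f x v • s.1 x + f x • Δ s

/-- The fibre over `x` of the gauge algebroid: the derivations at `x` of the line bundle. -/
def Gauge (𝓛 : HolLineBundle E V) (x : 𝓛.RProj) :
    Submodule ℝ (𝓛.Sections →ₗ[ℝ] 𝓛.HatFiber x) where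
  carrier := {Δ | ∃ v, 𝓛.IsSymbol Δ v}
  zero_mem' := by
    refine ⟨0, fun f _ s s' _ => ?_⟩
    rw [map_zero]
    change (0 : 𝓛.HatFiber x) = (0 : ℝ) • s.1 x + f x • (0 : 𝓛.HatFiber x)
    simp
  add_mem' := by
    rintro Δ Δ' ⟨v, hv⟩ ⟨v', hv'⟩
    refine ⟨v + v', fun f hf s s' h => ?_⟩
    rw [LinearMap.add_apply, LinearMap.add_apply, hv f hf s s' h, hv' f hf s s' h, map_add]
    change _ = (derivAlong f x v +
      derivAlong f x v') • s.1 x + f x • (Δ s + Δ' s)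
    rw [add_smul, smul_add]
    abel
  smul_mem' := by
    rintro r Δ ⟨v, hv⟩
    refine ⟨r • v, fun f hf s s' h => ?_⟩
    rw [LinearMap.smul_apply, LinearMap.smul_apply, hv f hf s s' h, map_smul]
    change _ = (r * derivAlong f x v) • s.1 x + f x • (r • Δ s)
    rw [smul_add, smul_smul, smul_comm]

/-- The symbol of a derivation. -/
def symbol (𝓛 : HolLineBundle E V) {x : 𝓛.RProj} (Δ : 𝓛.Gauge x) : TangentSpace 𝓘(ℝ, E × ℝ) x :=
  Δ.2.choose

/-- The fibre over `x` of the first jet bundle, the twisted dual of the gauge algebroid. -/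
abbrev Jet (𝓛 : HolLineBundle E V) (x : 𝓛.RProj) : Type _ := 𝓛.Gauge x →ₗ[ℝ] 𝓛.HatFiber x

/-- A smooth section of the gauge algebroid. -/
structure GaugeSection (𝓛 : HolLineBundle E V) where
  toFun : ∀ x, 𝓛.Gauge x
  smooth : ∀ s : 𝓛.Sections, (fun x => (toFun x).1 s) ∈ 𝓛.Sections

/-- The action of a section of the gauge algebroid on sections of the line bundle. -/
def GaugeSection.act {𝓛 : HolLineBundle E V} (Δ : 𝓛.GaugeSection) (s : 𝓛.Sections) : 𝓛.Sections :=
  ⟨fun x => (Δ.toFun x).1 s, Δ.smooth s⟩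

instance (𝓛 : HolLineBundle E V) : Nonempty 𝓛.GaugeSection :=
  ⟨⟨fun _ => 0, fun _ => 𝓛.Sections.zero_mem⟩⟩

/-- The bracket of sections of the gauge algebroid: the one which acts as the commutator. -/
def GaugeSection.bracket {𝓛 : HolLineBundle E V} (Δ Ξ : 𝓛.GaugeSection) : 𝓛.GaugeSection :=
  Classical.epsilon fun Ψ => ∀ s, Ψ.act s = Δ.act (Ξ.act s) - Ξ.act (Δ.act s)

/-- A smooth section of the first jet bundle. -/
structure JetSection (𝓛 : HolLineBundle E V) where
  toFun : ∀ x, 𝓛.Jet x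
  smooth : ∀ Δ : 𝓛.GaugeSection, (fun x => toFun x (Δ.toFun x)) ∈ 𝓛.Sections

/-- The contraction of a section of the jet bundle and a section of the gauge algebroid. -/
def JetSection.eval {𝓛 : HolLineBundle E V} (ψ : 𝓛.JetSection) (Δ : 𝓛.GaugeSection) : 𝓛.Sections :=
  ⟨fun x => ψ.toFun x (Δ.toFun x), ψ.smooth Δ⟩

/-- The first jet prolongation `d_D s` of a section `s` of the line bundle. -/
def jet (𝓛 : HolLineBundle E V) (s : 𝓛.Sections) : 𝓛.JetSection where
  toFun x := (LinearMap.applyₗ s).comp (𝓛.Gauge x).subtype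
  smooth Δ := Δ.smooth s

/-- The contraction with `Ξ` of the Lie derivative of `ψ` along `Δ`. -/
def JetSection.lie {𝓛 : HolLineBundle E V} (Δ : 𝓛.GaugeSection) (ψ : 𝓛.JetSection)
    (Ξ : 𝓛.GaugeSection) : 𝓛.Sections :=
  Δ.act (ψ.eval Ξ) - ψ.eval (Δ.bracket Ξ)

/-- An Atiyah `(1,1)`-tensor: a smooth endomorphism of the gauge algebroid. -/
structure AtiyahTensor (𝓛 : HolLineBundle E V) where
  toFun : ∀ x, 𝓛.Gauge x →ₗ[ℝ] 𝓛.Gauge x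
  smooth : ∀ (Δ : 𝓛.GaugeSection) (s : 𝓛.Sections),
    (fun x => (toFun x (Δ.toFun x)).1 s) ∈ 𝓛.Sections

/-- The value of an Atiyah tensor on a section of the gauge algebroid. -/
def AtiyahTensor.apply {𝓛 : HolLineBundle E V} (N : 𝓛.AtiyahTensor) (Δ : 𝓛.GaugeSection) :
    𝓛.GaugeSection :=
  ⟨fun x => N.toFun x (Δ.toFun x), N.smooth Δ⟩

/-- The transpose of an Atiyah tensor, acting on sections of the jet bundle. -/
def AtiyahTensor.transpose {𝓛 : HolLineBundle E V} (N : 𝓛.AtiyahTensor) (ψ : 𝓛.JetSection) :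
    𝓛.JetSection where
  toFun x := (ψ.toFun x).comp (N.toFun x)
  smooth Δ := ψ.smooth (N.apply Δ)

/-- The vanishing of the Nijenhuis torsion. -/
def AtiyahTensor.IsNijenhuis {𝓛 : HolLineBundle E V} (N : 𝓛.AtiyahTensor) : Prop :=
  ∀ (Δ Ξ : 𝓛.GaugeSection) (x : 𝓛.RProj),
    ((N.apply Δ).bracket (N.apply Ξ)).toFun x - N.toFun x (((N.apply Δ).bracket Ξ).toFun x)
      - N.toFun x ((Δ.bracket (N.apply Ξ)).toFun x)
      + N.toFun x (N.toFun x ((Δ.bracket Ξ).toFun x)) = 0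

/-- A skew-symmetric biderivation `J` of the line bundle, as the bundle map `J^♯` from the jet bundle
to the gauge algebroid, so that `J (ψ, χ) = ⟨χ, J^♯ ψ⟩`. -/
structure Biderivation (𝓛 : HolLineBundle E V) where
  sharp : ∀ x, 𝓛.Jet x →ₗ[ℝ] 𝓛.Gauge x
  skew : ∀ x (ψ χ : 𝓛.Jet x), χ (sharp x ψ) = -ψ (sharp x χ)
  smooth : ∀ (ψ : 𝓛.JetSection) (s : 𝓛.Sections), (fun x => (sharp x (ψ.toFun x)).1 s) ∈ 𝓛.Sections

namespace Biderivation

variable {𝓛 : HolLineBundle E V}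

/-- `J^♯ ψ`. -/
def sharpSection (J : 𝓛.Biderivation) (ψ : 𝓛.JetSection) : 𝓛.GaugeSection :=
  ⟨fun x => J.sharp x (ψ.toFun x), J.smooth ψ⟩

/-- `J (ψ, χ)`. -/
def val (J : 𝓛.Biderivation) (ψ χ : 𝓛.JetSection) : 𝓛.Sections := χ.eval (J.sharpSection ψ)

/-- The bracket `{s, s'} = J (d_D s, d_D s')` of sections of the line bundle. -/
def bracket (J : 𝓛.Biderivation) (s s' : 𝓛.Sections) : 𝓛.Sections := J.val (𝓛.jet s) (𝓛.jet s')

/-- `J` is a Jacobi structure: the bracket is a Lie bracket. -/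
def IsJacobi (J : 𝓛.Biderivation) : Prop :=
  ∀ s s' s'', J.bracket s (J.bracket s' s'') =
    J.bracket (J.bracket s s') s'' + J.bracket s' (J.bracket s s'')

/-- The contraction with `Ξ` of `[ψ, χ]_J = L_{J^♯ ψ} χ - L_{J^♯ χ} ψ - d_D (J (ψ, χ))`. -/
def jetBracket (J : 𝓛.Biderivation) (ψ χ : 𝓛.JetSection) (Ξ : 𝓛.GaugeSection) : 𝓛.Sections :=
  χ.lie (J.sharpSection ψ) Ξ - ψ.lie (J.sharpSection χ) Ξ - Ξ.act (J.val ψ χ)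

end Biderivation

/-- `(J, N)` is a Jacobi-Nijenhuis structure. -/
structure IsJacobiNijenhuis (𝓛 : HolLineBundle E V) (J : 𝓛.Biderivation) (N : 𝓛.AtiyahTensor) :
    Prop where
  jacobi : J.IsJacobi
  nijenhuis : N.IsNijenhuis
  skew : ∀ ψ χ, J.val ψ (N.transpose χ) + J.val χ (N.transpose ψ) = 0
  compatible : ∀ ψ χ Ξ,
    (N.transpose χ).lie (J.sharpSection ψ) Ξ - (N.transpose ψ).lie (J.sharpSection χ) Ξ
      - Ξ.act (J.val (N.transpose ψ) χ) = J.jetBracket ψ χ (N.apply Ξ)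

/-- `θ`, a one-form on `𝓛.RProj` with values in the line bundle, is smooth; this is expressed through
the composition of `θ` with the symbol map. -/
def IsSmoothForm (𝓛 : HolLineBundle E V)
    (θ : ∀ x, TangentSpace 𝓘(ℝ, E × ℝ) x →ₗ[ℝ] 𝓛.HatFiber x) : Prop :=
  ∀ Δ : 𝓛.GaugeSection, (fun x => θ x (𝓛.symbol (Δ.toFun x))) ∈ 𝓛.Sections

/-- The section `Θ Δ = θ (σ Δ)`. -/
def formEval (𝓛 : HolLineBundle E V)
    (θ : ∀ x, TangentSpace 𝓘(ℝ, E × ℝ) x →ₗ[ℝ] 𝓛.HatFiber x) (hθ : 𝓛.IsSmoothForm θ)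
    (Δ : 𝓛.GaugeSection) : 𝓛.Sections :=
  ⟨fun x => θ x (𝓛.symbol (Δ.toFun x)), hθ Δ⟩

/-- The value on `(Δ, Ξ)` of the Atiyah two-form `d_D (θ ∘ σ)`. -/
def dForm (𝓛 : HolLineBundle E V)
    (θ : ∀ x, TangentSpace 𝓘(ℝ, E × ℝ) x →ₗ[ℝ] 𝓛.HatFiber x) (hθ : 𝓛.IsSmoothForm θ)
    (Δ Ξ : 𝓛.GaugeSection) : 𝓛.Sections :=
  Δ.act (𝓛.formEval θ hθ Ξ) - Ξ.act (𝓛.formEval θ hθ Δ) - 𝓛.formEval θ hθ (Δ.bracket Ξ)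

/-- `(H, N)` is a contact-Nijenhuis structure, where the contact structure `H` is the kernel of the
form `θ`, which identifies the normal bundle of `H` with the line bundle: with `J` the biderivation
inverse to the Atiyah two-form `ω = d_D (θ ∘ σ)`, the pair `(J, N)` is a Jacobi-Nijenhuis
structure. -/
structure IsContactNijenhuis (𝓛 : HolLineBundle E V)
    (θ : ∀ x, TangentSpace 𝓘(ℝ, E × ℝ) x →ₗ[ℝ] 𝓛.HatFiber x) (N : 𝓛.AtiyahTensor) : Prop where
  contact : IsContact ∞ (fun x => LinearMap.ker (θ x))
  surjective : ∀ x, Function.Surjective (θ x)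
  smooth : 𝓛.IsSmoothForm θ
  exists_inverse : ∃ J : 𝓛.Biderivation,
    (∀ ψ Ξ, 𝓛.dForm θ smooth (J.sharpSection ψ) Ξ = ψ.eval Ξ) ∧ 𝓛.IsJacobiNijenhuis J N

/-- `Δ` is the derivation at the line spanned by `ε` induced by the tangent vector `v` at `ε`, that
is, `⟨ε, Δ s⟩` is the derivative along `v` of the function `⟨-, s⟩`. -/
def IsImage (𝓛 : HolLineBundle E V) (ε : 𝓛.Slit) (v : TangentSpace 𝓘(ℝ, E × ℂ) ε)
    (Δ : 𝓛.Gauge (𝓛.toProj ε)) : Prop :=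
  ∀ s : 𝓛.Sections,
    𝓛.pairing ε (Δ.1 s) = derivAlong (𝓛.homogenize s.1) ε v

/-- The complex structure on the tangent spaces of the slit total space. -/
def complexStructure (𝓛 : HolLineBundle E V) (ε : 𝓛.Slit) (v : TangentSpace 𝓘(ℝ, E × ℂ) ε) :
    TangentSpace 𝓘(ℝ, E × ℂ) ε :=
  (Complex.I • (show E × ℂ from v) : E × ℂ)

/-- The homogenization of the Atiyah tensor `N` is the complex structure of the slit total space. -/
def IsGaugeComplexStructure (𝓛 : HolLineBundle E V) (N : 𝓛.AtiyahTensor) : Prop :=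
  ∀ ε v Δ, 𝓛.IsImage ε v Δ → 𝓛.IsImage ε (𝓛.complexStructure ε v) (N.toFun _ Δ)

end HolLineBundle

/-! ### The conormal line bundle of a holomorphic hyperplane field -/

section Conormal

variable {E : Type*} [NormedAddCommGroup E] [NormedSpace ℂ E]
  {G : Type*} [TopologicalSpace G] [ChartedSpace E G]

/-- The complex dual of the normal space `T_g G / H_g`. -/
def Conormal (H : ∀ g : G, Submodule ℂ (TangentSpace 𝓘(ℂ, E) g)) (g : G) : Type _ :=
  (TangentSpace 𝓘(ℂ, E) g ⧸ H g) →ₗ[ℂ] ℂ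

variable {H : ∀ g : G, Submodule ℂ (TangentSpace 𝓘(ℂ, E) g)}

instance (g : G) : AddCommGroup (Conormal H g) :=
  inferInstanceAs (AddCommGroup ((TangentSpace 𝓘(ℂ, E) g ⧸ H g) →ₗ[ℂ] ℂ))

instance (g : G) : Module ℂ (Conormal H g) :=
  inferInstanceAs (Module ℂ ((TangentSpace 𝓘(ℂ, E) g ⧸ H g) →ₗ[ℂ] ℂ))

/-- A linear form on the normal space as a conormal vector. -/
def Conormal.mk {g : G} (ξ : (TangentSpace 𝓘(ℂ, E) g ⧸ H g) →ₗ[ℂ] ℂ) : Conormal H g := ξ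

/-- The pairing of a conormal vector with the class of a tangent vector. -/
def Conormal.eval {g : G} (ξ : Conormal H g) : TangentSpace 𝓘(ℂ, E) g →ₗ[ℂ] ℂ :=
  LinearMap.comp (show (TangentSpace 𝓘(ℂ, E) g ⧸ H g) →ₗ[ℂ] ℂ from ξ) (H g).mkQ

theorem Conormal.eval_injective {g : G} {ξ η : Conormal H g} (h : ξ.eval = η.eval) : ξ = η :=
  Submodule.linearMap_qext (H g) h

theorem Conormal.eval_smul {g : G} (c : ℂ) (ξ : Conormal H g) : (c • ξ).eval = c • ξ.eval := rfl

open Classical in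
/-- The conormal vector induced by a linear form which vanishes on `H g`. -/
def Conormal.ofForm (H : ∀ g : G, Submodule ℂ (TangentSpace 𝓘(ℂ, E) g)) {g : G}
    (α : TangentSpace 𝓘(ℂ, E) g →L[ℂ] ℂ) : Conormal H g :=
  if h : H g ≤ LinearMap.ker α.toLinearMap then Conormal.mk ((H g).liftQ α.toLinearMap h)
  else 0

theorem Conormal.eval_ofForm {g : G} {α : TangentSpace 𝓘(ℂ, E) g →L[ℂ] ℂ}
    (h : H g ≤ LinearMap.ker α.toLinearMap) : (Conormal.ofForm H α).eval = α.toLinearMap := by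
  unfold Conormal.ofForm
  rw [dif_pos h]
  exact (H g).liftQ_mkQ α.toLinearMap h

theorem Conormal.ofForm_smul {g : G} {u : ℂ} (hu : u ≠ 0) (α : TangentSpace 𝓘(ℂ, E) g →L[ℂ] ℂ) :
    Conormal.ofForm H (u • α) = u • Conormal.ofForm H α := by
  have hk : LinearMap.ker (u • α).toLinearMap = LinearMap.ker α.toLinearMap := by
    ext v
    change u * α v = 0 ↔ α v = 0
    simp [hu]
  by_cases h : H g ≤ LinearMap.ker α.toLinearMap
  · apply Conormal.eval_injective
    rw [Conormal.eval_smul, Conormal.eval_ofForm h, Conormal.eval_ofForm (hk ▸ h)]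
    rfl
  · unfold Conormal.ofForm
    rw [dif_neg h, dif_neg (hk ▸ h)]
    rw [smul_zero]

variable [IsManifold 𝓘(ℂ, E) ω G]

theorem IsDefiningForm.le_ker {n : WithTop ℕ∞} {U : Set G}
    {α : ∀ g : G, TangentSpace 𝓘(ℂ, E) g →L[ℂ] ℂ} (hα : IsDefiningForm n H U α) {g : G}
    (hg : g ∈ U) : H g ≤ LinearMap.ker (α g).toLinearMap :=
  fun v hv => (hα.mem_iff g hg v).1 hv

theorem IsDefiningForm.smul {U : Set G}
    {α : ∀ g : G, TangentSpace 𝓘(ℂ, E) g →L[ℂ] ℂ} (hα : IsDefiningForm ω H U α) {u : ℂ}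
    (hu : u ≠ 0) : IsDefiningForm ω H U (fun g => u • α g) where
  isOpen := hα.isOpen
  contMDiffOn := ContMDiffOn.smul_section (f := fun _ => u) contMDiffOn_const hα.contMDiffOn
  ne_zero g hg := smul_ne_zero hu (hα.ne_zero g hg)
  mem_iff g hg v := by
    rw [hα.mem_iff g hg v]
    change _ ↔ u * α g v = 0
    simp [hu]

/-- Two defining forms differ by a holomorphic factor. -/
theorem IsDefiningForm.exists_factor {U U' : Set G}
    {α α' : ∀ g : G, TangentSpace 𝓘(ℂ, E) g →L[ℂ] ℂ} (hα : IsDefiningForm ω H U α)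
    (hα' : IsDefiningForm ω H U' α') :
    ∃ d : G → ℂ, ContMDiffOn 𝓘(ℂ, E) 𝓘(ℂ) ω d (U ∩ U') ∧ ∀ g ∈ U ∩ U', α g = d g • α' g := by
  have key : ∀ g ∈ U ∩ U', ∀ v, α' g v ≠ 0 → α g = (α g v / α' g v) • α' g := by
    rintro g ⟨hg, hg'⟩ v hv
    ext w
    have h1 : α' g (w - (α' g w / α' g v) • v) = 0 := by
      rw [map_sub, map_smul, smul_eq_mul, div_mul_cancel₀ _ hv, sub_self]
    have h2 := (hα.mem_iff g hg _).1 ((hα'.mem_iff g hg' _).2 h1)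
    rw [map_sub, map_smul, smul_eq_mul, sub_eq_zero] at h2
    rw [h2]
    change _ = α g v / α' g v * α' g w
    field_simp
  have hex : ∀ g, ∃ c : ℂ, g ∈ U ∩ U' → α g = c • α' g := by
    intro g
    by_cases hg : g ∈ U ∩ U'
    · obtain ⟨v, hv⟩ : ∃ v, α' g v ≠ 0 := by
        by_contra! h
        exact hα'.ne_zero g hg.2 (ContinuousLinearMap.ext h)
      exact ⟨_, fun _ => key g hg v hv⟩
    · exact ⟨0, fun h => absurd h hg⟩
  choose d hd using hex
  refine ⟨d, fun g hg => ?_, hd⟩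
  obtain ⟨v, hv⟩ : ∃ v, α' g v ≠ 0 := by
    by_contra! h
    exact hα'.ne_zero g hg.2 (ContinuousLinearMap.ext h)
  set X : ∀ g : G, TangentSpace 𝓘(ℂ, E) g := FiberBundle.extend E v with hX
  have hXg : X g = v := FiberBundle.extend_apply_self E v
  have hXs : ContMDiffAt 𝓘(ℂ, E) 𝓘(ℂ, E).tangent ω
      (fun g => (⟨g, X g⟩ : TangentBundle 𝓘(ℂ, E) G)) g := FiberBundle.contMDiffAt_extend ..
  have hval : ∀ (W : Set G) (β : ∀ g : G, TangentSpace 𝓘(ℂ, E) g →L[ℂ] ℂ),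
      IsDefiningForm ω H W β → g ∈ W → ContMDiffAt 𝓘(ℂ, E) 𝓘(ℂ) ω (fun g => β g (X g)) g := by
    intro W β hβ hg
    have h1 := (hβ.contMDiffOn.contMDiffAt (hβ.isOpen.mem_nhds hg)).clm_bundle_apply hXs
    exact ((Bundle.contMDiffAt_section ..).1 h1)
  have h1 := hval U α hα hg.1
  have h2 := hval U' α' hα' hg.2
  have h3 : ContMDiffAt 𝓘(ℂ, E) 𝓘(ℂ) ω (fun g => α g (X g) / α' g (X g)) g :=
    h1.div₀ h2 (by rwa [hXg])
  refine (h3.congr_of_eventuallyEq ?_).contMDiffWithinAt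
  have h4 : ∀ᶠ y in 𝓝 g, α' y (X y) ≠ 0 := h2.continuousAt.eventually_ne (by rwa [hXg])
  filter_upwards [h4, (hα.isOpen.inter hα'.isOpen).mem_nhds hg] with y hy hyU
  have h5 := hd y hyU
  rw [h5]
  change _ = d y * α' y (X y) / α' y (X y)
  field_simp

theorem Conormal.finrank_eq_one {U : Set G} {α : ∀ g : G, TangentSpace 𝓘(ℂ, E) g →L[ℂ] ℂ}
    (hα : IsDefiningForm ω H U α) {g : G} (hg : g ∈ U) :
    Module.finrank ℂ (Conormal H g) = 1 := by
  have h0 : Conormal.ofForm H (α g) ≠ 0 := by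
    intro h
    apply hα.ne_zero g hg
    have h1 := Conormal.eval_ofForm (hα.le_ker hg)
    rw [h] at h1
    ext v
    exact (LinearMap.congr_fun h1 v).symm
  obtain ⟨v, hv⟩ : ∃ v, α g v ≠ 0 := by
    by_contra! h
    exact hα.ne_zero g hg (ContinuousLinearMap.ext h)
  refine (finrank_eq_one_iff_of_nonzero' _ h0).2 fun ξ => ⟨ξ.eval v / α g v, ?_⟩
  apply Conormal.eval_injective
  rw [Conormal.eval_smul, Conormal.eval_ofForm (hα.le_ker hg)]
  ext w
  have h1 : w - (α g w / α g v) • v ∈ H g := by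
    rw [hα.mem_iff g hg, map_sub, map_smul, smul_eq_mul, div_mul_cancel₀ _ hv, sub_self]
  have h2 : ξ.eval (w - (α g w / α g v) • v) = 0 := by
    change (show (TangentSpace 𝓘(ℂ, E) g ⧸ H g) →ₗ[ℂ] ℂ from ξ) ((H g).mkQ _) = 0
    rw [(Submodule.Quotient.mk_eq_zero (H g)).2 h1 |> fun h => (show (H g).mkQ _ = 0 from h), map_zero]
  rw [map_sub, map_smul, smul_eq_mul, sub_eq_zero] at h2
  rw [h2]
  change ξ.eval v / α g v * α g w = _
  field_simp

/-- The pull-back along a holomorphic map `f` of the conormal bundle of a holomorphic hyperplane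
field `H`, the complex dual of the normal bundle `TG / H`. Local defining forms of `H` are
frames. -/
def conormalPullback {F : Type*} [NormedAddCommGroup F] [NormedSpace ℂ F]
    {B : Type*} [TopologicalSpace B] [ChartedSpace F B]
    (f : B → G) (hf : ContMDiff 𝓘(ℂ, F) 𝓘(ℂ, E) ω f) (hH : IsHyperplaneField ω H) :
    HolLineBundle F (fun b => Conormal H (f b)) where
  frames := {φ | ∃ U α, IsDefiningForm ω H U α ∧
    φ = (f ⁻¹' U, fun b => Conormal.ofForm H (α (f b)))}
  isOpen := by
    rintro _ ⟨U, α, hα, rfl⟩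
    exact hα.isOpen.preimage hf.continuous
  ne_zero := by
    rintro _ ⟨U, α, hα, rfl⟩ b hb h
    change Conormal.ofForm H (α (f b)) = 0 at h
    apply hα.ne_zero _ hb
    have h1 := Conormal.eval_ofForm (hα.le_ker hb)
    rw [h] at h1
    ext v
    exact (LinearMap.congr_fun h1 v).symm
  exists_frame b := by
    obtain ⟨U, α, hb, hα⟩ := hH (f b)
    exact ⟨_, ⟨U, α, hα, rfl⟩, hb⟩
  smul_mem := by
    rintro _ ⟨U, α, hα, rfl⟩ u hu
    exact ⟨U, _, hα.smul hu, Prod.ext rfl (funext fun b => (Conormal.ofForm_smul hu _).symm)⟩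
  rank_one b := by
    obtain ⟨U, α, hb, hα⟩ := hH (f b)
    exact Conormal.finrank_eq_one hα hb
  transition := by
    rintro _ ⟨U, α, hα, rfl⟩ _ ⟨U', α', hα', rfl⟩
    obtain ⟨d, hd, h⟩ := hα.exists_factor hα'
    refine ⟨fun b => d (f b), hd.comp hf.contMDiffOn (fun b hb => hb), fun b hb => ?_⟩
    apply Conormal.eval_injective
    change (Conormal.ofForm H (α (f b))).eval = (d (f b) • Conormal.ofForm H (α' (f b))).eval
    rw [Conormal.eval_smul, Conormal.eval_ofForm (hα.le_ker hb.1),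
      Conormal.eval_ofForm (hα'.le_ker hb.2), h _ hb]
    rfl

end Conormal

/-! ### Holomorphic contact groupoids and the associated real contact groupoids -/

/-- A holomorphic contact groupoid. The holomorphic tangent bundle `T^{1,0}` of a complex manifold is
its tangent bundle, regarded as a complex vector bundle. -/
structure HolContactGroupoid (E F G X : Type*)
    [NormedAddCommGroup E] [NormedSpace ℂ E] [NormedAddCommGroup F] [NormedSpace ℂ F]
    [TopologicalSpace G] [ChartedSpace E G] [IsManifold 𝓘(ℂ, E) ω G]
    [TopologicalSpace X] [ChartedSpace F X] [IsManifold 𝓘(ℂ, F) ω X] where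
  grpd : GroupoidData G X
  isLieGroupoid : grpd.IsLieGroupoid ℂ (E := E) (F := F) ω
  H : ∀ g : G, Submodule ℂ (TangentSpace 𝓘(ℂ, E) g)
  isContact : IsContact ω H
  isMultiplicative : grpd.IsMultiplicative ℂ (F := F) H

namespace HolContactGroupoid

variable {E F G X : Type*}
  [NormedAddCommGroup E] [NormedSpace ℂ E] [NormedAddCommGroup F] [NormedSpace ℂ F]
  [TopologicalSpace G] [ChartedSpace E G] [IsManifold 𝓘(ℂ, E) ω G]
  [TopologicalSpace X] [ChartedSpace F X] [IsManifold 𝓘(ℂ, F) ω X]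

/-- The complex dual of the normal bundle `L_G = TG / H`. -/
def conormal (K : HolContactGroupoid E F G X) : HolLineBundle E (fun g : G => Conormal K.H g) :=
  conormalPullback id contMDiff_id K.isContact.hyperplane

/-- The complex dual of the core `L` of the groupoid `L_G`, that is, of its restriction to the
units. -/
def coreDual (K : HolContactGroupoid E F G X) :
    HolLineBundle F (fun x : X => Conormal K.H (K.grpd.one x)) :=
  conormalPullback K.grpd.one K.isLieGroupoid.contMDiff_one K.isContact.hyperplane

/-- In the groupoid dual to `L_G`, the arrows `ε₁` and `ε₂` are composable with product `ε`, that is,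
`⟨ε, v · w⟩ = ⟨ε₁, v⟩ + ⟨ε₂, w⟩` for the product `v · w` in `L_G` induced by that of the tangent
groupoid. -/
def DualMul (K : HolContactGroupoid E F G X) (ε₁ ε₂ ε : K.conormal.Slit) : Prop :=
  K.grpd.src ε₁.base = K.grpd.tgt ε₂.base ∧ ε.base = K.grpd.mul ε₁.base ε₂.base ∧
    ∀ (v : TangentSpace 𝓘(ℂ, E) ε₁.base) (w : TangentSpace 𝓘(ℂ, E) ε₂.base)
      (u : TangentSpace 𝓘(ℂ, E) ε.base),
      (K.grpd.tangent ℂ (F := F)).src (⟨ε₁.base, v⟩ : TangentBundle 𝓘(ℂ, E) G) =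
        (K.grpd.tangent ℂ (F := F)).tgt (⟨ε₂.base, w⟩ : TangentBundle 𝓘(ℂ, E) G) →
      (K.grpd.tangent ℂ (F := F)).mul ⟨ε₁.base, v⟩ ⟨ε₂.base, w⟩ =
        (⟨ε.base, u⟩ : TangentBundle 𝓘(ℂ, E) G) →
      ε.vec.eval u = ε₁.vec.eval v + ε₂.vec.eval w

/-- The unit arrow at a nonzero element of the dual of the core. -/
def tildeOne (K : HolContactGroupoid E F G X) (η : K.coreDual.Slit) : K.conormal.Slit :=
  ⟨K.grpd.one η.base, η.vec, η.ne_zero⟩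

theorem nonempty_slit (K : HolContactGroupoid E F G X) (ε : K.conormal.Slit) :
    Nonempty K.coreDual.Slit :=
  ⟨⟨K.grpd.src ε.base, K.coreDual.someVec _, K.coreDual.someVec_ne_zero _⟩⟩

/-- The groupoid of nonzero elements of the dual of `L_G` over the nonzero elements of the dual of
the core. -/
def tilde (K : HolContactGroupoid E F G X) : GroupoidData K.conormal.Slit K.coreDual.Slit where
  src ε := @Classical.epsilon _ (K.nonempty_slit ε) fun η => K.DualMul ε (K.tildeOne η) ε
  tgt ε := @Classical.epsilon _ (K.nonempty_slit ε) fun η => K.DualMul (K.tildeOne η) ε ε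
  one := K.tildeOne
  inv ε := @Classical.epsilon _ ⟨ε⟩ fun ε' => ∃ η, K.DualMul ε ε' (K.tildeOne η)
  mul ε₁ ε₂ := @Classical.epsilon _ ⟨ε₁⟩ fun ε => K.DualMul ε₁ ε₂ ε

/-- The groupoid induced on the real projective bundles of the duals of `L_G` and of the core. -/
def hat (K : HolContactGroupoid E F G X) : GroupoidData K.conormal.RProj K.coreDual.RProj where
  src x := K.coreDual.toProj (K.tilde.src (K.conormal.rep x))
  tgt x := K.coreDual.toProj (K.tilde.tgt (K.conormal.rep x))
  one y := ⟨K.grpd.one y.base, y.line⟩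
  inv x := K.conormal.toProj (K.tilde.inv (K.conormal.rep x))
  mul x₁ x₂ := @Classical.epsilon _ ⟨x₁⟩ fun x => ∃ ε₁ ε₂, K.conormal.toProj ε₁ = x₁ ∧
    K.conormal.toProj ε₂ = x₂ ∧ K.tilde.src ε₁ = K.tilde.tgt ε₂ ∧
    x = K.conormal.toProj (K.tilde.mul ε₁ ε₂)

/-- The derivative of the projection of the real projective bundle to the base. -/
def projDeriv (K : HolContactGroupoid E F G X) (x : K.conormal.RProj) :
    TangentSpace 𝓘(ℝ, E × ℝ) x →ₗ[ℝ] TangentSpace 𝓘(ℂ, E) x.base :=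
  (show (E × ℝ) →ₗ[ℝ] E from
    (mfderiv 𝓘(ℝ, E × ℝ) 𝓘(ℝ, E) HolLineBundle.RProj.base x).toLinearMap)

/-- The form on the real projective bundle of the dual of `L_G` with values in the dual of the
tautological line bundle, `⟨ξ, θ v⟩ = Re ⟨ξ, dq v mod H⟩`, with `q` the projection to `G`. The
corresponding homogeneous form on the slit total space is the real part of the tautological
holomorphic form `v ↦ ⟨ε, dp v mod H⟩`, whose differential is the complex symplectic form of the
symplectization of `H`; so the kernel of `θ` is the contact structure with symplectization
the real part of that form. -/
def hatForm (K : HolContactGroupoid E F G X) (x : K.conormal.RProj) :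
    TangentSpace 𝓘(ℝ, E × ℝ) x →ₗ[ℝ] K.conormal.HatFiber x where
  toFun v := ({
    toFun := fun ξ => (Conormal.eval ξ.1 (K.projDeriv x v)).re
    map_add' := fun ξ η => rfl
    map_smul' := fun r ξ => by
      change (Conormal.eval ((r : ℂ) • ξ.1) (K.projDeriv x v)).re = r * _
      rw [Conormal.eval_smul, LinearMap.smul_apply, smul_eq_mul, Complex.re_ofReal_mul] } :
    K.conormal.realLine x →ₗ[ℝ] ℝ)
  map_add' v w := by
    refine LinearMap.ext fun ξ => ?_
    change (Conormal.eval ξ.1 (K.projDeriv x (v + w))).re =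
      (Conormal.eval ξ.1 (K.projDeriv x v)).re + (Conormal.eval ξ.1 (K.projDeriv x w)).re
    rw [map_add, map_add, Complex.add_re]
  map_smul' r v := by
    refine LinearMap.ext fun ξ => ?_
    change (Conormal.eval ξ.1 (K.projDeriv x (r • v))).re =
      r * (Conormal.eval ξ.1 (K.projDeriv x v)).re
    have h : K.projDeriv x (r • v) = (r : ℂ) • K.projDeriv x v := map_smul (K.projDeriv x) r v
    rw [h, map_smul, smul_eq_mul, Complex.re_ofReal_mul]

/-- The kernel of the form `hatForm`. -/
def hatH (K : HolContactGroupoid E F G X) (x : K.conormal.RProj) :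
    Submodule ℝ (TangentSpace 𝓘(ℝ, E × ℝ) x) :=
  LinearMap.ker (K.hatForm x)

/-- The sections of the pull-back, along the multiplication, of the dual of the tautological line
bundle to the manifold of composable pairs of `K.hat`. They are regarded as functions on the
composable pairs of `K.tilde` which are smooth and homogeneous of degree one; a section `λ` of
the pulled-back bundle corresponds to `(ε₁, ε₂) ↦ ⟨ε₁ ε₂, λ⟩`. Values outside the set of
composable pairs do not matter. -/
def PairSections (K : HolContactGroupoid E F G X) :
    Submodule ℝ (K.conormal.Slit × K.conormal.Slit → ℝ) where
  carrier := {Φ | ContMDiffOn (𝓘(ℝ, E × ℂ).prod 𝓘(ℝ, E × ℂ)) 𝓘(ℝ, ℝ) ∞ Φ K.tilde.composable ∧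
    ∀ ε₁ ε₂, (ε₁, ε₂) ∈ K.tilde.composable → ∀ r : ℝˣ,
      Φ (K.conormal.rescale r ε₁, K.conormal.rescale r ε₂) = r * Φ (ε₁, ε₂)}
  zero_mem' := ⟨contMDiffOn_const, fun _ _ _ r => by simp⟩
  add_mem' := by
    rintro Φ Ψ ⟨h1, h2⟩ ⟨h3, h4⟩
    refine ⟨h1.add h3, fun ε₁ ε₂ h r => ?_⟩
    rw [Pi.add_apply, Pi.add_apply, h2 ε₁ ε₂ h, h4 ε₁ ε₂ h, mul_add]
  smul_mem' := by
    rintro c Φ ⟨h1, h2⟩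
    refine ⟨?_, fun ε₁ ε₂ h r => ?_⟩
    · have hc : ContMDiffOn (𝓘(ℝ, E × ℂ).prod 𝓘(ℝ, E × ℂ)) 𝓘(ℝ, ℝ) ∞
          (fun _ : K.conormal.Slit × K.conormal.Slit => c) K.tilde.composable := contMDiffOn_const
      exact hc.smul h1
    · rw [Pi.smul_apply, Pi.smul_apply, h2 ε₁ ε₂ h, smul_eq_mul, smul_eq_mul]
      ring

/-- `D`, mapping sections of the pull-back of the line bundle to `ℝ`, is a derivation at the
composable pair spanned by `(ε₁, ε₂)`, where the fibre is identified with `ℝ` by the evaluation on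
`ε₁ ε₂`. The symbol of `D` is a tangent vector of the manifold of composable pairs. -/
def IsPairDerivation (K : HolContactGroupoid E F G X) (ε₁ ε₂ : K.conormal.Slit)
    (D : K.PairSections →ₗ[ℝ] ℝ) : Prop :=
  ∃ (v₁ : TangentSpace 𝓘(ℝ, E × ℝ) (K.conormal.toProj ε₁))
    (v₂ : TangentSpace 𝓘(ℝ, E × ℝ) (K.conormal.toProj ε₂)),
    (K.hat.tangent ℝ (F := F × ℝ)).src
        (⟨K.conormal.toProj ε₁, v₁⟩ : TangentBundle 𝓘(ℝ, E × ℝ) K.conormal.RProj) =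
      (K.hat.tangent ℝ (F := F × ℝ)).tgt
        (⟨K.conormal.toProj ε₂, v₂⟩ : TangentBundle 𝓘(ℝ, E × ℝ) K.conormal.RProj) ∧
    ∀ f : K.conormal.RProj × K.conormal.RProj → ℝ,
      ContMDiffOn (𝓘(ℝ, E × ℝ).prod 𝓘(ℝ, E × ℝ)) 𝓘(ℝ, ℝ) ∞ f K.hat.composable →
      ∀ Φ Ψ : K.PairSections,
        (∀ p ∈ K.tilde.composable,
          Ψ.1 p = f (K.conormal.toProj p.1, K.conormal.toProj p.2) * Φ.1 p) →
        D Ψ = (show ℝ from mfderivWithin (𝓘(ℝ, E × ℝ).prod 𝓘(ℝ, E × ℝ)) 𝓘(ℝ, ℝ) f K.hat.composable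
            (K.conormal.toProj ε₁, K.conormal.toProj ε₂) (v₁, v₂)) * Φ.1 (ε₁, ε₂) +
          f (K.conormal.toProj ε₁, K.conormal.toProj ε₂) * D Φ

/-- The derivations `Δ₁` and `Δ₂` are composable in the groupoid structure of the gauge algebroid,
with product `Δ`: they are the images, under the two projections and the multiplication, of a
derivation of the line bundle over the manifold of composable pairs. -/
def GaugeMul (K : HolContactGroupoid E F G X) (ε₁ ε₂ : K.conormal.Slit)
    (Δ₁ : K.conormal.Gauge (K.conormal.toProj ε₁)) (Δ₂ : K.conormal.Gauge (K.conormal.toProj ε₂))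
    (Δ : K.conormal.Gauge (K.conormal.toProj (K.tilde.mul ε₁ ε₂))) : Prop :=
  ∃ D, K.IsPairDerivation ε₁ ε₂ D ∧ ∀ (s : K.conormal.Sections) (Φ : K.PairSections),
    ((∀ p ∈ K.tilde.composable, Φ.1 p = K.conormal.homogenize s.1 p.1) →
      D Φ = K.conormal.pairing ε₁ (Δ₁.1 s)) ∧
    ((∀ p ∈ K.tilde.composable, Φ.1 p = K.conormal.homogenize s.1 p.2) →
      D Φ = K.conormal.pairing ε₂ (Δ₂.1 s)) ∧
    ((∀ p ∈ K.tilde.composable, Φ.1 p = K.conormal.homogenize s.1 (K.tilde.mul p.1 p.2)) →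
      D Φ = K.conormal.pairing (K.tilde.mul ε₁ ε₂) (Δ.1 s))

/-- The one-jets `ψ₁` and `ψ₂` are composable in the groupoid structure of the first jet bundle, dual
to that of the gauge algebroid, with product `ψ`. -/
def JetMul (K : HolContactGroupoid E F G X) (ε₁ ε₂ : K.conormal.Slit)
    (ψ₁ : K.conormal.Jet (K.conormal.toProj ε₁)) (ψ₂ : K.conormal.Jet (K.conormal.toProj ε₂))
    (ψ : K.conormal.Jet (K.conormal.toProj (K.tilde.mul ε₁ ε₂))) : Prop :=
  ∀ Δ₁ Δ₂ Δ, K.GaugeMul ε₁ ε₂ Δ₁ Δ₂ Δ → K.conormal.pairing (K.tilde.mul ε₁ ε₂) (ψ Δ) =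
    K.conormal.pairing ε₁ (ψ₁ Δ₁) + K.conormal.pairing ε₂ (ψ₂ Δ₂)

/-- The Atiyah tensor `N` is multiplicative: the map `(Δ, ψ) ↦ ⟨ψ, N Δ⟩` from the fibred product of
the gauge algebroid and the first jet bundle to the line bundle is a groupoid map. -/
def IsMultiplicativeTensor (K : HolContactGroupoid E F G X) (N : K.conormal.AtiyahTensor) : Prop :=
  ∀ ε₁ ε₂, K.tilde.src ε₁ = K.tilde.tgt ε₂ →
    ∀ Δ₁ Δ₂ Δ, K.GaugeMul ε₁ ε₂ Δ₁ Δ₂ Δ → ∀ ψ₁ ψ₂ ψ, K.JetMul ε₁ ε₂ ψ₁ ψ₂ ψ →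
      K.conormal.pairing (K.tilde.mul ε₁ ε₂) (ψ (N.toFun _ Δ)) =
        K.conormal.pairing ε₁ (ψ₁ (N.toFun _ Δ₁)) + K.conormal.pairing ε₂ (ψ₂ (N.toFun _ Δ₂))

/-- `K.hat`, with the contact structure `K.hatH` and the Atiyah tensor `N`, is a contact-Nijenhuis
groupoid. -/
structure IsContactNijenhuisGroupoid (K : HolContactGroupoid E F G X)
    (N : K.conormal.AtiyahTensor) : Prop where
  isLieGroupoid : K.hat.IsLieGroupoid ℝ (E := E × ℝ) (F := F × ℝ) ∞
  isContactNijenhuis : K.conormal.IsContactNijenhuis K.hatForm N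
  isMultiplicative : K.hat.IsMultiplicative ℝ (F := F × ℝ) K.hatH
  isMultiplicativeTensor : K.IsMultiplicativeTensor N

end HolContactGroupoid


end

noncomputable section

section RestrictScalars

variable {E : Type*} [NormedAddCommGroup E] [NormedSpace ℂ E]
  {F : Type*} [NormedAddCommGroup F] [NormedSpace ℂ F]
  {D : Type*} [NormedAddCommGroup D] [NormedSpace ℂ D]
  {M : Type*} [TopologicalSpace M] [ChartedSpace E M]
  {N : Type*} [TopologicalSpace N] [ChartedSpace F N]
  {P : Type*} [TopologicalSpace P] [ChartedSpace D P]

theorem ContMDiffWithinAt.complexToReal {n : WithTop ℕ∞} {f : M → N} {s : Set M} {x : M}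
    (h : ContMDiffWithinAt 𝓘(ℂ, E) 𝓘(ℂ, F) n f s x) :
    ContMDiffWithinAt 𝓘(ℝ, E) 𝓘(ℝ, F) n f s x := by
  rw [contMDiffWithinAt_iff] at h ⊢
  exact ⟨h.1, h.2.restrict_scalars ℝ⟩

theorem ContMDiff.complexToReal {n : WithTop ℕ∞} {f : M → N}
    (h : ContMDiff 𝓘(ℂ, E) 𝓘(ℂ, F) n f) : ContMDiff 𝓘(ℝ, E) 𝓘(ℝ, F) n f :=
  fun x => (h x).complexToReal

theorem ContMDiffWithinAt.complexToReal_prod {n : WithTop ℕ∞} {f : M × P → N} {s : Set (M × P)}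
    {x : M × P} (h : ContMDiffWithinAt (𝓘(ℂ, E).prod 𝓘(ℂ, D)) 𝓘(ℂ, F) n f s x) :
    ContMDiffWithinAt (𝓘(ℝ, E).prod 𝓘(ℝ, D)) 𝓘(ℝ, F) n f s x := by
  rw [contMDiffWithinAt_iff] at h ⊢
  refine ⟨h.1, ?_⟩
  have h2 := h.2.restrict_scalars ℝ
  simp only [ModelWithCorners.range_eq_univ, inter_univ] at h2 ⊢
  exact h2

theorem HasMFDerivAt.complexToReal {f : M → N} {x : M}
    {f' : TangentSpace 𝓘(ℂ, E) x →L[ℂ] TangentSpace 𝓘(ℂ, F) (f x)}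
    (h : HasMFDerivAt 𝓘(ℂ, E) 𝓘(ℂ, F) f x f') :
    HasMFDerivAt 𝓘(ℝ, E) 𝓘(ℝ, F) f x
      ((show E →L[ℂ] F from f').restrictScalars ℝ : E →L[ℝ] F) :=
  ⟨h.1, HasFDerivWithinAt.restrictScalars ℝ h.2⟩

theorem HasMFDerivWithinAt.complexToReal_prod {f : M × P → N} {s : Set (M × P)} {x : M × P}
    {f' : TangentSpace (𝓘(ℂ, E).prod 𝓘(ℂ, D)) x →L[ℂ] TangentSpace 𝓘(ℂ, F) (f x)}
    (h : HasMFDerivWithinAt (𝓘(ℂ, E).prod 𝓘(ℂ, D)) 𝓘(ℂ, F) f s x f') :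
    HasMFDerivWithinAt (𝓘(ℝ, E).prod 𝓘(ℝ, D)) 𝓘(ℝ, F) f s x
      ((show E × D →L[ℂ] F from f').restrictScalars ℝ : E × D →L[ℝ] F) := by
  refine ⟨h.1, ?_⟩
  have h2 := HasFDerivWithinAt.restrictScalars ℝ h.2
  simp only [ModelWithCorners.range_eq_univ, inter_univ] at h2 ⊢
  exact h2

/-- The real derivative of a complex differentiable map. -/
theorem mfderiv_complexToReal {f : M → N} {x : M} (h : MDifferentiableAt 𝓘(ℂ, E) 𝓘(ℂ, F) f x)
    (v : E) : (mfderiv 𝓘(ℝ, E) 𝓘(ℝ, F) f x : E →L[ℝ] F) v =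
      (mfderiv 𝓘(ℂ, E) 𝓘(ℂ, F) f x : E →L[ℂ] F) v := by
  rw [h.hasMFDerivAt.complexToReal.mfderiv]
  rfl

theorem isManifold_complexToReal [IsManifold 𝓘(ℂ, E) ω M] : IsManifold 𝓘(ℝ, E) ∞ M := by
  refine isManifold_of_contDiffOn _ _ _ fun e e' he he' => ?_
  have h := (contDiffGroupoid ω 𝓘(ℂ, E)).compatible he he'
  have h2 := mem_groupoid_of_pregroupoid.1 h
  exact (ContDiffOn.restrict_scalars ℝ h2.1).of_le le_top

end RestrictScalars

section Retraction

variable {𝕜 : Type*} [RCLike 𝕜]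
  {E : Type*} [NormedAddCommGroup E] [NormedSpace 𝕜 E] [FiniteDimensional 𝕜 E]
  {F : Type*} [NormedAddCommGroup F] [NormedSpace 𝕜 F] [FiniteDimensional 𝕜 F]
  {D : Type*} [NormedAddCommGroup D] [NormedSpace 𝕜 D]

theorem ContDiffAt.exists_submersion_retraction {n : WithTop ℕ∞} (hn : n ≠ 0) {τ : E → F} {e : E}
    (hτ : ContDiffAt 𝕜 n τ e) (hs : Function.Surjective (fderiv 𝕜 τ e)) :
    ∃ R : F × E → E, ContDiffAt 𝕜 n R (τ e, e) ∧ R (τ e, e) = e ∧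
      (∀ᶠ p in 𝓝 (τ e, e), τ (R p) = p.1) ∧ ∀ᶠ k in 𝓝 e, R (τ k, k) = k := by
  have : CompleteSpace E := FiniteDimensional.complete 𝕜 E
  have : CompleteSpace F := FiniteDimensional.complete 𝕜 F
  obtain ⟨B0, hB0⟩ := (fderiv 𝕜 τ e).toLinearMap.exists_rightInverse_of_surjective
    (LinearMap.range_eq_top.2 hs)
  set B : F →L[𝕜] E := LinearMap.toContinuousLinearMap B0 with hBdef
  have hB : ∀ z, fderiv 𝕜 τ e (B z) = z := fun z => LinearMap.congr_fun hB0 z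
  let Φ : F × E → F × E := fun p => (τ (p.2 + B p.1), p.2)
  have hadd : ContDiff 𝕜 n (fun p : F × E => p.2 + B p.1) :=
    contDiff_snd.add (B.contDiff.comp contDiff_fst)
  have hτ' : ContDiffAt 𝕜 n τ ((0 : F × E).2 + e + B 0) := by simpa using hτ
  have hΦ : ContDiffAt 𝕜 n Φ (0, e) := by
    refine ContDiffAt.prodMk (ContDiffAt.comp (0, e) ?_ hadd.contDiffAt) contDiffAt_snd
    simpa using hτ
  have hd : HasFDerivAt Φ ((((fderiv 𝕜 τ e).comp
      (ContinuousLinearMap.snd 𝕜 F E + B.comp (ContinuousLinearMap.fst 𝕜 F E))).prod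
      (ContinuousLinearMap.snd 𝕜 F E))) (0, e) := by
    refine HasFDerivAt.prodMk ?_ hasFDerivAt_snd
    have h1 : HasFDerivAt τ (fderiv 𝕜 τ e) ((fun p : F × E => p.2 + B p.1) (0, e)) := by
      simpa using (hτ.differentiableAt hn).hasFDerivAt
    exact h1.comp (0, e) (hasFDerivAt_snd.add (B.hasFDerivAt.comp _ hasFDerivAt_fst))
  let L : (F × E) ≃L[𝕜] (F × E) := ContinuousLinearEquiv.equivOfInverse
    (((fderiv 𝕜 τ e).comp
      (ContinuousLinearMap.snd 𝕜 F E + B.comp (ContinuousLinearMap.fst 𝕜 F E))).prod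
      (ContinuousLinearMap.snd 𝕜 F E))
    ((ContinuousLinearMap.fst 𝕜 F E - (fderiv 𝕜 τ e).comp (ContinuousLinearMap.snd 𝕜 F E)).prod
      (ContinuousLinearMap.snd 𝕜 F E))
    (by rintro ⟨z, k⟩; ext <;> simp [hB]) (by rintro ⟨z, k⟩; ext <;> simp [hB])
  have hd' : HasFDerivAt Φ (L : (F × E) →L[𝕜] (F × E)) (0, e) := hd
  have hΦe : Φ (0, e) = (τ e, e) := by simp [Φ]
  set Ψ := hΦ.localInverse hd' hn with hΨ
  have hΨs : ContDiffAt 𝕜 n Ψ (τ e, e) := hΦe ▸ hΦ.to_localInverse hd' hn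
  have hΨe : Ψ (τ e, e) = (0, e) := hΦe ▸ hΦ.localInverse_apply_image hd' hn
  have hs' := hΦ.hasStrictFDerivAt' hd' hn
  have hr : ∀ᶠ p in 𝓝 (τ e, e), Φ (Ψ p) = p := hΦe ▸ hs'.eventually_right_inverse
  have hl : ∀ᶠ p in 𝓝 ((0 : F), e), Ψ (Φ p) = p := hs'.eventually_left_inverse
  refine ⟨fun p => (Ψ p).2 + B (Ψ p).1, hadd.contDiffAt.comp _ hΨs, by simp [hΨe], ?_, ?_⟩
  · filter_upwards [hr] with p hp
    exact congrArg Prod.fst hp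
  · have hc : ContinuousAt (fun k : E => ((0 : F), k)) e := by fun_prop
    filter_upwards [hc.eventually hl] with k hk
    have : Φ (0, k) = (τ k, k) := by simp [Φ]
    rw [this] at hk
    simp [hk]

variable {X N M : Type*} [TopologicalSpace X] [ChartedSpace F X] [TopologicalSpace N]
  [ChartedSpace E N] [TopologicalSpace M] 
  {H : Type*} [TopologicalSpace H] {J : ModelWithCorners 𝕜 D H} [ChartedSpace H M]

theorem ContMDiffAt.exists_submersion_retraction {n : WithTop ℕ∞} (hn : n ≠ 0)
    [IsManifold 𝓘(𝕜, F) n X] [IsManifold 𝓘(𝕜, E) n N] {t : N → X} {k : N}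
    (ht : ContMDiffAt 𝓘(𝕜, E) 𝓘(𝕜, F) n t k)
    (hs : Function.Surjective (mfderiv 𝓘(𝕜, E) 𝓘(𝕜, F) t k)) :
    ∃ R : X × N → N, ContMDiffAt (𝓘(𝕜, F).prod 𝓘(𝕜, E)) 𝓘(𝕜, E) n R (t k, k) ∧ R (t k, k) = k ∧
      (∀ᶠ p in 𝓝 (t k, k), t (R p) = p.1) ∧ ∀ᶠ k' in 𝓝 k, R (t k', k') = k' := by
  set e := extChartAt 𝓘(𝕜, E) k with he
  set x := extChartAt 𝓘(𝕜, F) (t k) with hx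
  obtain ⟨h1, h2⟩ := contMDiffAt_iff.1 ht
  simp only [ModelWithCorners.range_eq_univ, contDiffWithinAt_univ] at h2
  have hs2 : Function.Surjective (fderiv 𝕜 (x ∘ t ∘ e.symm) (e k)) := by
    have h3 := (ht.mdifferentiableAt hn).mfderiv
    rw [h3] at hs
    simp only [writtenInExtChartAt, ModelWithCorners.range_eq_univ, fderivWithin_univ] at hs
    exact hs
  obtain ⟨R, hR, hRe, hR1, hR2⟩ := h2.exists_submersion_retraction hn hs2
  have htk : (x ∘ t ∘ e.symm) (e k) = x (t k) := by
    simp [he]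
  rw [htk] at hR hRe hR1
  set Q : X × N → F × E := fun p => (x p.1, e p.2) with hQ
  have hQs : ContMDiffAt (𝓘(𝕜, F).prod 𝓘(𝕜, E)) 𝓘(𝕜, F × E) n Q (t k, k) := by
    refine ContMDiffAt.prodMk_space ?_ ?_
    · exact contMDiffAt_extChartAt.comp (t k, k) contMDiffAt_fst
    · exact contMDiffAt_extChartAt.comp (t k, k) contMDiffAt_snd
  have hRQ : ContMDiffAt (𝓘(𝕜, F).prod 𝓘(𝕜, E)) 𝓘(𝕜, E) n (R ∘ Q) (t k, k) :=
    ContMDiffAt.comp (t k, k) hR.contMDiffAt hQs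
  have hRQ0 : (R ∘ Q) (t k, k) = e k := hRe
  have hsymm : ContMDiffAt 𝓘(𝕜, E) 𝓘(𝕜, E) n e.symm (e k) :=
    (contMDiffOn_extChartAt_symm k).contMDiffAt (extChartAt_target_mem_nhds k)
  have hRs : ContMDiffAt (𝓘(𝕜, F).prod 𝓘(𝕜, E)) 𝓘(𝕜, E) n (e.symm ∘ R ∘ Q) (t k, k) := by
    refine ContMDiffAt.comp (t k, k) ?_ hRQ
    rwa [hRQ0]
  have hQt : Filter.Tendsto Q (𝓝 (t k, k)) (𝓝 (x (t k), e k)) := hQs.continuousAt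
  refine ⟨e.symm ∘ R ∘ Q, hRs, ?_, ?_, ?_⟩
  · change e.symm ((R ∘ Q) (t k, k)) = k
    rw [hRQ0, extChartAt_to_inv]
  · have hval : (e.symm ∘ R ∘ Q) (t k, k) = k := by
      change e.symm ((R ∘ Q) (t k, k)) = k
      rw [hRQ0, extChartAt_to_inv]
    have ha : ∀ᶠ p in 𝓝 (t k, k), t ((e.symm ∘ R ∘ Q) p) ∈ x.source := by
      have hc : ContinuousAt (t ∘ (e.symm ∘ R ∘ Q)) (t k, k) :=
        ContinuousAt.comp (by rw [hval]; exact ht.continuousAt) hRs.continuousAt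
      refine hc.eventually_mem ?_
      change x.source ∈ 𝓝 (t ((e.symm ∘ R ∘ Q) (t k, k)))
      rw [hval]
      exact extChartAt_source_mem_nhds _
    have hb : ∀ᶠ p in 𝓝 (t k, k), p.1 ∈ x.source :=
      continuousAt_fst.eventually_mem (extChartAt_source_mem_nhds _)
    filter_upwards [hQt.eventually hR1, ha, hb] with p hp hpa hpb
    exact x.injOn hpa hpb hp
  · have hc : ContinuousAt e k := continuousAt_extChartAt k
    filter_upwards [hc.eventually hR2, extChartAt_source_mem_nhds (I := 𝓘(𝕜, E)) k] with k' hk' hk2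
    change e.symm (R (x (t k'), e k')) = k'
    simp only [Function.comp] at hk'
    rw [e.left_inv hk2] at hk'
    rw [hk', e.left_inv hk2]

/-- A local retraction of `M × N` onto the fibred product of `f` and the submersion `t`. -/
theorem ContMDiffAt.exists_fibredProduct_retraction {n : WithTop ℕ∞} (hn : n ≠ 0)
    [IsManifold 𝓘(𝕜, F) n X] [IsManifold 𝓘(𝕜, E) n N] {t : N → X} {k : N}
    (ht : ContMDiffAt 𝓘(𝕜, E) 𝓘(𝕜, F) n t k)
    (hs : Function.Surjective (mfderiv 𝓘(𝕜, E) 𝓘(𝕜, F) t k)) {f : M → X} {m : M}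
    (hf : ContMDiffAt J 𝓘(𝕜, F) n f m) (hfm : f m = t k) :
    ∃ ρ : M × N → N, ContMDiffAt (J.prod 𝓘(𝕜, E)) 𝓘(𝕜, E) n ρ (m, k) ∧ ρ (m, k) = k ∧
      (∀ᶠ p in 𝓝 (m, k), t (ρ p) = f p.1) ∧
      (∀ᶠ p in 𝓝 (m, k), f p.1 = t p.2 → ρ p = p.2) ∧
      ∀ (v : D) (w : E), (mfderiv J 𝓘(𝕜, F) f m : D →L[𝕜] F) v =
        (mfderiv 𝓘(𝕜, E) 𝓘(𝕜, F) t k : E →L[𝕜] F) w →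
        (mfderiv (J.prod 𝓘(𝕜, E)) 𝓘(𝕜, E) ρ (m, k) : D × E →L[𝕜] E) (v, w) = w := by
  obtain ⟨R, hR, hRe, hR1, hR2⟩ := ContMDiffAt.exists_submersion_retraction hn ht hs
  have hg : ContMDiffAt (J.prod 𝓘(𝕜, E)) (𝓘(𝕜, F).prod 𝓘(𝕜, E)) n
      (fun p : M × N => (f p.1, p.2)) (m, k) :=
    (ContMDiffAt.comp (m, k) hf contMDiffAt_fst).prodMk contMDiffAt_snd
  have hgt : Filter.Tendsto (fun p : M × N => (f p.1, p.2)) (𝓝 (m, k)) (𝓝 (t k, k)) := by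
    have := hg.continuousAt
    rwa [ContinuousAt, hfm] at this
  have hR' : ContMDiffAt (𝓘(𝕜, F).prod 𝓘(𝕜, E)) 𝓘(𝕜, E) n R (f m, k) := by rwa [hfm]
  refine ⟨fun p => R (f p.1, p.2), ContMDiffAt.comp (m, k) hR' hg, by simp only [hfm, hRe],
    hgt.eventually hR1, ?_, fun v w hvw => ?_⟩
  · have : ∀ᶠ p : M × N in 𝓝 (m, k), R (t p.2, p.2) = p.2 :=
      (continuousAt_snd (p := (m, k))).eventually hR2
    filter_upwards [this] with p hp hpt
    rw [hpt, hp]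
  · have hRd : HasMFDerivAt (𝓘(𝕜, F).prod 𝓘(𝕜, E)) 𝓘(𝕜, E) R (f m, k) _ :=
      (hR'.mdifferentiableAt hn).hasMFDerivAt
    have hfd := (hf.mdifferentiableAt hn).hasMFDerivAt
    have h1 : HasMFDerivAt (J.prod 𝓘(𝕜, E)) (𝓘(𝕜, F).prod 𝓘(𝕜, E))
      (fun p : M × N => (f p.1, p.2)) (m, k) _ :=
      (HasMFDerivAt.comp (m, k) hfd (hasMFDerivAt_fst (m, k))).prodMk (hasMFDerivAt_snd (m, k))
    have h2 := HasMFDerivAt.comp (m, k) hRd h1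
    have h3 : HasMFDerivAt 𝓘(𝕜, E) (𝓘(𝕜, F).prod 𝓘(𝕜, E)) (fun k' : N => (t k', k')) k _ :=
      (ht.mdifferentiableAt hn).hasMFDerivAt.prodMk (hasMFDerivAt_id k)
    have hRd' : HasMFDerivAt (𝓘(𝕜, F).prod 𝓘(𝕜, E)) 𝓘(𝕜, E) R (t k, k) _ :=
      (hR.mdifferentiableAt hn).hasMFDerivAt
    have h4 := HasMFDerivAt.comp (f := fun k' : N => (t k', k')) k hRd' h3
    have h5 : HasMFDerivAt 𝓘(𝕜, E) 𝓘(𝕜, E) (R ∘ fun k' : N => (t k', k')) k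
        (ContinuousLinearMap.id 𝕜 E) := by
      exact (hasMFDerivAt_id k).congr_of_eventuallyEq hR2
    have h6 := hasMFDerivAt_unique h4 h5
    have h7 := congrArg (fun l : E →L[𝕜] E => l w) h6
    refine Eq.trans ?_ h7
    have h8 := h2.mfderiv
    refine (congrArg (fun l : D × E →L[𝕜] E => l (v, w)) h8).trans ?_
    change (mfderiv (𝓘(𝕜, F).prod 𝓘(𝕜, E)) 𝓘(𝕜, E) R (f m, k) : F × E →L[𝕜] E)
      ((mfderiv J 𝓘(𝕜, F) f m : D →L[𝕜] F) v, w) =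
      (mfderiv (𝓘(𝕜, F).prod 𝓘(𝕜, E)) 𝓘(𝕜, E) R (t k, k) : F × E →L[𝕜] E)
      ((mfderiv 𝓘(𝕜, E) 𝓘(𝕜, F) t k : E →L[𝕜] F) w, w)
    rw [hvw]
    have : ∀ y (hy : y = t k) (z : F × E), (mfderiv (𝓘(𝕜, F).prod 𝓘(𝕜, E)) 𝓘(𝕜, E) R (y, k) : F × E →L[𝕜] E) z =
      (mfderiv (𝓘(𝕜, F).prod 𝓘(𝕜, E)) 𝓘(𝕜, E) R (t k, k) : F × E →L[𝕜] E) z := by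
      rintro y rfl z; rfl
    exact this _ hfm _

end Retraction
end

noncomputable section

section CompEq

variable {𝕜 : Type*} [NontriviallyNormedField 𝕜]
  {E : Type*} [NormedAddCommGroup E] [NormedSpace 𝕜 E] {H : Type*} [TopologicalSpace H]
  {I : ModelWithCorners 𝕜 E H} {M : Type*} [TopologicalSpace M] [ChartedSpace H M]
  {E' : Type*} [NormedAddCommGroup E'] [NormedSpace 𝕜 E'] {H' : Type*} [TopologicalSpace H']
  {I' : ModelWithCorners 𝕜 E' H'} {M' : Type*} [TopologicalSpace M'] [ChartedSpace H' M']
  {E'' : Type*} [NormedAddCommGroup E''] [NormedSpace 𝕜 E''] {H'' : Type*} [TopologicalSpace H'']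
  {I'' : ModelWithCorners 𝕜 E'' H''} {M'' : Type*} [TopologicalSpace M''] [ChartedSpace H'' M'']

theorem HasMFDerivAt.comp_eq {g : M' → M''} {f : M → M'} {x : M} {y : M'} {g' : E' →L[𝕜] E''}
    {f' : E →L[𝕜] E'} (hg : HasMFDerivAt I' I'' g y g') (hf : HasMFDerivAt I I' f x f')
    (hy : f x = y) : HasMFDerivAt I I'' (fun z => g (f z)) x (g'.comp f' : E →L[𝕜] E'') := by
  subst hy
  exact HasMFDerivAt.comp x hg hf

theorem HasMFDerivWithinAt.comp_hasMFDerivAt_eq {g : M' → M''} {s : Set M'} {f : M → M'} {x : M}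
    {y : M'} {g' : E' →L[𝕜] E''} {f' : E →L[𝕜] E'} (hg : HasMFDerivWithinAt I' I'' g s y g')
    (hf : HasMFDerivAt I I' f x f') (hy : f x = y) (hs : ∀ᶠ z in 𝓝 x, f z ∈ s) :
    HasMFDerivAt I I'' (fun z => g (f z)) x (g'.comp f' : E →L[𝕜] E'') := by
  subst hy
  have h1 := HasMFDerivWithinAt.comp (s := f ⁻¹' s) x hg hf.hasMFDerivWithinAt subset_rfl
  exact h1.hasMFDerivAt hs

theorem HasMFDerivAt.eq_apply {f g : M → M'} {x : M} {f' g' : E →L[𝕜] E'}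
    (hf : HasMFDerivAt I I' f x f') (hg : HasMFDerivAt I I' g x g') (h : ∀ᶠ z in 𝓝 x, f z = g z)
    (v : E) : f' v = g' v := by
  have h1 : HasMFDerivAt I I' f x g' := HasMFDerivAt.congr_of_eventuallyEq hg h
  exact congrArg (fun l : E →L[𝕜] E' => l v) (hasMFDerivAt_unique hf h1)

theorem tangentBundle_eq_iff {x y : M} {v w : E} :
    ((⟨x, v⟩ : TangentBundle I M) = ⟨y, w⟩) ↔ x = y ∧ v = w := by
  constructor
  · intro h
    have h1 : x = y := congrArg Bundle.TotalSpace.proj h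
    subst h1
    exact ⟨rfl, Bundle.TotalSpace.mk_injective (F := E) (E := TangentSpace I) x h⟩
  · rintro ⟨rfl, rfl⟩
    rfl

end CompEq

namespace GroupoidData

section Derivs

variable {G X : Type*} (𝕜 : Type*) [NontriviallyNormedField 𝕜]
  (E : Type*) [NormedAddCommGroup E] [NormedSpace 𝕜 E]
  (F : Type*) [NormedAddCommGroup F] [NormedSpace 𝕜 F]
  [TopologicalSpace G] [ChartedSpace E G] [TopologicalSpace X] [ChartedSpace F X]

/-- The derivative of the source. -/
def dsrc (𝒢 : GroupoidData G X) (g : G) : E →L[𝕜] F := mfderiv 𝓘(𝕜, E) 𝓘(𝕜, F) 𝒢.src g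

/-- The derivative of the target. -/
def dtgt (𝒢 : GroupoidData G X) (g : G) : E →L[𝕜] F := mfderiv 𝓘(𝕜, E) 𝓘(𝕜, F) 𝒢.tgt g

/-- The derivative of the unit map. -/
def done (𝒢 : GroupoidData G X) (x : X) : F →L[𝕜] E := mfderiv 𝓘(𝕜, F) 𝓘(𝕜, E) 𝒢.one x

/-- The derivative of the inversion. -/
def dinv (𝒢 : GroupoidData G X) (g : G) : E →L[𝕜] E := mfderiv 𝓘(𝕜, E) 𝓘(𝕜, E) 𝒢.inv g

/-- A derivative of the multiplication; it is determined on composable tangent vectors. -/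
def dmul (𝒢 : GroupoidData G X) (g h : G) : E × E →L[𝕜] E :=
  mfderivWithin (𝓘(𝕜, E).prod 𝓘(𝕜, E)) 𝓘(𝕜, E) (fun p : G × G => 𝒢.mul p.1 p.2) 𝒢.composable (g, h)

end Derivs

namespace IsLieGroupoid

variable {G X : Type*} {𝕜 : Type*} [RCLike 𝕜]
  {E : Type*} [NormedAddCommGroup E] [NormedSpace 𝕜 E]
  {F : Type*} [NormedAddCommGroup F] [NormedSpace 𝕜 F]
  [TopologicalSpace G] [ChartedSpace E G] [TopologicalSpace X] [ChartedSpace F X]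
  {n : WithTop ℕ∞} {𝒢 : GroupoidData G X}

theorem hasMFDerivAt_src (h𝒢 : 𝒢.IsLieGroupoid 𝕜 (E := E) (F := F) n) (hn : n ≠ 0) (g : G) :
    HasMFDerivAt 𝓘(𝕜, E) 𝓘(𝕜, F) 𝒢.src g (𝒢.dsrc 𝕜 E F g) :=
  ((h𝒢.contMDiff_src g).mdifferentiableAt hn).hasMFDerivAt

theorem hasMFDerivAt_tgt (h𝒢 : 𝒢.IsLieGroupoid 𝕜 (E := E) (F := F) n) (hn : n ≠ 0) (g : G) :
    HasMFDerivAt 𝓘(𝕜, E) 𝓘(𝕜, F) 𝒢.tgt g (𝒢.dtgt 𝕜 E F g) :=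
  ((h𝒢.contMDiff_tgt g).mdifferentiableAt hn).hasMFDerivAt

theorem hasMFDerivAt_one (h𝒢 : 𝒢.IsLieGroupoid 𝕜 (E := E) (F := F) n) (hn : n ≠ 0) (x : X) :
    HasMFDerivAt 𝓘(𝕜, F) 𝓘(𝕜, E) 𝒢.one x (𝒢.done 𝕜 E F x) :=
  ((h𝒢.contMDiff_one x).mdifferentiableAt hn).hasMFDerivAt

theorem hasMFDerivAt_inv (h𝒢 : 𝒢.IsLieGroupoid 𝕜 (E := E) (F := F) n) (hn : n ≠ 0) (g : G) :
    HasMFDerivAt 𝓘(𝕜, E) 𝓘(𝕜, E) 𝒢.inv g (𝒢.dinv 𝕜 E g) :=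
  ((h𝒢.contMDiff_inv g).mdifferentiableAt hn).hasMFDerivAt

theorem hasMFDerivWithinAt_mul (h𝒢 : 𝒢.IsLieGroupoid 𝕜 (E := E) (F := F) n) (hn : n ≠ 0) {g h : G}
    (hgh : 𝒢.src g = 𝒢.tgt h) :
    HasMFDerivWithinAt (𝓘(𝕜, E).prod 𝓘(𝕜, E)) 𝓘(𝕜, E) (fun p : G × G => 𝒢.mul p.1 p.2)
      𝒢.composable (g, h) (𝒢.dmul 𝕜 E g h) :=
  ((h𝒢.contMDiffOn_mul (g, h) hgh).mdifferentiableWithinAt hn).hasMFDerivWithinAt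

variable {D : Type*} [NormedAddCommGroup D] [NormedSpace 𝕜 D] {H : Type*} [TopologicalSpace H]
  {J : ModelWithCorners 𝕜 D H} {M : Type*} [TopologicalSpace M] [ChartedSpace H M]

theorem hasMFDerivAt_mul (h𝒢 : 𝒢.IsLieGroupoid 𝕜 (E := E) (F := F) n) (hn : n ≠ 0) {g h : G}
    {φ ψ : M → G} {m : M} {φ' ψ' : D →L[𝕜] E} (hφ : HasMFDerivAt J 𝓘(𝕜, E) φ m φ')
    (hψ : HasMFDerivAt J 𝓘(𝕜, E) ψ m ψ') (hg : φ m = g) (hh : ψ m = h)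
    (hc : ∀ᶠ z in 𝓝 m, 𝒢.src (φ z) = 𝒢.tgt (ψ z)) :
    HasMFDerivAt J 𝓘(𝕜, E) (fun z => 𝒢.mul (φ z) (ψ z)) m
      ((𝒢.dmul 𝕜 E g h).comp (φ'.prod ψ') : D →L[𝕜] E) := by
  have hgh : 𝒢.src g = 𝒢.tgt h := by
    have := hc.self_of_nhds
    rwa [hg, hh] at this
  have h1 : HasMFDerivAt J (𝓘(𝕜, E).prod 𝓘(𝕜, E)) (fun z => (φ z, ψ z)) m
    (φ'.prod ψ' : D →L[𝕜] E × E) := hφ.prodMk hψ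
  exact (h𝒢.hasMFDerivWithinAt_mul hn hgh).comp_hasMFDerivAt_eq h1 (by rw [hg, hh]) hc

section Laws

variable [FiniteDimensional 𝕜 E] [FiniteDimensional 𝕜 F]
  [IsManifold 𝓘(𝕜, E) n G] [IsManifold 𝓘(𝕜, F) n X]

/-- A local retraction of `M × G` onto the pairs `(m, g)` with `f m = tgt g`. -/
theorem exists_retraction (h𝒢 : 𝒢.IsLieGroupoid 𝕜 (E := E) (F := F) n)
    (hn : n ≠ 0) {f : M → X} {m : M} {k : G} {f' : D →L[𝕜] F}
    (hf : ContMDiffAt J 𝓘(𝕜, F) n f m) (hf' : HasMFDerivAt J 𝓘(𝕜, F) f m f')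
    (hfm : f m = 𝒢.tgt k) :
    ∃ (ρ : M × G → G) (ρ' : D × E →L[𝕜] E),
      ContMDiffAt (J.prod 𝓘(𝕜, E)) 𝓘(𝕜, E) n ρ (m, k) ∧
      HasMFDerivAt (J.prod 𝓘(𝕜, E)) 𝓘(𝕜, E) ρ (m, k) ρ' ∧ ρ (m, k) = k ∧
      (∀ᶠ p in 𝓝 (m, k), f p.1 = 𝒢.tgt (ρ p)) ∧
      (∀ᶠ p in 𝓝 (m, k), f p.1 = 𝒢.tgt p.2 → ρ p = p.2) ∧
      ∀ (v : D) (w : E), f' v = 𝒢.dtgt 𝕜 E F k w → ρ' (v, w) = w := by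
  obtain ⟨ρ, h1, h2, h3, h4, h5⟩ := ContMDiffAt.exists_fibredProduct_retraction hn
    (h𝒢.contMDiff_tgt k) (h𝒢.submersion_tgt k) hf hfm
  refine ⟨ρ, mfderiv (J.prod 𝓘(𝕜, E)) 𝓘(𝕜, E) ρ (m, k), h1,
    (h1.mdifferentiableAt hn).hasMFDerivAt, h2, h3.mono fun p hp => hp.symm, h4,
    fun v w hvw => h5 v w ?_⟩
  rw [hf'.mfderiv]
  exact hvw

/-- A local retraction of `G × G` onto the composable pairs. -/
theorem exists_pair_retraction (h𝒢 : 𝒢.IsLieGroupoid 𝕜 (E := E) (F := F) n) (hn : n ≠ 0) {g h : G}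
    (hgh : 𝒢.src g = 𝒢.tgt h) :
    ∃ (ρ : G × G → G) (ρ' : E × E →L[𝕜] E),
      ContMDiffAt (𝓘(𝕜, E).prod 𝓘(𝕜, E)) 𝓘(𝕜, E) n ρ (g, h) ∧
      HasMFDerivAt (𝓘(𝕜, E).prod 𝓘(𝕜, E)) 𝓘(𝕜, E) ρ (g, h) ρ' ∧ ρ (g, h) = h ∧
      (∀ᶠ p in 𝓝 (g, h), 𝒢.src p.1 = 𝒢.tgt (ρ p)) ∧
      (∀ᶠ p in 𝓝 (g, h), 𝒢.src p.1 = 𝒢.tgt p.2 → ρ p = p.2) ∧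
      ∀ (v w : E), 𝒢.dsrc 𝕜 E F g v = 𝒢.dtgt 𝕜 E F h w → ρ' (v, w) = w :=
  h𝒢.exists_retraction hn (h𝒢.contMDiff_src g) (h𝒢.hasMFDerivAt_src hn g) hgh

variable (h𝒢 : 𝒢.IsLieGroupoid 𝕜 (E := E) (F := F) n) (hn : n ≠ 0)
include h𝒢 hn

/-- A derivative within the composable pairs is determined on composable tangent vectors. -/
theorem derivWithin_eq {F' : Type*} [NormedAddCommGroup F'] [NormedSpace 𝕜 F'] {H' : Type*}
    [TopologicalSpace H'] {I' : ModelWithCorners 𝕜 F' H'} {Y : Type*} [TopologicalSpace Y]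
    [ChartedSpace H' Y] {g h : G} (hgh : 𝒢.src g = 𝒢.tgt h) {f : G × G → Y}
    {A B : E × E →L[𝕜] F'}
    (hA : HasMFDerivWithinAt (𝓘(𝕜, E).prod 𝓘(𝕜, E)) I' f 𝒢.composable (g, h) A)
    (hB : HasMFDerivWithinAt (𝓘(𝕜, E).prod 𝓘(𝕜, E)) I' f 𝒢.composable (g, h) B)
    {v w : E} (hvw : 𝒢.dsrc 𝕜 E F g v = 𝒢.dtgt 𝕜 E F h w) : A (v, w) = B (v, w) := by
  obtain ⟨ρ, ρ', -, hρ', hρe, hρc, -, hρd⟩ := h𝒢.exists_pair_retraction hn hgh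
  have h1 : HasMFDerivAt (𝓘(𝕜, E).prod 𝓘(𝕜, E)) (𝓘(𝕜, E).prod 𝓘(𝕜, E))
      (fun p : G × G => (p.1, ρ p)) (g, h) ((ContinuousLinearMap.fst 𝕜 E E).prod ρ') :=
    (hasMFDerivAt_fst (g, h)).prodMk hρ'
  have h2 := (hA.comp_hasMFDerivAt_eq h1 (by simp only [hρe]) hρc).eq_apply
    (hB.comp_hasMFDerivAt_eq h1 (by simp only [hρe]) hρc) (Filter.Eventually.of_forall fun _ => rfl)
    (v, w)
  simpa [hρd v w hvw] using h2

theorem dsrc_dmul {g h : G} (hgh : 𝒢.src g = 𝒢.tgt h) {v w : E}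
    (hvw : 𝒢.dsrc 𝕜 E F g v = 𝒢.dtgt 𝕜 E F h w) :
    𝒢.dsrc 𝕜 E F (𝒢.mul g h) (𝒢.dmul 𝕜 E g h (v, w)) = 𝒢.dsrc 𝕜 E F h w := by
  obtain ⟨ρ, ρ', -, hρ', hρe, hρc, -, hρd⟩ := h𝒢.exists_pair_retraction hn hgh
  have h1 := h𝒢.hasMFDerivAt_mul hn (hasMFDerivAt_fst (g, h)) hρ' rfl hρe hρc
  have h2 := (h𝒢.hasMFDerivAt_src hn (𝒢.mul g h)).comp_eq h1 (by rw [hρe])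
  have h3 := (h𝒢.hasMFDerivAt_src hn h).comp_eq hρ' hρe
  have h4 := h2.eq_apply h3 (hρc.mono fun p hp => h𝒢.isGroupoid.src_mul _ _ hp) (v, w)
  change 𝒢.dsrc 𝕜 E F (𝒢.mul g h) (𝒢.dmul 𝕜 E g h (v, ρ' (v, w))) = 𝒢.dsrc 𝕜 E F h (ρ' (v, w)) at h4
  rwa [hρd v w hvw] at h4

theorem dtgt_dmul {g h : G} (hgh : 𝒢.src g = 𝒢.tgt h) {v w : E}
    (hvw : 𝒢.dsrc 𝕜 E F g v = 𝒢.dtgt 𝕜 E F h w) :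
    𝒢.dtgt 𝕜 E F (𝒢.mul g h) (𝒢.dmul 𝕜 E g h (v, w)) = 𝒢.dtgt 𝕜 E F g v := by
  obtain ⟨ρ, ρ', -, hρ', hρe, hρc, -, hρd⟩ := h𝒢.exists_pair_retraction hn hgh
  have h1 := h𝒢.hasMFDerivAt_mul hn (hasMFDerivAt_fst (g, h)) hρ' rfl hρe hρc
  have h2 := (h𝒢.hasMFDerivAt_tgt hn (𝒢.mul g h)).comp_eq h1 (by rw [hρe])
  have h3 := (h𝒢.hasMFDerivAt_tgt hn g).comp_eq
    (hasMFDerivAt_fst (I := 𝓘(𝕜, E)) (I' := 𝓘(𝕜, E)) (g, h)) rfl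
  have h4 := h2.eq_apply h3 (hρc.mono fun p hp => h𝒢.isGroupoid.tgt_mul _ _ hp) (v, w)
  change 𝒢.dtgt 𝕜 E F (𝒢.mul g h) (𝒢.dmul 𝕜 E g h (v, ρ' (v, w))) = 𝒢.dtgt 𝕜 E F g v at h4
  rwa [hρd v w hvw] at h4

theorem dmul_assoc {g h k : G} (hgh : 𝒢.src g = 𝒢.tgt h) (hhk : 𝒢.src h = 𝒢.tgt k) {v w u : E}
    (hvw : 𝒢.dsrc 𝕜 E F g v = 𝒢.dtgt 𝕜 E F h w) (hwu : 𝒢.dsrc 𝕜 E F h w = 𝒢.dtgt 𝕜 E F k u) :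
    𝒢.dmul 𝕜 E (𝒢.mul g h) k (𝒢.dmul 𝕜 E g h (v, w), u) =
      𝒢.dmul 𝕜 E g (𝒢.mul h k) (v, 𝒢.dmul 𝕜 E h k (w, u)) := by
  obtain ⟨ρ, ρ', hρ, hρ', hρe, hρc, -, hρd⟩ := h𝒢.exists_pair_retraction hn hgh
  have hs1 : ContMDiffAt (𝓘(𝕜, E).prod 𝓘(𝕜, E)) 𝓘(𝕜, F) n (fun p => 𝒢.src (ρ p)) (g, h) :=
    (h𝒢.contMDiff_src _).comp (g, h) hρ
  have hs2 := (h𝒢.hasMFDerivAt_src hn h).comp_eq hρ' hρe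
  obtain ⟨τ, τ', -, hτ', hτe, hτc, -, hτd⟩ := h𝒢.exists_retraction (k := k) hn
    (J := 𝓘(𝕜, E).prod 𝓘(𝕜, E)) hs1 hs2 (by rw [hρe, hhk])
  have hfst : HasMFDerivAt ((𝓘(𝕜, E).prod 𝓘(𝕜, E)).prod 𝓘(𝕜, E)) (𝓘(𝕜, E).prod 𝓘(𝕜, E))
      (Prod.fst : (G × G) × G → G × G) ((g, h), k) (ContinuousLinearMap.fst 𝕜 (E × E) E) :=
    hasMFDerivAt_fst ((g, h), k)
  have ht : Filter.Tendsto (Prod.fst : (G × G) × G → G × G) (𝓝 ((g, h), k)) (𝓝 (g, h)) :=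
    continuousAt_fst
  have hc1 := ht.eventually hρc
  have h1 : HasMFDerivAt ((𝓘(𝕜, E).prod 𝓘(𝕜, E)).prod 𝓘(𝕜, E)) 𝓘(𝕜, E)
      (fun p : (G × G) × G => p.1.1) ((g, h), k)
      ((ContinuousLinearMap.fst 𝕜 E E).comp (ContinuousLinearMap.fst 𝕜 (E × E) E)) :=
    HasMFDerivAt.comp_eq (y := (g, h)) (hasMFDerivAt_fst (g, h)) hfst rfl
  have h2 := hρ'.comp_eq hfst rfl
  have h12 := h𝒢.hasMFDerivAt_mul hn h1 h2 rfl hρe hc1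
  have h23 := h𝒢.hasMFDerivAt_mul hn h2 hτ' hρe hτe hτc
  have hl := h𝒢.hasMFDerivAt_mul hn h12 hτ' (g := 𝒢.mul g h) (by simp only [hρe]) hτe (by
    filter_upwards [hc1, hτc] with p hp hp'
    rw [h𝒢.isGroupoid.src_mul _ _ hp, hp'])
  have hr := h𝒢.hasMFDerivAt_mul hn h1 h23 rfl (h := 𝒢.mul h k) (by simp only [hρe, hτe]) (by
    filter_upwards [hc1, hτc] with p hp hp'
    rw [h𝒢.isGroupoid.tgt_mul _ _ hp', hp])
  have h4 := hl.eq_apply hr (by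
    filter_upwards [hc1, hτc] with p hp hp'
    exact h𝒢.isGroupoid.mul_assoc _ _ _ hp hp') ((v, w), u)
  have h5 : τ' ((v, w), u) = u := hτd (v, w) u (by simp [hρd v w hvw, hwu])
  change 𝒢.dmul 𝕜 E (𝒢.mul g h) k (𝒢.dmul 𝕜 E g h (v, ρ' (v, w)), τ' ((v, w), u)) =
    𝒢.dmul 𝕜 E g (𝒢.mul h k) (v, 𝒢.dmul 𝕜 E h k (ρ' (v, w), τ' ((v, w), u))) at h4
  rwa [hρd v w hvw, h5] at h4

omit [FiniteDimensional 𝕜 E] [FiniteDimensional 𝕜 F] [IsManifold 𝓘(𝕜, E) n G] [IsManifold 𝓘(𝕜, F) n X]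

theorem dsrc_done (x : X) (u : F) : 𝒢.dsrc 𝕜 E F (𝒢.one x) (𝒢.done 𝕜 E F x u) = u := by
  have h1 := (h𝒢.hasMFDerivAt_src hn (𝒢.one x)).comp_eq (h𝒢.hasMFDerivAt_one hn x) rfl
  exact h1.eq_apply (hasMFDerivAt_id x) (Filter.Eventually.of_forall h𝒢.isGroupoid.src_one) u

theorem dtgt_done (x : X) (u : F) : 𝒢.dtgt 𝕜 E F (𝒢.one x) (𝒢.done 𝕜 E F x u) = u := by
  have h1 := (h𝒢.hasMFDerivAt_tgt hn (𝒢.one x)).comp_eq (h𝒢.hasMFDerivAt_one hn x) rfl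
  exact h1.eq_apply (hasMFDerivAt_id x) (Filter.Eventually.of_forall h𝒢.isGroupoid.tgt_one) u

theorem dsrc_dinv (g : G) (v : E) : 𝒢.dsrc 𝕜 E F (𝒢.inv g) (𝒢.dinv 𝕜 E g v) = 𝒢.dtgt 𝕜 E F g v := by
  have h1 := (h𝒢.hasMFDerivAt_src hn (𝒢.inv g)).comp_eq (h𝒢.hasMFDerivAt_inv hn g) rfl
  exact h1.eq_apply (h𝒢.hasMFDerivAt_tgt hn g)
    (Filter.Eventually.of_forall h𝒢.isGroupoid.src_inv) v

theorem dtgt_dinv (g : G) (v : E) : 𝒢.dtgt 𝕜 E F (𝒢.inv g) (𝒢.dinv 𝕜 E g v) = 𝒢.dsrc 𝕜 E F g v := by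
  have h1 := (h𝒢.hasMFDerivAt_tgt hn (𝒢.inv g)).comp_eq (h𝒢.hasMFDerivAt_inv hn g) rfl
  exact h1.eq_apply (h𝒢.hasMFDerivAt_src hn g)
    (Filter.Eventually.of_forall h𝒢.isGroupoid.tgt_inv) v

theorem dmul_one_left (g : G) (v : E) :
    𝒢.dmul 𝕜 E (𝒢.one (𝒢.tgt g)) g (𝒢.done 𝕜 E F (𝒢.tgt g) (𝒢.dtgt 𝕜 E F g v), v) = v := by
  have h1 := (h𝒢.hasMFDerivAt_one hn (𝒢.tgt g)).comp_eq (h𝒢.hasMFDerivAt_tgt hn g) rfl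
  have h2 := h𝒢.hasMFDerivAt_mul hn h1 (hasMFDerivAt_id g) rfl rfl
    (Filter.Eventually.of_forall fun z => h𝒢.isGroupoid.src_one _)
  exact h2.eq_apply (hasMFDerivAt_id g) (Filter.Eventually.of_forall h𝒢.isGroupoid.one_mul) v

theorem dmul_one_right (g : G) (v : E) :
    𝒢.dmul 𝕜 E g (𝒢.one (𝒢.src g)) (v, 𝒢.done 𝕜 E F (𝒢.src g) (𝒢.dsrc 𝕜 E F g v)) = v := by
  have h1 := (h𝒢.hasMFDerivAt_one hn (𝒢.src g)).comp_eq (h𝒢.hasMFDerivAt_src hn g) rfl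
  have h2 := h𝒢.hasMFDerivAt_mul hn (hasMFDerivAt_id g) h1 rfl rfl
    (Filter.Eventually.of_forall fun z => (h𝒢.isGroupoid.tgt_one _).symm)
  exact h2.eq_apply (hasMFDerivAt_id g) (Filter.Eventually.of_forall h𝒢.isGroupoid.mul_one) v

theorem dmul_dinv (g : G) (v : E) :
    𝒢.dmul 𝕜 E g (𝒢.inv g) (v, 𝒢.dinv 𝕜 E g v) = 𝒢.done 𝕜 E F (𝒢.tgt g) (𝒢.dtgt 𝕜 E F g v) := by
  have h2 := h𝒢.hasMFDerivAt_mul hn (hasMFDerivAt_id g) (h𝒢.hasMFDerivAt_inv hn g) rfl rfl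
    (Filter.Eventually.of_forall fun z => (h𝒢.isGroupoid.tgt_inv _).symm)
  have h1 := (h𝒢.hasMFDerivAt_one hn (𝒢.tgt g)).comp_eq (h𝒢.hasMFDerivAt_tgt hn g) rfl
  exact h2.eq_apply h1 (Filter.Eventually.of_forall h𝒢.isGroupoid.mul_inv) v

end Laws

end IsLieGroupoid

end GroupoidData
end

noncomputable section

set_option linter.unusedSectionVars false

namespace HolLineBundle

variable {E : Type*} [NormedAddCommGroup E] [NormedSpace ℂ E]
  {B : Type*} [TopologicalSpace B] [ChartedSpace E B]
  {V : B → Type*} [∀ b, AddCommGroup (V b)] [∀ b, Module ℂ (V b)]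

section Algebra

theorem ratio_ne_zero (𝓛 : HolLineBundle E V) {b : B} {θ v : V b} (hθ : θ ≠ 0) (hv : v ≠ 0) :
    ratio θ v ≠ 0 := by
  intro h
  apply hv
  rw [← 𝓛.ratio_smul hθ v, h, zero_smul]

theorem ratio_smul_right (𝓛 : HolLineBundle E V) {b : B} {θ : V b} (hθ : θ ≠ 0) (c : ℂ) (v : V b) :
    ratio θ (c • v) = c * ratio θ v := by
  refine 𝓛.ratio_eq hθ ?_
  rw [mul_smul, 𝓛.ratio_smul hθ v]

theorem real_smul_eq {b : B} (r : ℝ) (v : V b) : r • v = (r : ℂ) • v := (Complex.coe_smul r v).symm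

theorem toProj_rescale (𝓛 : HolLineBundle E V) (r : ℝˣ) (ε : 𝓛.Slit) :
    𝓛.toProj (𝓛.rescale r ε) = 𝓛.toProj ε := by
  refine RProj.ext rfl (heq_of_eq ?_)
  exact (Projectivization.mk_eq_mk_iff' ℝ _ _ _ _).2 ⟨r, rfl⟩

theorem toProj_eq_iff (𝓛 : HolLineBundle E V) {ε ε' : 𝓛.Slit} :
    𝓛.toProj ε = 𝓛.toProj ε' ↔ ∃ r : ℝˣ, ε' = 𝓛.rescale r ε := by
  constructor
  · obtain ⟨b, v, hv⟩ := ε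
    obtain ⟨b', v', hv'⟩ := ε'
    intro h
    obtain rfl : b = b' := congrArg RProj.base h
    have h2 : Projectivization.mk ℝ v hv = Projectivization.mk ℝ v' hv' := by
      simpa [toProj] using h
    obtain ⟨a, ha⟩ := (Projectivization.mk_eq_mk_iff ℝ _ _ _ _).1 h2.symm
    exact ⟨a, Slit.ext rfl (heq_of_eq ha.symm)⟩
  · rintro ⟨r, rfl⟩
    exact (𝓛.toProj_rescale r ε).symm

theorem toProj_rep (𝓛 : HolLineBundle E V) (x : 𝓛.RProj) : 𝓛.toProj (𝓛.rep x) = x :=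
  RProj.ext rfl (heq_of_eq x.line.mk_rep)

theorem ratio_rescale (𝓛 : HolLineBundle E V) (r : ℝˣ) (ε : 𝓛.Slit) {θ : V ε.base} (hθ : θ ≠ 0) :
    ratio θ (𝓛.rescale r ε).vec = r * ratio θ ε.vec := by
  change ratio θ ((r : ℝ) • ε.vec) = _
  rw [real_smul_eq, 𝓛.ratio_smul_right hθ]

end Algebra

section Smooth

variable [IsManifold 𝓘(ℂ, E) ω B]

instance (𝓛 : HolLineBundle E V) : IsManifold 𝓘(ℝ, E × ℂ) ∞ 𝓛.Slit := isManifold_complexToReal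

/-- The chart of the slit total space given by a chart of the base and a frame. -/
def slitHomeo (𝓛 : HolLineBundle E V) {e : OpenPartialHomeomorph B E} (he : e ∈ atlas E B)
    {φ : Set B × (∀ b, V b)} (hφ : φ ∈ 𝓛.frames) : OpenPartialHomeomorph 𝓛.Slit (E × ℂ) :=
  𝓛.slitCore.openPartialHomeomorph (𝓛.slitChart e φ hφ) ⟨e, he, φ, hφ, rfl⟩

theorem slitHomeo_mem_atlas (𝓛 : HolLineBundle E V) {e : OpenPartialHomeomorph B E}
    (he : e ∈ atlas E B) {φ : Set B × (∀ b, V b)} (hφ : φ ∈ 𝓛.frames) :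
    𝓛.slitHomeo he hφ ∈ atlas (E × ℂ) 𝓛.Slit := by
  change _ ∈ ⋃ (g : PartialEquiv _ _) (hg : g ∈ 𝓛.slitCore.atlas),
        {𝓛.slitCore.openPartialHomeomorph g hg}
  simp only [mem_iUnion, mem_singleton_iff]
  exact ⟨_, ⟨e, he, φ, hφ, rfl⟩, rfl⟩

/-- The chart of the real projective bundle given by a chart of the base and a frame. -/
def projHomeo (𝓛 : HolLineBundle E V) {e : OpenPartialHomeomorph B E} (he : e ∈ atlas E B)
    {φ : Set B × (∀ b, V b)} (hφ : φ ∈ 𝓛.frames) : OpenPartialHomeomorph 𝓛.RProj (E × ℝ) :=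
  𝓛.projCore.openPartialHomeomorph (𝓛.projChart e φ hφ) ⟨e, he, φ, hφ, rfl⟩

theorem projHomeo_mem_atlas (𝓛 : HolLineBundle E V) {e : OpenPartialHomeomorph B E}
    (he : e ∈ atlas E B) {φ : Set B × (∀ b, V b)} (hφ : φ ∈ 𝓛.frames) :
    𝓛.projHomeo he hφ ∈ atlas (E × ℝ) 𝓛.RProj := by
  change _ ∈ ⋃ (g : PartialEquiv _ _) (hg : g ∈ 𝓛.projCore.atlas),
        {𝓛.projCore.openPartialHomeomorph g hg}
  simp only [mem_iUnion, mem_singleton_iff]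
  exact ⟨_, ⟨e, he, φ, hφ, rfl⟩, rfl⟩

theorem continuous_slit_base (𝓛 : HolLineBundle E V) : Continuous (Slit.base : 𝓛.Slit → B) := by
  rw [continuous_iff_continuousAt]
  intro ε
  let c := 𝓛.slitHomeo (chart_mem_atlas E ε.base) (𝓛.frameAt_mem ε.base)
  have hε : ε ∈ c.source := ⟨mem_chart_source E ε.base, 𝓛.mem_frameAt ε.base⟩
  have h1 : ContinuousAt (fun ε' => (chartAt E ε.base).symm (c ε').1) ε := by
    refine ContinuousAt.comp (g := (chartAt E ε.base).symm) ?_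
      (continuousAt_fst.comp (c.continuousAt hε))
    exact (chartAt E ε.base).continuousAt_symm (mem_chart_target E ε.base)
  refine h1.congr ?_
  filter_upwards [c.open_source.mem_nhds hε] with ε' hε'
  exact (chartAt E ε.base).left_inv hε'.1

theorem continuous_proj_base (𝓛 : HolLineBundle E V) : Continuous (RProj.base : 𝓛.RProj → B) := by
  rw [continuous_iff_continuousAt]
  intro x
  let c := 𝓛.projHomeo (chart_mem_atlas E x.base) (𝓛.frameAt'_mem x)
  have hε : x ∈ c.source := 𝓛.projCore.mem_chart_source x
  have h1 : ContinuousAt (fun ε' => (chartAt E x.base).symm (c ε').1) x := by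
    refine ContinuousAt.comp (g := (chartAt E x.base).symm) ?_
      (continuousAt_fst.comp (c.continuousAt hε))
    exact (chartAt E x.base).continuousAt_symm (mem_chart_target E x.base)
  refine h1.congr ?_
  filter_upwards [c.open_source.mem_nhds hε] with ε' hε'
  exact (chartAt E x.base).left_inv hε'.1

section Field

variable {𝕜 : Type*} [NontriviallyNormedField 𝕜] [NormedSpace 𝕜 E] [NormedSpace 𝕜 ℂ]
  {n : WithTop ℕ∞} [IsManifold 𝓘(𝕜, E) n B] {𝓛 : HolLineBundle E V}
  [IsManifold 𝓘(𝕜, E × ℂ) n 𝓛.Slit]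

theorem contMDiff_slit_base : ContMDiff 𝓘(𝕜, E × ℂ) 𝓘(𝕜, E) n (Slit.base : 𝓛.Slit → B) := by
  intro ε
  set c := 𝓛.slitHomeo (chart_mem_atlas E ε.base) (𝓛.frameAt_mem ε.base) with hc
  have hε : ε ∈ c.source := ⟨mem_chart_source E ε.base, 𝓛.mem_frameAt ε.base⟩
  have h1 : ContMDiffAt 𝓘(𝕜, E × ℂ) 𝓘(𝕜, E × ℂ) n c ε :=
    (contMDiffOn_of_mem_maximalAtlas (IsManifold.subset_maximalAtlas
      (𝓛.slitHomeo_mem_atlas _ _))).contMDiffAt (c.open_source.mem_nhds hε)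
  have h2 : ContMDiffAt 𝓘(𝕜, E) 𝓘(𝕜, E) n (chartAt E ε.base).symm (c ε).1 :=
    (contMDiffOn_symm_of_mem_maximalAtlas (IsManifold.subset_maximalAtlas
      (chart_mem_atlas E ε.base))).contMDiffAt
      ((chartAt E ε.base).open_target.mem_nhds (mem_chart_target E ε.base))
  have h3 : ContMDiffAt 𝓘(𝕜, E × ℂ) 𝓘(𝕜, E) n (fun ε' => (c ε').1) ε :=
    (contDiff_fst.contMDiff.contMDiffAt).comp ε h1
  refine (ContMDiffAt.comp ε h2 h3).congr_of_eventuallyEq ?_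
  filter_upwards [c.open_source.mem_nhds hε] with ε' hε'
  exact ((chartAt E ε.base).left_inv hε'.1).symm

theorem contMDiffAt_ratio {φ : Set B × (∀ b, V b)} (hφ : φ ∈ 𝓛.frames) {ε : 𝓛.Slit}
    (hε : ε.base ∈ φ.1) :
    ContMDiffAt 𝓘(𝕜, E × ℂ) 𝓘(𝕜, ℂ) n (fun ε' : 𝓛.Slit => ratio (φ.2 ε'.base) ε'.vec) ε := by
  set c := 𝓛.slitHomeo (chart_mem_atlas E ε.base) hφ with hc
  have hε : ε ∈ c.source := ⟨mem_chart_source E ε.base, hε⟩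
  have h1 : ContMDiffAt 𝓘(𝕜, E × ℂ) 𝓘(𝕜, E × ℂ) n c ε :=
    (contMDiffOn_of_mem_maximalAtlas (IsManifold.subset_maximalAtlas
      (𝓛.slitHomeo_mem_atlas _ _))).contMDiffAt (c.open_source.mem_nhds hε)
  exact (contDiff_snd.contMDiff.contMDiffAt).comp ε h1

/-- A map to the slit total space is smooth if its base point and its coefficient with respect to a
frame are. -/
theorem contMDiffWithinAt_slit {D : Type*} [NormedAddCommGroup D] [NormedSpace 𝕜 D] {H : Type*}
    [TopologicalSpace H] {J : ModelWithCorners 𝕜 D H} {M : Type*} [TopologicalSpace M]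
    [ChartedSpace H M] {f : M → 𝓛.Slit} {s : Set M} {m : M} {φ : Set B × (∀ b, V b)}
    (hφ : φ ∈ 𝓛.frames) (hm : (f m).base ∈ φ.1)
    (h1 : ContMDiffWithinAt J 𝓘(𝕜, E) n (fun m => (f m).base) s m)
    (h2 : ContMDiffWithinAt J 𝓘(𝕜, ℂ) n (fun m => ratio (φ.2 (f m).base) (f m).vec) s m) :
    ContMDiffWithinAt J 𝓘(𝕜, E × ℂ) n f s m := by
  set e := chartAt E (f m).base
  set c := 𝓛.slitHomeo (chart_mem_atlas E (f m).base) hφ with hc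
  have hε : f m ∈ c.source := ⟨mem_chart_source E (f m).base, hm⟩
  have h3 : ContMDiffWithinAt J 𝓘(𝕜, E) n (fun m => e (f m).base) s m := by
    refine ContMDiffAt.comp_contMDiffWithinAt m (g := e) ?_ h1
    exact (contMDiffOn_of_mem_maximalAtlas (IsManifold.subset_maximalAtlas
      (chart_mem_atlas E (f m).base))).contMDiffAt
      ((chartAt E (f m).base).open_source.mem_nhds (mem_chart_source E (f m).base))
  have h4 : ContMDiffWithinAt J 𝓘(𝕜, E × ℂ) n (fun m => c (f m)) s m := h3.prodMk_space h2
  have h5 : ContMDiffAt 𝓘(𝕜, E × ℂ) 𝓘(𝕜, E × ℂ) n c.symm (c (f m)) :=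
    (contMDiffOn_symm_of_mem_maximalAtlas (IsManifold.subset_maximalAtlas
      (𝓛.slitHomeo_mem_atlas _ _))).contMDiffAt (c.open_target.mem_nhds (c.map_source hε))
  have h6 := ContMDiffAt.comp_contMDiffWithinAt m h5 h4
  have h7 : ∀ᶠ m' in 𝓝[s] m, f m' ∈ c.source := by
    have ho : IsOpen (e.source ∩ φ.1) := e.open_source.inter (𝓛.isOpen φ hφ)
    exact h1.continuousWithinAt.eventually_mem (ho.mem_nhds ⟨mem_chart_source E (f m).base, hm⟩)
  refine h6.congr_of_eventuallyEq ?_ (c.left_inv hε).symm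
  filter_upwards [h7] with m' hm'
  exact (c.left_inv hm').symm

theorem contMDiffAt_slit {D : Type*} [NormedAddCommGroup D] [NormedSpace 𝕜 D] {H : Type*}
    [TopologicalSpace H] {J : ModelWithCorners 𝕜 D H} {M : Type*} [TopologicalSpace M]
    [ChartedSpace H M] {f : M → 𝓛.Slit} {m : M} {φ : Set B × (∀ b, V b)}
    (hφ : φ ∈ 𝓛.frames) (hm : (f m).base ∈ φ.1)
    (h1 : ContMDiffAt J 𝓘(𝕜, E) n (fun m => (f m).base) m)
    (h2 : ContMDiffAt J 𝓘(𝕜, ℂ) n (fun m => ratio (φ.2 (f m).base) (f m).vec) m) :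
    ContMDiffAt J 𝓘(𝕜, E × ℂ) n f m :=
  contMDiffWithinAt_slit hφ hm h1 h2

end Field

attribute [local instance] isManifold_complexToReal

variable {𝓛 : HolLineBundle E V}

theorem contMDiff_rescale_complex (r : ℝˣ) :
    ContMDiff 𝓘(ℂ, E × ℂ) 𝓘(ℂ, E × ℂ) ω (𝓛.rescale r) := by
  intro ε
  have hφ := 𝓛.frameAt_mem ε.base
  have hb := 𝓛.mem_frameAt ε.base
  refine contMDiffAt_slit hφ hb (contMDiff_slit_base ε) ?_
  have h1 : ContMDiffAt 𝓘(ℂ, E × ℂ) 𝓘(ℂ, ℂ) ω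
      (fun ε' : 𝓛.Slit => (r : ℂ) • ratio ((𝓛.frameAt ε.base).2 ε'.base) ε'.vec) ε :=
    ContMDiffAt.comp ε (g := fun z : ℂ => (r : ℂ) • z)
      ((contDiff_const_smul (r : ℂ)).contMDiff.contMDiffAt) (contMDiffAt_ratio hφ hb)
  refine h1.congr_of_eventuallyEq ?_
  have hn : ∀ᶠ ε' : 𝓛.Slit in 𝓝 ε, ε'.base ∈ (𝓛.frameAt ε.base).1 :=
    𝓛.continuous_slit_base.continuousAt.eventually_mem ((𝓛.isOpen _ hφ).mem_nhds hb)
  filter_upwards [hn] with ε' hε'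
  exact 𝓛.ratio_rescale r ε' (𝓛.ne_zero _ hφ _ hε')

theorem contMDiff_rescale (r : ℝˣ) :
    ContMDiff 𝓘(ℝ, E × ℂ) 𝓘(ℝ, E × ℂ) ∞ (𝓛.rescale r) :=
  (contMDiff_rescale_complex r).complexToReal.of_le le_top

theorem contMDiff_proj_base : ContMDiff 𝓘(ℝ, E × ℝ) 𝓘(ℝ, E) ∞ (RProj.base : 𝓛.RProj → B) := by
  intro x
  set c := 𝓛.projHomeo (chart_mem_atlas E x.base) (𝓛.frameAt'_mem x) with hc
  have hε : x ∈ c.source := 𝓛.projCore.mem_chart_source x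
  have h1 : ContMDiffAt 𝓘(ℝ, E × ℝ) 𝓘(ℝ, E × ℝ) ∞ c x :=
    (contMDiffOn_of_mem_maximalAtlas (IsManifold.subset_maximalAtlas
      (𝓛.projHomeo_mem_atlas _ _))).contMDiffAt (c.open_source.mem_nhds hε)
  have h2 : ContMDiffAt 𝓘(ℝ, E) 𝓘(ℝ, E) ∞ (chartAt E x.base).symm (c x).1 :=
    (contMDiffOn_symm_of_mem_maximalAtlas (IsManifold.subset_maximalAtlas
      (chart_mem_atlas E x.base))).contMDiffAt
      ((chartAt E x.base).open_target.mem_nhds (mem_chart_target E x.base))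
  have h3 : ContMDiffAt 𝓘(ℝ, E × ℝ) 𝓘(ℝ, E) ∞ (fun ε' => (c ε').1) x :=
    (contDiff_fst.contMDiff.contMDiffAt).comp x h1
  refine (ContMDiffAt.comp x h2 h3).congr_of_eventuallyEq ?_
  filter_upwards [c.open_source.mem_nhds hε] with ε' hε'
  exact ((chartAt E x.base).left_inv hε'.1).symm

theorem projHomeo_toProj {e : OpenPartialHomeomorph B E} (he : e ∈ atlas E B)
    {φ : Set B × (∀ b, V b)} (hφ : φ ∈ 𝓛.frames) {ε : 𝓛.Slit} (hε : ε.base ∈ φ.1) :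
    𝓛.projHomeo he hφ (𝓛.toProj ε) = (e ε.base, slope (ratio (φ.2 ε.base) ε.vec)) := by
  obtain ⟨r, hr, h⟩ := 𝓛.ratio_rep (𝓛.ne_zero φ hφ _ hε) ε.ne_zero
  refine Prod.ext rfl ?_
  change slope (ratio (φ.2 ε.base) (Projectivization.mk ℝ ε.vec ε.ne_zero).rep) = _
  rw [h, slope_smul hr]

theorem toProj_mem_source {e : OpenPartialHomeomorph B E} (he : e ∈ atlas E B)
    {φ : Set B × (∀ b, V b)} (hφ : φ ∈ 𝓛.frames) {ε : 𝓛.Slit} :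
    𝓛.toProj ε ∈ (𝓛.projHomeo he hφ).source ↔
      ε.base ∈ e.source ∧ ε.base ∈ φ.1 ∧ (ratio (φ.2 ε.base) ε.vec).re ≠ 0 := by
  have : ε.base ∈ φ.1 → ((ratio (φ.2 ε.base) (Projectivization.mk ℝ ε.vec ε.ne_zero).rep).re ≠ 0 ↔
      (ratio (φ.2 ε.base) ε.vec).re ≠ 0) := by
    intro hε
    obtain ⟨r, hr, h⟩ := 𝓛.ratio_rep (𝓛.ne_zero φ hφ _ hε) ε.ne_zero
    rw [h, Complex.re_ofReal_mul]
    simp [hr]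
  exact and_congr_right fun _ => and_congr_right this

theorem contMDiff_toProj : ContMDiff 𝓘(ℝ, E × ℂ) 𝓘(ℝ, E × ℝ) ∞ 𝓛.toProj := by
  intro ε
  set x := 𝓛.toProj ε with hx
  have hφ := 𝓛.frameAt'_mem x
  have he := chart_mem_atlas E x.base
  set φ := 𝓛.frameAt' x with hφd
  set c := 𝓛.projHomeo he hφ with hc
  have hxs : x ∈ c.source := 𝓛.projCore.mem_chart_source x
  obtain ⟨hb1, hb2, hb3⟩ := (toProj_mem_source he hφ).1 hxs
  have hr := contMDiffAt_ratio (𝕜 := ℝ) (n := ∞) hφ hb2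
  have h1 : ContMDiffAt 𝓘(ℝ, E × ℂ) 𝓘(ℝ, E) ∞ (fun ε' : 𝓛.Slit => chartAt E x.base ε'.base) ε :=
    ContMDiffAt.comp ε (g := chartAt E x.base) ((contMDiffOn_of_mem_maximalAtlas
      (IsManifold.subset_maximalAtlas he)).contMDiffAt
      ((chartAt E x.base).open_source.mem_nhds hb1)) (contMDiff_slit_base ε)
  have h2 : ContMDiffAt 𝓘(ℝ, E × ℂ) 𝓘(ℝ, ℝ) ∞
      (fun ε' : 𝓛.Slit => slope (ratio (φ.2 ε'.base) ε'.vec)) ε := by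
    refine ContMDiffAt.comp ε (g := slope) (ContDiffAt.contMDiffAt ?_) hr
    exact Complex.imCLM.contDiff.contDiffAt.div Complex.reCLM.contDiff.contDiffAt hb3
  have h3 : ContMDiffAt 𝓘(ℝ, E × ℂ) 𝓘(ℝ, E × ℝ) ∞ (fun ε' : 𝓛.Slit =>
      (chartAt E x.base ε'.base, slope (ratio (φ.2 ε'.base) ε'.vec))) ε := h1.prodMk_space h2
  have h4 : ContMDiffAt 𝓘(ℝ, E × ℝ) 𝓘(ℝ, E × ℝ) ∞ c.symm (c x) :=
    (contMDiffOn_symm_of_mem_maximalAtlas (IsManifold.subset_maximalAtlas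
      (𝓛.projHomeo_mem_atlas _ _))).contMDiffAt (c.open_target.mem_nhds (c.map_source hxs))
  have hcx : c x = (chartAt E x.base ε.base, slope (ratio (φ.2 ε.base) ε.vec)) :=
    projHomeo_toProj he hφ hb2
  rw [hcx] at h4
  refine (ContMDiffAt.comp ε h4 h3).congr_of_eventuallyEq ?_
  have ho : IsOpen ((chartAt E x.base).source ∩ φ.1) :=
    (chartAt E x.base).open_source.inter (𝓛.isOpen φ hφ)
  have hn : ∀ᶠ ε' : 𝓛.Slit in 𝓝 ε, ε'.base ∈ (chartAt E x.base).source ∩ φ.1 :=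
    𝓛.continuous_slit_base.continuousAt.eventually_mem (ho.mem_nhds ⟨hb1, hb2⟩)
  have hn2 : ∀ᶠ ε' : 𝓛.Slit in 𝓝 ε, (ratio (φ.2 ε'.base) ε'.vec).re ≠ 0 :=
    (Complex.continuous_re.continuousAt.comp hr.continuousAt).eventually_ne hb3
  filter_upwards [hn, hn2] with ε' hε' hε2
  have hs : 𝓛.toProj ε' ∈ c.source := (toProj_mem_source he hφ).2 ⟨hε'.1, hε'.2, hε2⟩
  rw [← c.left_inv hs, projHomeo_toProj he hφ hε'.2]
  rfl

/-- Local sections of the projection from the slit total space to the real projective bundle. -/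
theorem exists_section_toProj (ε : 𝓛.Slit) : ∃ σ : 𝓛.RProj → 𝓛.Slit,
    ContMDiffAt 𝓘(ℝ, E × ℝ) 𝓘(ℝ, E × ℂ) ∞ σ (𝓛.toProj ε) ∧ σ (𝓛.toProj ε) = ε ∧
      ∀ᶠ x in 𝓝 (𝓛.toProj ε), 𝓛.toProj (σ x) = x := by
  set x := 𝓛.toProj ε with hx
  have hφ := 𝓛.frameAt'_mem x
  have he := chart_mem_atlas E x.base
  set φ := 𝓛.frameAt' x with hφd
  set c := 𝓛.projHomeo he hφ with hc
  have hxs : x ∈ c.source := 𝓛.projCore.mem_chart_source x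
  obtain ⟨hb1, hb2, hb3⟩ := (toProj_mem_source he hφ).1 hxs
  let σ : 𝓛.RProj → 𝓛.Slit := fun y => ⟨y.base, 𝓛.fixVec
    ((1 + (slope (ratio (φ.2 y.base) y.line.rep) : ℂ) * Complex.I) • φ.2 y.base),
    𝓛.fixVec_ne_zero _⟩
  have hσ : ContMDiffAt 𝓘(ℝ, E × ℝ) 𝓘(ℝ, E × ℂ) ∞ σ x := by
    refine contMDiffAt_slit hφ hb2 (contMDiff_proj_base x) ?_
    have h1 : ContMDiffAt 𝓘(ℝ, E × ℝ) 𝓘(ℝ, ℂ) ∞ (fun y => 1 + ((c y).2 : ℂ) * Complex.I) x := by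
      have h2 : ContMDiffAt 𝓘(ℝ, E × ℝ) 𝓘(ℝ, E × ℝ) ∞ c x :=
        (contMDiffOn_of_mem_maximalAtlas (IsManifold.subset_maximalAtlas
          (𝓛.projHomeo_mem_atlas _ _))).contMDiffAt (c.open_source.mem_nhds hxs)
      refine ContMDiffAt.comp x (g := fun p : E × ℝ => 1 + (p.2 : ℂ) * Complex.I) ?_ h2
      have : ContDiff ℝ ∞ (fun p : E × ℝ => (p.2 : ℂ)) :=
        Complex.ofRealCLM.contDiff.comp contDiff_snd
      exact (contDiff_const.add (this.mul contDiff_const)).contMDiff.contMDiffAt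
    refine h1.congr_of_eventuallyEq ?_
    filter_upwards [c.open_source.mem_nhds hxs] with y hy
    have h4 := 𝓛.ne_zero φ hφ _ hy.2.1
    exact 𝓛.ratio_eq h4 (𝓛.fixVec_eq (one_add_smul_ne_zero h4 _))
  have hσ2 : ∀ y ∈ c.source, 𝓛.toProj (σ y) = y := by
    intro y hy
    have h4 := 𝓛.ne_zero φ hφ _ hy.2.1
    have h5 := one_add_smul_ne_zero h4 (slope (ratio (φ.2 y.base) y.line.rep))
    have h6 := 𝓛.mk_eq_of_slope h4 y.line.rep_nonzero hy.2.2 h5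
    rw [Projectivization.mk_rep] at h6
    refine RProj.ext rfl (heq_of_eq (Eq.trans ?_ h6))
    change Projectivization.mk ℝ _ _ = _
    congr 1
    exact 𝓛.fixVec_eq h5
  obtain ⟨r, hr⟩ := 𝓛.toProj_eq_iff.1 (hσ2 x hxs)
  refine ⟨fun y => 𝓛.rescale r (σ y), (contMDiff_rescale r _).comp x hσ, hr.symm, ?_⟩
  filter_upwards [c.open_source.mem_nhds hxs] with y hy
  rw [toProj_rescale, hσ2 y hy]

theorem exists_toProj_eq (x : 𝓛.RProj) : ∃ ε, 𝓛.toProj ε = x := ⟨_, 𝓛.toProj_rep x⟩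

/-- Smoothness descends to the real projective bundle. -/
theorem contMDiffAt_of_comp_toProj {D : Type*} [NormedAddCommGroup D] [NormedSpace ℝ D] {H : Type*}
    [TopologicalSpace H] {J : ModelWithCorners ℝ D H} {M : Type*} [TopologicalSpace M]
    [ChartedSpace H M] {f : 𝓛.RProj → M} {ε : 𝓛.Slit}
    (hf : ContMDiffAt 𝓘(ℝ, E × ℂ) J ∞ (fun ε => f (𝓛.toProj ε)) ε) :
    ContMDiffAt 𝓘(ℝ, E × ℝ) J ∞ f (𝓛.toProj ε) := by
  obtain ⟨σ, h1, h2, h3⟩ := exists_section_toProj ε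
  have h4 : ContMDiffAt 𝓘(ℝ, E × ℝ) J ∞ (fun x => f (𝓛.toProj (σ x))) (𝓛.toProj ε) :=
    ContMDiffAt.comp (𝓛.toProj ε) (g := fun ε => f (𝓛.toProj ε)) (by rwa [h2]) h1
  refine h4.congr_of_eventuallyEq ?_
  filter_upwards [h3] with x hx
  rw [hx]

/-- The derivative of the projection to the real projective bundle. -/
def dproj (𝓛 : HolLineBundle E V) (ε : 𝓛.Slit) : E × ℂ →L[ℝ] E × ℝ :=
  mfderiv 𝓘(ℝ, E × ℂ) 𝓘(ℝ, E × ℝ) 𝓛.toProj ε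

theorem hasMFDerivAt_toProj (ε : 𝓛.Slit) :
    HasMFDerivAt 𝓘(ℝ, E × ℂ) 𝓘(ℝ, E × ℝ) 𝓛.toProj ε (𝓛.dproj ε) :=
  ((contMDiff_toProj ε).mdifferentiableAt (by simp)).hasMFDerivAt

theorem dproj_surjective (ε : 𝓛.Slit) : Function.Surjective (𝓛.dproj ε) := by
  obtain ⟨σ, h1, h2, h3⟩ := exists_section_toProj ε
  intro w
  have hd : HasMFDerivAt 𝓘(ℝ, E × ℝ) 𝓘(ℝ, E × ℂ) σ (𝓛.toProj ε) _ :=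
    (h1.mdifferentiableAt (by simp)).hasMFDerivAt
  refine ⟨mfderiv 𝓘(ℝ, E × ℝ) 𝓘(ℝ, E × ℂ) σ (𝓛.toProj ε) w, ?_⟩
  exact ((hasMFDerivAt_toProj ε).comp_eq hd h2).eq_apply (hasMFDerivAt_id _) h3 w

end Smooth

section Topology

variable [IsManifold 𝓘(ℂ, E) ω B] {𝓛 : HolLineBundle E V}

theorem slit_t2Space [T2Space B] : T2Space 𝓛.Slit := by
  refine ⟨fun ε ε' hne => ?_⟩
  by_cases hb : ε.base = ε'.base
  · set c := 𝓛.slitHomeo (chart_mem_atlas E ε.base) (𝓛.frameAt_mem ε.base)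
    have hε : ε ∈ c.source := ⟨mem_chart_source E ε.base, 𝓛.mem_frameAt ε.base⟩
    have hε' : ε' ∈ c.source := by
      refine ⟨?_, ?_⟩ <;> rw [← hb]
      exacts [mem_chart_source E ε.base, 𝓛.mem_frameAt ε.base]
    obtain ⟨u, v, hu, hv, h1, h2, h3⟩ := t2_separation (c.injOn.ne hε hε' hne)
    refine ⟨_, _, c.isOpen_inter_preimage hu, c.isOpen_inter_preimage hv, ⟨hε, h1⟩, ⟨hε', h2⟩, ?_⟩
    exact (h3.preimage c).mono inter_subset_right inter_subset_right
  · obtain ⟨u, v, hu, hv, h1, h2, h3⟩ := t2_separation hb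
    exact ⟨_, _, hu.preimage 𝓛.continuous_slit_base, hv.preimage 𝓛.continuous_slit_base, h1, h2,
      h3.preimage _⟩

theorem exists_unit_re_ne_zero {z w : ℂ} (hz : z ≠ 0) (hw : w ≠ 0) :
    ∃ u : ℂ, u ≠ 0 ∧ (u * z).re ≠ 0 ∧ (u * w).re ≠ 0 := by
  by_cases h : ((starRingEnd ℂ) z * w).re = 0
  · refine ⟨(starRingEnd ℂ) z + (starRingEnd ℂ) w, ?_, ?_, ?_⟩
    · intro h0
      have h1 : ((starRingEnd ℂ) z + (starRingEnd ℂ) w) * z = 0 := by rw [h0, zero_mul]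
      have h2 := congrArg Complex.re h1
      have h3 : 0 < Complex.normSq z := Complex.normSq_pos.2 hz
      simp [Complex.normSq_apply] at h h2 h3
      nlinarith
    · have h3 : 0 < Complex.normSq z := Complex.normSq_pos.2 hz
      simp [Complex.normSq_apply] at h h3 ⊢
      nlinarith
    · have h3 : 0 < Complex.normSq w := Complex.normSq_pos.2 hw
      simp [Complex.normSq_apply] at h h3 ⊢
      nlinarith
  · refine ⟨(starRingEnd ℂ) z, by simpa using hz, ?_, h⟩
    have h3 : 0 < Complex.normSq z := Complex.normSq_pos.2 hz
    simp [Complex.normSq_apply] at h3 ⊢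
    exact h3.ne'

theorem proj_t2Space [T2Space B] : T2Space 𝓛.RProj := by
  refine ⟨fun x y hne => ?_⟩
  by_cases hb : x.base = y.base
  · obtain ⟨ε, rfl⟩ := exists_toProj_eq x
    obtain ⟨ε', rfl⟩ := exists_toProj_eq y
    have hb' : ε.base = ε'.base := hb
    have hφ := 𝓛.frameAt_mem ε.base
    set φ := 𝓛.frameAt ε.base
    have hm : ε.base ∈ φ.1 := 𝓛.mem_frameAt ε.base
    have hm' : ε'.base ∈ φ.1 := hb' ▸ hm
    have hθ := 𝓛.ne_zero φ hφ _ hm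
    have hθ' := 𝓛.ne_zero φ hφ _ hm'
    obtain ⟨u, hu0, hu1, hu2⟩ := exists_unit_re_ne_zero (𝓛.ratio_ne_zero hθ ε.ne_zero)
      (𝓛.ratio_ne_zero hθ' ε'.ne_zero)
    have hr : ∀ (b : B) (v : V b), φ.2 b ≠ 0 → ratio (u⁻¹ • φ.2 b) v = u * ratio (φ.2 b) v := by
      intro b v hθ
      refine 𝓛.ratio_eq (smul_ne_zero (inv_ne_zero hu0) hθ) ?_
      rw [smul_smul, mul_comm u, mul_assoc, mul_inv_cancel₀ hu0, mul_one, 𝓛.ratio_smul hθ]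
    set c := 𝓛.projHomeo (chart_mem_atlas E ε.base) (𝓛.smul_mem φ hφ u⁻¹ (inv_ne_zero hu0))
    have hε : 𝓛.toProj ε ∈ c.source := by
      refine (toProj_mem_source _ _).2 ⟨mem_chart_source E ε.base, hm, ?_⟩
      rwa [hr _ _ hθ]
    have hε' : 𝓛.toProj ε' ∈ c.source := by
      refine (toProj_mem_source _ _).2 ⟨by rw [← hb']; exact mem_chart_source E ε.base, hm', ?_⟩
      rwa [hr _ _ hθ']
    obtain ⟨u, v, hu, hv, h1, h2, h3⟩ := t2_separation (c.injOn.ne hε hε' hne)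
    refine ⟨_, _, c.isOpen_inter_preimage hu, c.isOpen_inter_preimage hv, ⟨hε, h1⟩, ⟨hε', h2⟩, ?_⟩
    exact (h3.preimage c).mono inter_subset_right inter_subset_right
  · obtain ⟨u, v, hu, hv, h1, h2, h3⟩ := t2_separation hb
    exact ⟨_, _, hu.preimage 𝓛.continuous_proj_base, hv.preimage 𝓛.continuous_proj_base, h1, h2,
      h3.preimage _⟩

theorem exists_countable_cover (𝓛 : HolLineBundle E V) [SecondCountableTopology B] :
    ∃ s : Set B, s.Countable ∧
      ∀ b, ∃ b' ∈ s, b ∈ (chartAt E b').source ∧ b ∈ (𝓛.frameAt b').1 := by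
  obtain ⟨s, hs, h⟩ := TopologicalSpace.countable_cover_nhds
    (f := fun b => (chartAt E b).source ∩ (𝓛.frameAt b).1) fun b =>
      ((chartAt E b).open_source.inter (𝓛.isOpen _ (𝓛.frameAt_mem b))).mem_nhds
        ⟨mem_chart_source E b, 𝓛.mem_frameAt b⟩
  refine ⟨s, hs, fun b => ?_⟩
  have hb : b ∈ ⋃ x ∈ s, (chartAt E x).source ∩ (𝓛.frameAt x).1 := h ▸ mem_univ b
  simpa only [mem_iUnion, exists_prop, mem_inter_iff] using hb

variable [FiniteDimensional ℂ E]

theorem slit_secondCountable [SecondCountableTopology B] : SecondCountableTopology 𝓛.Slit := by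
  have : ProperSpace E := FiniteDimensional.proper ℂ E
  obtain ⟨s, hs, h⟩ := 𝓛.exists_countable_cover
  have : Countable s := hs
  let c : s → OpenPartialHomeomorph 𝓛.Slit (E × ℂ) := fun b =>
    𝓛.slitHomeo (chart_mem_atlas E b.1) (𝓛.frameAt_mem b.1)
  have : ∀ i, SecondCountableTopology (c i).source := fun i => (c i).secondCountableTopology_source
  refine TopologicalSpace.secondCountableTopology_of_countable_cover (U := fun i => (c i).source)
    (fun i => (c i).open_source) ?_
  refine eq_univ_of_forall fun ε => ?_
  obtain ⟨b', hb', h1, h2⟩ := h ε.base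
  exact mem_iUnion.2 ⟨⟨b', hb'⟩, h1, h2⟩

theorem proj_secondCountable [SecondCountableTopology B] : SecondCountableTopology 𝓛.RProj := by
  have : ProperSpace E := FiniteDimensional.proper ℂ E
  obtain ⟨s, hs, h⟩ := 𝓛.exists_countable_cover
  have : Countable s := hs
  let c : s × Bool → OpenPartialHomeomorph 𝓛.RProj (E × ℝ) := fun b =>
    𝓛.projHomeo (chart_mem_atlas E b.1.1) (𝓛.smul_mem _ (𝓛.frameAt_mem b.1.1)
      (if b.2 then 1 else Complex.I) (by split_ifs <;> simp))
  have : ∀ i, SecondCountableTopology (c i).source := fun i => (c i).secondCountableTopology_source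
  refine TopologicalSpace.secondCountableTopology_of_countable_cover (U := fun i => (c i).source)
    (fun i => (c i).open_source) ?_
  refine eq_univ_of_forall fun x => ?_
  obtain ⟨ε, rfl⟩ := exists_toProj_eq x
  obtain ⟨b', hb', h1, h2⟩ := h ε.base
  have hθ := 𝓛.ne_zero _ (𝓛.frameAt_mem b') _ h2
  have hz := 𝓛.ratio_ne_zero hθ ε.ne_zero
  by_cases hre : (ratio ((𝓛.frameAt b').2 ε.base) ε.vec).re = 0
  · refine mem_iUnion.2 ⟨(⟨b', hb'⟩, false), (toProj_mem_source _ _).2 ⟨h1, h2, ?_⟩⟩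
    have h3 : ratio (Complex.I • (𝓛.frameAt b').2 ε.base) ε.vec =
        -Complex.I * ratio ((𝓛.frameAt b').2 ε.base) ε.vec := by
      refine 𝓛.ratio_eq (smul_ne_zero Complex.I_ne_zero hθ) ?_
      rw [smul_smul, mul_comm (-Complex.I), mul_assoc]
      simp [𝓛.ratio_smul hθ]
    simp only [Bool.false_eq_true, if_false]
    rw [h3]
    intro h0
    apply hz
    apply Complex.ext
    · exact hre
    · simpa using h0
  · refine mem_iUnion.2 ⟨(⟨b', hb'⟩, true), (toProj_mem_source _ _).2 ⟨h1, h2, ?_⟩⟩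
    simpa using hre

end Topology

end HolLineBundle
end

noncomputable section

namespace HolLineBundle

variable {E : Type*} [NormedAddCommGroup E] [NormedSpace ℂ E]
  {B : Type*} [TopologicalSpace B] [ChartedSpace E B]
  {V : B → Type*} [∀ b, AddCommGroup (V b)] [∀ b, Module ℂ (V b)]
  {𝓛 : HolLineBundle E V}

section Pairing

theorem pairing_injective (ε : 𝓛.Slit) : Function.Injective (𝓛.pairing ε) := by
  rw [injective_iff_map_eq_zero]
  intro l hl
  refine LinearMap.ext fun ⟨v, hv⟩ => ?_
  have hv' : (show V ε.base from v) ∈ Submodule.span ℝ {ε.vec} := by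
    rw [← Projectivization.submodule_mk (K := ℝ) ε.vec ε.ne_zero]
    exact hv
  obtain ⟨r, hr⟩ := Submodule.mem_span_singleton.1 hv'
  change r • ε.vec = v at hr
  subst hr
  have h1 := LinearMap.map_smul (show 𝓛.realLine (𝓛.toProj ε) →ₗ[ℝ] ℝ from l) r
    ⟨ε.vec, 𝓛.vec_mem ε⟩
  have h2 : (show 𝓛.realLine (𝓛.toProj ε) →ₗ[ℝ] ℝ from l) ⟨ε.vec, 𝓛.vec_mem ε⟩ = 0 := hl
  rw [h2, smul_zero] at h1
  exact h1

theorem pairing_surjective (ε : 𝓛.Slit) : Function.Surjective (𝓛.pairing ε) := by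
  have h : (Projectivization.mk ℝ ε.vec ε.ne_zero).submodule = Submodule.span ℝ {ε.vec} :=
    Projectivization.submodule_mk (K := ℝ) ε.vec ε.ne_zero
  let l : (Projectivization.mk ℝ ε.vec ε.ne_zero).submodule →ₗ[ℝ] ℝ :=
    (LinearEquiv.ofEq _ _ h ≪≫ₗ
      (LinearEquiv.toSpanNonzeroSingleton ℝ (V ε.base) ε.vec ε.ne_zero).symm).toLinearMap
  have hl : 𝓛.pairing ε l = 1 := by
    change (LinearEquiv.toSpanNonzeroSingleton ℝ (V ε.base) ε.vec ε.ne_zero).symm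
      (LinearEquiv.ofEq _ _ h ⟨ε.vec, 𝓛.vec_mem ε⟩) = 1
    rw [LinearEquiv.symm_apply_eq, LinearEquiv.toSpanNonzeroSingleton_one]
    rfl
  intro r
  exact ⟨r • (show 𝓛.HatFiber (𝓛.toProj ε) from l), by rw [map_smul, hl, smul_eq_mul, mul_one]⟩

/-- The identification of the fibre over a real line with `ℝ` given by a vector spanning it. -/
def pairEquiv (𝓛 : HolLineBundle E V) (ε : 𝓛.Slit) : 𝓛.HatFiber (𝓛.toProj ε) ≃ₗ[ℝ] ℝ :=
  LinearEquiv.ofBijective (𝓛.pairing ε) ⟨pairing_injective ε, pairing_surjective ε⟩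

theorem pairing_cast_rescale {ε : 𝓛.Slit} {r : ℝˣ} (h : 𝓛.toProj ε = 𝓛.toProj (𝓛.rescale r ε))
    (l : 𝓛.HatFiber (𝓛.toProj ε)) :
    𝓛.pairing (𝓛.rescale r ε) (h ▸ l) = r * 𝓛.pairing ε l := by
  have key : ∀ (b : B) (l₁ l₂ : ℙ ℝ (V b)) (h : (⟨b, l₁⟩ : 𝓛.RProj) = ⟨b, l₂⟩)
      (l : 𝓛.HatFiber ⟨b, l₁⟩) (v : V b) (hv : v ∈ 𝓛.realLine ⟨b, l₁⟩) (hv' : v ∈ 𝓛.realLine ⟨b, l₂⟩),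
      (show 𝓛.realLine ⟨b, l₂⟩ →ₗ[ℝ] ℝ from (h ▸ l : 𝓛.HatFiber ⟨b, l₂⟩)) ⟨v, hv'⟩ =
        (show 𝓛.realLine ⟨b, l₁⟩ →ₗ[ℝ] ℝ from l) ⟨v, hv⟩ := by
    intro b l₁ l₂ h l v hv hv'
    obtain rfl : l₁ = l₂ := by simpa using h
    rfl
  have hv : (r : ℝ) • ε.vec ∈ 𝓛.realLine (𝓛.toProj ε) := Submodule.smul_mem _ _ (𝓛.vec_mem ε)
  refine (key _ _ _ h l _ hv (𝓛.vec_mem (𝓛.rescale r ε))).trans ?_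
  exact LinearMap.map_smul (show 𝓛.realLine (𝓛.toProj ε) →ₗ[ℝ] ℝ from l) (r : ℝ)
    ⟨ε.vec, 𝓛.vec_mem ε⟩

theorem homogenize_rescale (s : ∀ x, 𝓛.HatFiber x) (r : ℝˣ) (ε : 𝓛.Slit) :
    𝓛.homogenize s (𝓛.rescale r ε) = r * 𝓛.homogenize s ε := by
  have h : 𝓛.toProj ε = 𝓛.toProj (𝓛.rescale r ε) := (𝓛.toProj_rescale r ε).symm
  have h1 : s (𝓛.toProj (𝓛.rescale r ε)) = h ▸ s (𝓛.toProj ε) := by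
    generalize 𝓛.toProj (𝓛.rescale r ε) = y at h
    subst h
    rfl
  rw [homogenize, h1, pairing_cast_rescale]
  rfl

theorem homogenize_injective {s t : ∀ x, 𝓛.HatFiber x}
    (h : ∀ ε, 𝓛.homogenize s ε = 𝓛.homogenize t ε) : s = t := by
  funext x
  obtain ⟨ε, rfl⟩ : ∃ ε, 𝓛.toProj ε = x := ⟨_, 𝓛.toProj_rep x⟩
  exact pairing_injective ε (h ε)

/-- A homogeneous function is the homogenization of a section. -/
theorem exists_homogenize_eq {f : 𝓛.Slit → ℝ} (hf : ∀ ε (r : ℝˣ), f (𝓛.rescale r ε) = r * f ε) :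
    ∃ s : ∀ x, 𝓛.HatFiber x, ∀ ε, 𝓛.homogenize s ε = f ε := by
  have key : ∀ x, ∃ l : 𝓛.HatFiber x, ∀ ε (h : x = 𝓛.toProj ε), 𝓛.pairing ε (h ▸ l) = f ε := by
    intro x
    obtain ⟨ε, rfl⟩ : ∃ ε, 𝓛.toProj ε = x := ⟨_, 𝓛.toProj_rep x⟩
    obtain ⟨l, hl⟩ := pairing_surjective ε (f ε)
    refine ⟨l, fun ε' h => ?_⟩
    obtain ⟨r, rfl⟩ := 𝓛.toProj_eq_iff.1 h
    rw [pairing_cast_rescale, hl, hf]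
  choose s hs using key
  exact ⟨s, fun ε => hs _ ε rfl⟩

end Pairing

variable [IsManifold 𝓘(ℂ, E) ω B]

attribute [local instance] isManifold_complexToReal

section Sections

theorem exists_section {f : 𝓛.Slit → ℝ} (hf : ∀ ε (r : ℝˣ), f (𝓛.rescale r ε) = r * f ε)
    (hf' : ContMDiff 𝓘(ℝ, E × ℂ) 𝓘(ℝ, ℝ) ∞ f) :
    ∃ s : 𝓛.Sections, ∀ ε, 𝓛.homogenize s.1 ε = f ε := by
  obtain ⟨s, hs⟩ := exists_homogenize_eq hf
  refine ⟨⟨s, ?_⟩, hs⟩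
  change ContMDiff 𝓘(ℝ, E × ℂ) 𝓘(ℝ, ℝ) ∞ (𝓛.homogenize s)
  rwa [funext hs]

theorem sections_ext {s t : 𝓛.Sections} (h : ∀ ε, 𝓛.homogenize s.1 ε = 𝓛.homogenize t.1 ε) :
    s = t := Subtype.ext (homogenize_injective h)

theorem contMDiff_homogenize (s : 𝓛.Sections) :
    ContMDiff 𝓘(ℝ, E × ℂ) 𝓘(ℝ, ℝ) ∞ (𝓛.homogenize s.1) := s.2

/-- A function on the slit total space which is homogeneous of degree zero descends. -/
theorem exists_function {f : 𝓛.Slit → ℝ} (hf : ∀ ε (r : ℝˣ), f (𝓛.rescale r ε) = f ε)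
    (hf' : ContMDiff 𝓘(ℝ, E × ℂ) 𝓘(ℝ, ℝ) ∞ f) :
    ∃ g : 𝓛.RProj → ℝ, ContMDiff 𝓘(ℝ, E × ℝ) 𝓘(ℝ, ℝ) ∞ g ∧ ∀ ε, g (𝓛.toProj ε) = f ε := by
  have h : ∀ ε, f (𝓛.rep (𝓛.toProj ε)) = f ε := by
    intro ε
    obtain ⟨r, hr⟩ := 𝓛.toProj_eq_iff.1 (𝓛.toProj_rep (𝓛.toProj ε)).symm
    rw [hr, hf]
  refine ⟨fun x => f (𝓛.rep x), fun x => ?_, h⟩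
  obtain ⟨ε, rfl⟩ := exists_toProj_eq x
  refine contMDiffAt_of_comp_toProj ?_
  simp only [h]
  exact hf' ε

/-- The product of a section with a smooth function. -/
theorem exists_smul_section {f : 𝓛.RProj → ℝ} (hf : ContMDiff 𝓘(ℝ, E × ℝ) 𝓘(ℝ, ℝ) ∞ f)
    (s : 𝓛.Sections) : ∃ t : 𝓛.Sections, (∀ x, t.1 x = f x • s.1 x) ∧
      ∀ ε, 𝓛.homogenize t.1 ε = f (𝓛.toProj ε) * 𝓛.homogenize s.1 ε := by
  have h : ∀ ε, 𝓛.homogenize (fun x => f x • s.1 x) ε = f (𝓛.toProj ε) * 𝓛.homogenize s.1 ε :=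
    fun ε => map_smul (𝓛.pairing ε) _ _
  refine ⟨⟨fun x => f x • s.1 x, ?_⟩, fun x => rfl, h⟩
  change ContMDiff 𝓘(ℝ, E × ℂ) 𝓘(ℝ, ℝ) ∞ (𝓛.homogenize _)
  rw [funext h]
  exact (hf.comp contMDiff_toProj).mul s.2

/-- Extension by zero. -/
theorem contMDiff_bump_mul {ρ : B → ℝ} (hρ : ContMDiff 𝓘(ℝ, E) 𝓘(ℝ, ℝ) ∞ ρ) {W : Set B}
    (hW : tsupport ρ ⊆ W) {f : 𝓛.Slit → ℝ}
    (hf : ∀ ε : 𝓛.Slit, ε.base ∈ W → ContMDiffAt 𝓘(ℝ, E × ℂ) 𝓘(ℝ, ℝ) ∞ f ε) :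
    ContMDiff 𝓘(ℝ, E × ℂ) 𝓘(ℝ, ℝ) ∞ (fun ε => ρ ε.base * f ε) := by
  intro ε
  by_cases h : ε.base ∈ tsupport ρ
  · exact ((hρ _).comp ε (contMDiff_slit_base ε)).mul (hf ε (hW h))
  · have h1 : ∀ᶠ ε' : 𝓛.Slit in 𝓝 ε, ε'.base ∈ (tsupport ρ)ᶜ :=
      𝓛.continuous_slit_base.continuousAt.eventually_mem
        ((isClosed_tsupport ρ).isOpen_compl.mem_nhds h)
    have h2 : ContMDiffAt 𝓘(ℝ, E × ℂ) 𝓘(ℝ, ℝ) ∞ (fun _ : 𝓛.Slit => (0 : ℝ)) ε := contMDiffAt_const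
    refine h2.congr_of_eventuallyEq ?_
    filter_upwards [h1] with ε' hε'
    rw [image_eq_zero_of_notMem_tsupport hε', zero_mul]

theorem exists_bump [FiniteDimensional ℂ E] [T2Space B] {b : B} {U : Set B} (hU : U ∈ 𝓝 b) :
    ∃ ρ : B → ℝ, ContMDiff 𝓘(ℝ, E) 𝓘(ℝ, ℝ) ∞ ρ ∧ tsupport ρ ⊆ U ∧ ∀ᶠ b' in 𝓝 b, ρ b' = 1 := by
  have : FiniteDimensional ℝ E := FiniteDimensional.complexToReal E
  obtain ⟨f, -, hf⟩ := (SmoothBumpFunction.nhds_basis_tsupport (I := 𝓘(ℝ, E)) b).mem_iff.1 hU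
  exact ⟨f, f.contMDiff, hf, f.eventuallyEq_one⟩

theorem chartAt_slit_rescale {ε ε' : 𝓛.Slit} (h : ε' ∈ (chartAt (E × ℂ) ε).source) (r : ℝˣ) :
    chartAt (E × ℂ) ε (𝓛.rescale r ε') =
      ((chartAt (E × ℂ) ε ε').1, (r : ℂ) * (chartAt (E × ℂ) ε ε').2) :=
  Prod.ext rfl (𝓛.ratio_rescale r ε' (𝓛.ne_zero _ (𝓛.frameAt_mem _) _ h.2))

theorem chartAt_slit_snd_ne_zero {ε ε' : 𝓛.Slit} (h : ε' ∈ (chartAt (E × ℂ) ε).source) :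
    (chartAt (E × ℂ) ε ε').2 ≠ 0 :=
  𝓛.ratio_ne_zero (𝓛.ne_zero _ (𝓛.frameAt_mem _) _ h.2) ε'.ne_zero

theorem contMDiffAt_chartAt_slit {ε ε' : 𝓛.Slit} (h : ε' ∈ (chartAt (E × ℂ) ε).source) :
    ContMDiffAt 𝓘(ℝ, E × ℂ) 𝓘(ℝ, E × ℂ) ∞ (chartAt (E × ℂ) ε) ε' :=
  (contMDiffOn_of_mem_maximalAtlas (IsManifold.subset_maximalAtlas
    (chart_mem_atlas _ ε))).contMDiffAt ((chartAt (E × ℂ) ε).open_source.mem_nhds h)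

variable [FiniteDimensional ℂ E] [T2Space B]

/-- Near a given point there are sections with prescribed homogenization in the chart. -/
theorem exists_section_chart {ε ε₁ : 𝓛.Slit} (hε₁ : ε₁ ∈ (chartAt (E × ℂ) ε).source) {g : E × ℂ → ℝ} (hg : ContDiff ℝ ∞ g)
    (hg' : ∀ y c (r : ℝ), g (y, r * c) = r * g (y, c)) :
    ∃ s : 𝓛.Sections, ∀ᶠ ε' in 𝓝 ε₁, 𝓛.homogenize s.1 ε' = g (chartAt (E × ℂ) ε ε') := by
  have hU : (chartAt E ε.base).source ∩ (𝓛.frameAt ε.base).1 ∈ 𝓝 ε₁.base :=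
    ((chartAt E ε.base).open_source.inter (𝓛.isOpen _ (𝓛.frameAt_mem _))).mem_nhds
      hε₁
  obtain ⟨ρ, h1, h2, h3⟩ := exists_bump (E := E) hU
  obtain ⟨s, hs⟩ := exists_section (𝓛 := 𝓛) (f := fun ε' => ρ ε'.base * g (chartAt (E × ℂ) ε ε')) (by
    intro ε' r
    change ρ ε'.base * _ = _
    by_cases h : ε'.base ∈ tsupport ρ
    · rw [chartAt_slit_rescale (h2 h), hg']
      ring
    · rw [image_eq_zero_of_notMem_tsupport h]
      ring)
    (contMDiff_bump_mul h1 h2 fun ε' h =>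
      hg.contMDiff.contMDiffAt.comp ε' (contMDiffAt_chartAt_slit h))
  refine ⟨s, ?_⟩
  filter_upwards [𝓛.continuous_slit_base.continuousAt.eventually h3] with ε' hε'
  rw [hs, hε', one_mul]

end Sections

section Lift

theorem hasMFDerivAt_chartAt_self {𝕜 : Type*} [NontriviallyNormedField 𝕜]
    {D : Type*} [NormedAddCommGroup D] [NormedSpace 𝕜 D] {M : Type*} [TopologicalSpace M]
    [ChartedSpace D M] [IsManifold 𝓘(𝕜, D) 1 M] (x : M) :
    HasMFDerivAt 𝓘(𝕜, D) 𝓘(𝕜, D) (chartAt D x) x (ContinuousLinearMap.id 𝕜 D) := by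
  have h1 := ((mdifferentiable_chart (I := 𝓘(𝕜, D)) x).mdifferentiableAt
    (mem_chart_source D x)).hasMFDerivAt
  have h2 := mfderiv_chartAt_eq_tangentCoordChange (I := 𝓘(𝕜, D)) (mem_chart_source D x)
  rw [h2] at h1
  have h3 : tangentCoordChange 𝓘(𝕜, D) x x x = ContinuousLinearMap.id 𝕜 D :=
    ContinuousLinearMap.ext fun v =>
      tangentCoordChange_self (I := 𝓘(𝕜, D)) (mem_extChartAt_source x)
  rw [h3] at h1
  exact h1

theorem derivAlong_eq_of_chart {D : Type*} [NormedAddCommGroup D] [NormedSpace ℝ D] {Y : Type*}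
    [TopologicalSpace Y] [ChartedSpace D Y] [IsManifold 𝓘(ℝ, D) 1 Y] {f : Y → ℝ} {y : Y}
    {g : D → ℝ} (h : ∀ᶠ z in 𝓝 y, f z = g (chartAt D y z))
    (hg : DifferentiableAt ℝ g (chartAt D y y)) (v : D) :
    derivAlong f y v = fderiv ℝ g (chartAt D y y) v := by
  have h1 := (hg.hasFDerivAt.hasMFDerivAt).comp_eq (hasMFDerivAt_chartAt_self (𝕜 := ℝ) y) rfl
  have h2 : HasMFDerivAt 𝓘(ℝ, D) 𝓘(ℝ, ℝ) f y _ := h1.congr_of_eventuallyEq h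
  change mfderiv 𝓘(ℝ, D) 𝓘(ℝ, ℝ) f y v = _
  rw [h2.mfderiv]
  rfl

theorem hasMFDerivAt_homogenize (s : 𝓛.Sections) (ε : 𝓛.Slit) :
    HasMFDerivAt 𝓘(ℝ, E × ℂ) 𝓘(ℝ, ℝ) (𝓛.homogenize s.1) ε
      (mfderiv 𝓘(ℝ, E × ℂ) 𝓘(ℝ, ℝ) (𝓛.homogenize s.1) ε) :=
  ((contMDiff_homogenize s ε).mdifferentiableAt (by simp)).hasMFDerivAt

/-- The homogenizations of sections separate tangent vectors. -/
theorem tangent_ext [FiniteDimensional ℂ E] [T2Space B] {ε : 𝓛.Slit} {v w : E × ℂ}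
    (h : ∀ s : 𝓛.Sections, derivAlong (𝓛.homogenize s.1) ε v = derivAlong (𝓛.homogenize s.1) ε w) :
    v = w := by
  have key : ∀ (g : E × ℂ → ℝ), ContDiff ℝ ∞ g → (∀ y c (r : ℝ), g (y, r * c) = r * g (y, c)) →
      fderiv ℝ g (chartAt (E × ℂ) ε ε) v = fderiv ℝ g (chartAt (E × ℂ) ε ε) w := by
    intro g hg hg'
    obtain ⟨s, hs⟩ := exists_section_chart (mem_chart_source _ ε) hg hg'
    have hd := (hg.differentiable (by simp)) (chartAt (E × ℂ) ε ε)
    rw [← derivAlong_eq_of_chart hs hd, ← derivAlong_eq_of_chart hs hd]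
    exact h s
  have hL : ∀ L : ℂ →L[ℝ] ℝ, L v.2 = L w.2 := by
    intro L
    have h1 := key (fun p => L p.2) (L.contDiff.comp contDiff_snd) (fun y c r => by
      rw [← Complex.real_smul, map_smul, smul_eq_mul])
    have h2 : HasFDerivAt (fun p : E × ℂ => L p.2) (L.comp (ContinuousLinearMap.snd ℝ E ℂ))
      (chartAt (E × ℂ) ε ε) := (L.comp (ContinuousLinearMap.snd ℝ E ℂ)).hasFDerivAt
    rw [h2.fderiv] at h1
    exact h1
  have h2 : v.2 = w.2 := Complex.ext (hL Complex.reCLM) (hL Complex.imCLM)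
  obtain ⟨L, hLc⟩ : ∃ L : ℂ →L[ℝ] ℝ, L (chartAt (E × ℂ) ε ε).2 ≠ 0 := by
    have hne := chartAt_slit_snd_ne_zero (mem_chart_source (E × ℂ) ε)
    by_contra! h0
    exact hne (Complex.ext (h0 Complex.reCLM) (h0 Complex.imCLM))
  have h1 : v.1 = w.1 := by
    have : FiniteDimensional ℝ E := FiniteDimensional.complexToReal E
    by_contra hne
    obtain ⟨l, hl⟩ : ∃ l : E →L[ℝ] ℝ, l v.1 ≠ l w.1 := by
      by_contra! h0
      exact hne (by
        apply (Module.finBasis ℝ E).ext_elem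
        intro i
        exact h0 (LinearMap.toContinuousLinearMap ((Module.finBasis ℝ E).coord i)))
    apply hl
    have h3 := key (fun p => l p.1 * L p.2)
      ((l.contDiff.comp contDiff_fst).mul (L.contDiff.comp contDiff_snd)) (fun y c r => by
        simp only
        rw [← Complex.real_smul, map_smul, smul_eq_mul]
        ring)
    have h4 : HasFDerivAt (fun p : E × ℂ => l p.1 * L p.2) _ (chartAt (E × ℂ) ε ε) :=
      (l.comp (ContinuousLinearMap.fst ℝ E ℂ)).hasFDerivAt.mul
      (L.comp (ContinuousLinearMap.snd ℝ E ℂ)).hasFDerivAt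
    rw [h4.fderiv] at h3
    simp [h2] at h3
    rcases h3 with h3 | h3
    · exact h3
    · exact absurd h3 hLc
  exact Prod.ext h1 h2

/-- A tangent vector of the slit total space induces a derivation. -/
theorem exists_isImage (ε : 𝓛.Slit) (v : E × ℂ) :
    ∃ Δ : 𝓛.Gauge (𝓛.toProj ε), 𝓛.IsImage ε v Δ ∧ 𝓛.IsSymbol Δ.1 (𝓛.dproj ε v) := by
  let Δ : 𝓛.Sections →ₗ[ℝ] 𝓛.HatFiber (𝓛.toProj ε) := {
    toFun := fun s => (𝓛.pairEquiv ε).symm (derivAlong (𝓛.homogenize s.1) ε v)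
    map_add' := fun s t => by
      rw [← map_add]
      congr 1
      have h1 := HasMFDerivAt.add (hasMFDerivAt_homogenize s ε) (hasMFDerivAt_homogenize t ε)
      have h2 : 𝓛.homogenize (s + t : 𝓛.Sections).1 = 𝓛.homogenize s.1 + 𝓛.homogenize t.1 :=
        funext fun ε => map_add (𝓛.pairing ε) _ _
      change mfderiv 𝓘(ℝ, E × ℂ) 𝓘(ℝ, ℝ) (𝓛.homogenize (s + t : 𝓛.Sections).1) ε v = _
      rw [h2, h1.mfderiv]
      rfl
    map_smul' := fun r s => by
      rw [RingHom.id_apply, ← map_smul]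
      congr 1
      have h1 := HasMFDerivAt.const_smul (s := r) (hasMFDerivAt_homogenize s ε)
      have h2 : 𝓛.homogenize (r • s : 𝓛.Sections).1 = r • 𝓛.homogenize s.1 :=
        funext fun ε => map_smul (𝓛.pairing ε) _ _
      change mfderiv 𝓘(ℝ, E × ℂ) 𝓘(ℝ, ℝ) (𝓛.homogenize (r • s : 𝓛.Sections).1) ε v = _
      rw [h2, h1.mfderiv]
      rfl }
  have hΔ : ∀ s, 𝓛.pairing ε (Δ s) = derivAlong (𝓛.homogenize s.1) ε v :=
    fun s => (𝓛.pairEquiv ε).apply_symm_apply _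
  have hs : 𝓛.IsSymbol Δ (𝓛.dproj ε v) := by
    intro f hf s s' hss
    apply pairing_injective ε
    have h0 : 𝓛.homogenize s'.1 = (fun ε => f (𝓛.toProj ε)) * 𝓛.homogenize s.1 := by
      funext ε'
      change 𝓛.pairing ε' (s'.1 _) = _
      rw [hss, map_smul]
      rfl
    have h1 : HasMFDerivAt 𝓘(ℝ, E × ℂ) 𝓘(ℝ, ℝ) (fun ε => f (𝓛.toProj ε)) ε _ :=
      ((hf (𝓛.toProj ε)).mdifferentiableAt (by simp)).hasMFDerivAt.comp_eq
        (hasMFDerivAt_toProj ε) rfl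
    have h2 := h1.mul (hasMFDerivAt_homogenize s ε)
    rw [hΔ, map_add, map_smul, map_smul, hΔ]
    change mfderiv 𝓘(ℝ, E × ℂ) 𝓘(ℝ, ℝ) (𝓛.homogenize s'.1) ε v = _
    rw [h0, h2.mfderiv]
    change f (𝓛.toProj ε) * derivAlong (𝓛.homogenize s.1) ε v +
      𝓛.homogenize s.1 ε * derivAlong f (𝓛.toProj ε) (𝓛.dproj ε v) =
      derivAlong f (𝓛.toProj ε) (𝓛.dproj ε v) * 𝓛.homogenize s.1 ε +
      f (𝓛.toProj ε) * derivAlong (𝓛.homogenize s.1) ε v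
    ring
  exact ⟨⟨Δ, _, hs⟩, hΔ, hs⟩

theorem IsImage.unique {ε : 𝓛.Slit} {v : E × ℂ} {Δ Δ' : 𝓛.Gauge (𝓛.toProj ε)}
    (h : 𝓛.IsImage ε v Δ) (h' : 𝓛.IsImage ε v Δ') : Δ = Δ' :=
  Subtype.ext (LinearMap.ext fun s => pairing_injective ε ((h s).trans (h' s).symm))

end Lift

end HolLineBundle
end

noncomputable section

namespace HolLineBundle

variable {E : Type*} [NormedAddCommGroup E] [NormedSpace ℂ E]
  {B : Type*} [TopologicalSpace B] [ChartedSpace E B]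
  {V : B → Type*} [∀ b, AddCommGroup (V b)] [∀ b, Module ℂ (V b)]
  {𝓛 : HolLineBundle E V}
  [IsManifold 𝓘(ℂ, E) ω B]

attribute [local instance] isManifold_complexToReal

/-- The Euler vector field. -/
theorem exists_euler (ε : 𝓛.Slit) : ∃ v : E × ℂ,
    (∀ s : 𝓛.Sections, derivAlong (𝓛.homogenize s.1) ε v = 𝓛.homogenize s.1 ε) ∧
      𝓛.dproj ε v = 0 := by
  set φ := 𝓛.frameAt ε.base
  have hφ := 𝓛.frameAt_mem ε.base
  have hb := 𝓛.mem_frameAt ε.base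
  have hθ := 𝓛.ne_zero _ hφ _ hb
  let γ : ℝ → 𝓛.Slit := fun t => ⟨ε.base, 𝓛.fixVec (t • ε.vec), 𝓛.fixVec_ne_zero _⟩
  have hγ1 : γ 1 = ε := Slit.ext rfl (heq_of_eq (by
    change 𝓛.fixVec ((1 : ℝ) • ε.vec) = ε.vec
    rw [one_smul, 𝓛.fixVec_eq ε.ne_zero]))
  have hne : ∀ᶠ t : ℝ in 𝓝 1, t ≠ 0 := eventually_ne_nhds one_ne_zero
  have hγr : ∀ (t : ℝ) (ht : t ≠ 0), γ t = 𝓛.rescale (Units.mk0 t ht) ε := fun t ht =>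
    Slit.ext rfl (heq_of_eq (𝓛.fixVec_eq (smul_ne_zero ht ε.ne_zero)))
  have hγ : ContMDiffAt 𝓘(ℝ, ℝ) 𝓘(ℝ, E × ℂ) ∞ γ 1 := by
    refine contMDiffAt_slit hφ hb contMDiffAt_const ?_
    have h1 : ContMDiffAt 𝓘(ℝ, ℝ) 𝓘(ℝ, ℂ) ∞ (fun t : ℝ => (t : ℂ) * ratio (φ.2 ε.base) ε.vec) 1 :=
      (Complex.ofRealCLM.contDiff.mul contDiff_const).contMDiff.contMDiffAt
    refine h1.congr_of_eventuallyEq ?_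
    filter_upwards [hne] with t ht
    rw [hγr t ht]
    exact 𝓛.ratio_rescale _ ε hθ
  have hd : HasMFDerivAt 𝓘(ℝ, ℝ) 𝓘(ℝ, E × ℂ) γ 1 _ := (hγ.mdifferentiableAt (by simp)).hasMFDerivAt
  refine ⟨mfderiv 𝓘(ℝ, ℝ) 𝓘(ℝ, E × ℂ) γ 1 (1 : ℝ), fun s => ?_, ?_⟩
  · have h1 := (hasMFDerivAt_homogenize s ε).comp_eq hd hγ1
    have h2 : HasMFDerivAt 𝓘(ℝ, ℝ) 𝓘(ℝ, ℝ) (fun t : ℝ => t * 𝓛.homogenize s.1 ε) 1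
        (ContinuousLinearMap.smulRight (1 : ℝ →L[ℝ] ℝ) (𝓛.homogenize s.1 ε)) :=
      ((hasDerivAt_id (1 : ℝ)).mul_const (𝓛.homogenize s.1 ε) |>.hasFDerivAt.congr_fderiv
        (by ext; simp; exact (one_mul (𝓛.homogenize s.1 ε)).symm)).hasMFDerivAt
    have h3 := h1.eq_apply h2 (by
      filter_upwards [hne] with t ht
      rw [hγr t ht, homogenize_rescale]
      rfl) (1 : ℝ)
    refine Eq.trans h3 ?_
    exact one_mul _
  · have h1 := (hasMFDerivAt_toProj ε).comp_eq hd hγ1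
    exact h1.eq_apply (hasMFDerivAt_const (𝓛.toProj ε) (1 : ℝ)) (by
      filter_upwards [hne] with t ht
      rw [hγr t ht, toProj_rescale]) (1 : ℝ)

variable [FiniteDimensional ℂ E] [T2Space B]

/-- A derivation with vanishing symbol is a multiple of the evaluation. -/
theorem exists_eq_mul_of_isSymbol_zero {ε : 𝓛.Slit} {Δ : 𝓛.Sections →ₗ[ℝ] 𝓛.HatFiber (𝓛.toProj ε)}
    (hΔ : 𝓛.IsSymbol Δ 0) : ∃ k : ℝ, ∀ s, 𝓛.pairing ε (Δ s) = k * 𝓛.homogenize s.1 ε := by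
  have hΔ' : ∀ (f : 𝓛.RProj → ℝ), ContMDiff 𝓘(ℝ, E × ℝ) 𝓘(ℝ, ℝ) ∞ f → ∀ s s' : 𝓛.Sections,
      (∀ ε, 𝓛.homogenize s'.1 ε = f (𝓛.toProj ε) * 𝓛.homogenize s.1 ε) →
      𝓛.pairing ε (Δ s') = f (𝓛.toProj ε) * 𝓛.pairing ε (Δ s) := by
    intro f hf s s' h
    obtain ⟨t, ht1, ht2⟩ := exists_smul_section hf s
    obtain rfl : t = s' := sections_ext fun ε => by rw [ht2, h]
    rw [hΔ f hf s t ht1, map_zero, zero_smul, zero_add, map_smul, smul_eq_mul]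
  have hU : (chartAt E ε.base).source ∩ (𝓛.frameAt ε.base).1 ∈ 𝓝 ε.base :=
    ((chartAt E ε.base).open_source.inter (𝓛.isOpen _ (𝓛.frameAt_mem _))).mem_nhds
      ⟨mem_chart_source E _, 𝓛.mem_frameAt _⟩
  obtain ⟨ρ, h1, h2, h3⟩ := exists_bump (E := E) hU
  have hρ : ρ ε.base = 1 := h3.self_of_nhds
  set c := chartAt (E × ℂ) ε with hc
  set c0 := (c ε).2 with hc0
  have hc0ne : c0 ≠ 0 := chartAt_slit_snd_ne_zero (mem_chart_source (E × ℂ) ε)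
  have hsm : ∀ L : ℂ →L[ℝ] ℝ, ∀ ε' : 𝓛.Slit,
      ε'.base ∈ (chartAt E ε.base).source ∩ (𝓛.frameAt ε.base).1 →
      ContMDiffAt 𝓘(ℝ, E × ℂ) 𝓘(ℝ, ℝ) ∞ (fun ε' => L ((c ε').2 / c0)) ε' := by
    intro L ε' h
    have : ContDiff ℝ ∞ (fun p : E × ℂ => L (p.2 / c0)) :=
      L.contDiff.comp (contDiff_snd.div_const c0)
    exact this.contMDiff.contMDiffAt.comp ε' (contMDiffAt_chartAt_slit h)
  have hzero : ∀ ε' : 𝓛.Slit, ¬ ε'.base ∈ (chartAt E ε.base).source ∩ (𝓛.frameAt ε.base).1 →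
      ρ ε'.base = 0 := fun ε' h => image_eq_zero_of_notMem_tsupport fun h' => h (h2 h')
  have hres : ∀ (L : ℂ →L[ℝ] ℝ) (r : ℝˣ) (ε' : 𝓛.Slit),
      ε'.base ∈ (chartAt E ε.base).source ∩ (𝓛.frameAt ε.base).1 →
      L ((c (𝓛.rescale r ε')).2 / c0) = r * L ((c ε').2 / c0) := by
    intro L r ε' h
    rw [hc, chartAt_slit_rescale h, mul_div_assoc, ← Complex.real_smul, map_smul, smul_eq_mul]
  have hS : ∀ L : ℂ →L[ℝ] ℝ, ∃ s : 𝓛.Sections, ∀ ε',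
      𝓛.homogenize s.1 ε' = ρ ε'.base * L ((c ε').2 / c0) := by
    intro L
    refine exists_section (fun ε' r => ?_) (contMDiff_bump_mul h1 h2 (hsm L))
    change ρ ε'.base * _ = _
    by_cases h : ε'.base ∈ (chartAt E ε.base).source ∩ (𝓛.frameAt ε.base).1
    · rw [hres L r ε' h]
      ring
    · rw [hzero ε' h]
      ring
  have hF : ∀ (L : ℂ →L[ℝ] ℝ) (s : 𝓛.Sections), ∃ f : 𝓛.RProj → ℝ,
      ContMDiff 𝓘(ℝ, E × ℝ) 𝓘(ℝ, ℝ) ∞ f ∧ ∀ ε', f (𝓛.toProj ε') = ρ ε'.base *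
        (𝓛.homogenize s.1 ε' * L ((c ε').2 / c0) /
          (Complex.reCLM ((c ε').2 / c0) ^ 2 + Complex.imCLM ((c ε').2 / c0) ^ 2)) := by
    intro L s
    refine exists_function (fun ε' r => ?_) (contMDiff_bump_mul h1 h2 fun ε' h => ?_)
    · change ρ ε'.base * _ = _
      by_cases h : ε'.base ∈ (chartAt E ε.base).source ∩ (𝓛.frameAt ε.base).1
      · rw [hres _ r ε' h, hres _ r ε' h, hres _ r ε' h, homogenize_rescale]
        have hr := r.ne_zero
        congr 1
        rw [show ∀ x y : ℝ, (r * x) ^ 2 + (r * y) ^ 2 = (r * r : ℝ) * (x ^ 2 + y ^ 2) from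
          fun x y => by ring, show ∀ x y : ℝ, (r * x) * (r * y) = (r * r : ℝ) * (x * y) from
          fun x y => by ring, mul_div_mul_left _ _ (mul_ne_zero hr hr)]
      · rw [hzero ε' h, zero_mul, zero_mul]
    · have hz : (c ε').2 / c0 ≠ 0 := div_ne_zero (chartAt_slit_snd_ne_zero h) hc0ne
      refine ContMDiffAt.div₀ ((s.2 ε').mul (hsm L ε' h))
        (((hsm _ ε' h).pow 2).add ((hsm _ ε' h).pow 2)) ?_
      have := Complex.normSq_pos.2 hz
      rw [Complex.normSq_apply] at this
      simp only [Complex.reCLM_apply, Complex.imCLM_apply]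
      nlinarith
  obtain ⟨s0, hs0⟩ := hS Complex.reCLM
  obtain ⟨s1, hs1⟩ := hS Complex.imCLM
  refine ⟨𝓛.pairing ε (Δ s0), fun s => ?_⟩
  obtain ⟨f0, hf0, hf0'⟩ := hF Complex.reCLM s
  obtain ⟨f1, hf1, hf1'⟩ := hF Complex.imCLM s
  obtain ⟨t0, -, ht0⟩ := exists_smul_section hf0 s0
  obtain ⟨t1, -, ht1⟩ := exists_smul_section hf1 s1
  have hρ2 : ContMDiff 𝓘(ℝ, E × ℝ) 𝓘(ℝ, ℝ) ∞ (fun x : 𝓛.RProj => ρ x.base * ρ x.base) :=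
    (h1.comp contMDiff_proj_base).mul (h1.comp contMDiff_proj_base)
  have hsum : ∀ ε', 𝓛.homogenize (t0 + t1 : 𝓛.Sections).1 ε' =
      (ρ ε'.base * ρ ε'.base) * 𝓛.homogenize s.1 ε' := by
    intro ε'
    have h0 : 𝓛.homogenize (t0 + t1 : 𝓛.Sections).1 ε' =
      𝓛.homogenize t0.1 ε' + 𝓛.homogenize t1.1 ε' := map_add (𝓛.pairing ε') _ _
    rw [h0, ht0, ht1, hf0', hf1', hs0, hs1]
    by_cases h : ε'.base ∈ (chartAt E ε.base).source ∩ (𝓛.frameAt ε.base).1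
    · have hz : (c ε').2 / c0 ≠ 0 := div_ne_zero (chartAt_slit_snd_ne_zero h) hc0ne
      have := Complex.normSq_pos.2 hz
      rw [Complex.normSq_apply] at this
      simp only [Complex.reCLM_apply, Complex.imCLM_apply]
      have h5 : ((c ε').2 / c0).re ^ 2 + ((c ε').2 / c0).im ^ 2 ≠ 0 := by nlinarith
      field_simp
    · rw [hzero ε' h]
      ring
  have e1 := hΔ' _ hρ2 s (t0 + t1) hsum
  have e2 := hΔ' _ hf0 s0 t0 ht0
  have e3 := hΔ' _ hf1 s1 t1 ht1
  have hcc : (c ε).2 / c0 = 1 := div_self hc0ne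
  rw [hf0', hρ, hcc] at e2
  rw [hf1', hρ, hcc] at e3
  rw [map_add, map_add, e2, e3] at e1
  have hρb : ρ (𝓛.toProj ε).base = 1 := hρ
  simp [hρb] at e1
  rw [← e1]
  ring

theorem exists_isImage_of_gauge (ε : 𝓛.Slit) (Δ : 𝓛.Gauge (𝓛.toProj ε)) :
    ∃ v : E × ℂ, 𝓛.IsImage ε v Δ := by
  obtain ⟨w, hw⟩ := Δ.2
  obtain ⟨v0, hv0⟩ := dproj_surjective ε w
  obtain ⟨Δ0, hΔ0, hΔ0'⟩ := exists_isImage ε v0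
  have h0 : 𝓛.IsSymbol (Δ.1 - Δ0.1) 0 := by
    intro f hf s s' h
    rw [LinearMap.sub_apply, LinearMap.sub_apply, hw f hf s s' h, hΔ0' f hf s s' h, hv0, map_zero,
      zero_smul, zero_add, smul_sub]
    abel
  obtain ⟨k, hk⟩ := exists_eq_mul_of_isSymbol_zero h0
  obtain ⟨v1, hv1, -⟩ := exists_euler ε
  refine ⟨v0 + k • v1, fun s => ?_⟩
  have h1 := hk s
  rw [LinearMap.sub_apply, map_sub, hΔ0 s, sub_eq_iff_eq_add, ← hv1 s] at h1
  rw [h1]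
  have h2 : derivAlong (𝓛.homogenize s.1) ε (v0 + k • v1) =
    derivAlong (𝓛.homogenize s.1) ε v0 + derivAlong (𝓛.homogenize s.1) ε (k • v1) := map_add _ _ _
  have h3 : derivAlong (𝓛.homogenize s.1) ε (k • v1) = k • derivAlong (𝓛.homogenize s.1) ε v1 :=
    map_smul _ _ _
  rw [h2, h3, smul_eq_mul, add_comm]

/-- The tangent vector at `ε` inducing a derivation. -/
def lift (ε : 𝓛.Slit) (Δ : 𝓛.Gauge (𝓛.toProj ε)) : E × ℂ := (exists_isImage_of_gauge ε Δ).choose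

theorem isImage_lift (ε : 𝓛.Slit) (Δ : 𝓛.Gauge (𝓛.toProj ε)) : 𝓛.IsImage ε (lift ε Δ) Δ :=
  (exists_isImage_of_gauge ε Δ).choose_spec

theorem IsImage.lift_eq {ε : 𝓛.Slit} {v : E × ℂ} {Δ : 𝓛.Gauge (𝓛.toProj ε)}
    (h : 𝓛.IsImage ε v Δ) : lift ε Δ = v :=
  tangent_ext fun s => (isImage_lift ε Δ s).symm.trans (h s)

/-- The derivations at `ε` are the tangent vectors at `ε`. -/
def liftEquiv (ε : 𝓛.Slit) : 𝓛.Gauge (𝓛.toProj ε) ≃ₗ[ℝ] (E × ℂ) where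
  toFun := lift ε
  invFun v := (exists_isImage ε v).choose
  map_add' Δ Δ' := by
    refine IsImage.lift_eq fun s => ?_
    change 𝓛.pairing ε (Δ.1 s + Δ'.1 s) = _
    rw [map_add, isImage_lift ε Δ s, isImage_lift ε Δ' s]
    exact (map_add (derivAlong (𝓛.homogenize s.1) ε) _ _).symm
  map_smul' r Δ := by
    refine IsImage.lift_eq fun s => ?_
    change 𝓛.pairing ε (r • Δ.1 s) = _
    rw [map_smul, isImage_lift ε Δ s]
    exact (map_smul (derivAlong (𝓛.homogenize s.1) ε) _ _).symm
  left_inv Δ := (exists_isImage ε (lift ε Δ)).choose_spec.1.unique (isImage_lift ε Δ)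
  right_inv v := (exists_isImage ε v).choose_spec.1.lift_eq

theorem liftEquiv_apply (ε : 𝓛.Slit) (Δ : 𝓛.Gauge (𝓛.toProj ε)) : liftEquiv ε Δ = lift ε Δ := rfl

theorem isImage_liftEquiv_symm (ε : 𝓛.Slit) (v : E × ℂ) : 𝓛.IsImage ε v ((liftEquiv ε).symm v) :=
  (exists_isImage ε v).choose_spec.1

theorem symbol_unique {ε : 𝓛.Slit} {Δ : 𝓛.Sections →ₗ[ℝ] 𝓛.HatFiber (𝓛.toProj ε)} {w w' : E × ℝ}
    (h : 𝓛.IsSymbol Δ w) (h' : 𝓛.IsSymbol Δ w') : w = w' := by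
  obtain ⟨v, hv⟩ := dproj_surjective ε (w - w')
  obtain ⟨Δ0, hΔ0, hΔ0'⟩ := exists_isImage ε v
  have h0 : 𝓛.IsSymbol Δ0.1 0 := by
    intro f hf s s' hs
    have h1 := (h f hf s s' hs).symm.trans (h' f hf s s' hs)
    rw [add_left_inj, ← sub_eq_zero, ← sub_smul] at h1
    have h2 : derivAlong f (𝓛.toProj ε) w - derivAlong f (𝓛.toProj ε) w' =
      derivAlong f (𝓛.toProj ε) (w - w') := (map_sub (derivAlong f (𝓛.toProj ε)) w w').symm
    rw [h2] at h1
    rw [hΔ0' f hf s s' hs, hv, h1, map_zero, zero_smul]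
  obtain ⟨k, hk⟩ := exists_eq_mul_of_isSymbol_zero h0
  obtain ⟨v1, hv1, hv1'⟩ := exists_euler ε
  have h3 : v = k • v1 := tangent_ext fun s => by
    refine ((hΔ0 s).symm.trans (hk s)).trans ?_
    rw [← hv1 s]
    exact (map_smul (derivAlong (𝓛.homogenize s.1) ε) k v1).symm
  rw [h3, map_smul, hv1', smul_zero] at hv
  exact (sub_eq_zero.1 hv.symm)

omit [FiniteDimensional ℂ E] [T2Space B] in
theorem isSymbol_dproj {ε : 𝓛.Slit} {v : E × ℂ} {Δ : 𝓛.Gauge (𝓛.toProj ε)} (h : 𝓛.IsImage ε v Δ) :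
    𝓛.IsSymbol Δ.1 (𝓛.dproj ε v) := by
  obtain ⟨Δ0, hΔ0, hΔ0'⟩ := exists_isImage ε v
  rwa [hΔ0.unique h] at hΔ0'

theorem symbol_eq (ε : 𝓛.Slit) (Δ : 𝓛.Gauge (𝓛.toProj ε)) :
    𝓛.symbol Δ = 𝓛.dproj ε (lift ε Δ) :=
  symbol_unique Δ.2.choose_spec (isSymbol_dproj (isImage_lift ε Δ))

end HolLineBundle
end

noncomputable section

section Charts

variable {D : Type*} [NormedAddCommGroup D] {M : Type*} [TopologicalSpace M] [ChartedSpace D M]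

/-- The derivative at `x` of the preferred chart at `x₀`. -/
def chartDeriv (𝕜 : Type*) [NontriviallyNormedField 𝕜] [NormedSpace 𝕜 D] (x₀ x : M) : D →L[𝕜] D :=
  mfderiv 𝓘(𝕜, D) 𝓘(𝕜, D) (chartAt D x₀) x

/-- The expression of a vector field in the preferred chart at `x₀`. -/
def chartField (𝕜 : Type*) [NontriviallyNormedField 𝕜] [NormedSpace 𝕜 D] (x₀ : M)
    (Y : M → D) (p : D) : D :=
  chartDeriv 𝕜 x₀ ((chartAt D x₀).symm p) (Y ((chartAt D x₀).symm p))

theorem chartDeriv_self {𝕜 : Type*} [NontriviallyNormedField 𝕜] [NormedSpace 𝕜 D]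
    [IsManifold 𝓘(𝕜, D) 1 M] (x : M) : chartDeriv 𝕜 x x = ContinuousLinearMap.id 𝕜 D :=
  (HolLineBundle.hasMFDerivAt_chartAt_self (𝕜 := 𝕜) x).mfderiv

theorem chartField_self {𝕜 : Type*} [NontriviallyNormedField 𝕜] [NormedSpace 𝕜 D]
    [IsManifold 𝓘(𝕜, D) 1 M] (x : M) (Y : M → D) :
    chartField 𝕜 x Y (chartAt D x x) = Y x := by
  unfold chartField
  rw [(chartAt D x).left_inv (mem_chart_source D x), chartDeriv_self]
  rfl

theorem contMDiffAt_chartAt_of_mem {𝕜 : Type*} [NontriviallyNormedField 𝕜] [NormedSpace 𝕜 D]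
    {n : WithTop ℕ∞} [IsManifold 𝓘(𝕜, D) n M] {x₀ x : M} (hx : x ∈ (chartAt D x₀).source) :
    ContMDiffAt 𝓘(𝕜, D) 𝓘(𝕜, D) n (chartAt D x₀) x :=
  (contMDiffOn_of_mem_maximalAtlas (IsManifold.subset_maximalAtlas
    (chart_mem_atlas _ x₀))).contMDiffAt ((chartAt D x₀).open_source.mem_nhds hx)

theorem hasMFDerivAt_chartAt {𝕜 : Type*} [NontriviallyNormedField 𝕜] [NormedSpace 𝕜 D]
    [IsManifold 𝓘(𝕜, D) 1 M] {x₀ x : M} (hx : x ∈ (chartAt D x₀).source) :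
    HasMFDerivAt 𝓘(𝕜, D) 𝓘(𝕜, D) (chartAt D x₀) x (chartDeriv 𝕜 x₀ x : D →L[𝕜] D) :=
  ((contMDiffAt_chartAt_of_mem (𝕜 := 𝕜) (n := 1) hx).mdifferentiableAt (by simp)).hasMFDerivAt

theorem contMDiffAt_chartAt_symm {𝕜 : Type*} [NontriviallyNormedField 𝕜] [NormedSpace 𝕜 D]
    {n : WithTop ℕ∞} [IsManifold 𝓘(𝕜, D) n M] {x₀ : M} {p : D} (hp : p ∈ (chartAt D x₀).target) :
    ContMDiffAt 𝓘(𝕜, D) 𝓘(𝕜, D) n (chartAt D x₀).symm p :=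
  (contMDiffOn_symm_of_mem_maximalAtlas (IsManifold.subset_maximalAtlas
    (chart_mem_atlas _ x₀))).contMDiffAt ((chartAt D x₀).open_target.mem_nhds hp)

theorem ContMDiffAt.contDiffAt_comp_symm {𝕜 : Type*} [NontriviallyNormedField 𝕜] [NormedSpace 𝕜 D]
    {W : Type*} [NormedAddCommGroup W] [NormedSpace 𝕜 W]
    {n : WithTop ℕ∞} [IsManifold 𝓘(𝕜, D) n M] {f : M → W} {x₀ : M} {p : D}
    (hp : p ∈ (chartAt D x₀).target)
    (hf : ContMDiffAt 𝓘(𝕜, D) 𝓘(𝕜, W) n f ((chartAt D x₀).symm p)) :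
    ContDiffAt 𝕜 n (fun p => f ((chartAt D x₀).symm p)) p :=
  (ContMDiffAt.comp p hf (contMDiffAt_chartAt_symm hp)).contDiffAt

theorem eventually_mem_chartAt_target {x₀ : M} {p : D} (hp : p ∈ (chartAt D x₀).target) :
    ∀ᶠ q in 𝓝 p, q ∈ (chartAt D x₀).target := (chartAt D x₀).open_target.mem_nhds hp

variable [NormedSpace ℝ D] [IsManifold 𝓘(ℝ, D) ∞ M]

theorem derivAlong_eq_fderiv {f : M → ℝ} {x₀ x : M} (hx : x ∈ (chartAt D x₀).source)
    (hf : ContMDiffAt 𝓘(ℝ, D) 𝓘(ℝ, ℝ) ∞ f x) (v : D) :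
    HolLineBundle.derivAlong f x v = fderiv ℝ (fun p => f ((chartAt D x₀).symm p)) (chartAt D x₀ x)
      (chartDeriv ℝ x₀ x v) := by
  have : IsManifold 𝓘(ℝ, D) 1 M := IsManifold.of_le (n := ∞) (by simp)
  set c := chartAt D x₀
  have hf' : ContMDiffAt 𝓘(ℝ, D) 𝓘(ℝ, ℝ) ∞ f (c.symm (c x)) := by rwa [c.left_inv hx]
  have h1 := ((hf'.contDiffAt_comp_symm (c.map_source hx)).differentiableAt (by simp)).hasFDerivAt.hasMFDerivAt
  have h2 := hasMFDerivAt_chartAt (𝕜 := ℝ) hx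
  have h3 := h1.comp_eq h2 rfl
  have h4 : HasMFDerivAt 𝓘(ℝ, D) 𝓘(ℝ, ℝ) f x _ := h3.congr_of_eventuallyEq (by
    filter_upwards [c.open_source.mem_nhds hx] with z hz
    rw [c.left_inv hz])
  change mfderiv 𝓘(ℝ, D) 𝓘(ℝ, ℝ) f x v = _
  rw [h4.mfderiv]
  rfl

theorem derivAlong_eq_fderiv_chartField {f : M → ℝ} {x₀ : M} {p : D}
    (hp : p ∈ (chartAt D x₀).target)
    (hf : ContMDiffAt 𝓘(ℝ, D) 𝓘(ℝ, ℝ) ∞ f ((chartAt D x₀).symm p)) (Y : M → D) :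
    HolLineBundle.derivAlong f ((chartAt D x₀).symm p) (Y ((chartAt D x₀).symm p)) =
      fderiv ℝ (fun p => f ((chartAt D x₀).symm p)) p (chartField ℝ x₀ Y p) := by
  rw [derivAlong_eq_fderiv ((chartAt D x₀).map_target hp) hf, (chartAt D x₀).right_inv hp]
  rfl

end Charts

namespace HolLineBundle

variable {E : Type*} [NormedAddCommGroup E] [NormedSpace ℂ E]
  {B : Type*} [TopologicalSpace B] [ChartedSpace E B]
  {V : B → Type*} [∀ b, AddCommGroup (V b)] [∀ b, Module ℂ (V b)]
  {𝓛 : HolLineBundle E V}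
  [IsManifold 𝓘(ℂ, E) ω B]

attribute [local instance] isManifold_complexToReal

theorem chartDeriv_complexToReal {ε₀ ε : 𝓛.Slit} (hε : ε ∈ (chartAt (E × ℂ) ε₀).source) (v : E × ℂ) :
    chartDeriv ℝ ε₀ ε v = chartDeriv ℂ ε₀ ε v :=
  mfderiv_complexToReal ((contMDiffAt_chartAt_of_mem (𝕜 := ℂ) (n := ω) hε).mdifferentiableAt
    (by simp)) v

theorem chartField_I_smul (ε₀ : 𝓛.Slit) (Y : 𝓛.Slit → E × ℂ) {p : E × ℂ}
    (hp : p ∈ (chartAt (E × ℂ) ε₀).target) :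
    chartField ℝ ε₀ (fun ε => Complex.I • Y ε) p = Complex.I • chartField ℝ ε₀ Y p := by
  unfold chartField
  rw [chartDeriv_complexToReal ((chartAt (E × ℂ) ε₀).map_target hp),
    chartDeriv_complexToReal ((chartAt (E × ℂ) ε₀).map_target hp), map_smul]

variable [FiniteDimensional ℂ E] [T2Space B]

/-- The vector field on the slit total space which corresponds to a section of the gauge
algebroid. -/
def GaugeSection.field (Δ : 𝓛.GaugeSection) (ε : 𝓛.Slit) : E × ℂ := lift ε (Δ.toFun (𝓛.toProj ε))

theorem homogenize_act (Δ : 𝓛.GaugeSection) (s : 𝓛.Sections) (ε : 𝓛.Slit) :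
    𝓛.homogenize (Δ.act s).1 ε = derivAlong (𝓛.homogenize s.1) ε (Δ.field ε) :=
  isImage_lift ε (Δ.toFun (𝓛.toProj ε)) s

theorem homogenize_act_symm (Δ : 𝓛.GaugeSection) (s : 𝓛.Sections) {ε₀ : 𝓛.Slit} {p : E × ℂ}
    (hp : p ∈ (chartAt (E × ℂ) ε₀).target) :
    𝓛.homogenize (Δ.act s).1 ((chartAt (E × ℂ) ε₀).symm p) =
      fderiv ℝ (fun p => 𝓛.homogenize s.1 ((chartAt (E × ℂ) ε₀).symm p)) p
        (chartField ℝ ε₀ Δ.field p) := by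
  rw [homogenize_act]
  exact derivAlong_eq_fderiv_chartField hp (s.2 _) Δ.field

omit [FiniteDimensional ℂ E] [T2Space B] in
theorem contDiffAt_homogenize_symm (s : 𝓛.Sections) {ε₀ : 𝓛.Slit} {p : E × ℂ}
    (hp : p ∈ (chartAt (E × ℂ) ε₀).target) :
    ContDiffAt ℝ ∞ (fun p => 𝓛.homogenize s.1 ((chartAt (E × ℂ) ε₀).symm p)) p :=
  ContMDiffAt.contDiffAt_comp_symm hp (s.2 _)

theorem contDiffAt_of_functionals {W W' : Type*} [NormedAddCommGroup W] [NormedSpace ℝ W]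
    [NormedAddCommGroup W'] [NormedSpace ℝ W'] [FiniteDimensional ℝ W'] {f : W → W'} {x : W}
    {n : WithTop ℕ∞} (h : ∀ l : W' →L[ℝ] ℝ, ContDiffAt ℝ n (fun y => l (f y)) x) :
    ContDiffAt ℝ n f x := by
  let b := Module.finBasis ℝ W'
  have h1 : f = fun y => b.equivFunL.symm (fun i => b.coord i (f y)) := by
    funext y
    exact (b.equivFun.symm_apply_apply (f y)).symm
  rw [h1]
  refine b.equivFunL.symm.contDiff.contDiffAt.comp x (contDiffAt_pi.2 fun i => ?_)
  exact h (LinearMap.toContinuousLinearMap (b.coord i))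

theorem exists_realFunctional_ne_zero {z : ℂ} (hz : z ≠ 0) : ∃ L : ℂ →L[ℝ] ℝ, L z ≠ 0 := by
  by_contra! h0
  exact hz (Complex.ext (h0 Complex.reCLM) (h0 Complex.imCLM))

/-- The vector field of a section of the gauge algebroid is smooth. -/
theorem contDiffAt_chartField (Δ : 𝓛.GaugeSection) {ε₀ : 𝓛.Slit} {p : E × ℂ}
    (hp : p ∈ (chartAt (E × ℂ) ε₀).target) : ContDiffAt ℝ ∞ (chartField ℝ ε₀ Δ.field) p := by
  set c := chartAt (E × ℂ) ε₀ with hc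
  set Y := chartField ℝ ε₀ Δ.field with hY
  have hε := c.map_target hp
  have key : ∀ (g : E × ℂ → ℝ), ContDiff ℝ ∞ g → (∀ y z (r : ℝ), g (y, r * z) = r * g (y, z)) →
      ContDiffAt ℝ ∞ (fun q => fderiv ℝ g q (Y q)) p := by
    intro g hg hg'
    obtain ⟨s, hs⟩ := exists_section_chart hε hg hg'
    have h1 := (c.symm.continuousAt hp).eventually hs
    refine (contDiffAt_homogenize_symm (Δ.act s) hp).congr_of_eventuallyEq ?_
    filter_upwards [h1.eventually_nhds, eventually_mem_chartAt_target hp] with q hq hqt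
    rw [homogenize_act_symm Δ s hqt]
    congr 1
    refine (Filter.EventuallyEq.fderiv_eq ?_).symm
    filter_upwards [hq, eventually_mem_chartAt_target hqt] with q' hq' hqt'
    rw [hq', c.right_inv hqt']
  have h2 : ∀ L : ℂ →L[ℝ] ℝ, ContDiffAt ℝ ∞ (fun q => L (Y q).2) p := by
    intro L
    refine (key (fun q => L q.2) (L.contDiff.comp contDiff_snd) (fun y c r => by
      rw [← Complex.real_smul, map_smul, smul_eq_mul])).congr_of_eventuallyEq
        (Filter.Eventually.of_forall fun q => ?_)
    have h2 : HasFDerivAt (fun p : E × ℂ => L p.2) (L.comp (ContinuousLinearMap.snd ℝ E ℂ)) q :=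
      (L.comp (ContinuousLinearMap.snd ℝ E ℂ)).hasFDerivAt
    change _ = fderiv ℝ _ q (Y q)
    rw [h2.fderiv]
    rfl
  have : FiniteDimensional ℝ E := FiniteDimensional.complexToReal E
  obtain ⟨L, hL⟩ : ∃ L : ℂ →L[ℝ] ℝ, L p.2 ≠ 0 := by
    have hne := chartAt_slit_snd_ne_zero hε
    rw [← hc, c.right_inv hp] at hne
    exact exists_realFunctional_ne_zero hne
  have h1 : ContDiffAt ℝ ∞ (fun q => (Y q).1) p := by
    refine contDiffAt_of_functionals fun l => ?_
    have h3 := key (fun q => l q.1 * L q.2)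
      ((l.contDiff.comp contDiff_fst).mul (L.contDiff.comp contDiff_snd)) (fun y c r => by
        simp only
        rw [← Complex.real_smul, map_smul, smul_eq_mul]
        ring)
    have hL2 : ContDiffAt ℝ ∞ (fun q : E × ℂ => L q.2) p :=
      (L.contDiff.comp contDiff_snd).contDiffAt
    have hl1 : ContDiffAt ℝ ∞ (fun q : E × ℂ => l q.1) p :=
      (l.contDiff.comp contDiff_fst).contDiffAt
    refine ((h3.sub (hl1.mul (h2 L))).div hL2 hL).congr_of_eventuallyEq ?_
    filter_upwards [hL2.continuousAt.eventually_ne hL] with q hq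
    have h4 : HasFDerivAt (fun p : E × ℂ => l p.1 * L p.2) _ q :=
      (l.comp (ContinuousLinearMap.fst ℝ E ℂ)).hasFDerivAt.mul
      (L.comp (ContinuousLinearMap.snd ℝ E ℂ)).hasFDerivAt
    refine (eq_div_iff hq).2 ?_
    beta_reduce
    rw [h4.fderiv]
    simp
    ring
  exact h1.prodMk (contDiffAt_of_functionals h2)

/-- A family of derivations preserving the smooth sections is a section of the gauge algebroid. -/
theorem exists_gaugeSection (A : 𝓛.Sections → 𝓛.Sections)
    (hA : ∀ ε, ∃ v : E × ℂ, ∀ s, 𝓛.homogenize (A s).1 ε = derivAlong (𝓛.homogenize s.1) ε v) :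
    ∃ Δ : 𝓛.GaugeSection, ∀ s, Δ.act s = A s := by
  have h : ∀ x, ∃ Δ : 𝓛.Gauge x, ∀ s, Δ.1 s = (A s).1 x := by
    intro x
    obtain ⟨ε, rfl⟩ := exists_toProj_eq x
    obtain ⟨v, hv⟩ := hA ε
    exact ⟨(liftEquiv ε).symm v, fun s => pairing_injective ε
      ((isImage_liftEquiv_symm ε v s).trans (hv s).symm)⟩
  choose Δ hΔ using h
  have h2 : ∀ s, (fun x => (Δ x).1 s) = (A s).1 := fun s => funext fun x => hΔ x s
  exact ⟨⟨Δ, fun s => by rw [h2 s]; exact (A s).2⟩, fun s => Subtype.ext (h2 s)⟩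

omit [FiniteDimensional ℂ E] [T2Space B] in
theorem homogenize_sub (s t : 𝓛.Sections) (ε : 𝓛.Slit) :
    𝓛.homogenize (s - t : 𝓛.Sections).1 ε = 𝓛.homogenize s.1 ε - 𝓛.homogenize t.1 ε :=
  map_sub (𝓛.pairing ε) _ _

theorem homogenize_commutator (Δ Ξ : 𝓛.GaugeSection) (s : 𝓛.Sections) {ε₀ : 𝓛.Slit} {p : E × ℂ}
    (hp : p ∈ (chartAt (E × ℂ) ε₀).target) :
    𝓛.homogenize (Δ.act (Ξ.act s) - Ξ.act (Δ.act s) : 𝓛.Sections).1 ((chartAt (E × ℂ) ε₀).symm p) =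
      fderiv ℝ (fun p => 𝓛.homogenize s.1 ((chartAt (E × ℂ) ε₀).symm p)) p
        (fderiv ℝ (chartField ℝ ε₀ Ξ.field) p (chartField ℝ ε₀ Δ.field p) -
          fderiv ℝ (chartField ℝ ε₀ Δ.field) p (chartField ℝ ε₀ Ξ.field p)) := by
  set u := fun p => 𝓛.homogenize s.1 ((chartAt (E × ℂ) ε₀).symm p) with hu
  have hus : ContDiffAt ℝ ∞ u p := contDiffAt_homogenize_symm s hp
  have h1 : ∀ Y Z : 𝓛.GaugeSection, fderiv ℝ
      (fun p => 𝓛.homogenize (Z.act s).1 ((chartAt (E × ℂ) ε₀).symm p)) p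
        (chartField ℝ ε₀ Y.field p) =
      fderiv ℝ (fderiv ℝ u) p (chartField ℝ ε₀ Y.field p) (chartField ℝ ε₀ Z.field p) +
      fderiv ℝ u p (fderiv ℝ (chartField ℝ ε₀ Z.field) p (chartField ℝ ε₀ Y.field p)) := by
    intro Y Z
    have h2 : (fun p => 𝓛.homogenize (Z.act s).1 ((chartAt (E × ℂ) ε₀).symm p)) =ᶠ[𝓝 p]
        fun p => fderiv ℝ u p (chartField ℝ ε₀ Z.field p) := by
      filter_upwards [eventually_mem_chartAt_target hp] with q hq
      exact homogenize_act_symm Z s hq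
    have h3 : HasFDerivAt (fderiv ℝ u) (fderiv ℝ (fderiv ℝ u) p) p :=
      ((hus.fderiv_right (m := ∞) (by simp)).differentiableAt (by simp)).hasFDerivAt
    have h4 := ((contDiffAt_chartField Z hp).differentiableAt (by simp)).hasFDerivAt
    rw [h2.fderiv_eq, (h3.clm_apply h4).fderiv]
    simp [add_comm]
  have h5 := (hus.isSymmSndFDerivAt (by
    rw [minSmoothness_of_isRCLikeNormedField]
    exact ENat.LEInfty.out)).eq
    (chartField ℝ ε₀ Δ.field p) (chartField ℝ ε₀ Ξ.field p)
  rw [homogenize_sub, homogenize_act_symm _ _ hp, homogenize_act_symm _ _ hp, h1, h1, h5, map_sub]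
  ring

theorem bracket_act (Δ Ξ : 𝓛.GaugeSection) (s : 𝓛.Sections) :
    (Δ.bracket Ξ).act s = Δ.act (Ξ.act s) - Ξ.act (Δ.act s) := by
  have h : ∃ Ψ : 𝓛.GaugeSection, ∀ s, Ψ.act s = Δ.act (Ξ.act s) - Ξ.act (Δ.act s) := by
    refine exists_gaugeSection _ fun ε => ?_
    refine ⟨fderiv ℝ (chartField ℝ ε Ξ.field) (chartAt (E × ℂ) ε ε) (Δ.field ε) -
          fderiv ℝ (chartField ℝ ε Δ.field) (chartAt (E × ℂ) ε ε) (Ξ.field ε), fun s => ?_⟩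
    have h1 := homogenize_commutator Δ Ξ s (mem_chart_target (E × ℂ) ε)
    rw [chartField_self, chartField_self, (chartAt (E × ℂ) ε).left_inv (mem_chart_source _ ε)] at h1
    rw [h1, derivAlong_eq_fderiv (mem_chart_source _ ε) (s.2 ε), chartDeriv_self]
    rfl
  exact Classical.epsilon_spec h s

theorem bracket_field (Δ Ξ : 𝓛.GaugeSection) (ε : 𝓛.Slit) : (Δ.bracket Ξ).field ε =
    fderiv ℝ (chartField ℝ ε Ξ.field) (chartAt (E × ℂ) ε ε) (Δ.field ε) -
      fderiv ℝ (chartField ℝ ε Δ.field) (chartAt (E × ℂ) ε ε) (Ξ.field ε) := by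
  refine tangent_ext (𝓛 := 𝓛) (ε := ε) fun s => ?_
  have h1 := homogenize_commutator Δ Ξ s (mem_chart_target (E × ℂ) ε)
  rw [chartField_self, chartField_self, (chartAt (E × ℂ) ε).left_inv (mem_chart_source _ ε),
    ← bracket_act, homogenize_act] at h1
  rw [h1, derivAlong_eq_fderiv (mem_chart_source _ ε) (s.2 ε), chartDeriv_self]
  rfl

end HolLineBundle
end

noncomputable section

namespace HolLineBundle

variable {E : Type*} [NormedAddCommGroup E] [NormedSpace ℂ E]
  {B : Type*} [TopologicalSpace B] [ChartedSpace E B]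
  {V : B → Type*} [∀ b, AddCommGroup (V b)] [∀ b, Module ℂ (V b)]
  {𝓛 : HolLineBundle E V}
  [IsManifold 𝓘(ℂ, E) ω B]

attribute [local instance] isManifold_complexToReal

theorem gauge_cast_apply {x y : 𝓛.RProj} (h : x = y) (Δ : 𝓛.Gauge x) (s : 𝓛.Sections) :
    (h ▸ Δ : 𝓛.Gauge y).1 s = (h ▸ Δ.1 s : 𝓛.HatFiber y) := by
  subst h
  rfl

/-- The derivative of the multiplication by a real number. -/
def drescale (r : ℝˣ) (ε : 𝓛.Slit) : E × ℂ →L[ℝ] E × ℂ :=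
  mfderiv 𝓘(ℝ, E × ℂ) 𝓘(ℝ, E × ℂ) (𝓛.rescale r) ε

theorem hasMFDerivAt_rescale (r : ℝˣ) (ε : 𝓛.Slit) :
    HasMFDerivAt 𝓘(ℝ, E × ℂ) 𝓘(ℝ, E × ℂ) (𝓛.rescale r) ε (drescale r ε : E × ℂ →L[ℝ] E × ℂ) :=
  ((contMDiff_rescale r ε).mdifferentiableAt (by simp)).hasMFDerivAt

theorem drescale_I_smul (r : ℝˣ) (ε : 𝓛.Slit) (v : E × ℂ) :
    drescale r ε (Complex.I • v) = Complex.I • drescale r ε v := by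
  have h1 := ((contMDiff_rescale_complex (𝓛 := 𝓛) r ε).mdifferentiableAt (by simp))
  have h2 : ∀ v, drescale r ε v =
      (mfderiv 𝓘(ℂ, E × ℂ) 𝓘(ℂ, E × ℂ) (𝓛.rescale r) ε : E × ℂ →L[ℂ] E × ℂ) v :=
    fun v => mfderiv_complexToReal h1 v
  rw [h2, h2]
  exact map_smul (mfderiv 𝓘(ℂ, E × ℂ) 𝓘(ℂ, E × ℂ) (𝓛.rescale r) ε : E × ℂ →L[ℂ] E × ℂ) _ _

theorem derivAlong_drescale (s : 𝓛.Sections) (r : ℝˣ) (ε : 𝓛.Slit) (v : E × ℂ) :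
    derivAlong (𝓛.homogenize s.1) (𝓛.rescale r ε) (drescale r ε v) =
      r * derivAlong (𝓛.homogenize s.1) ε v := by
  have h1 := (hasMFDerivAt_homogenize s (𝓛.rescale r ε)).comp_eq (hasMFDerivAt_rescale r ε) rfl
  have h2 := HasMFDerivAt.const_smul (s := (r : ℝ)) (hasMFDerivAt_homogenize s ε)
  exact h1.eq_apply h2 (Filter.Eventually.of_forall fun ε' => homogenize_rescale s.1 r ε') v

theorem IsImage.rescale {ε : 𝓛.Slit} {v : E × ℂ} {Δ : 𝓛.Gauge (𝓛.toProj ε)} (h : 𝓛.IsImage ε v Δ)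
    (r : ℝˣ) (hr : 𝓛.toProj ε = 𝓛.toProj (𝓛.rescale r ε)) :
    𝓛.IsImage (𝓛.rescale r ε) (drescale r ε v) (hr ▸ Δ) := by
  intro s
  rw [gauge_cast_apply, pairing_cast_rescale, derivAlong_drescale, h s]

variable [FiniteDimensional ℂ E] [T2Space B]

omit [FiniteDimensional ℂ E] [T2Space B] in
theorem contMDiffAt_derivAlong {Y : 𝓛.Slit → E × ℂ} {ε : 𝓛.Slit}
    (hY : ContDiffAt ℝ ∞ (chartField ℝ ε Y) (chartAt (E × ℂ) ε ε)) (s : 𝓛.Sections) :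
    ContMDiffAt 𝓘(ℝ, E × ℂ) 𝓘(ℝ, ℝ) ∞ (fun ε' => derivAlong (𝓛.homogenize s.1) ε' (Y ε')) ε := by
  set c := chartAt (E × ℂ) ε
  have h1 := ((contDiffAt_homogenize_symm s (mem_chart_target (E × ℂ) ε)).fderiv_right (m := ∞)
    (by simp)).clm_apply hY
  refine (h1.contMDiffAt.comp ε (contMDiffAt_chartAt_slit (mem_chart_source _ ε))).congr_of_eventuallyEq ?_
  filter_upwards [c.open_source.mem_nhds (mem_chart_source _ ε)] with ε' hε'
  have h2 := derivAlong_eq_fderiv_chartField (c.map_source hε') (s.2 _) Y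
  rw [c.left_inv hε'] at h2
  exact h2

/-- The endomorphism of a fibre of the gauge algebroid induced by the complex structure. -/
theorem exists_gaugeEndomorphism (x : 𝓛.RProj) : ∃ N : 𝓛.Gauge x →ₗ[ℝ] 𝓛.Gauge x,
    ∀ ε (h : x = 𝓛.toProj ε) (Δ : 𝓛.Gauge x) (v : E × ℂ),
      𝓛.IsImage ε v (h ▸ Δ) → 𝓛.IsImage ε (Complex.I • v : E × ℂ) (h ▸ N Δ) := by
  obtain ⟨ε, rfl⟩ := exists_toProj_eq x
  let J : (E × ℂ) →ₗ[ℝ] (E × ℂ) := (LinearMap.lsmul ℂ (E × ℂ) Complex.I).restrictScalars ℝ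
  refine ⟨(liftEquiv ε).symm.toLinearMap ∘ₗ J ∘ₗ (liftEquiv ε).toLinearMap, fun ε' h Δ v hv => ?_⟩
  obtain ⟨r, rfl⟩ := 𝓛.toProj_eq_iff.1 h
  have h1 := (isImage_lift ε Δ).rescale r h
  have h2 : v = drescale r ε (lift ε Δ) := by rw [← hv.lift_eq, ← h1.lift_eq]
  have h3 := (isImage_liftEquiv_symm ε (J (lift ε Δ))).rescale r h
  have h4 : drescale r ε (J (lift ε Δ)) = Complex.I • v := by
    rw [h2]
    exact drescale_I_smul r ε _
  rw [h4] at h3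
  exact h3

theorem existsUnique_gaugeComplexStructure :
    ∃! N : 𝓛.AtiyahTensor, 𝓛.IsGaugeComplexStructure N := by
  choose N hN using exists_gaugeEndomorphism (𝓛 := 𝓛)
  have hN' : ∀ ε v Δ, 𝓛.IsImage ε v Δ → 𝓛.IsImage ε (𝓛.complexStructure ε v) (N _ Δ) :=
    fun ε v Δ h => hN _ ε rfl Δ v h
  refine ⟨⟨N, fun Δ s => ?_⟩, hN', fun N' hN2 => ?_⟩
  · change ContMDiff 𝓘(ℝ, E × ℂ) 𝓘(ℝ, ℝ) ∞ (𝓛.homogenize _)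
    have h1 : 𝓛.homogenize (fun x => (N x (Δ.toFun x)).1 s) =
        fun ε => derivAlong (𝓛.homogenize s.1) ε (Complex.I • Δ.field ε : E × ℂ) :=
      funext fun ε => hN' ε _ _ (isImage_lift ε _) s
    rw [h1]
    intro ε
    refine contMDiffAt_derivAlong ?_ s
    have h2 := (contDiffAt_chartField Δ (mem_chart_target (E × ℂ) ε)).const_smul Complex.I
    refine h2.congr_of_eventuallyEq ?_
    filter_upwards [eventually_mem_chartAt_target (mem_chart_target (E × ℂ) ε)] with p hp
    exact chartField_I_smul ε Δ.field hp
  · obtain ⟨N', hs⟩ := N'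
    congr 1
    funext x
    obtain ⟨ε, rfl⟩ := exists_toProj_eq x
    refine LinearMap.ext fun Δ => ?_
    exact (hN2 ε _ Δ (isImage_lift ε Δ)).unique (hN' ε _ Δ (isImage_lift ε Δ))

theorem IsGaugeComplexStructure.lift_eq {N : 𝓛.AtiyahTensor} (hN : 𝓛.IsGaugeComplexStructure N)
    (ε : 𝓛.Slit) (Δ : 𝓛.Gauge (𝓛.toProj ε)) :
    lift ε (N.toFun _ Δ) = (Complex.I • lift ε Δ : E × ℂ) :=
  (hN ε _ Δ (isImage_lift ε Δ)).lift_eq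

theorem IsGaugeComplexStructure.field_apply {N : 𝓛.AtiyahTensor}
    (hN : 𝓛.IsGaugeComplexStructure N) (Δ : 𝓛.GaugeSection) :
    (N.apply Δ).field = fun ε => (Complex.I • Δ.field ε : E × ℂ) :=
  funext fun ε => hN.lift_eq ε _

theorem lift_injective (ε : 𝓛.Slit) : Function.Injective (lift (𝓛 := 𝓛) ε) :=
  (liftEquiv ε).injective

theorem IsGaugeComplexStructure.apply_apply {N : 𝓛.AtiyahTensor}
    (hN : 𝓛.IsGaugeComplexStructure N) (x : 𝓛.RProj) (Δ : 𝓛.Gauge x) :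
    N.toFun x (N.toFun x Δ) = -Δ := by
  obtain ⟨ε, rfl⟩ := exists_toProj_eq x
  apply lift_injective ε
  rw [hN.lift_eq, hN.lift_eq, smul_smul, Complex.I_mul_I, neg_one_smul]
  exact (map_neg (liftEquiv ε) Δ).symm

theorem IsGaugeComplexStructure.fderiv_chartField {N : 𝓛.AtiyahTensor}
    (hN : 𝓛.IsGaugeComplexStructure N) (Δ : 𝓛.GaugeSection) (ε : 𝓛.Slit) (v : E × ℂ) :
    fderiv ℝ (chartField ℝ ε (N.apply Δ).field) (chartAt (E × ℂ) ε ε) v =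
      Complex.I • fderiv ℝ (chartField ℝ ε Δ.field) (chartAt (E × ℂ) ε ε) v := by
  have h1 : chartField ℝ ε (N.apply Δ).field =ᶠ[𝓝 (chartAt (E × ℂ) ε ε)]
      Complex.I • chartField ℝ ε Δ.field := by
    filter_upwards [eventually_mem_chartAt_target (mem_chart_target (E × ℂ) ε)] with p hp
    rw [hN.field_apply]
    exact chartField_I_smul ε Δ.field hp
  have h2 := ((contDiffAt_chartField Δ (mem_chart_target (E × ℂ) ε)).differentiableAt
    (by simp)).hasFDerivAt
  rw [h1.fderiv_eq, (h2.const_smul Complex.I).fderiv]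
  rfl

theorem IsGaugeComplexStructure.isNijenhuis {N : 𝓛.AtiyahTensor}
    (hN : 𝓛.IsGaugeComplexStructure N) : N.IsNijenhuis := by
  intro Δ Ξ x
  obtain ⟨ε, rfl⟩ := exists_toProj_eq x
  apply (liftEquiv ε).injective
  rw [map_add, map_sub, map_sub, map_zero]
  simp only [liftEquiv_apply, hN.lift_eq]
  have h := bracket_field (𝓛 := 𝓛)
  unfold GaugeSection.field at h
  simp only [h]
  have h1 := hN.fderiv_chartField
  unfold GaugeSection.field at h1
  have h2 : ∀ Δ : 𝓛.GaugeSection, lift ε ((N.apply Δ).toFun (𝓛.toProj ε)) =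
    (Complex.I • lift ε (Δ.toFun (𝓛.toProj ε)) : E × ℂ) := fun Δ => hN.lift_eq ε _
  simp only [h1, h2, smul_sub, smul_smul, Complex.I_mul_I, neg_one_smul]
  abel

section Extension

omit [FiniteDimensional ℂ E] [T2Space B] in
theorem chartAt_slit_symm_rescale {ε₀ : 𝓛.Slit} {p : E × ℂ} (hp : p ∈ (chartAt (E × ℂ) ε₀).target)
    (r : ℝˣ) : (p.1, ((r : ℝ) : ℂ) * p.2) ∈ (chartAt (E × ℂ) ε₀).target ∧
      (chartAt (E × ℂ) ε₀).symm (p.1, ((r : ℝ) : ℂ) * p.2) =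
        𝓛.rescale r ((chartAt (E × ℂ) ε₀).symm p) := by
  set c := chartAt (E × ℂ) ε₀ with hc
  have h1 := c.map_target hp
  have h2 : 𝓛.rescale r (c.symm p) ∈ c.source := h1
  have h3 := chartAt_slit_rescale h1 r
  rw [← hc, c.right_inv hp] at h3
  rw [← h3]
  exact ⟨c.map_source h2, c.left_inv h2⟩

/-- Every tangent vector of the slit total space is the value of the vector field of a section of
the gauge algebroid. -/
theorem exists_gaugeSection_field (ε : 𝓛.Slit) (v : E × ℂ) : ∃ Δ : 𝓛.GaugeSection, Δ.field ε = v := by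
  have hU : (chartAt E ε.base).source ∩ (𝓛.frameAt ε.base).1 ∈ 𝓝 ε.base :=
    ((chartAt E ε.base).open_source.inter (𝓛.isOpen _ (𝓛.frameAt_mem _))).mem_nhds
      ⟨mem_chart_source E _, 𝓛.mem_frameAt _⟩
  obtain ⟨ρ, h1, h2, h3⟩ := exists_bump (E := E) hU
  set c := chartAt (E × ℂ) ε with hc
  have hc0 : (c ε).2 ≠ 0 := chartAt_slit_snd_ne_zero (mem_chart_source (E × ℂ) ε)
  let W : E × ℂ → E × ℂ := fun p => (v.1, p.2 * (v.2 / (c ε).2))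
  have hW : ContDiff ℝ ∞ W := contDiff_const.prodMk (contDiff_snd.mul contDiff_const)
  let u : 𝓛.Sections → E × ℂ → ℝ := fun s p => 𝓛.homogenize s.1 (c.symm p)
  have hu : ∀ s p, p ∈ c.target → ContDiffAt ℝ ∞ (u s) p := fun s p hp =>
    contDiffAt_homogenize_symm s hp
  have hur : ∀ s p, p ∈ c.target → ∀ r : ℝˣ,
      fderiv ℝ (u s) (p.1, ((r : ℝ) : ℂ) * p.2) (W (p.1, ((r : ℝ) : ℂ) * p.2)) =
        r * fderiv ℝ (u s) p (W p) := by
    intro s p hp r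
    let S : E × ℂ →L[ℝ] E × ℂ := (ContinuousLinearMap.fst ℝ E ℂ).prod
      ((r : ℝ) • ContinuousLinearMap.snd ℝ E ℂ)
    have hS : ∀ q : E × ℂ, S q = (q.1, ((r : ℝ) : ℂ) * q.2) := fun q =>
      Prod.ext rfl (Complex.real_smul)
    rw [← hS]
    have h4 : HasFDerivAt (fun q => u s (S q)) _ p := HasFDerivAt.comp (g := u s) p
      ((hu s (S p) (by rw [hS]; exact (chartAt_slit_symm_rescale hp r).1)).differentiableAt
        (by simp)).hasFDerivAt S.hasFDerivAt
    have h5 := ((hu s p hp).differentiableAt (by simp)).hasFDerivAt.const_mul (r : ℝ)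
    have h6 : (fun q => u s (S q)) =ᶠ[𝓝 p] fun q => r * u s q := by
      filter_upwards [eventually_mem_chartAt_target hp] with q hq
      change 𝓛.homogenize s.1 (c.symm (S q)) = _
      rw [hS, (chartAt_slit_symm_rescale hq r).2, homogenize_rescale]
    have h7 := congrArg (fun l => l (W p)) (h4.unique (h5.congr_of_eventuallyEq h6))
    have h8 : W (S p) = S (W p) := by
      rw [hS, hS]
      exact Prod.ext rfl (mul_assoc _ _ _)
    rw [h8]
    exact h7
  have hex : ∀ s, ∃ t : 𝓛.Sections, ∀ ε', 𝓛.homogenize t.1 ε' =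
      ρ ε'.base * fderiv ℝ (u s) (c ε') (W (c ε')) := by
    intro s
    refine exists_section (fun ε' r => ?_) (contMDiff_bump_mul h1 h2 fun ε' h => ?_)
    · change ρ ε'.base * _ = _
      by_cases h : ε'.base ∈ tsupport ρ
      · have h' : ε' ∈ c.source := h2 h
        rw [hc, chartAt_slit_rescale h', ← hc, hur s _ (c.map_source h')]
        ring
      · rw [image_eq_zero_of_notMem_tsupport h]
        ring
    · have h' : ε' ∈ c.source := h
      have h4 := ((hu s _ (c.map_source h')).fderiv_right (m := ∞) (by simp)).clm_apply
        hW.contDiffAt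
      exact h4.contMDiffAt.comp ε' (contMDiffAt_chartAt_slit h')
  choose A hA using hex
  obtain ⟨Δ, hΔ⟩ := exists_gaugeSection A (fun ε' => by
    by_cases h : ε'.base ∈ tsupport ρ
    · have h' : ε' ∈ c.source := h2 h
      have h4 := ((contMDiffAt_chartAt_symm (𝕜 := ℝ) (n := ∞) (c.map_source h')).mdifferentiableAt
        (by simp)).hasMFDerivAt
      let l : E × ℂ →L[ℝ] E × ℂ := mfderiv 𝓘(ℝ, E × ℂ) 𝓘(ℝ, E × ℂ) c.symm (c ε')
      refine ⟨ρ ε'.base • l (W (c ε')), fun s => ?_⟩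
      have h5 := (hasMFDerivAt_homogenize s ε').comp_eq h4 (c.left_inv h')
      have h6 := ((hu s _ (c.map_source h')).differentiableAt (by simp)).hasFDerivAt.hasMFDerivAt
      have h7 := h5.eq_apply h6 (Filter.Eventually.of_forall fun q => rfl) (W (c ε'))
      rw [hA, ← h7]
      exact (map_smul (derivAlong (𝓛.homogenize s.1) ε') _ _).symm
    · refine ⟨0, fun s => ?_⟩
      rw [hA, image_eq_zero_of_notMem_tsupport h, zero_mul]
      exact (map_zero (derivAlong (𝓛.homogenize s.1) ε')).symm)
  refine ⟨Δ, tangent_ext (𝓛 := 𝓛) (ε := ε) fun s => ?_⟩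
  rw [← homogenize_act, hΔ, hA, h3.self_of_nhds, one_mul,
    derivAlong_eq_fderiv (mem_chart_source _ ε) (s.2 ε), chartDeriv_self]
  change fderiv ℝ (u s) (c ε) (W (c ε)) = fderiv ℝ (u s) (c ε) v
  congr 1
  exact Prod.ext rfl (mul_div_cancel₀ _ hc0)

end Extension

end HolLineBundle
end

noncomputable section

namespace HolLineBundle

variable {E : Type*} [NormedAddCommGroup E] [NormedSpace ℂ E]
  {B : Type*} [TopologicalSpace B] [ChartedSpace E B]
  {V : B → Type*} [∀ b, AddCommGroup (V b)] [∀ b, Module ℂ (V b)]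
  {𝓛 : HolLineBundle E V}
  [IsManifold 𝓘(ℂ, E) ω B]

attribute [local instance] isManifold_complexToReal

section Differential

theorem GaugeSection.act_sub (Δ : 𝓛.GaugeSection) (s t : 𝓛.Sections) :
    Δ.act (s - t) = Δ.act s - Δ.act t :=
  Subtype.ext (funext fun x => map_sub (Δ.toFun x).1 s t)

theorem GaugeSection.act_neg (Δ : 𝓛.GaugeSection) (s : 𝓛.Sections) :
    Δ.act (-s) = -Δ.act s :=
  Subtype.ext (funext fun x => map_neg (Δ.toFun x).1 s)

/-- The differential of a section of the jet bundle, regarded as a one-form on the gauge algebroid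
with values in the line bundle. -/
def JetSection.d (Θ : 𝓛.JetSection) (Δ Ξ : 𝓛.GaugeSection) : 𝓛.Sections :=
  Δ.act (Θ.eval Ξ) - Ξ.act (Θ.eval Δ) - Θ.eval (Δ.bracket Ξ)

variable [FiniteDimensional ℂ E] [T2Space B]

theorem bracket_jacobi (Δ Ξ Ψ : 𝓛.GaugeSection) (x : 𝓛.RProj) :
    ((Δ.bracket Ξ).bracket Ψ).toFun x + ((Ξ.bracket Ψ).bracket Δ).toFun x +
      ((Ψ.bracket Δ).bracket Ξ).toFun x = 0 := by
  refine Subtype.ext (LinearMap.ext fun s => ?_)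
  have h : ((Δ.bracket Ξ).bracket Ψ).act s + ((Ξ.bracket Ψ).bracket Δ).act s +
      ((Ψ.bracket Δ).bracket Ξ).act s = 0 := by
    simp only [bracket_act, GaugeSection.act_sub]
    abel
  exact congrFun (congrArg Subtype.val h) x

theorem bracket_skew (Δ Ξ : 𝓛.GaugeSection) (x : 𝓛.RProj) :
    (Δ.bracket Ξ).toFun x = -(Ξ.bracket Δ).toFun x := by
  refine Subtype.ext (LinearMap.ext fun s => ?_)
  have h : (Δ.bracket Ξ).act s = -(Ξ.bracket Δ).act s := by
    simp only [bracket_act]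
    abel
  exact congrFun (congrArg Subtype.val h) x

theorem JetSection.d_closed (Θ : 𝓛.JetSection) (Δ Ξ Ψ : 𝓛.GaugeSection) :
    Δ.act (Θ.d Ξ Ψ) + Ξ.act (Θ.d Ψ Δ) + Ψ.act (Θ.d Δ Ξ) =
      Θ.d (Δ.bracket Ξ) Ψ + Θ.d (Ξ.bracket Ψ) Δ + Θ.d (Ψ.bracket Δ) Ξ := by
  have h : Θ.eval ((Δ.bracket Ξ).bracket Ψ) + Θ.eval ((Ξ.bracket Ψ).bracket Δ) +
      Θ.eval ((Ψ.bracket Δ).bracket Ξ) = 0 := by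
    refine Subtype.ext (funext fun x => ?_)
    change Θ.toFun x _ + Θ.toFun x _ + Θ.toFun x _ = 0
    rw [← map_add, ← map_add, bracket_jacobi, map_zero]
  have h2 := eq_neg_of_add_eq_zero_right h
  unfold JetSection.d
  simp only [bracket_act, GaugeSection.act_sub, h2]
  abel

theorem JetSection.eval_bracket_skew (Θ : 𝓛.JetSection) (Δ Ξ : 𝓛.GaugeSection) :
    Θ.eval (Δ.bracket Ξ) = -Θ.eval (Ξ.bracket Δ) := by
  refine Subtype.ext (funext fun x => ?_)
  change Θ.toFun x _ = -Θ.toFun x _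
  rw [bracket_skew, map_neg]

theorem JetSection.d_skew (Θ : 𝓛.JetSection) (Δ Ξ : 𝓛.GaugeSection) : Θ.d Δ Ξ = -Θ.d Ξ Δ := by
  unfold JetSection.d
  rw [Θ.eval_bracket_skew Δ Ξ]
  abel

/-- The inverse of the differential of a one-form is a Jacobi structure; it is compatible with `N`
if `N` is symmetric for the differential and the contraction of both is the differential of
the contraction of `N` with the form. -/
theorem isJacobiNijenhuis_of_d {Θ : 𝓛.JetSection} {J : 𝓛.Biderivation} {N : 𝓛.AtiyahTensor}
    (hJ : ∀ ψ Ξ, Θ.d (J.sharpSection ψ) Ξ = ψ.eval Ξ) (hN : N.IsNijenhuis)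
    (hsymm : ∀ Δ Ξ, Θ.d (N.apply Δ) Ξ = Θ.d Δ (N.apply Ξ))
    (hd : ∀ Δ Ξ, (N.transpose Θ).d Δ Ξ = Θ.d (N.apply Δ) Ξ) : 𝓛.IsJacobiNijenhuis J N := by
  have hNe : ∀ (χ : 𝓛.JetSection) Δ, (N.transpose χ).eval Δ = χ.eval (N.apply Δ) := fun χ Δ => rfl
  refine ⟨fun s t u => ?_, hN, fun ψ χ => ?_, fun ψ χ Ξ => ?_⟩
  · have hb : ∀ s t, J.bracket s t = (J.sharpSection (𝓛.jet s)).act t := fun s t => rfl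
    have hω : ∀ s Ξ, Θ.d (J.sharpSection (𝓛.jet s)) Ξ = Ξ.act s := fun s Ξ => hJ (𝓛.jet s) Ξ
    have hω' : ∀ s Ξ, Θ.d Ξ (J.sharpSection (𝓛.jet s)) = -Ξ.act s := fun s Ξ => by
      rw [Θ.d_skew, hω]
    have hsk : ∀ s t, (J.sharpSection (𝓛.jet s)).act t = -(J.sharpSection (𝓛.jet t)).act s := by
      intro s t
      rw [← hω t, ← hω' s]
    have h := Θ.d_closed (J.sharpSection (𝓛.jet s)) (J.sharpSection (𝓛.jet t))
      (J.sharpSection (𝓛.jet u))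
    simp only [hω, hω', bracket_act] at h
    have e : (J.sharpSection (𝓛.jet t)).act ((J.sharpSection (𝓛.jet u)).act s) =
        -(J.sharpSection (𝓛.jet t)).act ((J.sharpSection (𝓛.jet s)).act u) := by
      rw [hsk u s, GaugeSection.act_neg]
    rw [e] at h
    simp only [hb]
    rw [hsk ((J.sharpSection (𝓛.jet s)).act t) u]
    linear_combination (norm := abel) h
  · change χ.eval (N.apply (J.sharpSection ψ)) + ψ.eval (N.apply (J.sharpSection χ)) = 0
    rw [← hJ χ, ← hJ ψ, Θ.d_skew (J.sharpSection ψ), hsymm, add_neg_cancel]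
  · set A := J.sharpSection ψ with hA
    set C := J.sharpSection χ with hC
    have hψ : ∀ Y, ψ.eval Y = Θ.d A Y := fun Y => (hJ ψ Y).symm
    have hχ : ∀ Y, χ.eval Y = Θ.d C Y := fun Y => (hJ χ Y).symm
    have h1 : J.val (N.transpose ψ) χ = Θ.d C (N.apply A) := by
      change χ.eval (J.sharpSection (N.transpose ψ)) = _
      rw [hχ, Θ.d_skew, hJ, hNe, hψ, ← hsymm, ← Θ.d_skew]
    have h2 : J.val ψ χ = Θ.d C A := hχ A
    have c1 := (N.transpose Θ).d_closed A C Ξ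
    have c2 := Θ.d_closed A C (N.apply Ξ)
    have e1 : Θ.d C (N.apply (Ξ.bracket A)) = -Θ.d C (N.apply (A.bracket Ξ)) := by
      rw [← hχ, ← hχ]
      exact (N.transpose χ).eval_bracket_skew Ξ A
    have e2 : Θ.d C ((N.apply Ξ).bracket A) = -Θ.d C (A.bracket (N.apply Ξ)) := by
      rw [← hχ, ← hχ, χ.eval_bracket_skew]
    rw [hd, hd, hd, hd, hd, hd, hsymm C, Θ.d_skew (N.apply Ξ) A, Θ.d_skew (N.apply A) C,
      hsymm (A.bracket C), Θ.d_skew (N.apply (C.bracket Ξ)), Θ.d_skew (N.apply (Ξ.bracket A)), e1,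
      GaugeSection.act_neg, GaugeSection.act_neg] at c1
    rw [Θ.d_skew (N.apply Ξ) A, Θ.d_skew A C, Θ.d_skew (C.bracket _), 
      Θ.d_skew ((N.apply Ξ).bracket A), e2, GaugeSection.act_neg, GaugeSection.act_neg] at c2
    unfold Biderivation.jetBracket JetSection.lie
    simp only [hNe, h1, h2, hψ, hχ]
    linear_combination (norm := abel) c1 - c2

end Differential

section Inverse

variable [FiniteDimensional ℂ E] [T2Space B]

instance finiteDimensional_gauge (x : 𝓛.RProj) : FiniteDimensional ℝ (𝓛.Gauge x) := by
  obtain ⟨ε, rfl⟩ := exists_toProj_eq x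
  have : FiniteDimensional ℝ E := FiniteDimensional.complexToReal E
  exact Module.Finite.equiv (liftEquiv ε).symm

theorem finrank_gauge (x : 𝓛.RProj) :
    Module.finrank ℝ (𝓛.Gauge x) = Module.finrank ℝ (E × ℂ) := by
  obtain ⟨ε, rfl⟩ := exists_toProj_eq x
  exact (liftEquiv ε).finrank_eq

omit [FiniteDimensional ℂ E] [T2Space B] [IsManifold 𝓘(ℂ, E) ω B] in
theorem finrank_hatFiber (x : 𝓛.RProj) : Module.finrank ℝ (𝓛.HatFiber x) = 1 := by
  rw [← 𝓛.toProj_rep x, (𝓛.pairEquiv (𝓛.rep x)).finrank_eq, Module.finrank_self]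

omit [FiniteDimensional ℂ E] [T2Space B] [IsManifold 𝓘(ℂ, E) ω B] in
instance finiteDimensional_hatFiber (x : 𝓛.RProj) : FiniteDimensional ℝ (𝓛.HatFiber x) :=
  Module.finite_of_finrank_pos (by rw [finrank_hatFiber]; exact one_pos)

omit [IsManifold 𝓘(ℂ, E) ω B] [FiniteDimensional ℂ E] [T2Space B] in
theorem homogenize_finset_sum {ι : Type*} (t : Finset ι) {ε : 𝓛.Slit}
    (f : ι → 𝓛.HatFiber (𝓛.toProj ε)) : 𝓛.pairing ε (∑ i ∈ t, f i) = ∑ i ∈ t, 𝓛.pairing ε (f i) :=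
  map_sum (𝓛.pairing ε) f t

/-- The inverse of a smooth non-degenerate two-form on the gauge algebroid is a smooth
biderivation. -/
theorem exists_biderivation (w : ∀ x, 𝓛.Gauge x →ₗ[ℝ] 𝓛.Gauge x →ₗ[ℝ] 𝓛.HatFiber x)
    (hskew : ∀ x Δ Ξ, w x Δ Ξ = -w x Ξ Δ) (hnd : ∀ x Δ, (∀ Ξ, w x Δ Ξ = 0) → Δ = 0)
    (hsm : ∀ Δ Ξ : 𝓛.GaugeSection, (fun x => w x (Δ.toFun x) (Ξ.toFun x)) ∈ 𝓛.Sections) :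
    ∃ J : 𝓛.Biderivation, ∀ x (ψ : 𝓛.Jet x) Ξ, w x (J.sharp x ψ) Ξ = ψ Ξ := by
  have hinj : ∀ x, Function.Injective (w x) := by
    intro x
    rw [injective_iff_map_eq_zero]
    exact fun Δ h => hnd x Δ fun Ξ => by rw [h]; rfl
  have hfin : ∀ x, Module.finrank ℝ (𝓛.Gauge x) = Module.finrank ℝ (𝓛.Jet x) := by
    intro x
    rw [Module.finrank_linearMap, finrank_hatFiber, mul_one]
  let e : ∀ x, 𝓛.Gauge x ≃ₗ[ℝ] 𝓛.Jet x := fun x =>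
    haveI : FiniteDimensional ℝ (𝓛.Jet x) := Module.Finite.linearMap ℝ ℝ (𝓛.Gauge x) (𝓛.HatFiber x)
    LinearEquiv.ofInjectiveOfFinrankEq (w x) (hinj x) (hfin x)
  have he : ∀ x ψ, w x ((e x).symm ψ) = ψ := fun x ψ => (e x).apply_symm_apply ψ
  refine ⟨⟨fun x => (e x).symm, fun x ψ χ => ?_, fun ψ s => ?_⟩, fun x ψ Ξ => by
    change w x ((e x).symm ψ) Ξ = ψ Ξ
    rw [he]⟩
  · change χ ((e x).symm ψ) = -ψ ((e x).symm χ)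
    conv_lhs => rw [← he x χ]
    conv_rhs => rw [← he x ψ]
    exact hskew x _ _
  · change ContMDiff 𝓘(ℝ, E × ℂ) 𝓘(ℝ, ℝ) ∞ (𝓛.homogenize _)
    intro ε₀
    have : FiniteDimensional ℝ E := FiniteDimensional.complexToReal E
    let b := Module.finBasis ℝ (E × ℂ)
    choose D hD using fun i => exists_gaugeSection_field ε₀ (b i)
    let W : 𝓛.Slit → Matrix _ _ ℝ := fun ε => Matrix.of fun i j =>
      𝓛.pairing ε (w _ ((D j).toFun _) ((D i).toFun _))
    let y : 𝓛.Slit → _ → ℝ := fun ε i => 𝓛.pairing ε (ψ.toFun _ ((D i).toFun _))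
    have hWs : ∀ i j, ContMDiff 𝓘(ℝ, E × ℂ) 𝓘(ℝ, ℝ) ∞ (fun ε => W ε i j) := fun i j =>
      hsm (D j) (D i)
    have hys : ∀ i, ContMDiff 𝓘(ℝ, E × ℂ) 𝓘(ℝ, ℝ) ∞ (fun ε => y ε i) := fun i => ψ.smooth (D i)
    have hdet : ∀ A : 𝓛.Slit → Matrix (Fin (Module.finrank ℝ (E × ℂ))) (Fin (Module.finrank ℝ (E × ℂ))) ℝ,
        (∀ i j, ContMDiff 𝓘(ℝ, E × ℂ) 𝓘(ℝ, ℝ) ∞ (fun ε => A ε i j)) →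
        ContMDiff 𝓘(ℝ, E × ℂ) 𝓘(ℝ, ℝ) ∞ (fun ε => (A ε).det) := by
      intro A hA
      simp only [Matrix.det_apply']
      refine contMDiff_finsetSum fun σ _ => contMDiff_const.mul (contMDiff_finsetProd fun i _ => hA _ _)
    have hW := hdet W hWs
    have hcr : ∀ j, ContMDiff 𝓘(ℝ, E × ℂ) 𝓘(ℝ, ℝ) ∞ (fun ε => (W ε).cramer (y ε) j) := by
      intro j
      simp only [Matrix.cramer_apply]
      refine hdet _ fun i k => ?_
      by_cases hk : k = j
      · subst hk
        simpa using hys i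
      · simpa [Matrix.updateCol_ne hk] using hWs i k
    have hWmul : ∀ ε (g : Fin (Module.finrank ℝ (E × ℂ)) → ℝ) i, (W ε).mulVec g i =
        𝓛.pairing ε (w _ (∑ j, g j • (D j).toFun _) ((D i).toFun _)) := by
      intro ε g i
      rw [map_sum, LinearMap.sum_apply, homogenize_finset_sum]
      change ∑ j, W ε i j * g j = _
      refine Finset.sum_congr rfl fun j _ => ?_
      rw [map_smul, LinearMap.smul_apply, map_smul, smul_eq_mul, mul_comm]
      rfl
    have hspan : ∀ ε, LinearIndependent ℝ (fun j => (D j).toFun (𝓛.toProj ε)) →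
        ∀ Δ : 𝓛.Gauge (𝓛.toProj ε), (∀ i, w _ Δ ((D i).toFun _) = 0) → Δ = 0 := by
      intro ε hli Δ hΔ
      have htop := hli.span_eq_top_of_card_eq_finrank' (by rw [finrank_gauge, Fintype.card_fin])
      refine hnd _ Δ fun Ξ => ?_
      have hΞ : Ξ ∈ Submodule.span ℝ (Set.range fun j => (D j).toFun (𝓛.toProj ε)) := by
        rw [htop]
        trivial
      induction hΞ using Submodule.span_induction with
      | mem x hx =>
        obtain ⟨i, rfl⟩ := hx
        exact hΔ i
      | zero => rw [map_zero]
      | add x y _ _ hx hy => rw [map_add, hx, hy, add_zero]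
      | smul a x _ hx => rw [map_smul, hx, smul_zero]
    have hdet0 : (W ε₀).det ≠ 0 := by
      rw [Ne, ← Matrix.exists_mulVec_eq_zero_iff]
      push Not
      intro g hg h0
      have hli : LinearIndependent ℝ (fun j => (D j).toFun (𝓛.toProj ε₀)) := by
        have h1 : (fun j => (D j).toFun (𝓛.toProj ε₀)) = fun j => (liftEquiv ε₀).symm (b j) := by
          funext j
          rw [LinearEquiv.eq_symm_apply]
          exact hD j
        rw [h1]
        exact b.linearIndependent.map' (liftEquiv ε₀).symm.toLinearMap (LinearEquiv.ker _)
      have h2 := hspan ε₀ hli (∑ j, g j • (D j).toFun _) fun i => pairing_injective ε₀ (by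
        rw [← hWmul, h0, map_zero]
        rfl)
      exact hg (funext fun j => Fintype.linearIndependent_iff.1 hli g h2 j)
    have hev : ∀ᶠ ε in 𝓝 ε₀, (W ε).det ≠ 0 := hW.continuous.continuousAt.eventually_ne hdet0
    have hsum : ContMDiffAt 𝓘(ℝ, E × ℂ) 𝓘(ℝ, ℝ) ∞ (fun ε => ∑ j,
        ((W ε).cramer (y ε) j / (W ε).det) * 𝓛.homogenize ((D j).act s).1 ε) ε₀ :=
      contMDiffAt_finsetSum fun j _ => ((hcr j ε₀).div₀ (hW ε₀) hdet0).mul (((D j).act s).2 ε₀)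
    refine hsum.congr_of_eventuallyEq ?_
    filter_upwards [hev] with ε hε
    set g : Fin (Module.finrank ℝ (E × ℂ)) → ℝ := fun j => (W ε).cramer (y ε) j / (W ε).det with hg
    have hgW : (W ε).mulVec g = y ε := by
      have h1 : g = (W ε).det⁻¹ • (W ε).cramer (y ε) := by
        funext j
        simp [hg, div_eq_inv_mul]
      rw [h1, Matrix.mulVec_smul, Matrix.mulVec_cramer, smul_smul, inv_mul_cancel₀ hε, one_smul]
    have hli : LinearIndependent ℝ (fun j => (D j).toFun (𝓛.toProj ε)) := by
      rw [Fintype.linearIndependent_iff]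
      intro h h0 j
      have h1 : (W ε).mulVec h = 0 := by
        funext i
        rw [hWmul, h0, map_zero, LinearMap.zero_apply, map_zero]
        rfl
      exact congrFun (Matrix.eq_zero_of_mulVec_eq_zero hε h1) j
    have hkey : (e _).symm (ψ.toFun (𝓛.toProj ε)) = ∑ j, g j • (D j).toFun (𝓛.toProj ε) := by
      rw [← sub_eq_zero]
      refine hspan ε hli _ fun i => ?_
      rw [map_sub, LinearMap.sub_apply, he, sub_eq_zero]
      apply pairing_injective ε
      rw [← hWmul, hgW]
    change 𝓛.pairing ε (((e _).symm (ψ.toFun (𝓛.toProj ε))).1 s) = _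
    rw [hkey]
    have h2 : (∑ j, g j • (D j).toFun (𝓛.toProj ε)).1 s =
        ∑ j, g j • ((D j).toFun (𝓛.toProj ε)).1 s := by
      rw [Submodule.coe_sum, LinearMap.sum_apply]
      rfl
    rw [h2, homogenize_finset_sum]
    refine Finset.sum_congr rfl fun j _ => ?_
    rw [map_smul, smul_eq_mul]
    rfl

end Inverse

end HolLineBundle
end

noncomputable section

section ChartForms

variable {𝕜 : Type*} [NontriviallyNormedField 𝕜]
  {D : Type*} [NormedAddCommGroup D] [NormedSpace 𝕜 D] {M : Type*} [TopologicalSpace M]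
  [ChartedSpace D M] [IsManifold 𝓘(𝕜, D) 1 M]

theorem continuousLinearMapAt_eq_chartDeriv {x₀ x : M} (hx : x ∈ (chartAt D x₀).source) :
    ((trivializationAt D (TangentSpace 𝓘(𝕜, D)) x₀).continuousLinearMapAt 𝕜 x : D →L[𝕜] D) =
      (chartDeriv 𝕜 x₀ x : D →L[𝕜] D) :=
  TangentBundle.continuousLinearMapAt_trivializationAt hx

/-- A one-form at a point, as a form on the model space. -/
def formAt (α : ∀ x : M, TangentSpace 𝓘(𝕜, D) x →L[𝕜] 𝕜) (x : M) : D →L[𝕜] 𝕜 := α x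

/-- A vector field, as a map to the model space. -/
def fieldMap (𝕜 : Type*) [NontriviallyNormedField 𝕜] [NormedSpace 𝕜 D]
    (X : ∀ x : M, TangentSpace 𝓘(𝕜, D) x) (x : M) : D := X x

/-- The inverse of the derivative of the preferred chart at `x₀`. -/
def chartDerivInv (𝕜 : Type*) [NontriviallyNormedField 𝕜] [NormedSpace 𝕜 D]
    [IsManifold 𝓘(𝕜, D) 1 M] (x₀ x : M) : D →L[𝕜] D :=
  (trivializationAt D (TangentSpace 𝓘(𝕜, D)) x₀).symmL 𝕜 x

theorem chartDeriv_chartDerivInv {x₀ x : M} (hx : x ∈ (chartAt D x₀).source) (v : D) :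
    chartDeriv 𝕜 x₀ x (chartDerivInv 𝕜 x₀ x v) = v := by
  rw [← continuousLinearMapAt_eq_chartDeriv hx]
  exact (trivializationAt D (TangentSpace 𝓘(𝕜, D)) x₀).continuousLinearMapAt_symmL (R := 𝕜)
    (by simpa using hx) v

theorem chartDerivInv_chartDeriv {x₀ x : M} (hx : x ∈ (chartAt D x₀).source) (v : D) :
    chartDerivInv 𝕜 x₀ x (chartDeriv 𝕜 x₀ x v) = v := by
  rw [← continuousLinearMapAt_eq_chartDeriv hx]
  exact (trivializationAt D (TangentSpace 𝓘(𝕜, D)) x₀).symmL_continuousLinearMapAt (R := 𝕜)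
    (by simpa using hx) v

variable {n : WithTop ℕ∞}

theorem contMDiffAt_form_iff {α : ∀ x : M, TangentSpace 𝓘(𝕜, D) x →L[𝕜] 𝕜} {x₀ : M} :
    ContMDiffAt 𝓘(𝕜, D) (𝓘(𝕜, D).prod 𝓘(𝕜, D →L[𝕜] 𝕜)) n
      (fun g => Bundle.TotalSpace.mk' (D →L[𝕜] 𝕜)
      (E := fun g : M => TangentSpace 𝓘(𝕜, D) g →L[𝕜] Bundle.Trivial M 𝕜 g) g (α g)) x₀ ↔
    ContMDiffAt 𝓘(𝕜, D) 𝓘(𝕜, D →L[𝕜] 𝕜) n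
      (fun x => (formAt α x).comp (chartDerivInv 𝕜 x₀ x)) x₀ := by
  rw [contMDiffAt_hom_bundle]
  have h : ∀ x, ContinuousLinearMap.inCoordinates D (TangentSpace 𝓘(𝕜, D)) 𝕜 (Bundle.Trivial M 𝕜)
      x₀ x x₀ x (α x) = (formAt α x).comp (chartDerivInv 𝕜 x₀ x) := by
    intro x
    ext v
    unfold ContinuousLinearMap.inCoordinates
    simp
    rfl
  simp only [h]
  exact ⟨fun h => h.2, fun h => ⟨contMDiffAt_id, h⟩⟩

/-- The expression of a one-form of class `C^n` in a chart. -/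
theorem exists_chartForm [IsManifold 𝓘(𝕜, D) n M] {α : ∀ x : M, TangentSpace 𝓘(𝕜, D) x →L[𝕜] 𝕜} {x₀ : M}
    (h : ContMDiffAt 𝓘(𝕜, D) (𝓘(𝕜, D).prod 𝓘(𝕜, D →L[𝕜] 𝕜)) n
      (fun g => Bundle.TotalSpace.mk' (D →L[𝕜] 𝕜)
      (E := fun g : M => TangentSpace 𝓘(𝕜, D) g →L[𝕜] Bundle.Trivial M 𝕜 g) g (α g)) x₀) :
    ∃ a : D → D →L[𝕜] 𝕜, ContDiffAt 𝕜 n a (chartAt D x₀ x₀) ∧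
      ∀ x ∈ (chartAt D x₀).source, ∀ v, a (chartAt D x₀ x) (chartDeriv 𝕜 x₀ x v) =
        formAt α x v := by
  rw [contMDiffAt_form_iff] at h
  set c := chartAt D x₀ with hc
  refine ⟨fun p => (formAt α (c.symm p)).comp (chartDerivInv 𝕜 x₀ (c.symm p)),
    ContMDiffAt.contDiffAt_comp_symm (f := fun x => (formAt α x).comp (chartDerivInv 𝕜 x₀ x)) (mem_chart_target D x₀) ?_, fun x hx v => ?_⟩
  · rwa [c.left_inv (mem_chart_source D x₀)]
  · simp only [ContinuousLinearMap.comp_apply]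
    rw [c.left_inv hx, chartDerivInv_chartDeriv hx]

theorem contMDiffAt_form [IsManifold 𝓘(𝕜, D) n M] {α : ∀ x : M, TangentSpace 𝓘(𝕜, D) x →L[𝕜] 𝕜} {x₀ : M}
    {a : D → D →L[𝕜] 𝕜} (ha : ContDiffAt 𝕜 n a (chartAt D x₀ x₀))
    (h : ∀ᶠ x in 𝓝 x₀, ∀ v, a (chartAt D x₀ x) (chartDeriv 𝕜 x₀ x v) =
        formAt α x v) :
    ContMDiffAt 𝓘(𝕜, D) (𝓘(𝕜, D).prod 𝓘(𝕜, D →L[𝕜] 𝕜)) n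
      (fun g => Bundle.TotalSpace.mk' (D →L[𝕜] 𝕜)
      (E := fun g : M => TangentSpace 𝓘(𝕜, D) g →L[𝕜] Bundle.Trivial M 𝕜 g) g (α g)) x₀ := by
  rw [contMDiffAt_form_iff]
  refine (ha.contMDiffAt.comp x₀ (contMDiffAt_chartAt_of_mem
    (mem_chart_source D x₀))).congr_of_eventuallyEq ?_
  filter_upwards [h, (chartAt D x₀).open_source.mem_nhds (mem_chart_source D x₀)] with x hx hxs
  ext v
  rw [ContinuousLinearMap.comp_apply, ← hx]
  simp only [Function.comp_apply]
  rw [chartDeriv_chartDerivInv hxs]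

/-- Extension of a local vector field given in a chart. -/
theorem contMDiffAt_extend [IsManifold 𝓘(𝕜, D) n M] {x₀ : M} {Y : D → D}
    [IsManifold 𝓘(𝕜, D) (n + 1) M] (hY : ContDiffAt 𝕜 n Y (chartAt D x₀ x₀)) :
    ContMDiffAt 𝓘(𝕜, D) 𝓘(𝕜, D).tangent n
        (fun x => (⟨x, (chartDerivInv 𝕜 x₀ x (Y (chartAt D x₀ x)) : D)⟩ : TangentBundle 𝓘(𝕜, D) M)) x₀ := by
  have h := (Bundle.contMDiffAt_section (F := D) (E := TangentSpace 𝓘(𝕜, D)) (IB := 𝓘(𝕜, D)) (n := n)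
    (s := fun x : M => (chartDerivInv 𝕜 x₀ x (Y (chartAt D x₀ x)) : D)) x₀).2
  refine h ?_
  refine (hY.contMDiffAt.comp x₀ (contMDiffAt_chartAt_of_mem
    (mem_chart_source D x₀))).congr_of_eventuallyEq ?_
  filter_upwards [(chartAt D x₀).open_source.mem_nhds (mem_chart_source D x₀)] with x hx
  have h1 := chartDeriv_chartDerivInv (𝕜 := 𝕜) hx (Y (chartAt D x₀ x))
  rw [← continuousLinearMapAt_eq_chartDeriv hx] at h1
  refine Eq.trans ?_ h1
  exact ((trivializationAt D (TangentSpace 𝓘(𝕜, D)) x₀).continuousLinearMapAt_apply_of_mem 𝕜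
    (by simpa using hx) _).symm

section Bracket

variable [IsManifold 𝓘(𝕜, D) 2 M] [CompleteSpace D]

omit [IsManifold 𝓘(𝕜, D) 2 M] [CompleteSpace D] in
theorem mpullback_eq_chartField (X : ∀ x : M, TangentSpace 𝓘(𝕜, D) x) (x₀ : M) :
    VectorField.mpullbackWithin 𝓘(𝕜, D) 𝓘(𝕜, D) (extChartAt 𝓘(𝕜, D) x₀).symm X (range 𝓘(𝕜, D))
      =ᶠ[𝓝 (chartAt D x₀ x₀)] chartField 𝕜 x₀ (fieldMap 𝕜 X) := by
  filter_upwards [eventually_mem_chartAt_target (mem_chart_target D x₀)] with p hp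
  rw [VectorField.mpullbackWithin_apply]
  have hp' : p ∈ (extChartAt 𝓘(𝕜, D) x₀).target := by simpa using hp
  rw [ContinuousLinearMap.inverse_eq (mfderivWithin_extChartAt_symm_comp_mfderiv_extChartAt hp')
    (mfderiv_extChartAt_comp_mfderivWithin_extChartAt_symm hp')]
  rfl

omit [IsManifold 𝓘(𝕜, D) 2 M] [CompleteSpace D] in
theorem mlieBracket_eq_lieBracket (X Y : ∀ x : M, TangentSpace 𝓘(𝕜, D) x) (x : M) :
    VectorField.mlieBracket 𝓘(𝕜, D) X Y x =
      VectorField.lieBracket 𝕜 (chartField 𝕜 x (fieldMap 𝕜 X)) (chartField 𝕜 x (fieldMap 𝕜 Y)) (chartAt D x x) := by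
  rw [VectorField.mlieBracket, VectorField.mlieBracketWithin_apply]
  have h1 : (mfderiv 𝓘(𝕜, D) 𝓘(𝕜, D) (extChartAt 𝓘(𝕜, D) x) x).inverse = ContinuousLinearMap.id 𝕜 D := by
    rw [mfderiv_extChartAt_self]
    exact ContinuousLinearMap.inverse_id
  rw [h1]
  simp only [preimage_univ, ModelWithCorners.range_eq_univ, inter_univ]
  have h2 := mpullback_eq_chartField X x
  have h3 := mpullback_eq_chartField Y x
  simp only [ModelWithCorners.range_eq_univ] at h2 h3
  refine Eq.trans ?_ <| Filter.EventuallyEq.lieBracket_vectorField_eq (𝕜 := 𝕜) (V₁ := fieldMap 𝕜 (VectorField.mpullbackWithin 𝓘(𝕜, D) 𝓘(𝕜, D) (extChartAt 𝓘(𝕜, D) x).symm X univ)) (W₁ := fieldMap 𝕜 (VectorField.mpullbackWithin 𝓘(𝕜, D) 𝓘(𝕜, D) (extChartAt 𝓘(𝕜, D) x).symm Y univ)) h2 h3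
  rw [← VectorField.lieBracketWithin_univ]
  rfl

theorem differentiableAt_chartField {X : ∀ x : M, TangentSpace 𝓘(𝕜, D) x} {x : M} (hn : n ≠ 0)
    (hX : ContMDiffAt 𝓘(𝕜, D) 𝓘(𝕜, D).tangent n
        (fun g => (⟨g, X g⟩ : TangentBundle 𝓘(𝕜, D) M)) x) :
    DifferentiableAt 𝕜 (chartField 𝕜 x (fieldMap 𝕜 X)) (chartAt D x x) := by
  have h1 : MDifferentiableWithinAt 𝓘(𝕜, D) 𝓘(𝕜, D).tangent
    (fun g => (⟨g, X g⟩ : TangentBundle 𝓘(𝕜, D) M)) univ x :=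
    (hX.mdifferentiableAt hn).mdifferentiableWithinAt
  have h2 := h1.differentiableWithinAt_mpullbackWithin_vectorField
  simp only [preimage_univ, ModelWithCorners.range_eq_univ, inter_univ] at h2
  replace h2 := differentiableWithinAt_univ.1 h2
  have h3 := mpullback_eq_chartField X x
  simp only [ModelWithCorners.range_eq_univ] at h3
  exact h2.congr_of_eventuallyEq h3.symm

/-- `α [X, Y] = - dα (X, Y)` for vector fields annihilated by `α`. -/
theorem form_mlieBracket {α : ∀ x : M, TangentSpace 𝓘(𝕜, D) x →L[𝕜] 𝕜} {x : M}
    {a : D → D →L[𝕜] 𝕜} (hd : DifferentiableAt 𝕜 a (chartAt D x x))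
    (h : ∀ᶠ y in 𝓝 x, ∀ v, a (chartAt D x y) (chartDeriv 𝕜 x y v) =
        formAt α y v)
    {X Y : ∀ x : M, TangentSpace 𝓘(𝕜, D) x} (hn : n ≠ 0)
    (hX : ContMDiffAt 𝓘(𝕜, D) 𝓘(𝕜, D).tangent n
        (fun g => (⟨g, X g⟩ : TangentBundle 𝓘(𝕜, D) M)) x)
    (hY : ContMDiffAt 𝓘(𝕜, D) 𝓘(𝕜, D).tangent n
        (fun g => (⟨g, Y g⟩ : TangentBundle 𝓘(𝕜, D) M)) x)
    (hX0 : ∀ᶠ y in 𝓝 x, α y (X y) = 0) (hY0 : ∀ᶠ y in 𝓝 x, α y (Y y) = 0) :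
    α x (VectorField.mlieBracket 𝓘(𝕜, D) X Y x) =
      fderiv 𝕜 a (chartAt D x x) (Y x) (X x) - fderiv 𝕜 a (chartAt D x x) (X x) (Y x) := by
  set c := chartAt D x with hc
  have hx : α x (VectorField.mlieBracket 𝓘(𝕜, D) X Y x) =
      a (c x) (VectorField.lieBracket 𝕜 (chartField 𝕜 x (fieldMap 𝕜 X)) (chartField 𝕜 x (fieldMap 𝕜 Y)) (c x)) := by
    rw [mlieBracket_eq_lieBracket]
    refine (h.self_of_nhds _).symm.trans ?_
    rw [chartDeriv_self]
    rfl
  rw [hx]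
  have hc' : ContinuousAt c.symm (c x) := c.symm.continuousAt (mem_chart_target D x)
  have hcx : c.symm (c x) = x := c.left_inv (mem_chart_source D x)
  have key : ∀ Z : ∀ x : M, TangentSpace 𝓘(𝕜, D) x, (∀ᶠ y in 𝓝 x, α y (Z y) = 0) →
      DifferentiableAt 𝕜 (chartField 𝕜 x (fieldMap 𝕜 Z)) (c x) → ∀ v : D,
      a (c x) (fderiv 𝕜 (chartField 𝕜 x (fieldMap 𝕜 Z)) (c x) v) = - fderiv 𝕜 a (c x) v (Z x) := by
    intro Z hZ hZd v
    have h1 : (fun p => a p (chartField 𝕜 x (fieldMap 𝕜 Z) p)) =ᶠ[𝓝 (c x)] fun _ => 0 := by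
      rw [ContinuousAt, hcx] at hc'
      filter_upwards [hc'.eventually hZ, hc'.eventually h,
        eventually_mem_chartAt_target (mem_chart_target D x)] with p hp1 hp2 hp3
      have := hp2 (Z (c.symm p))
      rw [hc, (chartAt D x).right_inv hp3] at this
      exact this.trans hp1
    have h2 := hd.hasFDerivAt.clm_apply hZd.hasFDerivAt
    have h3 := congrArg (fun l => l v) (h2.unique ((hasFDerivAt_const (0 : 𝕜) (c x)).congr_of_eventuallyEq h1))
    simp only [add_apply, ContinuousLinearMap.comp_apply,
      ContinuousLinearMap.flip_apply, zero_apply] at h3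
    rw [hc, chartField_self] at h3
    exact eq_neg_of_add_eq_zero_left h3
  have hXd := differentiableAt_chartField hn hX
  have hYd := differentiableAt_chartField hn hY
  rw [VectorField.lieBracket, map_sub, key Y hY0 hYd, key X hX0 hXd, hc, chartField_self,
    chartField_self]
  change -(fderiv 𝕜 a _ (X x)) (Y x) - -(fderiv 𝕜 a _ (Y x)) (X x) = _
  rw [sub_neg_eq_add, neg_add_eq_sub]

/-- A local criterion for the non-degeneracy of the curvature. -/
theorem eq_zero_of_isContact {H : ∀ x : M, Submodule 𝕜 (TangentSpace 𝓘(𝕜, D) x)}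
    (hn : n ≠ 0) (hH : IsContact n H) {α : ∀ x : M, TangentSpace 𝓘(𝕜, D) x →L[𝕜] 𝕜} {U : Set M}
    (hα : IsDefiningForm n H U α) {x : M} (hx : x ∈ U) {a : D → D →L[𝕜] 𝕜}
    (hd : DifferentiableAt 𝕜 a (chartAt D x x))
    (h : ∀ᶠ y in 𝓝 x, ∀ v, a (chartAt D x y) (chartDeriv 𝕜 x y v) =
        formAt α y v) {u : D} (hu : a (chartAt D x x) u = 0)
    (hu' : ∀ w, a (chartAt D x x) w = 0 → fderiv 𝕜 a (chartAt D x x) u w =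
      fderiv 𝕜 a (chartAt D x x) w u) : u = 0 := by
  have hax : ∀ v : D, a (chartAt D x x) v = α x v := by
    intro v
    refine Eq.trans ?_ (h.self_of_nhds v)
    rw [chartDeriv_self]
    rfl
  have hU : ∀ᶠ y in 𝓝 x, y ∈ U := hα.isOpen.mem_nhds hx
  refine hH.nondegenerate x u ((hα.mem_iff x hx u).2 ((hax u).symm.trans hu)) ?_
  intro X Y hX hY hXY hXx
  have hX0 : ∀ᶠ y in 𝓝 x, α y (X y) = 0 := by
    filter_upwards [hXY, hU] with y hy hyU
    exact (hα.mem_iff y hyU _).1 hy.1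
  have hY0 : ∀ᶠ y in 𝓝 x, α y (Y y) = 0 := by
    filter_upwards [hXY, hU] with y hy hyU
    exact (hα.mem_iff y hyU _).1 hy.2
  rw [hα.mem_iff x hx, form_mlieBracket hd h hn hX hY hX0 hY0, hXx, sub_eq_zero]
  exact (hu' _ ((hax _).trans hY0.self_of_nhds)).symm

theorem isContact_of_chartForm [IsManifold 𝓘(𝕜, D) n M] [IsManifold 𝓘(𝕜, D) (n + 1) M]
    {H : ∀ x : M, Submodule 𝕜 (TangentSpace 𝓘(𝕜, D) x)} (hn : n ≠ 0)
    (hH : ∀ x, ∃ (U : Set M) (α : ∀ x : M, TangentSpace 𝓘(𝕜, D) x →L[𝕜] 𝕜) (a : D → D →L[𝕜] 𝕜),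
      x ∈ U ∧ IsDefiningForm n H U α ∧ ContDiffAt 𝕜 n a (chartAt D x x) ∧
      (∀ᶠ y in 𝓝 x, ∀ v, a (chartAt D x y) (chartDeriv 𝕜 x y v) =
        formAt α y v) ∧
      ∀ u, a (chartAt D x x) u = 0 → (∀ w, a (chartAt D x x) w = 0 →
        fderiv 𝕜 a (chartAt D x x) u w = fderiv 𝕜 a (chartAt D x x) w u) → u = 0) :
    IsContact n H := by
  refine ⟨fun x => ?_, fun x v hv hXY => ?_⟩
  · obtain ⟨U, α, a, hx, hα, -⟩ := hH x
    exact ⟨U, α, hx, hα⟩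
  obtain ⟨U, α, a, hx, hα, ha, h, hnd⟩ := hH x
  have hax : ∀ v : D, a (chartAt D x x) v = α x v := by
    intro v
    refine Eq.trans ?_ (h.self_of_nhds v)
    rw [chartDeriv_self]
    rfl
  obtain ⟨e, he⟩ : ∃ e, a (chartAt D x x) e ≠ 0 := by
    by_contra! h0
    exact hα.ne_zero x hx (ContinuousLinearMap.ext fun v => (hax v).symm.trans (h0 v))
  have hU : ∀ᶠ y in 𝓝 x, y ∈ U := hα.isOpen.mem_nhds hx
  have hs : ∀ᶠ y in 𝓝 x, y ∈ (chartAt D x).source :=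
    (chartAt D x).open_source.mem_nhds (mem_chart_source D x)
  have hne : ∀ᶠ y in 𝓝 x, a (chartAt D x y) e ≠ 0 := by
    have h1 : ContinuousAt (fun p => a p e) (chartAt D x x) :=
      (ha.continuousAt.clm_apply continuousAt_const)
    exact ((chartAt D x).continuousAt (mem_chart_source D x)).eventually (h1.eventually_ne he)
  have key : ∀ u : D, a (chartAt D x x) u = 0 → ∃ X : ∀ x : M, TangentSpace 𝓘(𝕜, D) x,
      ContMDiffAt 𝓘(𝕜, D) 𝓘(𝕜, D).tangent n
        (fun g => (⟨g, X g⟩ : TangentBundle 𝓘(𝕜, D) M)) x ∧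
      (∀ᶠ y in 𝓝 x, X y ∈ H y) ∧ X x = u := by
    intro u hu
    let Z : D → D := fun p => u - (a p u / a p e) • e
    have hZ : ContDiffAt 𝕜 n Z (chartAt D x x) :=
      contDiffAt_const.sub (((ha.clm_apply contDiffAt_const).div
        (ha.clm_apply contDiffAt_const) he).smul contDiffAt_const)
    refine ⟨fun y => (chartDerivInv 𝕜 x y (Z (chartAt D x y)) : D), contMDiffAt_extend hZ, ?_, ?_⟩
    · filter_upwards [h, hU, hs, hne] with y hy hyU hys hye
      refine (hα.mem_iff y hyU _).2 ((hy _).symm.trans ?_)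
      rw [chartDeriv_chartDerivInv hys]
      change a (chartAt D x y) (u - (a (chartAt D x y) u / a (chartAt D x y) e) • e) = 0
      rw [map_sub, map_smul, smul_eq_mul, div_mul_cancel₀ _ hye, sub_self]
    · have h1 : Z (chartAt D x x) = u := by
        change u - (a (chartAt D x x) u / a (chartAt D x x) e) • e = u
        rw [hu, zero_div, zero_smul, sub_zero]
      have h2 := chartDeriv_chartDerivInv (𝕜 := 𝕜) (mem_chart_source D x) u
      rw [chartDeriv_self] at h2
      exact (congrArg (chartDerivInv 𝕜 x x) h1).trans h2
  have hv' : a (chartAt D x x) v = 0 := (hax v).trans ((hα.mem_iff x hx v).1 hv)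
  refine hnd v hv' fun w hw => ?_
  obtain ⟨X, hX, hXH, hXx⟩ := key v hv'
  obtain ⟨Y, hY, hYH, hYx⟩ := key w hw
  have h1 := hXY X Y hX hY (hXH.and hYH) hXx
  have hX0 : ∀ᶠ y in 𝓝 x, α y (X y) = 0 := by
    filter_upwards [hXH, hU] with y hy hyU
    exact (hα.mem_iff y hyU _).1 hy
  have hY0 : ∀ᶠ y in 𝓝 x, α y (Y y) = 0 := by
    filter_upwards [hYH, hU] with y hy hyU
    exact (hα.mem_iff y hyU _).1 hy
  rw [hα.mem_iff x hx, form_mlieBracket (ha.differentiableAt hn) h hn hX hY hX0 hY0, sub_eq_zero,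
    hXx, hYx] at h1
  exact h1.symm

end Bracket

end ChartForms

end

noncomputable section

namespace HolLineBundle

variable {E : Type*} [NormedAddCommGroup E] [NormedSpace ℂ E]
  {B : Type*} [TopologicalSpace B] [ChartedSpace E B]
  {V : B → Type*} [∀ b, AddCommGroup (V b)] [∀ b, Module ℂ (V b)]
  {𝓛 : HolLineBundle E V}
  [IsManifold 𝓘(ℂ, E) ω B]

attribute [local instance] isManifold_complexToReal

variable [FiniteDimensional ℂ E] [T2Space B]

/-- The differential of a section of the jet bundle which is, in a chart, the real part of a
holomorphic one-form. -/
theorem JetSection.homogenize_d {Θ : 𝓛.JetSection} {ε : 𝓛.Slit} {T : E × ℂ → E × ℂ →L[ℂ] ℂ}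
    (hT : DifferentiableAt ℂ T (chartAt (E × ℂ) ε ε))
    (h : ∀ Δ : 𝓛.GaugeSection, ∀ᶠ z in 𝓝 ε, 𝓛.homogenize (Θ.eval Δ).1 z =
      (T (chartAt (E × ℂ) ε z) (chartField ℝ ε Δ.field (chartAt (E × ℂ) ε z))).re)
    (Δ Ξ : 𝓛.GaugeSection) :
    𝓛.homogenize (Θ.d Δ Ξ).1 ε =
      (fderiv ℂ T (chartAt (E × ℂ) ε ε) (Δ.field ε) (Ξ.field ε) -
        fderiv ℂ T (chartAt (E × ℂ) ε ε) (Ξ.field ε) (Δ.field ε)).re := by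
  have : IsManifold 𝓘(ℝ, E × ℂ) 1 𝓛.Slit := IsManifold.of_le (n := ∞) (by simp)
  set p := chartAt (E × ℂ) ε ε with hp
  have hTR := (hT.hasFDerivAt.restrictScalars ℝ)
  have hfield : ∀ Δ : 𝓛.GaugeSection, chartField ℝ ε Δ.field p = Δ.field ε := fun Δ =>
    chartField_self ε Δ.field
  have key : ∀ Δ Ξ : 𝓛.GaugeSection, 𝓛.homogenize (Δ.act (Θ.eval Ξ)).1 ε =
      (fderiv ℂ T p (Δ.field ε) (Ξ.field ε) +
        T p (fderiv ℝ (chartField ℝ ε Ξ.field) p (Δ.field ε))).re := by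
    intro Δ Ξ
    have hc := ((contDiffAt_chartField Ξ (mem_chart_target (E × ℂ) ε)).differentiableAt
      (by simp)).hasFDerivAt
    have h0 : HasFDerivAt (fun q => (T q).restrictScalars ℝ)
        ((ContinuousLinearMap.restrictScalarsL ℂ (E × ℂ) ℂ ℝ ℝ).comp
          ((fderiv ℂ T p).restrictScalars ℝ)) p :=
      (ContinuousLinearMap.restrictScalarsL ℂ (E × ℂ) ℂ ℝ ℝ).hasFDerivAt.comp p hTR
    have h1 := Complex.reCLM.hasFDerivAt.comp p (h0.clm_apply hc)
    rw [homogenize_act, derivAlong_eq_of_chart (g := fun q => (T q (chartField ℝ ε Ξ.field q)).re)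
      (h Ξ) h1.differentiableAt]
    refine (congrArg (fun l => l (Δ.field ε)) h1.fderiv).trans ?_
    rw [add_comm (fderiv ℂ T p (Δ.field ε) (Ξ.field ε)), ← hfield Ξ]
    rfl
  change 𝓛.homogenize (Δ.act (Θ.eval Ξ) - Ξ.act (Θ.eval Δ) - Θ.eval (Δ.bracket Ξ) : 𝓛.Sections).1 ε
    = _
  rw [homogenize_sub, homogenize_sub, key, key, (h _).self_of_nhds, chartField_self, bracket_field,
    map_sub]
  simp only [Complex.add_re, Complex.sub_re]
  ring

/-- If the differential of `Θ` is the real part of a non-degenerate holomorphic two-form, it is the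
inverse of a Jacobi-Nijenhuis structure. -/
theorem exists_isJacobiNijenhuis {Θ : 𝓛.JetSection} {N : 𝓛.AtiyahTensor}
    (hN : 𝓛.IsGaugeComplexStructure N)
    (h : ∀ ε : 𝓛.Slit, ∃ T : E × ℂ → E × ℂ →L[ℂ] ℂ,
      DifferentiableAt ℂ T (chartAt (E × ℂ) ε ε) ∧
      (∀ Δ : 𝓛.GaugeSection, ∀ᶠ z in 𝓝 ε, 𝓛.homogenize (Θ.eval Δ).1 z =
        (T (chartAt (E × ℂ) ε z) (chartField ℝ ε Δ.field (chartAt (E × ℂ) ε z))).re) ∧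
      ∀ v, (∀ w, fderiv ℂ T (chartAt (E × ℂ) ε ε) v w = fderiv ℂ T (chartAt (E × ℂ) ε ε) w v) →
        v = 0) :
    ∃ J : 𝓛.Biderivation, (∀ ψ Ξ, Θ.d (J.sharpSection ψ) Ξ = ψ.eval Ξ) ∧
      𝓛.IsJacobiNijenhuis J N := by
  have hw : ∀ x : 𝓛.RProj, ∃ w : 𝓛.Gauge x →ₗ[ℝ] 𝓛.Gauge x →ₗ[ℝ] 𝓛.HatFiber x,
      (∀ Δ Ξ, w Δ Ξ = -w Ξ Δ) ∧ (∀ Δ, (∀ Ξ, w Δ Ξ = 0) → Δ = 0) ∧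
      ∀ Δ Ξ : 𝓛.GaugeSection, w (Δ.toFun x) (Ξ.toFun x) = (Θ.d Δ Ξ).1 x := by
    intro x
    obtain ⟨ε, rfl⟩ := exists_toProj_eq x
    obtain ⟨T, hT, hΘ, hnd⟩ := h ε
    set T' := fderiv ℂ T (chartAt (E × ℂ) ε ε) with hT'
    let b : E × ℂ →ₗ[ℝ] E × ℂ →ₗ[ℝ] ℝ := LinearMap.mk₂ ℝ (fun v w => (T' v w - T' w v).re)
      (fun u v w => by simp only [map_add, add_apply, Complex.sub_re, Complex.add_re]; ring)
      (fun r u v => by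
        have h1 : (r • u : E × ℂ) = (r : ℂ) • u := (Complex.coe_smul r u).symm
        rw [h1, map_smul, map_smul, smul_apply, ← smul_sub, smul_eq_mul, Complex.re_ofReal_mul,
          smul_eq_mul])
      (fun u v w => by simp only [map_add, add_apply, Complex.sub_re, Complex.add_re]; ring)
      (fun r u v => by
        have h1 : (r • v : E × ℂ) = (r : ℂ) • v := (Complex.coe_smul r v).symm
        rw [h1, map_smul, map_smul, smul_apply, ← smul_sub, smul_eq_mul, Complex.re_ofReal_mul,
          smul_eq_mul])
    refine ⟨(b.compl₁₂ (liftEquiv ε).toLinearMap (liftEquiv ε).toLinearMap).compr₂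
      (𝓛.pairEquiv ε).symm.toLinearMap, fun Δ Ξ => ?_, fun Δ hΔ => ?_, fun Δ Ξ => ?_⟩
    · change (𝓛.pairEquiv ε).symm (T' _ _ - T' _ _).re = -(𝓛.pairEquiv ε).symm (T' _ _ - T' _ _).re
      rw [← map_neg, ← Complex.neg_re, neg_sub]
    · apply (liftEquiv ε).injective
      rw [map_zero]
      have h0 : ∀ w : E × ℂ, (T' (liftEquiv ε Δ) w - T' w (liftEquiv ε Δ)).re = 0 := by
        intro w
        have h1 : (𝓛.pairEquiv ε).symm (T' (liftEquiv ε Δ) (liftEquiv ε ((liftEquiv ε).symm w)) -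
          T' (liftEquiv ε ((liftEquiv ε).symm w)) (liftEquiv ε Δ)).re = 0 := hΔ ((liftEquiv ε).symm w)
        rwa [LinearEquiv.apply_symm_apply, LinearEquiv.map_eq_zero_iff] at h1
      refine hnd _ fun w => sub_eq_zero.1 (Complex.ext (h0 w) ?_)
      have h1 := h0 (Complex.I • w)
      rw [map_smul, map_smul, smul_apply, ← smul_sub, smul_eq_mul, Complex.I_mul_re,
        neg_eq_zero] at h1
      exact h1
    · apply pairing_injective ε
      refine Eq.trans ?_ (JetSection.homogenize_d hT hΘ Δ Ξ).symm
      exact (𝓛.pairEquiv ε).apply_symm_apply _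
  choose w hskew hnd hd using hw
  obtain ⟨J, hJ⟩ := exists_biderivation w hskew hnd (fun Δ Ξ => by
    have h1 : (fun x => w x (Δ.toFun x) (Ξ.toFun x)) = (Θ.d Δ Ξ).1 := funext fun x => hd x Δ Ξ
    rw [h1]
    exact (Θ.d Δ Ξ).2)
  have hJ' : ∀ ψ Ξ, Θ.d (J.sharpSection ψ) Ξ = ψ.eval Ξ := fun ψ Ξ => Subtype.ext <| funext fun x =>
    (hd x _ _).symm.trans (hJ x _ _)
  have hNf : ∀ (Δ : 𝓛.GaugeSection) ε, (N.apply Δ).field ε = Complex.I • Δ.field ε := fun Δ ε =>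
    congrFun (hN.field_apply Δ) ε
  refine ⟨J, hJ', isJacobiNijenhuis_of_d hJ' hN.isNijenhuis (fun Δ Ξ => sections_ext fun ε => ?_)
    (fun Δ Ξ => sections_ext fun ε => ?_)⟩
  · obtain ⟨T, hT, hΘ, -⟩ := h ε
    rw [JetSection.homogenize_d hT hΘ, JetSection.homogenize_d hT hΘ, hNf, hNf, map_smul, map_smul,
      smul_apply, map_smul, map_smul, smul_apply]
  · obtain ⟨T, hT, hΘ, -⟩ := h ε
    have h2 : ∀ Δ : 𝓛.GaugeSection, ∀ᶠ z in 𝓝 ε, 𝓛.homogenize ((N.transpose Θ).eval Δ).1 z =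
        ((fun p => Complex.I • T p) (chartAt (E × ℂ) ε z)
          (chartField ℝ ε Δ.field (chartAt (E × ℂ) ε z))).re := by
      intro Δ
      filter_upwards [hΘ (N.apply Δ), (chartAt (E × ℂ) ε).open_source.mem_nhds
        (mem_chart_source (E × ℂ) ε)] with z hz hzs
      refine hz.trans ?_
      rw [hN.field_apply, chartField_I_smul _ _ ((chartAt (E × ℂ) ε).map_source hzs), map_smul]
      rfl
    rw [JetSection.homogenize_d (hT.const_smul Complex.I) h2, JetSection.homogenize_d hT hΘ, hNf,
      fderiv_const_smul hT, map_smul, map_smul]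
    rfl

end HolLineBundle
end

noncomputable section

section BaseMap

variable {E : Type*} [NormedAddCommGroup E] [NormedSpace ℂ E]
  {B : Type*} [TopologicalSpace B] [ChartedSpace E B] [IsManifold 𝓘(ℂ, E) ω B]

theorem fst_chartDeriv {D : Type*} [NormedAddCommGroup D] [NormedSpace ℝ D]
    {M : Type*} [TopologicalSpace M] [ChartedSpace (E × D) M] [IsManifold 𝓘(ℝ, E × D) 1 M]
    {β : M → B} {x₀ x : M} {b₀ : B} {β' : E × D →L[ℝ] E}
    (hβ : HasMFDerivAt 𝓘(ℝ, E × D) 𝓘(ℝ, E) β x β') (hx : x ∈ (chartAt (E × D) x₀).source)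
    (hb : β x ∈ (chartAt E b₀).source)
    (h : ∀ z, (chartAt (E × D) x₀ z).1 = chartAt E b₀ (β z)) (v : E × D) :
    (chartDeriv ℝ x₀ x v).1 = chartDeriv ℂ b₀ (β x) (β' v) := by
  have : IsManifold 𝓘(ℂ, E) 1 B := IsManifold.of_le (n := ω) (by simp)
  have h1 := (hasMFDerivAt_chartAt (𝕜 := ℂ) hb).complexToReal
  have h2 := h1.comp_eq hβ rfl
  have h3 := ((ContinuousLinearMap.fst ℝ E D).hasFDerivAt (x := chartAt (E × D) x₀ x)).hasMFDerivAt.comp_eq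
    (hasMFDerivAt_chartAt (𝕜 := ℝ) hx) rfl
  exact h3.eq_apply h2 (Filter.Eventually.of_forall h) v

end BaseMap

namespace HolLineBundle

variable {E : Type*} [NormedAddCommGroup E] [NormedSpace ℂ E]
  {B : Type*} [TopologicalSpace B] [ChartedSpace E B]
  {V : B → Type*} [∀ b, AddCommGroup (V b)] [∀ b, Module ℂ (V b)]
  {𝓛 : HolLineBundle E V}
  [IsManifold 𝓘(ℂ, E) ω B]

attribute [local instance] isManifold_complexToReal

theorem hasMFDerivAt_slit_base (ε : 𝓛.Slit) :
    HasMFDerivAt 𝓘(ℂ, E × ℂ) 𝓘(ℂ, E) (Slit.base : 𝓛.Slit → B) ε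
      (ContinuousLinearMap.fst ℂ E ℂ) := by
  have : IsManifold 𝓘(ℂ, E) 1 B := IsManifold.of_le (n := ω) (by simp)
  have : IsManifold 𝓘(ℂ, E × ℂ) 1 𝓛.Slit := IsManifold.of_le (n := ω) (by simp)
  have h := ((contMDiff_slit_base (𝕜 := ℂ) (n := ω) (𝓛 := 𝓛)).mdifferentiable (by simp) ε).hasMFDerivAt
  have h1 := (hasMFDerivAt_chartAt_self (𝕜 := ℂ) ε.base).comp_eq h rfl
  have h2 := ((ContinuousLinearMap.fst ℂ E ℂ).hasFDerivAt
    (x := chartAt (E × ℂ) ε ε)).hasMFDerivAt.comp_eq (hasMFDerivAt_chartAt_self (𝕜 := ℂ) ε) rfl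
  have e : ContinuousLinearMap.fst ℂ E ℂ =
      (mfderiv 𝓘(ℂ, E × ℂ) 𝓘(ℂ, E) (Slit.base : 𝓛.Slit → B) ε : E × ℂ →L[ℂ] E) :=
    ContinuousLinearMap.ext fun v => h2.eq_apply h1 (Filter.Eventually.of_forall fun z => rfl) v
  rw [e]
  exact h

theorem hasMFDerivAt_slit_base_real (ε : 𝓛.Slit) :
    HasMFDerivAt 𝓘(ℝ, E × ℂ) 𝓘(ℝ, E) (Slit.base : 𝓛.Slit → B) ε
      (ContinuousLinearMap.fst ℝ E ℂ) :=
  (hasMFDerivAt_slit_base ε).complexToReal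

theorem hasMFDerivAt_proj_base (x : 𝓛.RProj) :
    HasMFDerivAt 𝓘(ℝ, E × ℝ) 𝓘(ℝ, E) (RProj.base : 𝓛.RProj → B) x
      (ContinuousLinearMap.fst ℝ E ℝ) := by
  have : IsManifold 𝓘(ℝ, E) 1 B := IsManifold.of_le (n := ∞) (by simp)
  have : IsManifold 𝓘(ℝ, E × ℝ) 1 𝓛.RProj := IsManifold.of_le (n := ∞) (by simp)
  have h := ((contMDiff_proj_base (𝓛 := 𝓛)).mdifferentiable (by simp) x).hasMFDerivAt
  have h1 := (hasMFDerivAt_chartAt_self (𝕜 := ℝ) x.base).comp_eq h rfl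
  have h2 := ((ContinuousLinearMap.fst ℝ E ℝ).hasFDerivAt
    (x := chartAt (E × ℝ) x x)).hasMFDerivAt.comp_eq (hasMFDerivAt_chartAt_self (𝕜 := ℝ) x) rfl
  have e : ContinuousLinearMap.fst ℝ E ℝ =
      (mfderiv 𝓘(ℝ, E × ℝ) 𝓘(ℝ, E) (RProj.base : 𝓛.RProj → B) x : E × ℝ →L[ℝ] E) :=
    ContinuousLinearMap.ext fun v => h2.eq_apply h1 (Filter.Eventually.of_forall fun z => rfl) v
  rw [e]
  exact h

theorem dproj_fst (ε : 𝓛.Slit) (v : E × ℂ) : (𝓛.dproj ε v).1 = v.1 :=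
  ((hasMFDerivAt_proj_base (𝓛.toProj ε)).comp_eq (hasMFDerivAt_toProj ε) rfl).eq_apply
    (hasMFDerivAt_slit_base_real ε) (Filter.Eventually.of_forall fun _ => rfl) v

end HolLineBundle

namespace HolContactGroupoid

variable {E F G X : Type*}
  [NormedAddCommGroup E] [NormedSpace ℂ E] [NormedAddCommGroup F] [NormedSpace ℂ F]
  [TopologicalSpace G] [ChartedSpace E G] [IsManifold 𝓘(ℂ, E) ω G]
  [TopologicalSpace X] [ChartedSpace F X] [IsManifold 𝓘(ℂ, F) ω X]
  (K : HolContactGroupoid E F G X)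

attribute [local instance] isManifold_complexToReal

/-- A frame of the conormal bundle is given by a defining form. -/
theorem exists_form_of_frame {φ : Set G × (∀ g, Conormal K.H g)} (hφ : φ ∈ K.conormal.frames) :
    ∃ α : ∀ g : G, TangentSpace 𝓘(ℂ, E) g →L[ℂ] ℂ, IsDefiningForm ω K.H φ.1 α ∧
      ∀ g ∈ φ.1, ∀ (ξ : Conormal K.H g) (v : E),
        ξ.eval v = HolLineBundle.ratio (φ.2 g) ξ * formAt α g v := by
  obtain ⟨U, α, hα, h⟩ := hφ
  have h1 : φ.1 = U := by rw [h]; rfl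
  refine ⟨α, h1 ▸ hα, fun g hg ξ v => ?_⟩
  have h2 := K.conormal.ratio_smul (K.conormal.ne_zero φ ⟨U, α, hα, h⟩ g hg) ξ
  have h3 : φ.2 g = Conormal.ofForm K.H (α g) := by rw [h]; rfl
  have h4 : (φ.2 g).eval v = formAt α g v := by
    rw [h3, Conormal.eval_ofForm (hα.le_ker (h1 ▸ hg))]
    rfl
  rw [← h4]
  conv_lhs => rw [← h2]
  rfl

theorem exists_form_ne_zero {U : Set G} {α : ∀ g : G, TangentSpace 𝓘(ℂ, E) g →L[ℂ] ℂ}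
    (hα : IsDefiningForm ω K.H U α) {g : G} (hg : g ∈ U) : ∃ e : E, formAt α g e ≠ 0 := by
  by_contra! h
  exact hα.ne_zero g hg (ContinuousLinearMap.ext h)

theorem exists_conormal_chartForm {U : Set G} {α : ∀ g : G, TangentSpace 𝓘(ℂ, E) g →L[ℂ] ℂ}
    (hα : IsDefiningForm ω K.H U α) {g : G} (hg : g ∈ U) :
    ∃ a : E → E →L[ℂ] ℂ, ContDiffAt ℂ ω a (chartAt E g g) ∧
      (∀ y ∈ (chartAt E g).source, ∀ v, a (chartAt E g y) (chartDeriv ℂ g y v) = formAt α y v) ∧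
      (∀ v, a (chartAt E g g) v = formAt α g v) := by
  have : IsManifold 𝓘(ℂ, E) 1 G := IsManifold.of_le (n := ω) (by simp)
  obtain ⟨a, ha, h⟩ := exists_chartForm (hα.contMDiffOn.contMDiffAt (hα.isOpen.mem_nhds hg))
  refine ⟨a, ha, h, fun v => ?_⟩
  refine Eq.trans ?_ (h g (mem_chart_source E g) v)
  rw [chartDeriv_self]
  rfl

theorem eq_zero_of_chartForm [FiniteDimensional ℂ E] {U : Set G} {α : ∀ g : G, TangentSpace 𝓘(ℂ, E) g →L[ℂ] ℂ}
    (hα : IsDefiningForm ω K.H U α) {g : G} (hg : g ∈ U) {a : E → E →L[ℂ] ℂ}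
    (ha : ContDiffAt ℂ ω a (chartAt E g g))
    (h : ∀ y ∈ (chartAt E g).source, ∀ v, a (chartAt E g y) (chartDeriv ℂ g y v) = formAt α y v)
    {u : E} (hu : a (chartAt E g g) u = 0)
    (hu' : ∀ w, a (chartAt E g g) w = 0 → fderiv ℂ a (chartAt E g g) u w =
      fderiv ℂ a (chartAt E g g) w u) : u = 0 := by
  have : IsManifold 𝓘(ℂ, E) 1 G := IsManifold.of_le (n := ω) (by simp)
  have : IsManifold 𝓘(ℂ, E) 2 G := IsManifold.of_le (n := ω) (by simp)
  have : CompleteSpace E := FiniteDimensional.complete ℂ E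
  refine eq_zero_of_isContact (n := ω) (by simp) K.isContact hα hg
    (ha.differentiableAt (by simp)) ?_ hu hu'
  filter_upwards [(chartAt E g).open_source.mem_nhds (mem_chart_source E g)] with y hy using h y hy

theorem projDeriv_apply (x : K.conormal.RProj) (v : E × ℝ) : K.projDeriv x v = v.1 := by
  change (mfderiv 𝓘(ℝ, E × ℝ) 𝓘(ℝ, E) HolLineBundle.RProj.base x) v = _
  rw [(HolLineBundle.hasMFDerivAt_proj_base x).mfderiv]
  rfl

/-- The value of a conormal vector on a tangent vector. -/
def evalAt (ε : K.conormal.Slit) : E →ₗ[ℂ] ℂ := Conormal.eval ε.vec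

theorem pairing_hatForm (ε : K.conormal.Slit) (v : E × ℝ) :
    K.conormal.pairing ε (K.hatForm (K.conormal.toProj ε) v) = (K.evalAt ε v.1).re :=
  congrArg (fun u : E => (K.evalAt ε u).re) (K.projDeriv_apply (K.conormal.toProj ε) v)

theorem exists_evalAt_eq (ε : K.conormal.Slit) (z : ℂ) : ∃ u, K.evalAt ε u = z := by
  obtain ⟨e, he⟩ : ∃ e, K.evalAt ε e ≠ 0 := by
    by_contra! h
    exact ε.ne_zero (Conormal.eval_injective (LinearMap.ext h))
  refine ⟨(z / K.evalAt ε e) • e, ?_⟩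
  rw [map_smul, smul_eq_mul, div_mul_cancel₀ _ he]

theorem hatForm_surjective (x : K.conormal.RProj) : Function.Surjective (K.hatForm x) := by
  obtain ⟨ε, rfl⟩ := HolLineBundle.exists_toProj_eq x
  intro l
  obtain ⟨u, hu⟩ := K.exists_evalAt_eq ε (K.conormal.pairing ε l : ℝ)
  refine ⟨((u, 0) : E × ℝ), HolLineBundle.pairing_injective ε ?_⟩
  rw [pairing_hatForm, hu, Complex.ofReal_re]

theorem mem_hatH_iff (ε : K.conormal.Slit) (v : E × ℝ) :
    v ∈ K.hatH (K.conormal.toProj ε) ↔ (K.evalAt ε v.1).re = 0 := by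
  rw [← pairing_hatForm]
  exact ((K.conormal.pairEquiv ε).map_eq_zero_iff).symm

/-- The local expression of the tautological form. -/
theorem exists_chart_liouville [FiniteDimensional ℂ E] (ε : K.conormal.Slit) :
    ∃ T : E × ℂ → E × ℂ →L[ℂ] ℂ, ContDiffAt ℂ ω T (chartAt (E × ℂ) ε ε) ∧
      (∀ z ∈ (chartAt (E × ℂ) ε).source, ∀ v : E × ℂ, K.evalAt z v.1 =
        T (chartAt (E × ℂ) ε z) (chartDeriv ℝ ε z v)) ∧
      ∀ v, (∀ w, fderiv ℂ T (chartAt (E × ℂ) ε ε) v w = fderiv ℂ T (chartAt (E × ℂ) ε ε) w v) →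
        v = 0 := by
  have : IsManifold 𝓘(ℝ, E × ℂ) 1 K.conormal.Slit := IsManifold.of_le (n := ∞) (by simp)
  set φ := K.conormal.frameAt ε.base with hφ
  have hφm := K.conormal.mem_frameAt ε.base
  obtain ⟨α, hα, hev⟩ := K.exists_form_of_frame (K.conormal.frameAt_mem ε.base)
  obtain ⟨a, ha, h, hself⟩ := K.exists_conormal_chartForm hα hφm
  have hda := ha.differentiableAt (by simp)
  set p := chartAt (E × ℂ) ε ε with hp
  have hp1 : p.1 = chartAt E ε.base ε.base := rfl
  let T : E × ℂ → E × ℂ →L[ℂ] ℂ := fun q => q.2 • (a q.1).comp (ContinuousLinearMap.fst ℂ E ℂ)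
  have ha1 : ContDiffAt ℂ ω (fun q : E × ℂ => a q.1) p := ContDiffAt.comp p (hp1 ▸ ha) contDiffAt_fst
  have hT : ContDiffAt ℂ ω T p := contDiffAt_snd.smul (ha1.clm_comp contDiffAt_const)
  have hT' : ∀ v w, fderiv ℂ T p v w = v.2 * a p.1 w.1 + p.2 * fderiv ℂ a p.1 v.1 w.1 := by
    intro v w
    have h1 : HasFDerivAt (fun q => T q w)
        ((ContinuousLinearMap.apply ℂ ℂ w).comp (fderiv ℂ T p)) p :=
      (ContinuousLinearMap.apply ℂ ℂ w).hasFDerivAt.comp p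
        (hT.differentiableAt (by simp)).hasFDerivAt
    have h2 : HasFDerivAt (fun q : E × ℂ => a q.1 w.1)
      ((ContinuousLinearMap.apply ℂ ℂ w.1).comp ((fderiv ℂ a p.1).comp
        (ContinuousLinearMap.fst ℂ E ℂ))) p :=
      (ContinuousLinearMap.apply ℂ ℂ w.1).hasFDerivAt.comp p
        (HasFDerivAt.comp p (f := Prod.fst) (hp1 ▸ hda.hasFDerivAt) hasFDerivAt_fst)
    have h3 := congrArg (fun l => l v) (h1.unique (hasFDerivAt_snd.mul h2))
    refine h3.trans ?_
    change p.2 * fderiv ℂ a p.1 v.1 w.1 + a p.1 w.1 * v.2 = _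
    ring
  refine ⟨T, hT, fun z hz v => ?_, fun v hv => ?_⟩
  · have h1 : (chartDeriv ℝ ε z v).1 = chartDeriv ℂ ε.base z.base v.1 :=
      fst_chartDeriv (β := HolLineBundle.Slit.base) (b₀ := ε.base)
      (HolLineBundle.hasMFDerivAt_slit_base_real z) hz hz.1 (fun _ => rfl) v
    change _ = HolLineBundle.ratio (φ.2 z.base) z.vec * a (chartAt E ε.base z.base) (chartDeriv ℝ ε z v).1
    rw [h1, h z.base hz.1]
    exact hev z.base hz.2 z.vec v.1
  · have hc : p.2 ≠ 0 := HolLineBundle.chartAt_slit_snd_ne_zero (mem_chart_source _ ε)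
    simp only [hT'] at hv
    obtain ⟨e, he⟩ := K.exists_form_ne_zero hα hφm
    rw [← hself, ← hp1] at he
    have h1 : a p.1 v.1 = 0 := by simpa using (hv (0, 1)).symm
    have h2 : v.1 = 0 := by
      refine K.eq_zero_of_chartForm hα hφm ha h h1 fun w hw => ?_
      rw [← hp1] at hw ⊢
      have h3 := hv (w, 0)
      simp only [hw, mul_zero, zero_add, zero_mul] at h3
      exact mul_left_cancel₀ hc h3
    have h3 := hv (e, 0)
    simp only [h2, map_zero, zero_apply, mul_zero, add_zero, mul_eq_zero, he, or_false] at h3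
    exact Prod.ext h2 h3

section Nijenhuis

variable [FiniteDimensional ℂ E] [T2Space G]

open HolLineBundle

theorem pairing_hatForm_symbol (ε : K.conormal.Slit)
    (Δ : K.conormal.Gauge (K.conormal.toProj ε)) :
    K.conormal.pairing ε (K.hatForm _ (K.conormal.symbol Δ)) =
      (K.evalAt ε (liftEquiv ε Δ).1).re := by
  rw [symbol_eq, pairing_hatForm, dproj_fst]
  rfl

theorem homogenize_hatForm (Δ : K.conormal.GaugeSection) (z : K.conormal.Slit) :
    K.conormal.homogenize (fun x => K.hatForm x (K.conormal.symbol (Δ.toFun x))) z =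
      (K.evalAt z (Δ.field z).1).re :=
  K.pairing_hatForm_symbol z _

theorem homogenize_hatForm_chart {ε : K.conormal.Slit} {T : E × ℂ → E × ℂ →L[ℂ] ℂ}
    (hT : ∀ z ∈ (chartAt (E × ℂ) ε).source, ∀ v : E × ℂ, K.evalAt z v.1 =
        T (chartAt (E × ℂ) ε z) (chartDeriv ℝ ε z v)) (Δ : K.conormal.GaugeSection) :
    ∀ᶠ z in 𝓝 ε, K.conormal.homogenize (fun x => K.hatForm x (K.conormal.symbol (Δ.toFun x))) z =
      (T (chartAt (E × ℂ) ε z) (chartField ℝ ε Δ.field (chartAt (E × ℂ) ε z))).re := by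
  filter_upwards [(chartAt (E × ℂ) ε).open_source.mem_nhds (mem_chart_source _ ε)] with z hz
  rw [homogenize_hatForm, hT z hz, chartField, (chartAt (E × ℂ) ε).left_inv hz]

theorem isSmoothForm_hatForm : K.conormal.IsSmoothForm K.hatForm := by
  intro Δ ε
  obtain ⟨T, hT, hTe, -⟩ := K.exists_chart_liouville ε
  have h0 : ContDiffAt ℝ ∞ (fun q => (T q).restrictScalars ℝ) (chartAt (E × ℂ) ε ε) :=
    (ContinuousLinearMap.restrictScalarsL ℂ (E × ℂ) ℂ ℝ ℝ).contDiff.contDiffAt.comp _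
      ((hT.restrict_scalars ℝ).of_le le_top)
  have h1 := h0.clm_apply (contDiffAt_chartField Δ (mem_chart_target (E × ℂ) ε))
  have h2 := Complex.reCLM.contDiff.contDiffAt.comp _ h1
  exact (ContMDiffAt.comp ε h2.contMDiffAt
    (contMDiffAt_chartAt_slit (mem_chart_source _ ε))).congr_of_eventuallyEq
      (K.homogenize_hatForm_chart hTe Δ)

/-- The composition of `hatForm` with the symbol map. -/
def hatJet : K.conormal.JetSection where
  toFun x :=
    { toFun := fun Δ => K.hatForm x (K.conormal.symbol Δ)
      map_add' := fun Δ Ξ => by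
        obtain ⟨ε, rfl⟩ := exists_toProj_eq x
        apply pairing_injective ε
        rw [map_add, pairing_hatForm_symbol, pairing_hatForm_symbol, pairing_hatForm_symbol,
          map_add, Prod.fst_add, map_add, Complex.add_re]
      map_smul' := fun r Δ => by
        obtain ⟨ε, rfl⟩ := exists_toProj_eq x
        apply pairing_injective ε
        rw [RingHom.id_apply, map_smul, pairing_hatForm_symbol, pairing_hatForm_symbol, map_smul,
          Prod.smul_fst, ← Complex.coe_smul, map_smul, smul_eq_mul, Complex.re_ofReal_mul,
          smul_eq_mul] }
  smooth := K.isSmoothForm_hatForm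

theorem exists_inverse_hatForm {N : K.conormal.AtiyahTensor}
    (hN : K.conormal.IsGaugeComplexStructure N) : ∃ J : K.conormal.Biderivation,
      (∀ ψ Ξ, K.conormal.dForm K.hatForm K.isSmoothForm_hatForm (J.sharpSection ψ) Ξ = ψ.eval Ξ) ∧
        K.conormal.IsJacobiNijenhuis J N := by
  refine exists_isJacobiNijenhuis (Θ := K.hatJet) hN fun ε => ?_
  obtain ⟨T, hT, hTe, hnd⟩ := K.exists_chart_liouville ε
  exact ⟨T, hT.differentiableAt (by simp), K.homogenize_hatForm_chart hTe, hnd⟩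

end Nijenhuis

theorem exists_chart_hatForm [FiniteDimensional ℂ E] (x : K.conormal.RProj) :
    ∃ (U : Set K.conormal.RProj)
      (β : ∀ x : K.conormal.RProj, TangentSpace 𝓘(ℝ, E × ℝ) x →L[ℝ] ℝ)
      (b : E × ℝ → E × ℝ →L[ℝ] ℝ),
      x ∈ U ∧ IsDefiningForm ∞ K.hatH U β ∧ ContDiffAt ℝ ∞ b (chartAt (E × ℝ) x x) ∧
      (∀ᶠ y in 𝓝 x, ∀ v, b (chartAt (E × ℝ) x y) (chartDeriv ℝ x y v) = formAt β y v) ∧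
      ∀ u, b (chartAt (E × ℝ) x x) u = 0 → (∀ w, b (chartAt (E × ℝ) x x) w = 0 →
        fderiv ℝ b (chartAt (E × ℝ) x x) u w = fderiv ℝ b (chartAt (E × ℝ) x x) w u) → u = 0 := by
  have : IsManifold 𝓘(ℝ, E × ℝ) 1 K.conormal.RProj := IsManifold.of_le (n := ∞) (by simp)
  set φ := K.conormal.frameAt' x with hφ
  have hφm : x.base ∈ φ.1 := K.conormal.mem_frameAt x.base
  obtain ⟨α, hα, hev⟩ := K.exists_form_of_frame (K.conormal.frameAt'_mem x)
  set c := chartAt (E × ℝ) x with hc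
  let z : E × ℝ → ℂ := fun p => 1 + (p.2 : ℂ) * Complex.I
  have hz : ContDiff ℝ ∞ z :=
    contDiff_const.add ((Complex.ofRealCLM.contDiff.comp contDiff_snd).mul contDiff_const)
  let form : ℂ → (E →L[ℂ] ℂ) → E × ℝ →L[ℝ] ℝ := fun z a =>
    Complex.reCLM.comp (((z • a).restrictScalars ℝ).comp (ContinuousLinearMap.fst ℝ E ℝ))
  have hform : ∀ (z : E × ℝ → ℂ) (a : E × ℝ → E →L[ℂ] ℂ) (p : E × ℝ), ContDiffAt ℝ ∞ z p →
      ContDiffAt ℝ ∞ a p → ContDiffAt ℝ ∞ (fun q => form (z q) (a q)) p := by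
    intro z a p hz ha
    exact contDiffAt_const.clm_comp (((ContinuousLinearMap.restrictScalarsL ℂ E ℂ ℝ
      ℝ).contDiff.contDiffAt.comp p (hz.smul ha)).clm_comp contDiffAt_const)
  let β : ∀ y : K.conormal.RProj, TangentSpace 𝓘(ℝ, E × ℝ) y →L[ℝ] ℝ := fun y =>
    form (z (c y)) (formAt α y.base)
  -- the expression of `β` in the chart at `y`
  have hchart : ∀ (y : K.conormal.RProj) (a : E → E →L[ℂ] ℂ),
      (∀ g ∈ (chartAt E y.base).source, ∀ v,
        a (chartAt E y.base g) (chartDeriv ℂ y.base g v) = formAt α g v) →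
      ∀ᶠ y' in 𝓝 y, ∀ v, form (z (c y')) (a (chartAt (E × ℝ) y y').1) (chartDeriv ℝ y y' v) =
        formAt β y' v := by
    intro y a h
    filter_upwards [(chartAt (E × ℝ) y).open_source.mem_nhds (mem_chart_source _ y)] with y' hy' v
    have h1 : (chartDeriv ℝ y y' v).1 = chartDeriv ℂ y.base y'.base v.1 :=
      fst_chartDeriv (β := HolLineBundle.RProj.base) (b₀ := y.base)
        (HolLineBundle.hasMFDerivAt_proj_base y') hy' hy'.1 (fun _ => rfl) v
    change (z (c y') * a (chartAt E y.base y'.base) (chartDeriv ℝ y y' v).1).re =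
      (z (c y') * formAt α y'.base v.1).re
    rw [h1, h y'.base hy'.1]
  have hcoord : ∀ ε : K.conormal.Slit, K.conormal.toProj ε ∈ c.source → ∃ r : ℝ, r ≠ 0 ∧
      ∀ v : E, (K.evalAt ε v).re = r * (z (c (K.conormal.toProj ε)) * formAt α ε.base v).re := by
    intro ε hε
    have h1 := (HolLineBundle.toProj_mem_source (chart_mem_atlas E x.base)
      (K.conormal.frameAt'_mem x)).1 hε
    have h2 : (c (K.conormal.toProj ε)).2 =
        HolLineBundle.slope (HolLineBundle.ratio (φ.2 ε.base) ε.vec) :=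
      congrArg Prod.snd (HolLineBundle.projHomeo_toProj (chart_mem_atlas E x.base)
        (K.conormal.frameAt'_mem x) h1.2.1)
    refine ⟨_, h1.2.2, fun v => ?_⟩
    have h3 : K.evalAt ε v = _ := hev ε.base h1.2.1 ε.vec v
    rw [h3, ← Complex.re_ofReal_mul, ← mul_assoc]
    congr 2
    change _ = _ * (1 + ((c (K.conormal.toProj ε)).2 : ℂ) * Complex.I)
    rw [h2]
    have h4 := h1.2.2
    apply Complex.ext
    · simp [φ]
    · simp [HolLineBundle.slope, φ]
      field_simp
  have hzre : ∀ p, (z p).re = 1 := fun p => by simp [z]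
  have hz0 : ∀ p, z p ≠ 0 := fun p h => by
    have h1 := hzre p
    rw [h] at h1
    exact zero_ne_one h1
  refine ⟨c.source, β, ?_⟩
  obtain ⟨a, ha, ha', hself⟩ := K.exists_conormal_chartForm hα hφm
  have hcx : (c x).1 = chartAt E x.base x.base := rfl
  have ha1 : ContDiffAt ℝ ∞ (fun q : E × ℝ => a q.1) (c x) :=
    ContDiffAt.comp _ (hcx ▸ (ha.restrict_scalars ℝ).of_le le_top) contDiffAt_fst
  have hb := hform z (fun q => a q.1) (c x) hz.contDiffAt ha1
  refine ⟨fun q => form (z q) (a q.1), mem_chart_source _ x, ⟨c.open_source, ?_, ?_, ?_⟩, hb, hchart x a ha', ?_⟩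
  · intro y hy
    refine ContMDiffAt.contMDiffWithinAt ?_
    obtain ⟨a, ha, ha', -⟩ := K.exists_conormal_chartForm hα (g := y.base) hy.2.1
    have h1 : (chartAt (E × ℝ) y y).1 = chartAt E y.base y.base := rfl
    have h2 : ContDiffAt ℝ ∞ (fun q => z (c ((chartAt (E × ℝ) y).symm q))) (chartAt (E × ℝ) y y) := by
      refine ContMDiffAt.contDiffAt_comp_symm (f := fun y => z (c y)) (mem_chart_target _ y) ?_
      rw [(chartAt (E × ℝ) y).left_inv (mem_chart_source _ y)]
      have hz' : ContMDiffAt 𝓘(ℝ, E × ℝ) 𝓘(ℝ, ℂ) ∞ z (c y) := hz.contDiffAt.contMDiffAt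
      exact hz'.comp y (contMDiffAt_chartAt_of_mem hy)
    refine contMDiffAt_form (a := fun q => form (z (c ((chartAt (E × ℝ) y).symm q))) (a q.1))
      (hform _ _ _ h2 (ContDiffAt.comp _ (h1 ▸ (ha.restrict_scalars ℝ).of_le le_top)
        contDiffAt_fst)) ?_
    filter_upwards [hchart y a ha', (chartAt (E × ℝ) y).open_source.mem_nhds (mem_chart_source _ y)] with y' hy' hs v
    rw [← hy' v, (chartAt (E × ℝ) y).left_inv hs]
  · intro y hy h0
    obtain ⟨e, he⟩ := K.exists_form_ne_zero hα hy.2.1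
    have h1 : formAt β y (((z (c y) * formAt α y.base e)⁻¹ • e, 0) : E × ℝ) = 0 := by
      change β y _ = 0
      rw [h0]
      rfl
    change (z (c y) * formAt α y.base ((z (c y) * formAt α y.base e)⁻¹ • e)).re = 0 at h1
    rw [map_smul, smul_eq_mul, mul_left_comm, inv_mul_cancel₀ (mul_ne_zero (hz0 _) he)] at h1
    simp at h1
  · intro y hy v
    obtain ⟨ε, rfl⟩ := HolLineBundle.exists_toProj_eq y
    obtain ⟨r, hr, h⟩ := hcoord ε hy
    refine (K.mem_hatH_iff ε v).trans ?_
    rw [h]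
    exact ⟨fun h' => (mul_eq_zero.1 h').resolve_left hr, fun h' => mul_eq_zero_of_right r h'⟩
  · intro u hu hw
    have hd : ∀ v w, fderiv ℝ (fun q => form (z q) (a q.1)) (c x) v w =
        (v.2 * Complex.I * a (c x).1 w.1 + z (c x) * fderiv ℂ a (c x).1 v.1 w.1).re := by
      intro v w
      have h1 := (ContinuousLinearMap.apply ℝ ℝ w).hasFDerivAt.comp (c x)
        (hb.differentiableAt (by simp)).hasFDerivAt
      have h2 : HasFDerivAt z ((Complex.ofRealCLM.comp (ContinuousLinearMap.snd ℝ E ℝ)).smulRight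
          Complex.I) (c x) :=
        (((Complex.ofRealCLM.comp (ContinuousLinearMap.snd ℝ E ℝ)).smulRight
          Complex.I).hasFDerivAt (x := c x)).const_add 1
      have h3 : HasFDerivAt (fun q : E × ℝ => a q.1 w.1)
        (((ContinuousLinearMap.apply ℂ ℂ w.1).restrictScalars ℝ).comp
          (((fderiv ℂ a (c x).1).restrictScalars ℝ).comp (ContinuousLinearMap.fst ℝ E ℝ))) (c x) :=
        ((ContinuousLinearMap.apply ℂ ℂ w.1).restrictScalars ℝ).hasFDerivAt.comp (c x)
          (HasFDerivAt.comp (c x) (f := Prod.fst)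
            ((hcx ▸ (ha.differentiableAt (by simp)).hasFDerivAt :
              HasFDerivAt a (fderiv ℂ a (c x).1) (c x).1).restrictScalars ℝ) hasFDerivAt_fst)
      have h4 := Complex.reCLM.hasFDerivAt.comp (c x) (h2.mul h3)
      refine (congrArg (fun l => l v) (h1.unique h4)).trans ?_
      change (z (c x) * fderiv ℂ a (c x).1 v.1 w.1 + a (c x).1 w.1 * (v.2 * Complex.I)).re = _
      congr 1
      ring
    have hu0 : (z (c x) * a (c x).1 u.1).re = 0 := hu
    replace hw : ∀ w : E × ℝ, (z (c x) * a (c x).1 w.1).re = 0 → _ := fun w h => hw w h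
    simp only [hd] at hw
    rw [← hcx] at hself
    have h1 : a (c x).1 u.1 = 0 := by
      have h2 := hw (0, 1) (by simp)
      simp only [map_zero, mul_zero, zero_apply, add_zero, Complex.zero_re, Complex.ofReal_one,
        one_mul, Complex.I_mul_re, zero_eq_neg] at h2
      rw [Complex.mul_re, h2, hzre, mul_zero, sub_zero, one_mul] at hu0
      exact Complex.ext hu0 h2
    have h2 : u.1 = 0 := by
      refine K.eq_zero_of_chartForm hα hφm ha ha' h1 fun w hw' => ?_
      rw [← hcx] at hw' ⊢
      have h3 : ∀ w, a (c x).1 w = 0 →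
          (z (c x) * (fderiv ℂ a (c x).1 u.1 w - fderiv ℂ a (c x).1 w u.1)).re = 0 := by
        intro w hw'
        have h4 := hw (w, 0) (by simp [hw'])
        simp only [h1, hw', mul_zero, zero_add] at h4
        rw [mul_sub, Complex.sub_re, h4, sub_self]
      have h5 := h3 (Complex.I • w) (by rw [map_smul, hw', smul_zero])
      rw [map_smul, map_smul, smul_apply, ← smul_sub, smul_eq_mul, mul_left_comm,
        Complex.I_mul_re, neg_eq_zero] at h5
      exact sub_eq_zero.1 ((mul_eq_zero.1 (Complex.ext (h3 w hw') h5)).resolve_left (hz0 _))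
    obtain ⟨e, he⟩ := K.exists_form_ne_zero hα hφm
    rw [← hself] at he
    have h6 : a (c x).1 ((Complex.I * (starRingEnd ℂ) (z (c x)) / a (c x).1 e) • e) =
        Complex.I * (starRingEnd ℂ) (z (c x)) := by
      rw [map_smul, smul_eq_mul, div_mul_cancel₀ _ he]
    have h7 := hw (_, 0) (show (z (c x) * a (c x).1 ((Complex.I * (starRingEnd ℂ) (z (c x)) /
      a (c x).1 e) • e)).re = 0 by
        rw [h6, mul_left_comm, Complex.mul_conj, Complex.I_mul_re, Complex.ofReal_im, neg_zero])
    simp only [h6, h2, map_zero, zero_apply, mul_zero, add_zero, Complex.ofReal_zero, zero_mul,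
      Complex.zero_re] at h7
    refine Prod.ext h2 ?_
    rw [mul_assoc, Complex.re_ofReal_mul, ← mul_assoc, Complex.I_mul_I, neg_one_mul,
      Complex.neg_re, Complex.conj_re, hzre] at h7
    simpa using h7

theorem isContact_hatH [FiniteDimensional ℂ E] : IsContact ∞ K.hatH := by
  have : IsManifold 𝓘(ℝ, E × ℝ) 1 K.conormal.RProj := IsManifold.of_le (n := ∞) (by simp)
  have : IsManifold 𝓘(ℝ, E × ℝ) 2 K.conormal.RProj :=
    IsManifold.of_le (n := ∞) (show ((2 : ℕ∞) : WithTop ℕ∞) ≤ ((⊤ : ℕ∞) : WithTop ℕ∞) from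
      WithTop.coe_le_coe.2 le_top)
  have : IsManifold 𝓘(ℝ, E × ℝ) (∞ + 1) K.conormal.RProj := IsManifold.of_le (n := ∞) le_rfl
  have : FiniteDimensional ℝ E := FiniteDimensional.complexToReal E
  have : CompleteSpace (E × ℝ) := FiniteDimensional.complete ℝ _
  exact isContact_of_chartForm (by simp) K.exists_chart_hatForm

/-- The contact structure and the complex structure of the gauge algebroid form a contact-Nijenhuis
structure. -/
theorem isContactNijenhuis [FiniteDimensional ℂ E] [T2Space G] {N : K.conormal.AtiyahTensor}
    (hN : K.conormal.IsGaugeComplexStructure N) :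
    K.conormal.IsContactNijenhuis K.hatForm N where
  contact := K.isContact_hatH
  surjective := K.hatForm_surjective
  smooth := K.isSmoothForm_hatForm
  exists_inverse := K.exists_inverse_hatForm hN

end HolContactGroupoid
end

noncomputable section

namespace GroupoidData.IsLieGroupoid

variable {G X : Type*} {𝕜 : Type*} [RCLike 𝕜]
  {E : Type*} [NormedAddCommGroup E] [NormedSpace 𝕜 E]
  {F : Type*} [NormedAddCommGroup F] [NormedSpace 𝕜 F]
  [TopologicalSpace G] [ChartedSpace E G] [TopologicalSpace X] [ChartedSpace F X]
  [FiniteDimensional 𝕜 E] [FiniteDimensional 𝕜 F]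
  {n : WithTop ℕ∞} {𝒢 : GroupoidData G X}

omit [FiniteDimensional 𝕜 E] [FiniteDimensional 𝕜 F] in
theorem dinv_dmul (h𝒢 : 𝒢.IsLieGroupoid 𝕜 (E := E) (F := F) n) (hn : n ≠ 0) (g : G) (v : E) :
    𝒢.dmul 𝕜 E (𝒢.inv g) g (𝒢.dinv 𝕜 E g v, v) = 𝒢.done 𝕜 E F (𝒢.src g) (𝒢.dsrc 𝕜 E F g v) := by
  have h2 := h𝒢.hasMFDerivAt_mul hn (h𝒢.hasMFDerivAt_inv hn g) (hasMFDerivAt_id g) rfl rfl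
    (Filter.Eventually.of_forall fun z => (h𝒢.isGroupoid.src_inv _))
  have h1 := (h𝒢.hasMFDerivAt_one hn (𝒢.src g)).comp_eq (h𝒢.hasMFDerivAt_src hn g) rfl
  exact h2.eq_apply h1 (Filter.Eventually.of_forall h𝒢.isGroupoid.inv_mul) v

end GroupoidData.IsLieGroupoid

theorem GroupoidData.IsGroupoid.inv_inv {G X : Type*} {𝒢 : GroupoidData G X} (h : 𝒢.IsGroupoid)
    (g : G) : 𝒢.inv (𝒢.inv g) = g := by
  have h1 := h.mul_assoc g (𝒢.inv g) (𝒢.inv (𝒢.inv g)) (h.tgt_inv g).symm (h.tgt_inv _).symm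
  rw [h.mul_inv, h.mul_inv, h.tgt_inv, h.mul_one, ← h.src_inv g, ← h.tgt_inv (𝒢.inv g),
    h.one_mul] at h1
  exact h1

theorem GroupoidData.IsGroupoid.eq_inv {G X : Type*} {𝒢 : GroupoidData G X} (h : 𝒢.IsGroupoid)
    {g k : G} (hgk : 𝒢.src g = 𝒢.tgt k) {x : X} (hx : 𝒢.mul g k = 𝒢.one x) : k = 𝒢.inv g := by
  have h0 : x = 𝒢.tgt g := by rw [← h.tgt_mul g k hgk, hx, h.tgt_one]
  have h0' : x = 𝒢.src k := by rw [← h.src_mul g k hgk, hx, h.src_one]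
  have h1 := h.mul_assoc (𝒢.inv g) g k (h.src_inv g) hgk
  rw [h.inv_mul, hx, hgk, h.one_mul, h0, ← h.src_inv, h.mul_one] at h1
  exact h1

namespace HolLineBundle

variable {E : Type*} [NormedAddCommGroup E] [NormedSpace ℂ E]
  {B : Type*} [TopologicalSpace B] [ChartedSpace E B]
  {V : B → Type*} [∀ b, AddCommGroup (V b)] [∀ b, Module ℂ (V b)]
  {𝓛 : HolLineBundle E V}

/-- Multiplication of a nonzero vector by a nonzero complex number. -/
def cscale (c : ℂˣ) (ε : 𝓛.Slit) : 𝓛.Slit :=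
  ⟨ε.base, (c : ℂ) • ε.vec, smul_ne_zero c.ne_zero ε.ne_zero⟩

theorem exists_cscale_eq {ε ε' : 𝓛.Slit} (h : ε'.base = ε.base) : ∃ c, ε' = cscale c ε := by
  obtain ⟨b, v, hv⟩ := ε
  obtain ⟨b', v', hv'⟩ := ε'
  obtain rfl : b' = b := h
  refine ⟨Units.mk0 (ratio v v') (𝓛.ratio_ne_zero hv hv'), ?_⟩
  simp only [cscale, Units.val_mk0, 𝓛.ratio_smul hv v']

theorem rescale_eq_cscale (r : ℝˣ) (ε : 𝓛.Slit) :
    𝓛.rescale r ε = cscale (Units.map Complex.ofRealHom.toMonoidHom r) ε := by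
  refine Slit.ext rfl (heq_of_eq ?_)
  exact real_smul_eq (r : ℝ) ε.vec

theorem cscale_one (ε : 𝓛.Slit) : cscale 1 ε = ε := Slit.ext rfl (heq_of_eq (one_smul ℂ ε.vec))

end HolLineBundle

namespace HolContactGroupoid

variable {E F G X : Type*}
  [NormedAddCommGroup E] [NormedSpace ℂ E] [NormedAddCommGroup F] [NormedSpace ℂ F]
  [TopologicalSpace G] [ChartedSpace E G] [IsManifold 𝓘(ℂ, E) ω G]
  [TopologicalSpace X] [ChartedSpace F X] [IsManifold 𝓘(ℂ, F) ω X]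
  (K : HolContactGroupoid E F G X)

open HolLineBundle

/-- The contact hyperplane at `g`, as a subspace of the model space. -/
def hyperplane (g : G) : Submodule ℂ E := K.H g

theorem evalAt_cscale (c : ℂˣ) (ε : K.conormal.Slit) (v : E) :
    K.evalAt (cscale c ε) v = c * K.evalAt ε v := rfl

theorem evalAt_eq_zero_iff (ε : K.conormal.Slit) (v : E) :
    K.evalAt ε v = 0 ↔ v ∈ K.hyperplane ε.base := by
  obtain ⟨α, hα, hev⟩ := K.exists_form_of_frame (K.conormal.frameAt_mem ε.base)
  have hb := K.conormal.mem_frameAt ε.base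
  have h1 : K.evalAt ε v = _ := hev ε.base hb ε.vec v
  have h2 := K.conormal.ratio_ne_zero (K.conormal.ne_zero _ (K.conormal.frameAt_mem ε.base) _ hb)
    ε.ne_zero
  rw [h1]
  refine Iff.trans ?_ (hα.mem_iff ε.base hb v).symm
  exact ⟨fun h => (mul_eq_zero.1 h).resolve_left h2, fun h => mul_eq_zero_of_right _ h⟩

theorem slit_ext_evalAt {ε ε' : K.conormal.Slit} (hb : ε.base = ε'.base)
    (h : ∀ v, K.evalAt ε v = K.evalAt ε' v) : ε = ε' := by
  obtain ⟨b, ξ, hξ⟩ := ε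
  obtain ⟨b', ξ', hξ'⟩ := ε'
  obtain rfl : b = b' := hb
  obtain rfl : ξ = ξ' := Conormal.eval_injective (LinearMap.ext h)
  rfl

theorem exists_slit (g : G) (f : E →ₗ[ℂ] ℂ) (hf : ∀ v ∈ K.hyperplane g, f v = 0) (hne : f ≠ 0) :
    ∃ ε : K.conormal.Slit, ε.base = g ∧ ∀ v, K.evalAt ε v = f v := by
  let f' : TangentSpace 𝓘(ℂ, E) g →ₗ[ℂ] ℂ := f
  have hf' : K.H g ≤ LinearMap.ker f' := fun v hv => hf v hv
  have h : ∀ v : E, (Conormal.mk ((K.H g).liftQ f' hf') : Conormal K.H g).eval v = f v := fun v =>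
    LinearMap.congr_fun ((K.H g).liftQ_mkQ f' hf') v
  refine ⟨⟨g, Conormal.mk ((K.H g).liftQ f' hf'), fun h0 => hne (LinearMap.ext fun v => ?_)⟩, rfl, h⟩
  rw [← h v, h0]
  rfl

theorem exists_base_eq (g : G) : ∃ ε : K.conormal.Slit, ε.base = g :=
  ⟨⟨g, K.conormal.someVec g, K.conormal.someVec_ne_zero g⟩, rfl⟩

theorem done_mem (x : X) (u : F) : K.grpd.done ℂ E F x u ∈ K.hyperplane (K.grpd.one x) :=
  K.isMultiplicative.one_mem ⟨x, u⟩

theorem dinv_mem {g : G} {v : E} (hv : v ∈ K.hyperplane g) :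
    K.grpd.dinv ℂ E g v ∈ K.hyperplane (K.grpd.inv g) :=
  K.isMultiplicative.inv_mem ⟨g, v⟩ hv

theorem dmul_mem {g h : G} (hgh : K.grpd.src g = K.grpd.tgt h) {v w : E}
    (hvw : K.grpd.dsrc ℂ E F g v = K.grpd.dtgt ℂ E F h w) (hv : v ∈ K.hyperplane g)
    (hw : w ∈ K.hyperplane h) : K.grpd.dmul ℂ E g h (v, w) ∈ K.hyperplane (K.grpd.mul g h) :=
  K.isMultiplicative.mul_mem ⟨g, v⟩ ⟨h, w⟩ (tangentBundle_eq_iff.2 ⟨hgh, hvw⟩) hv hw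

theorem exists_dsrc_eq (g : G) (u : F) : ∃ v ∈ K.hyperplane g, K.grpd.dsrc ℂ E F g v = u :=
  K.isMultiplicative.covers g u

theorem exists_dtgt_eq (g : G) (u : F) : ∃ v ∈ K.hyperplane g, K.grpd.dtgt ℂ E F g v = u := by
  obtain ⟨v, hv, hvu⟩ := K.exists_dsrc_eq (K.grpd.inv g) u
  have h1 := K.dinv_mem hv
  have h2 := K.isLieGroupoid.dtgt_dinv (by simp) (K.grpd.inv g) v
  rw [K.isLieGroupoid.isGroupoid.inv_inv] at h1 h2
  exact ⟨_, h1, h2.trans hvu⟩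

/-- A linear right inverse of the derivative of the source with values in the hyperplane. -/
theorem exists_dsrc_section (g : G) : ∃ τ : F →ₗ[ℂ] E, ∀ u, τ u ∈ K.hyperplane g ∧
    K.grpd.dsrc ℂ E F g (τ u) = u := by
  obtain ⟨τ, hτ⟩ := ((K.grpd.dsrc ℂ E F g).toLinearMap.comp
    (K.hyperplane g).subtype).exists_rightInverse_of_surjective (LinearMap.range_eq_top.2 fun u => by
      obtain ⟨v, hv, h⟩ := K.exists_dsrc_eq g u
      exact ⟨⟨v, hv⟩, h⟩)
  exact ⟨(K.hyperplane g).subtype.comp τ, fun u => ⟨(τ u).2, LinearMap.congr_fun hτ u⟩⟩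

/-- A linear right inverse of the derivative of the target with values in the hyperplane. -/
theorem exists_dtgt_section (g : G) : ∃ τ : F →ₗ[ℂ] E, ∀ u, τ u ∈ K.hyperplane g ∧
    K.grpd.dtgt ℂ E F g (τ u) = u := by
  obtain ⟨τ, hτ⟩ := ((K.grpd.dtgt ℂ E F g).toLinearMap.comp
    (K.hyperplane g).subtype).exists_rightInverse_of_surjective (LinearMap.range_eq_top.2 fun u => by
      obtain ⟨v, hv, h⟩ := K.exists_dtgt_eq g u
      exact ⟨⟨v, hv⟩, h⟩)
  exact ⟨(K.hyperplane g).subtype.comp τ, fun u => ⟨(τ u).2, LinearMap.congr_fun hτ u⟩⟩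

theorem dualMul_iff {ε₁ ε₂ ε : K.conormal.Slit} : K.DualMul ε₁ ε₂ ε ↔
    K.grpd.src ε₁.base = K.grpd.tgt ε₂.base ∧ ε.base = K.grpd.mul ε₁.base ε₂.base ∧
      ∀ v w : E, K.grpd.dsrc ℂ E F ε₁.base v = K.grpd.dtgt ℂ E F ε₂.base w →
        K.evalAt ε (K.grpd.dmul ℂ E ε₁.base ε₂.base (v, w)) = K.evalAt ε₁ v + K.evalAt ε₂ w := by
  refine and_congr_right fun h1 => and_congr_right fun h2 => ⟨fun h v w hvw => ?_, fun h v w u hvw hu => ?_⟩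
  · exact h v w _ (tangentBundle_eq_iff.2 ⟨h1, hvw⟩) (tangentBundle_eq_iff.2 ⟨h2.symm, rfl⟩)
  · have h3 := (tangentBundle_eq_iff.1 hvw).2
    have h4 := (tangentBundle_eq_iff.1 hu).2
    exact (congrArg (K.evalAt ε) h4.symm).trans (h v w h3)

variable {K}

theorem DualMul.cscale {ε₁ ε₂ ε : K.conormal.Slit} (h : K.DualMul ε₁ ε₂ ε) (c : ℂˣ) :
    K.DualMul (cscale c ε₁) (cscale c ε₂) (cscale c ε) := by
  rw [dualMul_iff] at h ⊢
  refine ⟨h.1, h.2.1, fun v w hvw => ?_⟩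
  rw [evalAt_cscale, evalAt_cscale, evalAt_cscale, ← mul_add, ← h.2.2 v w hvw]
  rfl

section

variable [FiniteDimensional ℂ E] [FiniteDimensional ℂ F]

theorem mem_left_of_dmul_mem {g h : G} (hgh : K.grpd.src g = K.grpd.tgt h) {v w : E}
    (hvw : K.grpd.dsrc ℂ E F g v = K.grpd.dtgt ℂ E F h w)
    (hm : K.grpd.dmul ℂ E g h (v, w) ∈ K.hyperplane (K.grpd.mul g h)) (hw : w ∈ K.hyperplane h) :
    v ∈ K.hyperplane g := by
  have hL := K.isLieGroupoid
  have hG := hL.isGroupoid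
  have h2 : K.grpd.dsrc ℂ E F h w = K.grpd.dtgt ℂ E F (K.grpd.inv h) (K.grpd.dinv ℂ E h w) :=
    (hL.dtgt_dinv (by simp) h w).symm
  have h1 := K.dmul_mem (h := K.grpd.inv h) (w := K.grpd.dinv ℂ E h w)
    ((hG.src_mul g h hgh).trans (hG.tgt_inv h).symm)
    ((hL.dsrc_dmul (by simp) hgh hvw).trans h2) hm (K.dinv_mem hw)
  rw [hL.dmul_assoc (by simp) hgh (hG.tgt_inv h).symm hvw h2, hL.dmul_dinv (F := F) (by simp),
    hG.mul_assoc g h _ hgh (hG.tgt_inv h).symm, hG.mul_inv, ← hgh, ← hvw,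
    hL.dmul_one_right (by simp), hG.mul_one] at h1
  exact h1

theorem mem_right_of_dmul_mem {g h : G} (hgh : K.grpd.src g = K.grpd.tgt h) {v w : E}
    (hvw : K.grpd.dsrc ℂ E F g v = K.grpd.dtgt ℂ E F h w)
    (hm : K.grpd.dmul ℂ E g h (v, w) ∈ K.hyperplane (K.grpd.mul g h)) (hv : v ∈ K.hyperplane g) :
    w ∈ K.hyperplane h := by
  have hL := K.isLieGroupoid
  have hG := hL.isGroupoid
  have h2 : K.grpd.dsrc ℂ E F (K.grpd.inv g) (K.grpd.dinv ℂ E g v) = K.grpd.dtgt ℂ E F g v :=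
    hL.dsrc_dinv (by simp) g v
  have h1 := K.dmul_mem (g := K.grpd.inv g) (v := K.grpd.dinv ℂ E g v)
    ((hG.src_inv g).trans (hG.tgt_mul g h hgh).symm)
    (h2.trans (hL.dtgt_dmul (by simp) hgh hvw).symm) (K.dinv_mem hv) hm
  rw [← hL.dmul_assoc (by simp) (hG.src_inv g) hgh h2 hvw, hL.dinv_dmul (F := F) (by simp),
    ← hG.mul_assoc _ g h (hG.src_inv g) hgh, hG.inv_mul, hgh, hvw,
    hL.dmul_one_left (by simp), hG.one_mul] at h1
  exact h1

/-- Every nonzero element of the dual of `L_G` over a product is the product of unique elements. -/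
theorem exists_dualMul_of_mul (x : K.conormal.Slit) {g h : G} (hgh : K.grpd.src g = K.grpd.tgt h)
    (hx : x.base = K.grpd.mul g h) :
    ∃ a b, a.base = g ∧ b.base = h ∧ K.DualMul a b x := by
  obtain ⟨τ, hτ⟩ := K.exists_dsrc_section g
  obtain ⟨σ, hσ⟩ := K.exists_dtgt_section h
  let ds := (K.grpd.dsrc ℂ E F g).toLinearMap
  let dt := (K.grpd.dtgt ℂ E F h).toLinearMap
  let dm := (K.grpd.dmul ℂ E g h).toLinearMap
  let a := (K.evalAt x).comp (dm.comp (LinearMap.id.prod (σ.comp ds)))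
  let b := (K.evalAt x).comp (dm.comp ((τ.comp dt).prod LinearMap.id))
  have hzero : ∀ v ∈ K.hyperplane g, ∀ w ∈ K.hyperplane h, ds v = dt w →
      K.evalAt x (dm (v, w)) = 0 := by
    intro v hv w hw hvw
    rw [evalAt_eq_zero_iff, hx]
    exact K.dmul_mem hgh hvw hv hw
  have hab : ∀ v w, ds v = dt w → K.evalAt x (dm (v, w)) = a v + b w := by
    intro v w hvw
    have h1 : ((v, w) : E × E) = (v, σ (ds v)) + (τ (dt w), w) - (τ (dt w), σ (ds v)) := by simp
    rw [h1, map_sub, map_add, map_sub, map_add, hzero (τ (dt w)) (hτ _).1 (σ (ds v)) (hσ _).1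
      ((hτ _).2.trans (hvw.symm.trans (hσ _).2.symm)), sub_zero]
    rfl
  have ha0 : ∀ v ∈ K.hyperplane g, a v = 0 := fun v hv =>
    hzero v hv _ (hσ _).1 (hσ _).2.symm
  have hb0 : ∀ w ∈ K.hyperplane h, b w = 0 := fun w hw =>
    hzero _ (hτ _).1 w hw (hτ _).2
  have hex : ∀ g, ∃ e, e ∉ K.hyperplane g := by
    intro g
    obtain ⟨ε, rfl⟩ := K.exists_base_eq g
    obtain ⟨e, he⟩ := K.exists_evalAt_eq ε 1
    refine ⟨e, fun h => ?_⟩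
    rw [← evalAt_eq_zero_iff, he] at h
    exact one_ne_zero h
  have ha : a ≠ 0 := by
    intro h0
    obtain ⟨e, he⟩ := hex g
    refine he (mem_left_of_dmul_mem hgh (w := σ (ds e)) (hσ _).2.symm ?_ (hσ _).1)
    rw [← hx, ← evalAt_eq_zero_iff]
    exact LinearMap.congr_fun h0 e
  have hb : b ≠ 0 := by
    intro h0
    obtain ⟨e, he⟩ := hex h
    refine he (mem_right_of_dmul_mem hgh (v := τ (dt e)) (hτ _).2 ?_ (hτ _).1)
    rw [← hx, ← evalAt_eq_zero_iff]
    exact LinearMap.congr_fun h0 e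
  obtain ⟨a', rfl, ha'⟩ := K.exists_slit g a ha0 ha
  obtain ⟨b', rfl, hb'⟩ := K.exists_slit h b hb0 hb
  refine ⟨a', b', rfl, rfl, K.dualMul_iff.2 ⟨hgh, hx, fun v w hvw => ?_⟩⟩
  rw [ha', hb']
  exact hab v w hvw

end

theorem DualMul.unique_factors {a b a' b' x : K.conormal.Slit} (h : K.DualMul a b x)
    (h' : K.DualMul a' b' x) (ha : a.base = a'.base) (hb : b.base = b'.base) :
    a = a' ∧ b = b' := by
  rw [dualMul_iff] at h h'
  constructor
  · refine K.slit_ext_evalAt ha fun v => ?_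
    obtain ⟨w, hw, hvw⟩ := K.exists_dtgt_eq b.base (K.grpd.dsrc ℂ E F a.base v)
    have h1 := h.2.2 v w hvw.symm
    rw [ha, hb] at h1 hvw
    rw [h'.2.2 v w hvw.symm, (K.evalAt_eq_zero_iff b' w).2 (hb ▸ hw),
      (K.evalAt_eq_zero_iff b w).2 hw] at h1
    simpa using h1.symm
  · refine K.slit_ext_evalAt hb fun w => ?_
    obtain ⟨v, hv, hvw⟩ := K.exists_dsrc_eq a.base (K.grpd.dtgt ℂ E F b.base w)
    have h1 := h.2.2 v w hvw
    rw [ha, hb] at h1 hvw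
    rw [h'.2.2 v w hvw, (K.evalAt_eq_zero_iff a' v).2 (ha ▸ hv),
      (K.evalAt_eq_zero_iff a v).2 hv] at h1
    simpa using h1.symm

theorem cscale_injective {c : ℂˣ} {ε : K.conormal.Slit} (h : cscale c ε = ε) : c = 1 := by
  obtain ⟨e, he⟩ := K.exists_evalAt_eq ε 1
  have h1 := K.evalAt_cscale c ε e
  rw [h, he, mul_one] at h1
  exact Units.ext h1.symm

theorem DualMul.unique_of_left {a b b' x x' : K.conormal.Slit} (h : K.DualMul a b x)
    (h' : K.DualMul a b' x') (hb : b.base = b'.base) : b = b' ∧ x = x' := by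
  obtain ⟨c, rfl⟩ := exists_cscale_eq (ε := x) (ε' := x') (by rw [h.2.1, h'.2.1, hb])
  have h1 := (h.cscale c).unique_factors h' rfl hb
  obtain rfl := cscale_injective h1.1
  exact ⟨(cscale_one b).symm.trans h1.2, (cscale_one x).symm⟩

section

variable [FiniteDimensional ℂ E] [FiniteDimensional ℂ F]

theorem exists_dualMul_of_left (a : K.conormal.Slit) {h : G}
    (hgh : K.grpd.src a.base = K.grpd.tgt h) : ∃ b x, b.base = h ∧ K.DualMul a b x := by
  obtain ⟨x, hx⟩ := K.exists_base_eq (K.grpd.mul a.base h)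
  obtain ⟨a', b, ha', hb, hm⟩ := exists_dualMul_of_mul x hgh hx
  obtain ⟨c, rfl⟩ := exists_cscale_eq ha'.symm
  exact ⟨HolLineBundle.cscale c b, HolLineBundle.cscale c x, hb, hm.cscale c⟩

/-- The values of the product of three composable elements of the dual of `L_G`. -/
theorem DualMul.evalAt_assoc {a b c x y : K.conormal.Slit} (h : K.DualMul a b x)
    (h' : K.DualMul x c y) {v w u : E}
    (hvw : K.grpd.dsrc ℂ E F a.base v = K.grpd.dtgt ℂ E F b.base w)
    (hwu : K.grpd.dsrc ℂ E F b.base w = K.grpd.dtgt ℂ E F c.base u) :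
    K.evalAt y (K.grpd.dmul ℂ E (K.grpd.mul a.base b.base) c.base
      (K.grpd.dmul ℂ E a.base b.base (v, w), u)) = K.evalAt a v + K.evalAt b w + K.evalAt c u := by
  rw [dualMul_iff] at h h'
  rw [← h.2.2 v w hvw, ← h'.2.2]
  · rw [h.2.1]
  · rw [h.2.1, K.isLieGroupoid.dsrc_dmul (by simp) h.1 hvw, hwu]

theorem DualMul.evalAt_assoc' {a b c y z : K.conormal.Slit} (h : K.DualMul b c z)
    (h' : K.DualMul a z y) {v w u : E}
    (hvw : K.grpd.dsrc ℂ E F a.base v = K.grpd.dtgt ℂ E F b.base w)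
    (hwu : K.grpd.dsrc ℂ E F b.base w = K.grpd.dtgt ℂ E F c.base u) :
    K.evalAt y (K.grpd.dmul ℂ E a.base (K.grpd.mul b.base c.base)
      (v, K.grpd.dmul ℂ E b.base c.base (w, u))) = K.evalAt a v + K.evalAt b w + K.evalAt c u := by
  rw [dualMul_iff] at h h'
  rw [add_assoc, ← h.2.2 w u hwu, ← h'.2.2]
  · rw [h.2.1]
  · rw [h.2.1, K.isLieGroupoid.dtgt_dmul (by simp) h.1 hwu, hvw]

omit [FiniteDimensional ℂ E] [FiniteDimensional ℂ F] in
/-- Factors of a triple product are determined by the product. -/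
theorem eq_of_triple {a b c a' b' c' : K.conormal.Slit} (ha : a.base = a'.base)
    (hb : b.base = b'.base) (hc : c.base = c'.base)
    (hm : ∀ v w u, K.grpd.dsrc ℂ E F a.base v = K.grpd.dtgt ℂ E F b.base w →
      K.grpd.dsrc ℂ E F b.base w = K.grpd.dtgt ℂ E F c.base u →
      K.evalAt a v + K.evalAt b w + K.evalAt c u = K.evalAt a' v + K.evalAt b' w + K.evalAt c' u) :
    a = a' ∧ b = b' ∧ c = c' := by
  have hz : ∀ {p p' : K.conormal.Slit} {v : E}, p.base = p'.base → v ∈ K.hyperplane p.base →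
      K.evalAt p v = 0 ∧ K.evalAt p' v = 0 := fun h hv =>
    ⟨(K.evalAt_eq_zero_iff _ _).2 hv, (K.evalAt_eq_zero_iff _ _).2 (h ▸ hv)⟩
  refine ⟨K.slit_ext_evalAt ha fun v => ?_, K.slit_ext_evalAt hb fun w => ?_,
    K.slit_ext_evalAt hc fun u => ?_⟩
  · obtain ⟨w, hw, hvw⟩ := K.exists_dtgt_eq b.base (K.grpd.dsrc ℂ E F a.base v)
    obtain ⟨u, hu, hwu⟩ := K.exists_dtgt_eq c.base (K.grpd.dsrc ℂ E F b.base w)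
    have h := hm v w u hvw.symm hwu.symm
    simpa [hz hb hw, hz hc hu] using h
  · obtain ⟨v, hv, hvw⟩ := K.exists_dsrc_eq a.base (K.grpd.dtgt ℂ E F b.base w)
    obtain ⟨u, hu, hwu⟩ := K.exists_dtgt_eq c.base (K.grpd.dsrc ℂ E F b.base w)
    have h := hm v w u hvw hwu.symm
    simpa [hz ha hv, hz hc hu] using h
  · obtain ⟨w, hw, hwu⟩ := K.exists_dsrc_eq b.base (K.grpd.dtgt ℂ E F c.base u)
    obtain ⟨v, hv, hvw⟩ := K.exists_dsrc_eq a.base (K.grpd.dtgt ℂ E F b.base w)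
    have h := hm v w u hvw hwu
    simpa [hz hb hw, hz ha hv] using h

theorem DualMul.assoc {a b c x y : K.conormal.Slit} (h : K.DualMul a b x) (h' : K.DualMul x c y) :
    ∃ z, K.DualMul b c z ∧ K.DualMul a z y := by
  have hG := K.isLieGroupoid.isGroupoid
  have hbc : K.grpd.src b.base = K.grpd.tgt c.base := by
    rw [← h'.1, h.2.1, hG.src_mul _ _ h.1]
  have hy : y.base = K.grpd.mul a.base (K.grpd.mul b.base c.base) := by
    rw [h'.2.1, h.2.1, hG.mul_assoc _ _ _ h.1 hbc]
  obtain ⟨a', z, ha', hz, h1⟩ := exists_dualMul_of_mul y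
    (h.1.trans (hG.tgt_mul _ _ hbc).symm) hy
  obtain ⟨b', c', hb', hc', h2⟩ := exists_dualMul_of_mul z hbc hz
  obtain ⟨rfl, rfl, rfl⟩ := eq_of_triple ha'.symm hb'.symm hc'.symm fun v w u hvw hwu => by
    rw [← h.evalAt_assoc h' hvw hwu, ← h2.evalAt_assoc' h1 (by rw [ha', hb']; exact hvw)
      (by rw [hb', hc']; exact hwu), ha', hb', hc',
      K.isLieGroupoid.dmul_assoc (by simp) h.1 hbc hvw hwu]
  exact ⟨z, h2, h1⟩

end

end HolContactGroupoid
end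

noncomputable section

namespace HolContactGroupoid

variable {E F G X : Type*}
  [NormedAddCommGroup E] [NormedSpace ℂ E] [NormedAddCommGroup F] [NormedSpace ℂ F]
  [TopologicalSpace G] [ChartedSpace E G] [IsManifold 𝓘(ℂ, E) ω G]
  [TopologicalSpace X] [ChartedSpace F X] [IsManifold 𝓘(ℂ, F) ω X]
  {K : HolContactGroupoid E F G X}

open HolLineBundle

variable (K) in
theorem tildeOne_base (η : K.coreDual.Slit) : (K.tildeOne η).base = K.grpd.one η.base := rfl

theorem tildeOne_injective : Function.Injective K.tildeOne := by
  rintro ⟨b, v, hv⟩ ⟨b', v', hv'⟩ h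
  have hG := K.isLieGroupoid.isGroupoid
  have h1 : K.grpd.one b = K.grpd.one b' := congrArg Slit.base h
  obtain rfl : b = b' := by rw [← hG.src_one b, h1, hG.src_one]
  have h2 : v = v' := by injection h
  subst h2
  rfl

theorem exists_tildeOne_eq {ε : K.conormal.Slit} {x : X} (h : ε.base = K.grpd.one x) :
    ∃ η, η.base = x ∧ K.tildeOne η = ε := by
  obtain ⟨b, v, hv⟩ := ε
  obtain rfl : b = K.grpd.one x := h
  exact ⟨⟨x, v, hv⟩, rfl, rfl⟩

theorem tildeOne_cscale (c : ℂˣ) (η : K.coreDual.Slit) :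
    K.tildeOne (cscale c η) = cscale c (K.tildeOne η) := rfl

section

variable [FiniteDimensional ℂ E] [FiniteDimensional ℂ F]

theorem exists_dualMul_tildeOne_right (ε : K.conormal.Slit) :
    ∃ η, K.DualMul ε (K.tildeOne η) ε := by
  have hL := K.isLieGroupoid
  have hG := hL.isGroupoid
  obtain ⟨a, b, ha, hb, h⟩ := exists_dualMul_of_mul ε (hG.tgt_one (K.grpd.src ε.base)).symm
    (hG.mul_one ε.base).symm
  obtain ⟨η, hη, rfl⟩ := exists_tildeOne_eq hb
  obtain rfl : a = ε := by
    refine K.slit_ext_evalAt ha fun v => ?_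
    have h1 := (K.dualMul_iff.1 h).2.2 v (K.grpd.done ℂ E F (K.grpd.src ε.base)
      (K.grpd.dsrc ℂ E F ε.base v)) (by rw [hb, hL.dtgt_done (by simp), ha])
    rw [hb, ha, hL.dmul_one_right (by simp), (K.evalAt_eq_zero_iff (K.tildeOne η) _).2
      (hb ▸ K.done_mem _ _), add_zero] at h1
    exact h1.symm
  exact ⟨η, h⟩

theorem exists_dualMul_tildeOne_left (ε : K.conormal.Slit) :
    ∃ η, K.DualMul (K.tildeOne η) ε ε := by
  have hL := K.isLieGroupoid
  have hG := hL.isGroupoid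
  obtain ⟨a, b, ha, hb, h⟩ := exists_dualMul_of_mul ε (hG.src_one (K.grpd.tgt ε.base))
    (hG.one_mul ε.base).symm
  obtain ⟨η, hη, rfl⟩ := exists_tildeOne_eq ha
  obtain rfl : b = ε := by
    refine K.slit_ext_evalAt hb fun v => ?_
    have h1 := (K.dualMul_iff.1 h).2.2 (K.grpd.done ℂ E F (K.grpd.tgt ε.base)
      (K.grpd.dtgt ℂ E F ε.base v)) v (by rw [ha, hL.dsrc_done (by simp), hb])
    rw [hb, ha, hL.dmul_one_left (by simp), (K.evalAt_eq_zero_iff (K.tildeOne η) _).2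
      (ha ▸ K.done_mem _ _), zero_add] at h1
    exact h1.symm
  exact ⟨η, h⟩

variable (K) in
theorem dualMul_src (ε : K.conormal.Slit) : K.DualMul ε (K.tildeOne (K.tilde.src ε)) ε :=
  Classical.epsilon_spec (exists_dualMul_tildeOne_right ε)

variable (K) in
theorem dualMul_tgt (ε : K.conormal.Slit) : K.DualMul (K.tildeOne (K.tilde.tgt ε)) ε ε :=
  Classical.epsilon_spec (exists_dualMul_tildeOne_left ε)

variable (K) in
theorem tilde_src_base (ε : K.conormal.Slit) : (K.tilde.src ε).base = K.grpd.src ε.base :=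
  (K.isLieGroupoid.isGroupoid.tgt_one _).symm.trans (K.dualMul_src ε).1.symm

variable (K) in
theorem tilde_tgt_base (ε : K.conormal.Slit) : (K.tilde.tgt ε).base = K.grpd.tgt ε.base :=
  (K.isLieGroupoid.isGroupoid.src_one _).symm.trans (K.dualMul_tgt ε).1

theorem tilde_src_eq {ε : K.conormal.Slit} {η : K.coreDual.Slit}
    (h : K.DualMul ε (K.tildeOne η) ε) : K.tilde.src ε = η := by
  have h1 : η.base = K.grpd.src ε.base :=
    (K.isLieGroupoid.isGroupoid.tgt_one _).symm.trans h.1.symm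
  exact tildeOne_injective ((K.dualMul_src ε).unique_factors h rfl
    (congrArg K.grpd.one ((K.tilde_src_base ε).trans h1.symm))).2

theorem tilde_tgt_eq {ε : K.conormal.Slit} {η : K.coreDual.Slit}
    (h : K.DualMul (K.tildeOne η) ε ε) : K.tilde.tgt ε = η := by
  have h1 : η.base = K.grpd.tgt ε.base :=
    (K.isLieGroupoid.isGroupoid.src_one _).symm.trans h.1
  exact tildeOne_injective ((K.dualMul_tgt ε).unique_factors h
    (congrArg K.grpd.one ((K.tilde_tgt_base ε).trans h1.symm)) rfl).1

/-- Elements of the dual of `L_G` can be multiplied if and only if they are composable. -/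
theorem exists_dualMul_iff {a b : K.conormal.Slit} :
    (∃ x, K.DualMul a b x) ↔ K.tilde.src a = K.tilde.tgt b := by
  have key : ∀ {a b x : K.conormal.Slit}, K.DualMul a b x →
      K.DualMul (K.tildeOne (K.tilde.src a)) b b ∧ K.DualMul a b x := by
    intro a b x h
    obtain ⟨z, hz, hz'⟩ := (K.dualMul_src a).assoc h
    obtain ⟨-, rfl⟩ := hz'.unique_factors h rfl (by
      rw [hz.2.1, tildeOne_base, tilde_src_base, h.1, K.isLieGroupoid.isGroupoid.one_mul])
    exact ⟨hz, h⟩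
  constructor
  · rintro ⟨x, h⟩
    exact (tilde_tgt_eq (key h).1).symm
  · intro h
    have h0 : K.grpd.src a.base = K.grpd.tgt b.base := by
      rw [← tilde_src_base, ← tilde_tgt_base, h]
    obtain ⟨b', x, hb', hx⟩ := exists_dualMul_of_left a h0
    have h1 := (key hx).1
    have h2 := K.dualMul_tgt b
    rw [← h] at h2
    obtain ⟨rfl, -⟩ := h1.unique_of_left h2 hb'
    exact ⟨x, hx⟩

theorem dualMul_mul {a b : K.conormal.Slit} (h : K.tilde.src a = K.tilde.tgt b) :
    K.DualMul a b (K.tilde.mul a b) :=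
  Classical.epsilon_spec (exists_dualMul_iff.2 h)

theorem DualMul.mul_eq {a b x : K.conormal.Slit} (h : K.DualMul a b x) : K.tilde.mul a b = x :=
  ((dualMul_mul (exists_dualMul_iff.1 ⟨x, h⟩)).unique_of_left h rfl).2

theorem tilde_mul_base {a b : K.conormal.Slit} (h : K.tilde.src a = K.tilde.tgt b) :
    (K.tilde.mul a b).base = K.grpd.mul a.base b.base := (dualMul_mul h).2.1

theorem DualMul.src_eq {a b x : K.conormal.Slit} (h : K.DualMul a b x) :
    K.tilde.src x = K.tilde.src b := by
  obtain ⟨z, hz, hz'⟩ := h.assoc (K.dualMul_src x)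
  obtain ⟨-, rfl⟩ := hz'.unique_factors h rfl (by
    rw [hz.2.1, tildeOne_base, tilde_src_base, h.2.1, K.isLieGroupoid.isGroupoid.src_mul _ _ h.1,
      K.isLieGroupoid.isGroupoid.mul_one])
  exact (tilde_src_eq hz).symm

theorem DualMul.tgt_eq {a b x : K.conormal.Slit} (h : K.DualMul a b x) :
    K.tilde.tgt x = K.tilde.tgt a := by
  obtain ⟨z, hz, hz'⟩ := (K.dualMul_tgt a).assoc h
  obtain ⟨-, rfl⟩ := hz.unique_of_left h rfl
  exact tilde_tgt_eq hz'

variable (K) in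
omit [FiniteDimensional ℂ E] [FiniteDimensional ℂ F] in
theorem dualMul_one (η : K.coreDual.Slit) :
    K.DualMul (K.tildeOne η) (K.tildeOne η) (K.tildeOne η) := by
  have hL := K.isLieGroupoid
  have hG := hL.isGroupoid
  set x := η.base
  have hx : K.grpd.src (K.grpd.one x) = x := hG.src_one x
  have hx' : K.grpd.tgt (K.grpd.one x) = x := hG.tgt_one x
  refine K.dualMul_iff.2 ⟨hx.trans hx'.symm, ?_, fun v w hvw => ?_⟩
  · have h1 := hG.one_mul (K.grpd.one x)
    rw [hx'] at h1
    exact h1.symm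
  change K.grpd.dsrc ℂ E F (K.grpd.one x) v = K.grpd.dtgt ℂ E F (K.grpd.one x) w at hvw
  change K.evalAt _ (K.grpd.dmul ℂ E (K.grpd.one x) (K.grpd.one x) (v, w)) = _
  set u := K.grpd.dsrc ℂ E F (K.grpd.one x) v with hu
  have h1 := hL.dmul_one_right (by simp) (K.grpd.one x) v
  have h2 := hL.dmul_one_left (by simp) (K.grpd.one x) w
  have h3 := hL.dmul_one_left (by simp) (K.grpd.one x) (K.grpd.done ℂ E F x u)
  have h4 := hL.dtgt_done (by simp) x u
  rw [hx] at h1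
  rw [hx'] at h2 h3
  rw [← hvw] at h2
  rw [h4] at h3
  rw [← hu] at h1
  have h5 : ((v, w) : E × E) = (v, K.grpd.done ℂ E F x u) + (K.grpd.done ℂ E F x u, w) -
      (K.grpd.done ℂ E F x u, K.grpd.done ℂ E F x u) := by simp
  rw [h5, map_sub, map_add, h1, h2, h3, map_sub, map_add,
    (K.evalAt_eq_zero_iff (K.tildeOne η) (K.grpd.done ℂ E F x u)).2 (K.done_mem x u), sub_zero]

theorem tilde_src_one (η : K.coreDual.Slit) : K.tilde.src (K.tilde.one η) = η :=
  tilde_src_eq (K.dualMul_one η)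

theorem tilde_tgt_one (η : K.coreDual.Slit) : K.tilde.tgt (K.tilde.one η) = η :=
  tilde_tgt_eq (K.dualMul_one η)

theorem exists_dualMul_inv (ε : K.conormal.Slit) :
    ∃ ε' η, K.DualMul ε ε' (K.tildeOne η) := by
  have hG := K.isLieGroupoid.isGroupoid
  obtain ⟨ε', x, h', h⟩ := exists_dualMul_of_left ε (hG.tgt_inv ε.base).symm
  obtain ⟨η, -, rfl⟩ := exists_tildeOne_eq (x := K.grpd.tgt ε.base)
    (h.2.1.trans (by rw [h', hG.mul_inv]))
  exact ⟨ε', η, h⟩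

variable (K) in
theorem dualMul_inv (ε : K.conormal.Slit) :
    K.DualMul ε (K.tilde.inv ε) (K.tildeOne (K.tilde.tgt ε)) := by
  obtain ⟨η, h⟩ := Classical.epsilon_spec (exists_dualMul_inv ε)
  have h1 : K.tilde.tgt ε = η := by rw [← h.tgt_eq]; exact tilde_tgt_one η
  rw [h1]
  exact h

variable (K) in
theorem tilde_inv_base (ε : K.conormal.Slit) : (K.tilde.inv ε).base = K.grpd.inv ε.base :=
  K.isLieGroupoid.isGroupoid.eq_inv (K.dualMul_inv ε).1 (K.dualMul_inv ε).2.1.symm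

variable (K) in
theorem isGroupoid_tilde : K.tilde.IsGroupoid where
  src_mul g h hgh := (dualMul_mul hgh).src_eq
  tgt_mul g h hgh := (dualMul_mul hgh).tgt_eq
  mul_assoc g h k hgh hhk := by
    have h1 := dualMul_mul hgh
    obtain ⟨z, hz, hz'⟩ := h1.assoc (dualMul_mul (h1.src_eq.trans hhk))
    rw [hz.mul_eq, hz'.mul_eq]
  src_one := tilde_src_one
  tgt_one := tilde_tgt_one
  one_mul g := (K.dualMul_tgt g).mul_eq
  mul_one g := (K.dualMul_src g).mul_eq
  src_inv g := by rw [← (K.dualMul_inv g).src_eq]; exact tilde_src_one _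
  tgt_inv g := (exists_dualMul_iff.1 ⟨_, K.dualMul_inv g⟩).symm
  mul_inv g := (K.dualMul_inv g).mul_eq
  inv_mul g := by
    have h0 : K.tilde.src (K.tilde.inv g) = K.tilde.tgt g := by
      rw [← (K.dualMul_inv g).src_eq]; exact tilde_src_one _
    obtain ⟨z, hz, hz'⟩ := (K.dualMul_inv g).assoc (K.dualMul_tgt g)
    rw [hz.mul_eq]
    refine (hz'.unique_factors (K.dualMul_src g) rfl ?_).2
    rw [hz.2.1, tilde_inv_base, K.isLieGroupoid.isGroupoid.inv_mul, tildeOne_base, tilde_src_base]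

theorem tilde_src_cscale (c : ℂˣ) (ε : K.conormal.Slit) :
    K.tilde.src (cscale c ε) = cscale c (K.tilde.src ε) :=
  tilde_src_eq ((K.dualMul_src ε).cscale c)

theorem tilde_tgt_cscale (c : ℂˣ) (ε : K.conormal.Slit) :
    K.tilde.tgt (cscale c ε) = cscale c (K.tilde.tgt ε) :=
  tilde_tgt_eq ((K.dualMul_tgt ε).cscale c)

theorem tilde_mul_cscale (c : ℂˣ) {a b : K.conormal.Slit} (h : K.tilde.src a = K.tilde.tgt b) :
    K.tilde.mul (cscale c a) (cscale c b) = cscale c (K.tilde.mul a b) :=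
  ((dualMul_mul h).cscale c).mul_eq

theorem tilde_inv_cscale (c : ℂˣ) (ε : K.conormal.Slit) :
    K.tilde.inv (cscale c ε) = cscale c (K.tilde.inv ε) := by
  have h1 := (K.dualMul_inv ε).cscale c
  rw [← tildeOne_cscale, ← tilde_tgt_cscale] at h1
  exact ((K.dualMul_inv (cscale c ε)).unique_factors h1 rfl
    ((K.tilde_inv_base _).trans (K.tilde_inv_base ε).symm)).2

end

end HolContactGroupoid
end

noncomputable section

attribute [local instance] isManifold_complexToReal

section

variable {𝕜 : Type*} [RCLike 𝕜] {D : Type*} [NormedAddCommGroup D] [NormedSpace 𝕜 D]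
  {M : Type*} [TopologicalSpace M] [ChartedSpace D M]
  {W : Type*} [NormedAddCommGroup W] [NormedSpace 𝕜 W]

/-- The value of a one-form on the derivative of a map depends analytically on the point. -/
theorem contDiffAt_form_mfderiv [IsManifold 𝓘(𝕜, D) ω M]
    {α : ∀ x : M, TangentSpace 𝓘(𝕜, D) x →L[𝕜] 𝕜} {f : W → M} {p : W}
    (hα : ContMDiffAt 𝓘(𝕜, D) (𝓘(𝕜, D).prod 𝓘(𝕜, D →L[𝕜] 𝕜)) ω
      (fun g => Bundle.TotalSpace.mk' (D →L[𝕜] 𝕜)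
      (E := fun g : M => TangentSpace 𝓘(𝕜, D) g →L[𝕜] Bundle.Trivial M 𝕜 g) g (α g)) (f p))
    (hf : ContMDiffAt 𝓘(𝕜, W) 𝓘(𝕜, D) ω f p) (w : W) :
    ContDiffAt 𝕜 ω (fun q => formAt α (f q) ((mfderiv 𝓘(𝕜, W) 𝓘(𝕜, D) f q : W →L[𝕜] D) w)) p := by
  have : IsManifold 𝓘(𝕜, D) 1 M := IsManifold.of_le (n := ω) le_top
  obtain ⟨a, ha, h⟩ := exists_chartForm hα
  have hF : ContDiffAt 𝕜 ω (fun q => chartAt D (f p) (f q)) p := by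
    have h1 : ContMDiffAt 𝓘(𝕜, D) 𝓘(𝕜, D) ω (chartAt D (f p)) (f p) :=
      contMDiffAt_of_mem_maximalAtlas (IsManifold.chart_mem_maximalAtlas _) (mem_chart_source D _)
    exact (h1.comp p hf).contDiffAt
  have h2 : ContDiffAt 𝕜 ω (fun q => a (chartAt D (f p) (f q))
      (fderiv 𝕜 (fun q => chartAt D (f p) (f q)) q w)) p :=
    (ha.comp p hF).clm_apply ((hF.fderiv_right le_rfl).clm_apply contDiffAt_const)
  refine h2.congr_of_eventuallyEq ?_
  have h3 : ∀ᶠ q in 𝓝 p, ContMDiffAt 𝓘(𝕜, W) 𝓘(𝕜, D) ω f q := 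
    (contMDiffAt_iff_contMDiffAt_nhds (by simp)).1 hf
  have h4 : ∀ᶠ q in 𝓝 p, f q ∈ (chartAt D (f p)).source :=
    hf.continuousAt.eventually_mem ((chartAt D (f p)).open_source.mem_nhds (mem_chart_source D _))
  filter_upwards [h3, h4] with q hq hq'
  set L : W →L[𝕜] D := mfderiv 𝓘(𝕜, W) 𝓘(𝕜, D) f q
  have h5 : HasMFDerivAt 𝓘(𝕜, W) 𝓘(𝕜, D) (fun q => chartAt D (f p) (f q)) q
      ((chartDeriv 𝕜 (f p) (f q)).comp L : W →L[𝕜] D) :=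
    (hasMFDerivAt_chartAt hq').comp_eq ((hq.mdifferentiableAt (by simp)).hasMFDerivAt) rfl
  have h6 : HasFDerivAt (fun q => chartAt D (f p) (f q)) ((chartDeriv 𝕜 (f p) (f q)).comp L) q :=
    hasMFDerivAt_iff_hasFDerivAt.1 h5
  exact (h _ hq' _).symm.trans (congrArg _ (DFunLike.congr_fun h6.fderiv w).symm)

/-- The inverse of the preferred chart at a point has the identity as derivative. -/
theorem hasMFDerivAt_chartAt_symm_self [IsManifold 𝓘(𝕜, D) 1 M] (x : M) :
    HasMFDerivAt 𝓘(𝕜, D) 𝓘(𝕜, D) (chartAt D x).symm (chartAt D x x)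
      (ContinuousLinearMap.id 𝕜 D : D →L[𝕜] D) := by
  have h1 := ((contMDiffAt_chartAt_symm (𝕜 := 𝕜) (n := 1)
    ((chartAt D x).map_source (mem_chart_source D x))).mdifferentiableAt (by simp)).hasMFDerivAt
  set L : D →L[𝕜] D := mfderiv 𝓘(𝕜, D) 𝓘(𝕜, D) (chartAt D x).symm (chartAt D x x)
  have h2 := (hasMFDerivAt_chartAt (𝕜 := 𝕜) (mem_chart_source D x)).comp_eq h1
    ((chartAt D x).left_inv (mem_chart_source D x))
  rw [chartDeriv_self] at h2
  have h3 : L = ContinuousLinearMap.id 𝕜 D := by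
    ext v
    refine h2.eq_apply (hasMFDerivAt_id (I := 𝓘(𝕜, D)) _) ?_ v
    filter_upwards [(chartAt D x).open_target.mem_nhds
      ((chartAt D x).map_source (mem_chart_source D x))] with z hz
    exact (chartAt D x).right_inv hz
  exact h3 ▸ h1

end

namespace HolContactGroupoid

variable {E F G X : Type*}
  [NormedAddCommGroup E] [NormedSpace ℂ E] [NormedAddCommGroup F] [NormedSpace ℂ F]
  [TopologicalSpace G] [ChartedSpace E G] [IsManifold 𝓘(ℂ, E) ω G]
  [TopologicalSpace X] [ChartedSpace F X] [IsManifold 𝓘(ℂ, F) ω X]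
  {K : HolContactGroupoid E F G X}

open HolLineBundle

theorem evalAt_eq_ratio_mul {φ : Set G × (∀ g, Conormal K.H g)}
    {α : ∀ g : G, TangentSpace 𝓘(ℂ, E) g →L[ℂ] ℂ}
    (h : ∀ g ∈ φ.1, ∀ (ξ : Conormal K.H g) (v : E), ξ.eval v = ratio (φ.2 g) ξ * formAt α g v)
    (ε : K.conormal.Slit) {g : G} (hg : ε.base = g) (hε : g ∈ φ.1) (v : E) :
    K.evalAt ε v = ratio (φ.2 ε.base) ε.vec * formAt α g v := by
  subst hg
  exact h _ hε _ _

variable [FiniteDimensional ℂ E] [FiniteDimensional ℂ F]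

/-- In terms of local frames, the multiplication of the dual of `L_G` is given by two holomorphic
functions of the composable pairs of arrows. -/
theorem exists_dualMul_coefficients {g₀ h₀ : G} (hgh : K.grpd.src g₀ = K.grpd.tgt h₀)
    {φ₁ φ₂ φ₃ : Set G × (∀ g, Conormal K.H g)} (hφ₁ : φ₁ ∈ K.conormal.frames)
    (hφ₂ : φ₂ ∈ K.conormal.frames) (hφ₃ : φ₃ ∈ K.conormal.frames) (h₁ : g₀ ∈ φ₁.1)
    (h₂ : h₀ ∈ φ₂.1) (h₃ : K.grpd.mul g₀ h₀ ∈ φ₃.1) :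
    ∃ A B : G × G → ℂ, ContMDiffAt (𝓘(ℂ, E).prod 𝓘(ℂ, E)) 𝓘(ℂ, ℂ) ω A (g₀, h₀) ∧
      ContMDiffAt (𝓘(ℂ, E).prod 𝓘(ℂ, E)) 𝓘(ℂ, ℂ) ω B (g₀, h₀) ∧
      A (g₀, h₀) ≠ 0 ∧ B (g₀, h₀) ≠ 0 ∧
      ∀ᶠ p in 𝓝 (g₀, h₀), ∀ a b x : K.conormal.Slit, a.base = p.1 → b.base = p.2 →
        K.DualMul a b x →
        ratio (φ₁.2 a.base) a.vec = ratio (φ₃.2 x.base) x.vec * A p ∧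
        ratio (φ₂.2 b.base) b.vec = ratio (φ₃.2 x.base) x.vec * B p := by
  have hL := K.isLieGroupoid
  obtain ⟨α₁, hα₁, e₁⟩ := K.exists_form_of_frame hφ₁
  obtain ⟨α₂, hα₂, e₂⟩ := K.exists_form_of_frame hφ₂
  obtain ⟨α₃, hα₃, e₃⟩ := K.exists_form_of_frame hφ₃
  obtain ⟨ρ, ρ', hρ, hρ', hρ0, hρt, hρe, hρw⟩ := hL.exists_pair_retraction (by simp) hgh
  set c₁ := chartAt E g₀
  set c₂ := chartAt E h₀
  have m₁ : g₀ ∈ c₁.source := mem_chart_source E g₀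
  have m₂ : h₀ ∈ c₂.source := mem_chart_source E h₀
  set p₀ : E × E := (c₁ g₀, c₂ h₀)
  -- the parametrization of the composable pairs
  set f₁ : E × E → G := fun p => c₁.symm p.1
  set f₂ : E × E → G := fun p => ρ (c₁.symm p.1, c₂.symm p.2)
  set f₃ : E × E → G := fun p => K.grpd.mul (f₁ p) (f₂ p)
  have v₁ : f₁ p₀ = g₀ := c₁.left_inv m₁
  have v₁' : c₂.symm p₀.2 = h₀ := c₂.left_inv m₂
  have v₂ : f₂ p₀ = h₀ := by
    change ρ (f₁ p₀, c₂.symm p₀.2) = h₀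
    rw [v₁, v₁', hρ0]
  have v₃ : f₃ p₀ = K.grpd.mul g₀ h₀ := by change K.grpd.mul (f₁ p₀) (f₂ p₀) = _; rw [v₁, v₂]
  have s₁ : ContMDiffAt 𝓘(ℂ, E × E) 𝓘(ℂ, E) ω f₁ p₀ := by
    have := contMDiffAt_chartAt_symm (𝕜 := ℂ) (n := ω) (c₁.map_source m₁)
    exact this.comp p₀ contDiffAt_fst.contMDiffAt
  have s₁' : ContMDiffAt 𝓘(ℂ, E × E) 𝓘(ℂ, E) ω (fun p : E × E => c₂.symm p.2) p₀ := by
    have := contMDiffAt_chartAt_symm (𝕜 := ℂ) (n := ω) (c₂.map_source m₂)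
    exact this.comp p₀ contDiffAt_snd.contMDiffAt
  have s₁₂ := s₁.prodMk s₁'
  have v₁₂ : (f₁ p₀, c₂.symm p₀.2) = (g₀, h₀) := by rw [v₁, v₁']
  have s₂ : ContMDiffAt 𝓘(ℂ, E × E) 𝓘(ℂ, E) ω f₂ p₀ := by
    rw [← v₁₂] at hρ
    exact hρ.comp p₀ s₁₂
  have hc : ∀ᶠ p in 𝓝 p₀, K.grpd.src (f₁ p) = K.grpd.tgt (f₂ p) := by
    rw [← v₁₂] at hρt
    exact s₁₂.continuousAt.eventually hρt
  have s₃ : ContMDiffAt 𝓘(ℂ, E × E) 𝓘(ℂ, E) ω f₃ p₀ := by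
    have h1 := hL.contMDiffOn_mul (f₁ p₀, f₂ p₀) hc.self_of_nhds
    have h2 := (s₁.prodMk s₂).contMDiffWithinAt (s := {p | K.grpd.src (f₁ p) = K.grpd.tgt (f₂ p)})
    exact (ContMDiffWithinAt.comp p₀ h1 h2 (fun p hp => hp)).contMDiffAt hc
  have M1 : IsManifold 𝓘(ℂ, E) 1 G := IsManifold.of_le (n := ω) le_top
  have d₁ : HasMFDerivAt 𝓘(ℂ, E × E) 𝓘(ℂ, E) f₁ p₀ (ContinuousLinearMap.fst ℂ E E) :=
    (hasMFDerivAt_chartAt_symm_self (𝕜 := ℂ) g₀).comp_eq (f := Prod.fst)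
      (hasFDerivAt_fst (p := p₀)).hasMFDerivAt rfl
  have d₁' : HasMFDerivAt 𝓘(ℂ, E × E) 𝓘(ℂ, E) (fun p : E × E => c₂.symm p.2) p₀
      (ContinuousLinearMap.snd ℂ E E) :=
    (hasMFDerivAt_chartAt_symm_self (𝕜 := ℂ) h₀).comp_eq (f := Prod.snd)
      (hasFDerivAt_snd (p := p₀)).hasMFDerivAt rfl
  have d₂ : HasMFDerivAt 𝓘(ℂ, E × E) 𝓘(ℂ, E) f₂ p₀ ρ' := by
    have h1 : HasMFDerivAt 𝓘(ℂ, E × E) 𝓘(ℂ, E) f₂ p₀ (ρ'.comp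
        ((ContinuousLinearMap.fst ℂ E E).prod (ContinuousLinearMap.snd ℂ E E)) : E × E →L[ℂ] E) :=
      hρ'.comp_eq (d₁.prodMk d₁') v₁₂
    exact h1
  obtain ⟨v0, hv0⟩ := K.exists_form_ne_zero hα₁ h₁
  obtain ⟨w0, hw0, hw0'⟩ : ∃ w0, K.grpd.dtgt ℂ E F h₀ w0 = 0 ∧ formAt α₂ h₀ w0 ≠ 0 := by
    obtain ⟨w, hw⟩ := K.exists_form_ne_zero hα₂ h₂
    obtain ⟨w', hw', hw''⟩ := K.exists_dtgt_eq h₀ (K.grpd.dtgt ℂ E F h₀ w)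
    refine ⟨w - w', by rw [map_sub, hw'', sub_self], ?_⟩
    have : formAt α₂ h₀ w' = 0 := (hα₂.mem_iff h₀ h₂ w').1 hw'
    rwa [map_sub, this, sub_zero]
  have sm : ∀ (α : ∀ g : G, TangentSpace 𝓘(ℂ, E) g →L[ℂ] ℂ) (U : Set G) (f : E × E → G) (g : G)
      (w : E × E), IsDefiningForm ω K.H U α → g ∈ U → f p₀ = g →
      ContMDiffAt 𝓘(ℂ, E × E) 𝓘(ℂ, E) ω f p₀ → ContDiffAt ℂ ω
        (fun q => formAt α (f q) ((mfderiv 𝓘(ℂ, E × E) 𝓘(ℂ, E) f q : E × E →L[ℂ] E) w)) p₀ := by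
    intro α U f g w hα hg hf hs
    subst hf
    exact contDiffAt_form_mfderiv (hα.contMDiffOn.contMDiffAt (hα.isOpen.mem_nhds hg)) hs w
  let D₁ : E × E → E × E →L[ℂ] E := fun q => mfderiv 𝓘(ℂ, E × E) 𝓘(ℂ, E) f₁ q
  let D₂ : E × E → E × E →L[ℂ] E := fun q => mfderiv 𝓘(ℂ, E × E) 𝓘(ℂ, E) f₂ q
  let D₃ : E × E → E × E →L[ℂ] E := fun q => mfderiv 𝓘(ℂ, E × E) 𝓘(ℂ, E) f₃ q
  set a₁ : E × E → ℂ := fun q => formAt α₁ (f₁ q) (D₁ q (v0, 0)) with ha₁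
  set a₂ : E × E → ℂ := fun q => formAt α₂ (f₂ q) (D₂ q (v0, 0)) with ha₂
  set a₃ : E × E → ℂ := fun q => formAt α₃ (f₃ q) (D₃ q (v0, 0)) with ha₃
  set b₂ : E × E → ℂ := fun q => formAt α₂ (f₂ q) (D₂ q (0, w0)) with hb₂
  set b₃ : E × E → ℂ := fun q => formAt α₃ (f₃ q) (D₃ q (0, w0)) with hb₃
  have sa₁ : ContDiffAt ℂ ω a₁ p₀ := sm _ _ _ _ _ hα₁ h₁ v₁ s₁
  have sa₂ : ContDiffAt ℂ ω a₂ p₀ := sm _ _ _ _ _ hα₂ h₂ v₂ s₂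
  have sa₃ : ContDiffAt ℂ ω a₃ p₀ := sm _ _ _ _ _ hα₃ h₃ v₃ s₃
  have sb₂ : ContDiffAt ℂ ω b₂ p₀ := sm _ _ _ _ _ hα₂ h₂ v₂ s₂
  have sb₃ : ContDiffAt ℂ ω b₃ p₀ := sm _ _ _ _ _ hα₃ h₃ v₃ s₃
  have na₁ : a₁ p₀ ≠ 0 := by
    have h1 : D₁ p₀ = ContinuousLinearMap.fst ℂ E E := d₁.mfderiv
    simp only [ha₁, h1, v₁]
    exact hv0
  have nb₂ : b₂ p₀ ≠ 0 := by
    have h1 : D₂ p₀ = ρ' := d₂.mfderiv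
    simp only [hb₂, h1, v₂]
    rwa [hρw 0 w0 (by rw [map_zero, hw0])]
  -- the relations along the parametrization
  have rel : ∀ᶠ p in 𝓝 p₀, ∀ a b x : K.conormal.Slit, a.base = f₁ p → b.base = f₂ p →
      K.DualMul a b x →
      ratio (φ₁.2 a.base) a.vec = ratio (φ₃.2 x.base) x.vec * ((a₃ p - b₃ p / b₂ p * a₂ p) / a₁ p) ∧
      ratio (φ₂.2 b.base) b.vec = ratio (φ₃.2 x.base) x.vec * (b₃ p / b₂ p) := by
    have u : ∀ (U : Set G) (f : E × E → G) (g : G), IsOpen U → g ∈ U → f p₀ = g →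
        ContMDiffAt 𝓘(ℂ, E × E) 𝓘(ℂ, E) ω f p₀ → ∀ᶠ p in 𝓝 p₀, f p ∈ U := by
      intro U f g hU hg hf hs
      subst hf
      exact hs.continuousAt.eventually_mem (hU.mem_nhds hg)
    filter_upwards [u _ _ _ hα₁.isOpen h₁ v₁ s₁, u _ _ _ hα₂.isOpen h₂ v₂ s₂,
      u _ _ _ hα₃.isOpen h₃ v₃ s₃, hc.eventually_nhds,
      (contMDiffAt_iff_contMDiffAt_nhds (by simp)).1 s₁,
      (contMDiffAt_iff_contMDiffAt_nhds (by simp)).1 s₂,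
      sa₁.continuousAt.eventually_ne na₁, sb₂.continuousAt.eventually_ne nb₂]
      with p i₁ i₂ i₃ hcp t₁ t₂ n₁ n₂ a b x ha hb hab
    have hx : x.base = f₃ p := by rw [hab.2.1, ha, hb]
    have k₁ : HasMFDerivAt 𝓘(ℂ, E × E) 𝓘(ℂ, E) f₁ p (D₁ p) :=
      (t₁.mdifferentiableAt (by simp)).hasMFDerivAt
    have k₂ : HasMFDerivAt 𝓘(ℂ, E × E) 𝓘(ℂ, E) f₂ p (D₂ p) :=
      (t₂.mdifferentiableAt (by simp)).hasMFDerivAt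
    have k₃ : D₃ p = (K.grpd.dmul ℂ E (f₁ p) (f₂ p)).comp ((D₁ p).prod (D₂ p)) :=
      (hL.hasMFDerivAt_mul (by simp) k₁ k₂ rfl rfl hcp).mfderiv
    have key : ∀ q, ratio (φ₃.2 x.base) x.vec * formAt α₃ (f₃ p) (D₃ p q) =
        ratio (φ₁.2 a.base) a.vec * formAt α₁ (f₁ p) (D₁ p q) +
        ratio (φ₂.2 b.base) b.vec * formAt α₂ (f₂ p) (D₂ p q) := by
      intro q
      have hq : K.grpd.dsrc ℂ E F (f₁ p) (D₁ p q) = K.grpd.dtgt ℂ E F (f₂ p) (D₂ p q) :=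
        ((hL.hasMFDerivAt_src (by simp) _).comp_eq k₁ rfl).eq_apply
          ((hL.hasMFDerivAt_tgt (by simp) _).comp_eq k₂ rfl) hcp q
      rw [← evalAt_eq_ratio_mul e₁ a ha i₁, ← evalAt_eq_ratio_mul e₂ b hb i₂,
        ← evalAt_eq_ratio_mul e₃ x hx i₃, k₃]
      have := (K.dualMul_iff.1 hab).2.2 (D₁ p q) (D₂ p q) (by rw [ha, hb]; exact hq)
      rw [ha, hb] at this
      exact this
    have z₁ : D₁ p (0, w0) = 0 := by
      have h1 : HasMFDerivAt 𝓘(ℂ, E) 𝓘(ℂ, E) (fun y => f₁ (p.1, y)) p.2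
          ((D₁ p).comp (ContinuousLinearMap.inr ℂ E E) : E →L[ℂ] E) :=
        k₁.comp_eq (hasFDerivAt_prodMk_right p.1 p.2).hasMFDerivAt rfl
      exact h1.eq_apply (hasMFDerivAt_const (f₁ p) _) (Filter.Eventually.of_forall fun y => rfl) w0
    have r1 := key (0, w0)
    have r2 := key (v0, 0)
    rw [z₁, map_zero, mul_zero, zero_add] at r1
    have r3 : ratio (φ₂.2 b.base) b.vec = ratio (φ₃.2 x.base) x.vec * (b₃ p / b₂ p) := by
      rw [mul_div_assoc', eq_div_iff n₂]
      exact r1.symm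
    refine ⟨?_, r3⟩
    rw [mul_div_assoc', eq_div_iff n₁]
    rw [r3] at r2
    linear_combination -r2
  have sB : ContDiffAt ℂ ω (fun p => b₃ p / b₂ p) p₀ := sb₃.div sb₂ nb₂
  have sA : ContDiffAt ℂ ω (fun p => (a₃ p - b₃ p / b₂ p * a₂ p) / a₁ p) p₀ :=
    (sa₃.sub (sB.mul sa₂)).div sa₁ na₁
  have sc : ContMDiffAt (𝓘(ℂ, E).prod 𝓘(ℂ, E)) 𝓘(ℂ, E × E) ω (fun p : G × G => (c₁ p.1, c₂ p.2))
      (g₀, h₀) :=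
    ((contMDiffAt_chartAt_of_mem (𝕜 := ℂ) m₁).comp (g₀, h₀) contMDiffAt_fst).prodMk_space
      ((contMDiffAt_chartAt_of_mem (𝕜 := ℂ) m₂).comp (g₀, h₀) contMDiffAt_snd)
  have rel' : ∀ᶠ p in 𝓝 (g₀, h₀), ∀ a b x : K.conormal.Slit, a.base = p.1 → b.base = p.2 →
      K.DualMul a b x →
      ratio (φ₁.2 a.base) a.vec = ratio (φ₃.2 x.base) x.vec *
        ((a₃ (c₁ p.1, c₂ p.2) - b₃ (c₁ p.1, c₂ p.2) / b₂ (c₁ p.1, c₂ p.2) * a₂ (c₁ p.1, c₂ p.2)) /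
          a₁ (c₁ p.1, c₂ p.2)) ∧
      ratio (φ₂.2 b.base) b.vec = ratio (φ₃.2 x.base) x.vec *
        (b₃ (c₁ p.1, c₂ p.2) / b₂ (c₁ p.1, c₂ p.2)) := by
    filter_upwards [sc.continuousAt.eventually rel, hρe,
      (c₁.open_source.prod c₂.open_source).mem_nhds (show (g₀, h₀) ∈ _ from ⟨m₁, m₂⟩)]
      with p hp hρp hps a b x ha hb hab
    have l₁ : f₁ (c₁ p.1, c₂ p.2) = p.1 := c₁.left_inv hps.1
    have l₂ : f₂ (c₁ p.1, c₂ p.2) = p.2 := by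
      have : f₂ (c₁ p.1, c₂ p.2) = ρ (c₁.symm (c₁ p.1), c₂.symm (c₂ p.2)) := rfl
      rw [this, c₁.left_inv hps.1, c₂.left_inv hps.2]
      exact hρp (by rw [← ha, ← hb]; exact hab.1)
    exact hp a b x (ha.trans l₁.symm) (hb.trans l₂.symm) hab
  obtain ⟨x, hx⟩ := K.exists_base_eq (K.grpd.mul g₀ h₀)
  obtain ⟨a, b, ha, hb, hab⟩ := exists_dualMul_of_mul x hgh hx
  have rel0 := rel'.self_of_nhds a b x ha hb hab
  refine ⟨fun p => (a₃ (c₁ p.1, c₂ p.2) - b₃ (c₁ p.1, c₂ p.2) / b₂ (c₁ p.1, c₂ p.2) *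
    a₂ (c₁ p.1, c₂ p.2)) / a₁ (c₁ p.1, c₂ p.2),
    fun p => b₃ (c₁ p.1, c₂ p.2) / b₂ (c₁ p.1, c₂ p.2),
    sA.contMDiffAt.comp (g₀, h₀) sc, sB.contMDiffAt.comp (g₀, h₀) sc, fun h0 => ?_,
    fun h0 => ?_, rel'⟩
  · have h1 : ratio (φ₁.2 a.base) a.vec = 0 := by
      rw [rel0.1]
      exact mul_eq_zero_of_right _ h0
    exact K.conormal.ratio_ne_zero (K.conormal.ne_zero _ hφ₁ _ (ha ▸ h₁)) a.ne_zero h1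
  · have h1 : ratio (φ₂.2 b.base) b.vec = 0 := by
      rw [rel0.2]
      exact mul_eq_zero_of_right _ h0
    exact K.conormal.ratio_ne_zero (K.conormal.ne_zero _ hφ₂ _ (hb ▸ h₂)) b.ne_zero h1

end HolContactGroupoid
end

noncomputable section

attribute [local instance] isManifold_complexToReal

namespace HolLineBundle

variable {E : Type*} [NormedAddCommGroup E] [NormedSpace ℂ E]
  {B : Type*} [TopologicalSpace B] [ChartedSpace E B] [IsManifold 𝓘(ℂ, E) ω B]
  {V : B → Type*} [∀ b, AddCommGroup (V b)] [∀ b, Module ℂ (V b)] {𝓛 : HolLineBundle E V}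

/-- The exponential, with values in the units. -/
def expUnit (t : ℂ) : ℂˣ := Units.mk0 (Complex.exp t) (Complex.exp_ne_zero t)

theorem exists_hasMFDerivAt_cscale (ε : 𝓛.Slit) : ∃ L : ℂ →L[ℂ] E × ℂ,
    HasMFDerivAt 𝓘(ℂ, ℂ) 𝓘(ℂ, E × ℂ) (fun t => cscale (expUnit t) ε) 0 L ∧
      (L 1).1 = 0 ∧ (L 1).2 ≠ 0 := by
  obtain ⟨φ, hφ, hε⟩ := 𝓛.exists_frame ε.base
  have h0 : φ.2 ε.base ≠ 0 := 𝓛.ne_zero φ hφ _ hε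
  have hr : ∀ t, ratio (φ.2 ε.base) (cscale (expUnit t) ε).vec =
      Complex.exp t * ratio (φ.2 ε.base) ε.vec := fun t => 𝓛.ratio_smul_right h0 _ _
  have hs : ContMDiffAt 𝓘(ℂ, ℂ) 𝓘(ℂ, E × ℂ) ω (fun t => cscale (expUnit t) ε : ℂ → 𝓛.Slit) 0 := by
    refine contMDiffAt_slit hφ hε contMDiffAt_const ?_
    have h1 : ContDiff ℂ ω (fun t => Complex.exp t * ratio (φ.2 ε.base) ε.vec) :=
      Complex.contDiff_exp.mul contDiff_const
    exact h1.contMDiff.contMDiffAt.congr_of_eventuallyEq (Filter.Eventually.of_forall hr)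
  have he : (cscale (expUnit 0) ε : 𝓛.Slit) = ε := by
    have : expUnit 0 = 1 := Units.ext Complex.exp_zero
    rw [this, cscale_one]
  have hL := (hs.mdifferentiableAt (by simp)).hasMFDerivAt
  set L : ℂ →L[ℂ] E × ℂ := mfderiv 𝓘(ℂ, ℂ) 𝓘(ℂ, E × ℂ) (fun t => cscale (expUnit t) ε : ℂ → 𝓛.Slit) 0
  have h1 : (L 1).1 = 0 := by
    have h2 := (hasMFDerivAt_slit_base ε).comp_eq hL he
    exact h2.eq_apply (hasMFDerivAt_const ε.base _) (Filter.Eventually.of_forall fun t => rfl) 1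
  refine ⟨L, hL, h1, fun h2 => ?_⟩
  have h3 : L 1 = 0 := Prod.ext h1 h2
  have h4 := ((contMDiffAt_ratio (𝕜 := ℂ) (n := ω) hφ hε).mdifferentiableAt (by simp)).hasMFDerivAt
  set R : E × ℂ →L[ℂ] ℂ :=
    mfderiv 𝓘(ℂ, E × ℂ) 𝓘(ℂ, ℂ) (fun ε' : 𝓛.Slit => ratio (φ.2 ε'.base) ε'.vec) ε
  have h5 : HasMFDerivAt 𝓘(ℂ, ℂ) 𝓘(ℂ, ℂ)
      (fun t => ratio (φ.2 ε.base) (cscale (expUnit t) ε).vec) 0 (R.comp L : ℂ →L[ℂ] ℂ) :=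
    h4.comp_eq hL he
  have h6 : HasDerivAt (fun t => Complex.exp t * ratio (φ.2 ε.base) ε.vec)
      (Complex.exp 0 * ratio (φ.2 ε.base) ε.vec) 0 := (Complex.hasDerivAt_exp 0).mul_const _
  have h7 := h5.eq_apply h6.hasFDerivAt.hasMFDerivAt (Filter.Eventually.of_forall hr) 1
  rw [ContinuousLinearMap.comp_apply, h3, map_zero] at h7
  refine 𝓛.ratio_ne_zero h0 ε.ne_zero ?_
  simpa using h7.symm

variable {F : Type*} [NormedAddCommGroup F] [NormedSpace ℂ F]
  {X : Type*} [TopologicalSpace X] [ChartedSpace F X] [IsManifold 𝓘(ℂ, F) ω X]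
  {U : X → Type*} [∀ b, AddCommGroup (U b)] [∀ b, Module ℂ (U b)] {𝓜 : HolLineBundle F U}

theorem exists_mfderiv_eq_of_cscale {f : 𝓛.Slit → 𝓜.Slit} {f₀ : B → X} {ε : 𝓛.Slit}
    {f₀' : E →L[ℂ] F} (hf : MDifferentiableAt 𝓘(ℂ, E × ℂ) 𝓘(ℂ, F × ℂ) f ε)
    (hb : ∀ ε, (f ε).base = f₀ ε.base) (hc : ∀ c ε, f (cscale c ε) = cscale c (f ε))
    (h₀ : HasMFDerivAt 𝓘(ℂ, E) 𝓘(ℂ, F) f₀ ε.base f₀') {v : E} {u : F × ℂ} (hv : f₀' v = u.1) :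
    ∃ z : ℂ, (mfderiv 𝓘(ℂ, E × ℂ) 𝓘(ℂ, F × ℂ) f ε : E × ℂ →L[ℂ] F × ℂ) (v, z) = u := by
  have hA := hf.hasMFDerivAt
  set A : E × ℂ →L[ℂ] F × ℂ := mfderiv 𝓘(ℂ, E × ℂ) 𝓘(ℂ, F × ℂ) f ε
  obtain ⟨L, hL, hL1, hL2⟩ := exists_hasMFDerivAt_cscale ε
  obtain ⟨L', hL', hL1', hL2'⟩ := exists_hasMFDerivAt_cscale (f ε)
  have he : (cscale (expUnit 0) ε : 𝓛.Slit) = ε := by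
    have : expUnit 0 = 1 := Units.ext Complex.exp_zero
    rw [this, cscale_one]
  have h1 : A (L 1) = L' 1 :=
    (hA.comp_eq hL he).eq_apply hL' (Filter.Eventually.of_forall fun t => hc _ _) 1
  have h2 : ∀ v, (A v).1 = f₀' v.1 := fun v =>
    ((hasMFDerivAt_slit_base (f ε)).comp_eq hA rfl).eq_apply
      (h₀.comp_eq (hasMFDerivAt_slit_base ε) rfl) (Filter.Eventually.of_forall hb) v
  set k : ℂ := (u.2 - (A (v, 0)).2) / (L' 1).2
  have hk : (v, k * (L 1).2) = (v, 0) + k • L 1 := by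
    refine Prod.ext ?_ ?_
    · rw [Prod.fst_add, Prod.smul_fst, hL1, smul_zero, add_zero]
    · rw [Prod.snd_add, Prod.smul_snd, smul_eq_mul, zero_add]
  suffices h : A (v, k * (L 1).2) = u from ⟨_, h⟩
  rw [hk, map_add, map_smul, h1]
  refine Prod.ext ?_ ?_
  · rw [Prod.fst_add, Prod.smul_fst, hL1', smul_zero, add_zero, h2, hv]
  · rw [Prod.snd_add, Prod.smul_snd, smul_eq_mul, div_mul_cancel₀ _ hL2']
    ring

/-- A homogeneous map covering a submersion is a submersion. -/
theorem surjective_mfderiv_of_cscale {f : 𝓛.Slit → 𝓜.Slit} {f₀ : B → X} {ε : 𝓛.Slit}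
    {f₀' : E →L[ℂ] F} (hf : MDifferentiableAt 𝓘(ℂ, E × ℂ) 𝓘(ℂ, F × ℂ) f ε)
    (hb : ∀ ε, (f ε).base = f₀ ε.base) (hc : ∀ c ε, f (cscale c ε) = cscale c (f ε))
    (h₀ : HasMFDerivAt 𝓘(ℂ, E) 𝓘(ℂ, F) f₀ ε.base f₀') (hs : Function.Surjective f₀') :
    Function.Surjective (mfderiv 𝓘(ℂ, E × ℂ) 𝓘(ℂ, F × ℂ) f ε) := fun u => by
  obtain ⟨v, hv⟩ := hs (show F × ℂ from u).1
  obtain ⟨z, hz⟩ := exists_mfderiv_eq_of_cscale hf hb hc h₀ hv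
  exact ⟨_, hz⟩

end HolLineBundle

namespace HolContactGroupoid

variable {E F G X : Type*}
  [NormedAddCommGroup E] [NormedSpace ℂ E] [NormedAddCommGroup F] [NormedSpace ℂ F]
  [TopologicalSpace G] [ChartedSpace E G] [IsManifold 𝓘(ℂ, E) ω G]
  [TopologicalSpace X] [ChartedSpace F X] [IsManifold 𝓘(ℂ, F) ω X]
  (K : HolContactGroupoid E F G X)

open HolLineBundle

variable {K} in
theorem coreDual_frame_mem {φ : Set G × (∀ g, Conormal K.H g)} (hφ : φ ∈ K.conormal.frames) :
    ((K.grpd.one ⁻¹' φ.1, fun x => φ.2 (K.grpd.one x)) :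
      Set X × (∀ x, Conormal K.H (K.grpd.one x))) ∈ K.coreDual.frames := by
  obtain ⟨U, α, hα, rfl⟩ := hφ
  exact ⟨U, α, hα, rfl⟩

theorem contMDiff_tildeOne : ContMDiff 𝓘(ℂ, F × ℂ) 𝓘(ℂ, E × ℂ) ω K.tildeOne := by
  intro η
  obtain ⟨φ, hφ, hη⟩ := K.conormal.exists_frame (K.grpd.one η.base)
  exact contMDiffAt_slit hφ hη ((K.isLieGroupoid.contMDiff_one _).comp η (contMDiff_slit_base η))
    (contMDiffAt_ratio (coreDual_frame_mem hφ) hη)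

variable [FiniteDimensional ℂ E] [FiniteDimensional ℂ F]

theorem contMDiff_tilde_src : ContMDiff 𝓘(ℂ, E × ℂ) 𝓘(ℂ, F × ℂ) ω K.tilde.src := by
  intro ε
  have hL := K.isLieGroupoid
  obtain ⟨φ, hφ, hε⟩ := K.conormal.exists_frame ε.base
  obtain ⟨φ', hφ', hε'⟩ := K.conormal.exists_frame (K.grpd.one (K.grpd.src ε.base))
  obtain ⟨A, B, -, hB, -, -, h⟩ := exists_dualMul_coefficients
    (hL.isGroupoid.tgt_one (K.grpd.src ε.base)).symm hφ hφ' hφ hε hε'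
    (by rw [hL.isGroupoid.mul_one]; exact hε)
  have hb := contMDiff_slit_base (𝕜 := ℂ) (n := ω) ε
  have hs := (hL.contMDiff_src _).comp ε hb
  have hp : ContMDiffAt 𝓘(ℂ, E × ℂ) (𝓘(ℂ, E).prod 𝓘(ℂ, E)) ω
    (fun ε : K.conormal.Slit => (ε.base, K.grpd.one (K.grpd.src ε.base))) ε :=
    hb.prodMk ((hL.contMDiff_one _).comp ε hs)
  refine contMDiffAt_slit (coreDual_frame_mem hφ') (by rw [tilde_src_base]; exact hε')
    (hs.congr_of_eventuallyEq (Filter.Eventually.of_forall K.tilde_src_base)) ?_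
  refine ((contMDiffAt_ratio hφ hε).mul (hB.comp ε hp)).congr_of_eventuallyEq ?_
  filter_upwards [hp.continuousAt.eventually h] with a ha
  exact (ha a _ a rfl (by rw [tildeOne_base, tilde_src_base]) (K.dualMul_src a)).2

theorem contMDiff_tilde_tgt : ContMDiff 𝓘(ℂ, E × ℂ) 𝓘(ℂ, F × ℂ) ω K.tilde.tgt := by
  intro ε
  have hL := K.isLieGroupoid
  obtain ⟨φ, hφ, hε⟩ := K.conormal.exists_frame ε.base
  obtain ⟨φ', hφ', hε'⟩ := K.conormal.exists_frame (K.grpd.one (K.grpd.tgt ε.base))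
  obtain ⟨A, B, hA, -, -, -, h⟩ := exists_dualMul_coefficients
    (hL.isGroupoid.src_one (K.grpd.tgt ε.base)) hφ' hφ hφ hε' hε
    (by rw [hL.isGroupoid.one_mul]; exact hε)
  have hb := contMDiff_slit_base (𝕜 := ℂ) (n := ω) ε
  have hs := (hL.contMDiff_tgt _).comp ε hb
  have hp : ContMDiffAt 𝓘(ℂ, E × ℂ) (𝓘(ℂ, E).prod 𝓘(ℂ, E)) ω
    (fun ε : K.conormal.Slit => (K.grpd.one (K.grpd.tgt ε.base), ε.base)) ε :=
    ((hL.contMDiff_one _).comp ε hs).prodMk hb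
  refine contMDiffAt_slit (coreDual_frame_mem hφ') (by rw [tilde_tgt_base]; exact hε')
    (hs.congr_of_eventuallyEq (Filter.Eventually.of_forall K.tilde_tgt_base)) ?_
  refine ((contMDiffAt_ratio hφ hε).mul (hA.comp ε hp)).congr_of_eventuallyEq ?_
  filter_upwards [hp.continuousAt.eventually h] with a ha
  exact (ha _ a a (by rw [tildeOne_base, tilde_tgt_base]) rfl (K.dualMul_tgt a)).1

theorem contMDiff_tilde_inv : ContMDiff 𝓘(ℂ, E × ℂ) 𝓘(ℂ, E × ℂ) ω K.tilde.inv := by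
  intro ε
  have hL := K.isLieGroupoid
  obtain ⟨φ, hφ, hε⟩ := K.conormal.exists_frame ε.base
  obtain ⟨φ', hφ', hε'⟩ := K.conormal.exists_frame (K.grpd.inv ε.base)
  obtain ⟨ψ, hψ, hε''⟩ := K.conormal.exists_frame (K.grpd.one (K.grpd.tgt ε.base))
  obtain ⟨A, B, hA, hB, hA0, -, h⟩ := exists_dualMul_coefficients
    (hL.isGroupoid.tgt_inv ε.base).symm hφ hφ' hψ hε hε'
    (by rw [hL.isGroupoid.mul_inv]; exact hε'')
  have hb := contMDiff_slit_base (𝕜 := ℂ) (n := ω) ε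
  have hs := (hL.contMDiff_inv _).comp ε hb
  have hp : ContMDiffAt 𝓘(ℂ, E × ℂ) (𝓘(ℂ, E).prod 𝓘(ℂ, E)) ω
    (fun ε : K.conormal.Slit => (ε.base, K.grpd.inv ε.base)) ε := hb.prodMk hs
  refine contMDiffAt_slit hφ' (by rw [tilde_inv_base]; exact hε')
    (hs.congr_of_eventuallyEq (Filter.Eventually.of_forall K.tilde_inv_base)) ?_
  refine (((contMDiffAt_ratio hφ hε).mul (hB.comp ε hp)).div₀ (hA.comp ε hp)
    hA0).congr_of_eventuallyEq ?_
  filter_upwards [hp.continuousAt.eventually h,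
    (hA.comp ε hp).continuousAt.eventually_ne hA0] with a ha ha0
  obtain ⟨h1, h2⟩ := ha a _ _ rfl (K.tilde_inv_base a) (K.dualMul_inv a)
  refine h2.trans ?_
  change _ = ratio (φ.2 a.base) a.vec * B (a.base, K.grpd.inv a.base) /
    A (a.base, K.grpd.inv a.base)
  change A (a.base, K.grpd.inv a.base) ≠ 0 at ha0
  rw [h1]
  field_simp

theorem contMDiffOn_tilde_mul : ContMDiffOn (𝓘(ℂ, E × ℂ).prod 𝓘(ℂ, E × ℂ)) 𝓘(ℂ, E × ℂ) ω
    (fun p : K.conormal.Slit × K.conormal.Slit => K.tilde.mul p.1 p.2) K.tilde.composable := by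
  rintro ⟨ε₁, ε₂⟩ hε
  have hL := K.isLieGroupoid
  have hε0 : K.tilde.src ε₁ = K.tilde.tgt ε₂ := hε
  have hgh : K.grpd.src ε₁.base = K.grpd.tgt ε₂.base := (dualMul_mul hε0).1
  obtain ⟨φ₁, hφ₁, h₁⟩ := K.conormal.exists_frame ε₁.base
  obtain ⟨φ₂, hφ₂, h₂⟩ := K.conormal.exists_frame ε₂.base
  obtain ⟨φ₃, hφ₃, h₃⟩ := K.conormal.exists_frame (K.grpd.mul ε₁.base ε₂.base)
  obtain ⟨A, B, hA, -, hA0, -, h⟩ := exists_dualMul_coefficients hgh hφ₁ hφ₂ hφ₃ h₁ h₂ h₃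
  have hb₁ : ContMDiffAt (𝓘(ℂ, E × ℂ).prod 𝓘(ℂ, E × ℂ)) 𝓘(ℂ, E) ω
      (fun p : K.conormal.Slit × K.conormal.Slit => p.1.base) (ε₁, ε₂) :=
    (contMDiff_slit_base ε₁).comp (ε₁, ε₂) contMDiffAt_fst
  have hb₂ : ContMDiffAt (𝓘(ℂ, E × ℂ).prod 𝓘(ℂ, E × ℂ)) 𝓘(ℂ, E) ω
      (fun p : K.conormal.Slit × K.conormal.Slit => p.2.base) (ε₁, ε₂) :=
    (contMDiff_slit_base ε₂).comp (ε₁, ε₂) contMDiffAt_snd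
  have hp := hb₁.prodMk hb₂
  have hr : ContMDiffAt (𝓘(ℂ, E × ℂ).prod 𝓘(ℂ, E × ℂ)) 𝓘(ℂ, ℂ) ω
      (fun p : K.conormal.Slit × K.conormal.Slit => ratio (φ₁.2 p.1.base) p.1.vec) (ε₁, ε₂) :=
    ContMDiffAt.comp (g := fun ε : K.conormal.Slit => ratio (φ₁.2 ε.base) ε.vec) (ε₁, ε₂)
      (contMDiffAt_ratio hφ₁ h₁) contMDiffAt_fst
  have hm : ContMDiffWithinAt (𝓘(ℂ, E × ℂ).prod 𝓘(ℂ, E × ℂ)) 𝓘(ℂ, E) ω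
      (fun p : K.conormal.Slit × K.conormal.Slit => K.grpd.mul p.1.base p.2.base)
      K.tilde.composable (ε₁, ε₂) :=
    (hL.contMDiffOn_mul (ε₁.base, ε₂.base) hgh).comp (ε₁, ε₂) hp.contMDiffWithinAt
      (fun p hp => (dualMul_mul hp).1)
  refine contMDiffWithinAt_slit hφ₃ (by rw [tilde_mul_base hε0]; exact h₃)
    (hm.congr (fun p hp => tilde_mul_base hp) (tilde_mul_base hε0)) ?_
  have hA' := hA.comp (ε₁, ε₂) hp
  refine ((hr.div₀ hA' hA0).contMDiffWithinAt).congr_of_eventuallyEq_of_mem ?_ hε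
  filter_upwards [nhdsWithin_le_nhds (hp.continuousAt.eventually h),
    nhdsWithin_le_nhds (hA'.continuousAt.eventually_ne hA0), self_mem_nhdsWithin] with p hp hp0 hpc
  obtain ⟨h1, -⟩ := hp p.1 p.2 _ rfl rfl (dualMul_mul hpc)
  change A (p.1.base, p.2.base) ≠ 0 at hp0
  change _ = ratio (φ₁.2 p.1.base) p.1.vec / A (p.1.base, p.2.base)
  rw [h1, mul_div_cancel_right₀ _ hp0]

theorem isLieGroupoid_tilde : K.tilde.IsLieGroupoid ℂ (E := E × ℂ) (F := F × ℂ) ω := by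
  have hL := K.isLieGroupoid
  have := hL.t2_arrows
  have := hL.t2_objects
  have := hL.secondCountable_arrows
  have := hL.secondCountable_objects
  exact {
    t2_arrows := slit_t2Space
    t2_objects := slit_t2Space
    secondCountable_arrows := slit_secondCountable
    secondCountable_objects := slit_secondCountable
    isGroupoid := K.isGroupoid_tilde
    contMDiff_src := K.contMDiff_tilde_src
    contMDiff_tgt := K.contMDiff_tilde_tgt
    contMDiff_one := K.contMDiff_tildeOne
    contMDiff_inv := K.contMDiff_tilde_inv
    contMDiffOn_mul := K.contMDiffOn_tilde_mul
    submersion_src := fun ε => surjective_mfderiv_of_cscale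
      ((K.contMDiff_tilde_src ε).mdifferentiableAt (by simp)) K.tilde_src_base tilde_src_cscale
      (hL.hasMFDerivAt_src (by simp) _) (hL.submersion_src _)
    submersion_tgt := fun ε => surjective_mfderiv_of_cscale
      ((K.contMDiff_tilde_tgt ε).mdifferentiableAt (by simp)) K.tilde_tgt_base tilde_tgt_cscale
      (hL.hasMFDerivAt_tgt (by simp) _) (hL.submersion_tgt _) }

end HolContactGroupoid

namespace GroupoidData.IsLieGroupoid

variable {G X : Type*} {E : Type*} [NormedAddCommGroup E] [NormedSpace ℂ E]
  {F : Type*} [NormedAddCommGroup F] [NormedSpace ℂ F]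
  [TopologicalSpace G] [ChartedSpace E G] [TopologicalSpace X] [ChartedSpace F X]
  {𝒢 : GroupoidData G X}

theorem dsrc_complexToReal (h : 𝒢.IsLieGroupoid ℂ (E := E) (F := F) ω) (g : G) (v : E) :
    𝒢.dsrc ℝ E F g v = 𝒢.dsrc ℂ E F g v :=
  mfderiv_complexToReal ((h.contMDiff_src g).mdifferentiableAt (by simp)) v

theorem dtgt_complexToReal (h : 𝒢.IsLieGroupoid ℂ (E := E) (F := F) ω) (g : G) (v : E) :
    𝒢.dtgt ℝ E F g v = 𝒢.dtgt ℂ E F g v :=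
  mfderiv_complexToReal ((h.contMDiff_tgt g).mdifferentiableAt (by simp)) v

theorem complexToReal (h : 𝒢.IsLieGroupoid ℂ (E := E) (F := F) ω) :
    𝒢.IsLieGroupoid ℝ (E := E) (F := F) ∞ where
  t2_arrows := h.t2_arrows
  t2_objects := h.t2_objects
  secondCountable_arrows := h.secondCountable_arrows
  secondCountable_objects := h.secondCountable_objects
  isGroupoid := h.isGroupoid
  contMDiff_src := h.contMDiff_src.complexToReal.of_le (by simp)
  contMDiff_tgt := h.contMDiff_tgt.complexToReal.of_le (by simp)
  contMDiff_one := h.contMDiff_one.complexToReal.of_le (by simp)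
  contMDiff_inv := h.contMDiff_inv.complexToReal.of_le (by simp)
  contMDiffOn_mul := fun p hp => (h.contMDiffOn_mul p hp).complexToReal_prod.of_le (by simp)
  submersion_src := fun g u => by
    obtain ⟨v, hv⟩ := h.submersion_src g u
    exact ⟨v, (h.dsrc_complexToReal g v).trans hv⟩
  submersion_tgt := fun g u => by
    obtain ⟨v, hv⟩ := h.submersion_tgt g u
    exact ⟨v, (h.dtgt_complexToReal g v).trans hv⟩

end GroupoidData.IsLieGroupoid
end

noncomputable section

attribute [local instance] isManifold_complexToReal

namespace HolContactGroupoid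

variable {E F G X : Type*}
  [NormedAddCommGroup E] [NormedSpace ℂ E] [NormedAddCommGroup F] [NormedSpace ℂ F]
  [TopologicalSpace G] [ChartedSpace E G] [IsManifold 𝓘(ℂ, E) ω G]
  [TopologicalSpace X] [ChartedSpace F X] [IsManifold 𝓘(ℂ, F) ω X]
  [FiniteDimensional ℂ E] [FiniteDimensional ℂ F]
  (K : HolContactGroupoid E F G X)

open HolLineBundle

omit [FiniteDimensional ℂ E] [FiniteDimensional ℂ F] in
theorem exists_rep_eq (ε : K.conormal.Slit) :
    ∃ r : ℝˣ, K.conormal.rep (K.conormal.toProj ε) = K.conormal.rescale r ε :=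
  K.conormal.toProj_eq_iff.1 (K.conormal.toProj_rep _).symm

theorem tilde_src_rescale (r : ℝˣ) (ε : K.conormal.Slit) :
    K.tilde.src (K.conormal.rescale r ε) = K.coreDual.rescale r (K.tilde.src ε) := by
  rw [rescale_eq_cscale, rescale_eq_cscale, tilde_src_cscale]

theorem tilde_tgt_rescale (r : ℝˣ) (ε : K.conormal.Slit) :
    K.tilde.tgt (K.conormal.rescale r ε) = K.coreDual.rescale r (K.tilde.tgt ε) := by
  rw [rescale_eq_cscale, rescale_eq_cscale, tilde_tgt_cscale]

theorem tilde_inv_rescale (r : ℝˣ) (ε : K.conormal.Slit) :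
    K.tilde.inv (K.conormal.rescale r ε) = K.conormal.rescale r (K.tilde.inv ε) := by
  rw [rescale_eq_cscale, rescale_eq_cscale, tilde_inv_cscale]

variable {K} in
theorem tilde_mul_rescale (r : ℝˣ) {a b : K.conormal.Slit} (h : K.tilde.src a = K.tilde.tgt b) :
    K.tilde.mul (K.conormal.rescale r a) (K.conormal.rescale r b) =
      K.conormal.rescale r (K.tilde.mul a b) := by
  rw [rescale_eq_cscale, rescale_eq_cscale, rescale_eq_cscale, tilde_mul_cscale _ h]

variable {K} in
omit [FiniteDimensional ℂ E] [FiniteDimensional ℂ F] in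
theorem rescale_injective {r s : ℝˣ} {η : K.coreDual.Slit}
    (h : K.coreDual.rescale r η = K.coreDual.rescale s η) : r = s := by
  have h1 := congrArg K.tildeOne h
  rw [rescale_eq_cscale, rescale_eq_cscale, tildeOne_cscale, tildeOne_cscale] at h1
  obtain ⟨v, hv⟩ := K.exists_evalAt_eq (K.tildeOne η) 1
  have h2 := congrArg (fun ε => K.evalAt ε v) h1
  have h3 : ((Units.map Complex.ofRealHom.toMonoidHom r : ℂˣ) : ℂ) * K.evalAt (K.tildeOne η) v =
    ((Units.map Complex.ofRealHom.toMonoidHom s : ℂˣ) : ℂ) * K.evalAt (K.tildeOne η) v := by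
    rw [← evalAt_cscale, h1, evalAt_cscale]
  rw [hv, mul_one, mul_one] at h3
  exact Units.ext (Complex.ofReal_injective h3)

theorem hat_src_toProj (ε : K.conormal.Slit) :
    K.hat.src (K.conormal.toProj ε) = K.coreDual.toProj (K.tilde.src ε) := by
  obtain ⟨r, hr⟩ := K.exists_rep_eq ε
  change K.coreDual.toProj (K.tilde.src (K.conormal.rep (K.conormal.toProj ε))) = _
  rw [hr, tilde_src_rescale, toProj_rescale]

theorem hat_tgt_toProj (ε : K.conormal.Slit) :
    K.hat.tgt (K.conormal.toProj ε) = K.coreDual.toProj (K.tilde.tgt ε) := by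
  obtain ⟨r, hr⟩ := K.exists_rep_eq ε
  change K.coreDual.toProj (K.tilde.tgt (K.conormal.rep (K.conormal.toProj ε))) = _
  rw [hr, tilde_tgt_rescale, toProj_rescale]

theorem hat_inv_toProj (ε : K.conormal.Slit) :
    K.hat.inv (K.conormal.toProj ε) = K.conormal.toProj (K.tilde.inv ε) := by
  obtain ⟨r, hr⟩ := K.exists_rep_eq ε
  change K.conormal.toProj (K.tilde.inv (K.conormal.rep (K.conormal.toProj ε))) = _
  rw [hr, tilde_inv_rescale, toProj_rescale]

omit [FiniteDimensional ℂ E] [FiniteDimensional ℂ F] in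
theorem hat_one_toProj (η : K.coreDual.Slit) :
    K.hat.one (K.coreDual.toProj η) = K.conormal.toProj (K.tilde.one η) := rfl

variable {K}

theorem exists_composable_right (ε₁ : K.conormal.Slit) {x : K.conormal.RProj}
    (h : K.hat.src (K.conormal.toProj ε₁) = K.hat.tgt x) :
    ∃ ε₂, K.conormal.toProj ε₂ = x ∧ K.tilde.src ε₁ = K.tilde.tgt ε₂ := by
  obtain ⟨ε, rfl⟩ := exists_toProj_eq x
  rw [hat_src_toProj, hat_tgt_toProj] at h
  obtain ⟨r, hr⟩ := K.coreDual.toProj_eq_iff.1 h.symm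
  exact ⟨K.conormal.rescale r ε, K.conormal.toProj_rescale r ε, by rw [tilde_tgt_rescale, hr]⟩

theorem hat_src_eq_tgt {a b : K.conormal.Slit} (h : K.tilde.src a = K.tilde.tgt b) :
    K.hat.src (K.conormal.toProj a) = K.hat.tgt (K.conormal.toProj b) := by
  rw [hat_src_toProj, hat_tgt_toProj, h]

theorem hat_mul_toProj {a b : K.conormal.Slit} (h : K.tilde.src a = K.tilde.tgt b) :
    K.hat.mul (K.conormal.toProj a) (K.conormal.toProj b) =
      K.conormal.toProj (K.tilde.mul a b) := by
  have hex : ∃ x, ∃ ε₁ ε₂, K.conormal.toProj ε₁ = K.conormal.toProj a ∧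
    K.conormal.toProj ε₂ = K.conormal.toProj b ∧ K.tilde.src ε₁ = K.tilde.tgt ε₂ ∧
    x = K.conormal.toProj (K.tilde.mul ε₁ ε₂) := ⟨_, a, b, rfl, rfl, h, rfl⟩
  obtain ⟨ε₁, ε₂, h1, h2, h3, h4⟩ := Classical.epsilon_spec hex
  refine h4.trans ?_
  obtain ⟨r, rfl⟩ := K.conormal.toProj_eq_iff.1 h1.symm
  obtain ⟨s, rfl⟩ := K.conormal.toProj_eq_iff.1 h2.symm
  rw [tilde_src_rescale, tilde_tgt_rescale, h] at h3
  obtain rfl := rescale_injective h3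
  rw [tilde_mul_rescale _ h, toProj_rescale]

variable (K)

theorem isGroupoid_hat : K.hat.IsGroupoid := by
  have hT := K.isGroupoid_tilde
  have comp : ∀ x y, K.hat.src x = K.hat.tgt y → ∃ a b, K.conormal.toProj a = x ∧
      K.conormal.toProj b = y ∧ K.tilde.src a = K.tilde.tgt b := by
    intro x y h
    obtain ⟨a, rfl⟩ := exists_toProj_eq x
    obtain ⟨b, hb, hab⟩ := exists_composable_right a h
    exact ⟨a, b, rfl, hb, hab⟩
  constructor
  · intro x y h
    obtain ⟨a, b, rfl, rfl, hab⟩ := comp x y h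
    rw [hat_mul_toProj hab, hat_src_toProj, hat_src_toProj, hT.src_mul a b hab]
  · intro x y h
    obtain ⟨a, b, rfl, rfl, hab⟩ := comp x y h
    rw [hat_mul_toProj hab, hat_tgt_toProj, hat_tgt_toProj, hT.tgt_mul a b hab]
  · intro x y z h h'
    obtain ⟨a, b, rfl, rfl, hab⟩ := comp x y h
    obtain ⟨c, rfl, hbc⟩ := exists_composable_right b h'
    rw [hat_mul_toProj hab, hat_mul_toProj ((hT.src_mul a b hab).trans hbc), hat_mul_toProj hbc,
      hat_mul_toProj (hab.trans (hT.tgt_mul b c hbc).symm), hT.mul_assoc a b c hab hbc]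
  · intro y
    obtain ⟨η, rfl⟩ := exists_toProj_eq y
    rw [hat_one_toProj, hat_src_toProj, hT.src_one]
  · intro y
    obtain ⟨η, rfl⟩ := exists_toProj_eq y
    rw [hat_one_toProj, hat_tgt_toProj, hT.tgt_one]
  · intro x
    obtain ⟨a, rfl⟩ := exists_toProj_eq x
    rw [hat_tgt_toProj, hat_one_toProj, hat_mul_toProj (hT.src_one _), hT.one_mul]
  · intro x
    obtain ⟨a, rfl⟩ := exists_toProj_eq x
    rw [hat_src_toProj, hat_one_toProj, hat_mul_toProj (hT.tgt_one _).symm, hT.mul_one]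
  · intro x
    obtain ⟨a, rfl⟩ := exists_toProj_eq x
    rw [hat_inv_toProj, hat_src_toProj, hat_tgt_toProj, hT.src_inv]
  · intro x
    obtain ⟨a, rfl⟩ := exists_toProj_eq x
    rw [hat_inv_toProj, hat_src_toProj, hat_tgt_toProj, hT.tgt_inv]
  · intro x
    obtain ⟨a, rfl⟩ := exists_toProj_eq x
    rw [hat_inv_toProj, hat_mul_toProj (hT.tgt_inv _).symm, hat_tgt_toProj, hT.mul_inv,
      hat_one_toProj]
  · intro x
    obtain ⟨a, rfl⟩ := exists_toProj_eq x
    rw [hat_inv_toProj, hat_mul_toProj (hT.src_inv _), hat_src_toProj, hT.inv_mul,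
      hat_one_toProj]

theorem contMDiff_hat_src : ContMDiff 𝓘(ℝ, E × ℝ) 𝓘(ℝ, F × ℝ) ∞ K.hat.src := by
  intro x
  obtain ⟨ε, rfl⟩ := exists_toProj_eq x
  refine contMDiffAt_of_comp_toProj (((contMDiff_toProj _).comp ε
    (K.isLieGroupoid_tilde.complexToReal.contMDiff_src ε)).congr_of_eventuallyEq ?_)
  exact Filter.Eventually.of_forall K.hat_src_toProj

theorem contMDiff_hat_tgt : ContMDiff 𝓘(ℝ, E × ℝ) 𝓘(ℝ, F × ℝ) ∞ K.hat.tgt := by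
  intro x
  obtain ⟨ε, rfl⟩ := exists_toProj_eq x
  refine contMDiffAt_of_comp_toProj (((contMDiff_toProj _).comp ε
    (K.isLieGroupoid_tilde.complexToReal.contMDiff_tgt ε)).congr_of_eventuallyEq ?_)
  exact Filter.Eventually.of_forall K.hat_tgt_toProj

theorem contMDiff_hat_inv : ContMDiff 𝓘(ℝ, E × ℝ) 𝓘(ℝ, E × ℝ) ∞ K.hat.inv := by
  intro x
  obtain ⟨ε, rfl⟩ := exists_toProj_eq x
  refine contMDiffAt_of_comp_toProj (((contMDiff_toProj _).comp ε
    (K.isLieGroupoid_tilde.complexToReal.contMDiff_inv ε)).congr_of_eventuallyEq ?_)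
  exact Filter.Eventually.of_forall K.hat_inv_toProj

theorem contMDiff_hat_one : ContMDiff 𝓘(ℝ, F × ℝ) 𝓘(ℝ, E × ℝ) ∞ K.hat.one := by
  intro x
  obtain ⟨ε, rfl⟩ := exists_toProj_eq x
  exact contMDiffAt_of_comp_toProj ((contMDiff_toProj _).comp ε
    (K.isLieGroupoid_tilde.complexToReal.contMDiff_one ε))

theorem contMDiffOn_hat_mul : ContMDiffOn (𝓘(ℝ, E × ℝ).prod 𝓘(ℝ, E × ℝ)) 𝓘(ℝ, E × ℝ) ∞
    (fun p : K.conormal.RProj × K.conormal.RProj => K.hat.mul p.1 p.2) K.hat.composable := by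
  rintro ⟨x₁, x₂⟩ hx
  have hL := K.isLieGroupoid
  obtain ⟨ε₁, rfl⟩ := exists_toProj_eq x₁
  obtain ⟨ε₂, rfl, hε⟩ := exists_composable_right ε₁ hx
  have hgh : K.grpd.src ε₁.base = K.grpd.tgt ε₂.base := (dualMul_mul hε).1
  obtain ⟨σ, hσ, hσ0, hσp⟩ := exists_section_toProj ε₁
  obtain ⟨φ₁, hφ₁, h₁⟩ := K.conormal.exists_frame ε₁.base
  obtain ⟨φ₂, hφ₂, h₂⟩ := K.conormal.exists_frame ε₂.base
  obtain ⟨φ₃, hφ₃, h₃⟩ := K.conormal.exists_frame (K.grpd.mul ε₁.base ε₂.base)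
  obtain ⟨A, B, hA, -, hA0, -, h⟩ := exists_dualMul_coefficients hgh hφ₁ hφ₂ hφ₃ h₁ h₂ h₃
  have hex : ∀ p : K.conormal.RProj × K.conormal.RProj, ∃ b, p ∈ K.hat.composable →
      K.conormal.toProj (σ p.1) = p.1 → K.conormal.toProj b = p.2 ∧
        K.tilde.src (σ p.1) = K.tilde.tgt b := by
    intro p
    by_cases hp : p ∈ K.hat.composable ∧ K.conormal.toProj (σ p.1) = p.1
    · obtain ⟨b, hb⟩ := exists_composable_right (σ p.1) (x := p.2) (by rw [hp.2]; exact hp.1)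
      exact ⟨b, fun _ _ => hb⟩
    · exact ⟨ε₁, fun h1 h2 => absurd ⟨h1, h2⟩ hp⟩
  choose τ hτ using hex
  set p₀ : K.conormal.RProj × K.conormal.RProj := (K.conormal.toProj ε₁, K.conormal.toProj ε₂)
  have hσe : ∀ᶠ p in 𝓝[K.hat.composable] p₀, p ∈ K.hat.composable ∧
      K.conormal.toProj (σ p.1) = p.1 := by
    filter_upwards [self_mem_nhdsWithin,
      nhdsWithin_le_nhds (continuousAt_fst.eventually hσp)] with p h1 h2
    exact ⟨h1, h2⟩
  have hσ0' : K.conormal.toProj (σ p₀.1) = p₀.1 := by rw [hσ0]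
  have hb₁ : ContMDiffAt (𝓘(ℝ, E × ℝ).prod 𝓘(ℝ, E × ℝ)) 𝓘(ℝ, E) ∞
      (fun p : K.conormal.RProj × K.conormal.RProj => p.1.base) p₀ :=
    (contMDiff_proj_base _).comp p₀ contMDiffAt_fst
  have hb₂ : ContMDiffAt (𝓘(ℝ, E × ℝ).prod 𝓘(ℝ, E × ℝ)) 𝓘(ℝ, E) ∞
      (fun p : K.conormal.RProj × K.conormal.RProj => p.2.base) p₀ :=
    (contMDiff_proj_base _).comp p₀ contMDiffAt_snd
  have hp := hb₁.prodMk hb₂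
  have hσs : ContMDiffAt (𝓘(ℝ, E × ℝ).prod 𝓘(ℝ, E × ℝ)) 𝓘(ℝ, E × ℂ) ∞
      (fun p : K.conormal.RProj × K.conormal.RProj => σ p.1) p₀ := hσ.comp p₀ contMDiffAt_fst
  have hr : ContMDiffAt (𝓘(ℝ, E × ℝ).prod 𝓘(ℝ, E × ℝ)) 𝓘(ℝ, ℂ) ∞
      (fun p : K.conormal.RProj × K.conormal.RProj =>
        ratio (φ₁.2 (σ p.1).base) (σ p.1).vec) p₀ := by
    have h1 := contMDiffAt_ratio (𝕜 := ℝ) (n := ∞) hφ₁ h₁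
    rw [← hσ0] at h1
    exact ContMDiffAt.comp (g := fun ε : K.conormal.Slit => ratio (φ₁.2 ε.base) ε.vec) p₀ h1 hσs
  have hm : ContMDiffWithinAt (𝓘(ℝ, E × ℝ).prod 𝓘(ℝ, E × ℝ)) 𝓘(ℝ, E) ∞
      (fun p : K.conormal.RProj × K.conormal.RProj => K.grpd.mul p.1.base p.2.base)
      K.hat.composable p₀ := by
    refine ((hL.contMDiffOn_mul (ε₁.base, ε₂.base) hgh).complexToReal_prod.of_le
      (by simp)).comp p₀ hp.contMDiffWithinAt ?_
    rintro ⟨y₁, y₂⟩ hy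
    obtain ⟨a, rfl⟩ := exists_toProj_eq y₁
    obtain ⟨b, rfl, hab⟩ := exists_composable_right a hy
    exact (dualMul_mul hab).1
  have hbase : ∀ p, p ∈ K.hat.composable → K.conormal.toProj (σ p.1) = p.1 →
      (K.tilde.mul (σ p.1) (τ p)).base = K.grpd.mul p.1.base p.2.base := by
    intro p h1 h2
    rw [tilde_mul_base (hτ p h1 h2).2]
    exact congrArg₂ K.grpd.mul (congrArg RProj.base h2) (congrArg RProj.base (hτ p h1 h2).1)
  have hA' : ContMDiffAt (𝓘(ℝ, E × ℝ).prod 𝓘(ℝ, E × ℝ)) 𝓘(ℝ, ℂ) ∞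
      (fun p : K.conormal.RProj × K.conormal.RProj => (A (p.1.base, p.2.base))⁻¹) p₀ := by
    have h1 : ContMDiffAt (𝓘(ℝ, E).prod 𝓘(ℝ, E)) 𝓘(ℝ, ℂ) ∞ (fun q => (A q)⁻¹) (ε₁.base, ε₂.base) :=
      (ContMDiffWithinAt.complexToReal_prod (hA.inv₀ hA0)).of_le (by simp)
    exact ContMDiffAt.comp (g := fun q => (A q)⁻¹) p₀ h1 hp
  have hrA : ContMDiffAt (𝓘(ℝ, E × ℝ).prod 𝓘(ℝ, E × ℝ)) 𝓘(ℝ, ℂ) ∞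
      (fun p : K.conormal.RProj × K.conormal.RProj =>
        ratio (φ₁.2 (σ p.1).base) (σ p.1).vec * (A (p.1.base, p.2.base))⁻¹) p₀ :=
    ContMDiffAt.comp (g := fun z : ℂ × ℂ => z.1 * z.2) p₀
      (contDiff_mul (𝕜 := ℝ) (𝔸 := ℂ)).contMDiff.contMDiffAt (hr.prodMk_space hA')
  have hX : ContMDiffWithinAt (𝓘(ℝ, E × ℝ).prod 𝓘(ℝ, E × ℝ)) 𝓘(ℝ, E × ℂ) ∞
      (fun p => K.tilde.mul (σ p.1) (τ p)) K.hat.composable p₀ := by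
    refine contMDiffWithinAt_slit hφ₃ (by rw [hbase p₀ hx hσ0']; exact h₃)
      (hm.congr_of_eventuallyEq_of_mem ?_ hx) ?_
    · filter_upwards [hσe] with p hp
      exact hbase p hp.1 hp.2
    · refine (hrA.contMDiffWithinAt).congr_of_eventuallyEq_of_mem ?_ hx
      filter_upwards [hσe, nhdsWithin_le_nhds (hp.continuousAt.eventually h),
        nhdsWithin_le_nhds (hA'.continuousAt.eventually_ne (inv_ne_zero hA0))] with p hpc hp hp0
      obtain ⟨h1, -⟩ := hp (σ p.1) (τ p) _ (congrArg RProj.base hpc.2)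
        (congrArg RProj.base (hτ p hpc.1 hpc.2).1) (dualMul_mul (hτ p hpc.1 hpc.2).2)
      rw [h1, mul_assoc, mul_inv_cancel₀ (fun h0 => hp0 (inv_eq_zero.2 h0)), mul_one]
  refine ((contMDiff_toProj _).comp_contMDiffWithinAt p₀ hX).congr_of_eventuallyEq_of_mem ?_ hx
  filter_upwards [hσe] with p hp
  have h1 := hat_mul_toProj (hτ p hp.1 hp.2).2
  rw [hp.2, (hτ p hp.1 hp.2).1] at h1
  exact h1

theorem hat_dsrc_dproj (ε : K.conormal.Slit) (v : E × ℂ) :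
    K.hat.dsrc ℝ (E × ℝ) (F × ℝ) (K.conormal.toProj ε) (K.conormal.dproj ε v) =
      K.coreDual.dproj (K.tilde.src ε) (K.tilde.dsrc ℝ (E × ℂ) (F × ℂ) ε v) := by
  have h1 : HasMFDerivAt 𝓘(ℝ, E × ℝ) 𝓘(ℝ, F × ℝ) K.hat.src (K.conormal.toProj ε)
      (K.hat.dsrc ℝ (E × ℝ) (F × ℝ) (K.conormal.toProj ε)) :=
    ((K.contMDiff_hat_src _).mdifferentiableAt (by simp)).hasMFDerivAt
  exact (h1.comp_eq (hasMFDerivAt_toProj ε) rfl).eq_apply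
    ((hasMFDerivAt_toProj (K.tilde.src ε)).comp_eq
      (K.isLieGroupoid_tilde.complexToReal.hasMFDerivAt_src (by simp) ε) rfl)
    (Filter.Eventually.of_forall K.hat_src_toProj) v

theorem hat_dtgt_dproj (ε : K.conormal.Slit) (v : E × ℂ) :
    K.hat.dtgt ℝ (E × ℝ) (F × ℝ) (K.conormal.toProj ε) (K.conormal.dproj ε v) =
      K.coreDual.dproj (K.tilde.tgt ε) (K.tilde.dtgt ℝ (E × ℂ) (F × ℂ) ε v) := by
  have h1 : HasMFDerivAt 𝓘(ℝ, E × ℝ) 𝓘(ℝ, F × ℝ) K.hat.tgt (K.conormal.toProj ε)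
      (K.hat.dtgt ℝ (E × ℝ) (F × ℝ) (K.conormal.toProj ε)) :=
    ((K.contMDiff_hat_tgt _).mdifferentiableAt (by simp)).hasMFDerivAt
  exact (h1.comp_eq (hasMFDerivAt_toProj ε) rfl).eq_apply
    ((hasMFDerivAt_toProj (K.tilde.tgt ε)).comp_eq
      (K.isLieGroupoid_tilde.complexToReal.hasMFDerivAt_tgt (by simp) ε) rfl)
    (Filter.Eventually.of_forall K.hat_tgt_toProj) v

theorem isLieGroupoid_hat : K.hat.IsLieGroupoid ℝ (E := E × ℝ) (F := F × ℝ) ∞ := by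
  have hL := K.isLieGroupoid
  have hT := K.isLieGroupoid_tilde.complexToReal
  have := hL.t2_arrows
  have := hL.t2_objects
  have := hL.secondCountable_arrows
  have := hL.secondCountable_objects
  refine {
    t2_arrows := proj_t2Space
    t2_objects := proj_t2Space
    secondCountable_arrows := proj_secondCountable
    secondCountable_objects := proj_secondCountable
    isGroupoid := K.isGroupoid_hat
    contMDiff_src := K.contMDiff_hat_src
    contMDiff_tgt := K.contMDiff_hat_tgt
    contMDiff_one := K.contMDiff_hat_one
    contMDiff_inv := K.contMDiff_hat_inv
    contMDiffOn_mul := K.contMDiffOn_hat_mul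
    submersion_src := fun x u => ?_
    submersion_tgt := fun x u => ?_ }
  · obtain ⟨ε, rfl⟩ := exists_toProj_eq x
    obtain ⟨w, hw⟩ := K.coreDual.dproj_surjective (K.tilde.src ε) u
    obtain ⟨v, hv⟩ := hT.submersion_src ε w
    refine ⟨K.conormal.dproj ε v, (K.hat_dsrc_dproj ε v).trans ?_⟩
    exact (congrArg _ hv).trans hw
  · obtain ⟨ε, rfl⟩ := exists_toProj_eq x
    obtain ⟨w, hw⟩ := K.coreDual.dproj_surjective (K.tilde.tgt ε) u
    obtain ⟨v, hv⟩ := hT.submersion_tgt ε w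
    refine ⟨K.conormal.dproj ε v, (K.hat_dtgt_dproj ε v).trans ?_⟩
    exact (congrArg _ hv).trans hw

end HolContactGroupoid
end

noncomputable section

attribute [local instance] isManifold_complexToReal

namespace GroupoidData.IsLieGroupoid

variable {G X : Type*} {E : Type*} [NormedAddCommGroup E] [NormedSpace ℂ E]
  {F : Type*} [NormedAddCommGroup F] [NormedSpace ℂ F]
  [TopologicalSpace G] [ChartedSpace E G] [TopologicalSpace X] [ChartedSpace F X]
  {𝒢 : GroupoidData G X}

theorem dmul_complexToReal [FiniteDimensional ℂ E] [FiniteDimensional ℂ F]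
    [IsManifold 𝓘(ℂ, E) ω G] [IsManifold 𝓘(ℂ, F) ω X]
    (h : 𝒢.IsLieGroupoid ℂ (E := E) (F := F) ω) {g k : G} (hgk : 𝒢.src g = 𝒢.tgt k) {v w : E}
    (hvw : 𝒢.dsrc ℂ E F g v = 𝒢.dtgt ℂ E F k w) :
    𝒢.dmul ℝ E g k (v, w) = 𝒢.dmul ℂ E g k (v, w) := by
  have : FiniteDimensional ℝ E := FiniteDimensional.complexToReal E
  have : FiniteDimensional ℝ F := FiniteDimensional.complexToReal F
  refine h.complexToReal.derivWithin_eq (by simp) hgk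
    (h.complexToReal.hasMFDerivWithinAt_mul (by simp) hgk)
    (h.hasMFDerivWithinAt_mul (by simp) hgk).complexToReal_prod ?_
  rw [h.dsrc_complexToReal, h.dtgt_complexToReal, hvw]

end GroupoidData.IsLieGroupoid

namespace HolContactGroupoid

variable {E F G X : Type*}
  [NormedAddCommGroup E] [NormedSpace ℂ E] [NormedAddCommGroup F] [NormedSpace ℂ F]
  [TopologicalSpace G] [ChartedSpace E G] [IsManifold 𝓘(ℂ, E) ω G]
  [TopologicalSpace X] [ChartedSpace F X] [IsManifold 𝓘(ℂ, F) ω X]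
  [FiniteDimensional ℂ E] [FiniteDimensional ℂ F]
  (K : HolContactGroupoid E F G X)

open HolLineBundle

theorem hat_dsrc_fst (x : K.conormal.RProj) (v : E × ℝ) :
    (K.hat.dsrc ℝ (E × ℝ) (F × ℝ) x v).1 = K.grpd.dsrc ℂ E F x.base v.1 :=
  ((hasMFDerivAt_proj_base _).comp_eq (K.isLieGroupoid_hat.hasMFDerivAt_src (by simp) x)
    rfl).eq_apply (HasMFDerivAt.comp_eq
      (K.isLieGroupoid.hasMFDerivAt_src (by simp) x.base).complexToReal
      (hasMFDerivAt_proj_base x) rfl)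
    (Filter.Eventually.of_forall fun x => by
      obtain ⟨ε, rfl⟩ := exists_toProj_eq x
      rw [hat_src_toProj]
      exact K.tilde_src_base ε) v

theorem hat_dtgt_fst (x : K.conormal.RProj) (v : E × ℝ) :
    (K.hat.dtgt ℝ (E × ℝ) (F × ℝ) x v).1 = K.grpd.dtgt ℂ E F x.base v.1 :=
  ((hasMFDerivAt_proj_base _).comp_eq (K.isLieGroupoid_hat.hasMFDerivAt_tgt (by simp) x)
    rfl).eq_apply (HasMFDerivAt.comp_eq
      (K.isLieGroupoid.hasMFDerivAt_tgt (by simp) x.base).complexToReal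
      (hasMFDerivAt_proj_base x) rfl)
    (Filter.Eventually.of_forall fun x => by
      obtain ⟨ε, rfl⟩ := exists_toProj_eq x
      rw [hat_tgt_toProj]
      exact K.tilde_tgt_base ε) v

theorem hat_dinv_fst (x : K.conormal.RProj) (v : E × ℝ) :
    (K.hat.dinv ℝ (E × ℝ) x v).1 = K.grpd.dinv ℂ E x.base v.1 :=
  ((hasMFDerivAt_proj_base _).comp_eq (K.isLieGroupoid_hat.hasMFDerivAt_inv (by simp) x)
    rfl).eq_apply (HasMFDerivAt.comp_eq
      (K.isLieGroupoid.hasMFDerivAt_inv (by simp) x.base).complexToReal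
      (hasMFDerivAt_proj_base x) rfl)
    (Filter.Eventually.of_forall fun x => by
      obtain ⟨ε, rfl⟩ := exists_toProj_eq x
      rw [hat_inv_toProj]
      exact K.tilde_inv_base ε) v

theorem hat_done_fst (y : K.coreDual.RProj) (v : F × ℝ) :
    (K.hat.done ℝ (E × ℝ) (F × ℝ) y v).1 = K.grpd.done ℂ E F y.base v.1 :=
  ((hasMFDerivAt_proj_base _).comp_eq (K.isLieGroupoid_hat.hasMFDerivAt_one (by simp) y)
    rfl).eq_apply (HasMFDerivAt.comp_eq
      (K.isLieGroupoid.hasMFDerivAt_one (by simp) y.base).complexToReal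
      (hasMFDerivAt_proj_base y) rfl)
    (Filter.Eventually.of_forall fun x => rfl) v

theorem hat_dmul_fst {a b : K.conormal.Slit} (h : K.tilde.src a = K.tilde.tgt b) {v w : E × ℝ}
    (hvw : K.hat.dsrc ℝ (E × ℝ) (F × ℝ) (K.conormal.toProj a) v =
      K.hat.dtgt ℝ (E × ℝ) (F × ℝ) (K.conormal.toProj b) w) :
    (K.hat.dmul ℝ (E × ℝ) (K.conormal.toProj a) (K.conormal.toProj b) (v, w)).1 =
      K.grpd.dmul ℂ E a.base b.base (v.1, w.1) := by
  have : FiniteDimensional ℝ E := FiniteDimensional.complexToReal E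
  have : FiniteDimensional ℝ F := FiniteDimensional.complexToReal F
  have hab : K.grpd.src a.base = K.grpd.tgt b.base := (dualMul_mul h).1
  have hmaps : MapsTo (fun p : K.conormal.RProj × K.conormal.RProj => (p.1.base, p.2.base))
      K.hat.composable K.grpd.composable := by
    rintro ⟨y₁, y₂⟩ hy
    obtain ⟨a, rfl⟩ := exists_toProj_eq y₁
    obtain ⟨b, rfl, hab⟩ := exists_composable_right a hy
    exact (dualMul_mul hab).1
  have h1 : HasMFDerivWithinAt (𝓘(ℝ, E × ℝ).prod 𝓘(ℝ, E × ℝ)) 𝓘(ℝ, E)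
      (fun p : K.conormal.RProj × K.conormal.RProj => (K.hat.mul p.1 p.2).base) K.hat.composable
      (K.conormal.toProj a, K.conormal.toProj b)
      ((ContinuousLinearMap.fst ℝ E ℝ).comp
        (K.hat.dmul ℝ (E × ℝ) (K.conormal.toProj a) (K.conormal.toProj b)) :
        (E × ℝ) × (E × ℝ) →L[ℝ] E) :=
    HasMFDerivAt.comp_hasMFDerivWithinAt (g := (RProj.base : K.conormal.RProj → G)) _
      (hasMFDerivAt_proj_base _)
      (K.isLieGroupoid_hat.hasMFDerivWithinAt_mul (by simp) (hat_src_eq_tgt h))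
  have h2 : HasMFDerivAt (𝓘(ℝ, E × ℝ).prod 𝓘(ℝ, E × ℝ)) (𝓘(ℝ, E).prod 𝓘(ℝ, E))
      (fun p : K.conormal.RProj × K.conormal.RProj => (p.1.base, p.2.base))
      (K.conormal.toProj a, K.conormal.toProj b)
      (((ContinuousLinearMap.fst ℝ E ℝ).comp (ContinuousLinearMap.fst ℝ (E × ℝ) (E × ℝ))).prod
        ((ContinuousLinearMap.fst ℝ E ℝ).comp (ContinuousLinearMap.snd ℝ (E × ℝ) (E × ℝ))) :
        (E × ℝ) × (E × ℝ) →L[ℝ] E × E) :=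
    ((hasMFDerivAt_proj_base _).comp_eq (f := Prod.fst) (hasMFDerivAt_fst _) rfl).prodMk
      ((hasMFDerivAt_proj_base _).comp_eq (f := Prod.snd) (hasMFDerivAt_snd _) rfl)
  have h3 := (K.isLieGroupoid.complexToReal.hasMFDerivWithinAt_mul (by simp) hab).comp
    (K.conormal.toProj a, K.conormal.toProj b) h2.hasMFDerivWithinAt hmaps
  have h4 : HasMFDerivWithinAt (𝓘(ℝ, E × ℝ).prod 𝓘(ℝ, E × ℝ)) 𝓘(ℝ, E)
      (fun p : K.conormal.RProj × K.conormal.RProj => (K.hat.mul p.1 p.2).base) K.hat.composable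
      (K.conormal.toProj a, K.conormal.toProj b)
      ((K.grpd.dmul ℝ E a.base b.base).comp
        (((ContinuousLinearMap.fst ℝ E ℝ).comp (ContinuousLinearMap.fst ℝ (E × ℝ) (E × ℝ))).prod
        ((ContinuousLinearMap.fst ℝ E ℝ).comp (ContinuousLinearMap.snd ℝ (E × ℝ) (E × ℝ)))) :
        (E × ℝ) × (E × ℝ) →L[ℝ] E) := by
    have hbase : ∀ p ∈ K.hat.composable, (K.hat.mul p.1 p.2).base =
        K.grpd.mul p.1.base p.2.base := by
      rintro ⟨y₁, y₂⟩ hy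
      obtain ⟨a, rfl⟩ := exists_toProj_eq y₁
      obtain ⟨b, rfl, hab⟩ := exists_composable_right a hy
      change (K.hat.mul (K.conormal.toProj a) (K.conormal.toProj b)).base = _
      rw [hat_mul_toProj hab]
      exact tilde_mul_base hab
    exact h3.congr_of_eventuallyEq (Filter.eventually_of_mem self_mem_nhdsWithin hbase)
      (hbase _ (hat_src_eq_tgt h))
  refine (K.isLieGroupoid_hat.derivWithin_eq (by simp) (hat_src_eq_tgt h) h1 h4 hvw).trans ?_
  refine K.isLieGroupoid.dmul_complexToReal hab ?_
  have h5 := congrArg Prod.fst hvw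
  rwa [hat_dsrc_fst, hat_dtgt_fst] at h5

theorem evalAt_inv (ε : K.conormal.Slit) (v : E) :
    K.evalAt (K.tilde.inv ε) (K.grpd.dinv ℂ E ε.base v) = -K.evalAt ε v := by
  have hL := K.isLieGroupoid
  have h1 := (K.dualMul_iff.1 (K.dualMul_inv ε)).2.2 v (K.grpd.dinv ℂ E ε.base v)
    (by rw [tilde_inv_base, hL.dtgt_dinv (by simp)])
  rw [tilde_inv_base, hL.dmul_dinv (by simp), (K.evalAt_eq_zero_iff _ _).2] at h1
  · exact (neg_eq_of_add_eq_zero_right h1.symm).symm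
  · rw [tildeOne_base, tilde_tgt_base]
    exact K.done_mem _ _

theorem isMultiplicative_hatH : K.hat.IsMultiplicative ℝ (F := F × ℝ) K.hatH where
  one_mem := by
    rintro ⟨y, v⟩
    obtain ⟨η, rfl⟩ := exists_toProj_eq y
    refine (K.mem_hatH_iff (K.tildeOne η) (K.hat.done ℝ (E × ℝ) (F × ℝ) (K.coreDual.toProj η) v)).2 ?_
    refine (congrArg (fun e => (K.evalAt (K.tildeOne η) e).re) (K.hat_done_fst _ v)).trans ?_
    change (K.evalAt (K.tildeOne η) (K.grpd.done ℂ E F η.base (show F × ℝ from v).1)).re = 0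
    rw [(K.evalAt_eq_zero_iff (K.tildeOne η) _).2 (K.done_mem _ _), Complex.zero_re]
  inv_mem := by
    rintro ⟨x, v⟩ hv
    obtain ⟨ε, rfl⟩ := exists_toProj_eq x
    have h1 := (K.mem_hatH_iff ε v).1 hv
    have h2 : K.hat.dinv ℝ (E × ℝ) (K.conormal.toProj ε) v ∈
        K.hatH (K.conormal.toProj (K.tilde.inv ε)) := by
      refine (K.mem_hatH_iff _ (K.hat.dinv ℝ (E × ℝ) (K.conormal.toProj ε) v)).2 ?_
      have h3 : (K.hat.dinv ℝ (E × ℝ) (K.conormal.toProj ε) v).1 = K.grpd.dinv ℂ E ε.base v.1 :=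
        K.hat_dinv_fst _ v
      rw [h3, evalAt_inv, Complex.neg_re, h1, neg_zero]
    rw [← hat_inv_toProj] at h2
    exact h2
  mul_mem := by
    rintro ⟨x, v⟩ ⟨y, w⟩ hvw hv hw
    obtain ⟨h1, h2⟩ := tangentBundle_eq_iff.1 hvw
    obtain ⟨a, rfl⟩ := exists_toProj_eq x
    obtain ⟨b, rfl, hab⟩ := exists_composable_right a h1
    have h3 := (K.mem_hatH_iff a v).1 hv
    have h4 := (K.mem_hatH_iff b w).1 hw
    have h5 : K.hat.dmul ℝ (E × ℝ) (K.conormal.toProj a) (K.conormal.toProj b) (v, w) ∈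
        K.hatH (K.conormal.toProj (K.tilde.mul a b)) := by
      refine (K.mem_hatH_iff _
        (K.hat.dmul ℝ (E × ℝ) (K.conormal.toProj a) (K.conormal.toProj b) (v, w))).2 ?_
      have h6 := K.hat_dmul_fst hab h2
      have h7 := ((K.hat_dsrc_fst _ v).symm.trans (congrArg Prod.fst h2)).trans
        (K.hat_dtgt_fst _ w)
      have h8 := (K.dualMul_iff.1 (dualMul_mul hab)).2.2 _ _ h7
      refine (congrArg (fun e => (K.evalAt (K.tilde.mul a b) e).re) h6).trans ?_
      refine (congrArg Complex.re h8).trans ?_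
      rw [Complex.add_re, h3, h4, add_zero]
    rw [← hat_mul_toProj hab] at h5
    exact h5
  covers := by
    intro x u
    obtain ⟨ε, rfl⟩ := exists_toProj_eq x
    obtain ⟨w, hw⟩ := K.coreDual.dproj_surjective (K.tilde.src ε) u
    obtain ⟨v, hv, hvw⟩ := K.exists_dsrc_eq ε.base w.1
    obtain ⟨z, hz⟩ := exists_mfderiv_eq_of_cscale (ε := ε)
      ((K.contMDiff_tilde_src ε).mdifferentiableAt (by simp)) K.tilde_src_base tilde_src_cscale
      (K.isLieGroupoid.hasMFDerivAt_src (by simp) _) hvw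
    refine ⟨K.conormal.dproj ε (v, z), ?_, ?_⟩
    · refine (K.mem_hatH_iff ε _).2 ?_
      rw [dproj_fst, (K.evalAt_eq_zero_iff ε v).2 hv, Complex.zero_re]
    · refine (K.hat_dsrc_dproj ε (v, z)).trans ((congrArg _ ?_).trans hw)
      exact (K.isLieGroupoid_tilde.dsrc_complexToReal ε (v, z)).trans hz

end HolContactGroupoid
end

noncomputable section

attribute [local instance] isManifold_complexToReal

section

variable {𝕜 : Type*} [NontriviallyNormedField 𝕜]
  {E : Type*} [NormedAddCommGroup E] [NormedSpace 𝕜 E] {H : Type*} [TopologicalSpace H]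
  {I : ModelWithCorners 𝕜 E H} {M : Type*} [TopologicalSpace M] [ChartedSpace H M]
  {E' : Type*} [NormedAddCommGroup E'] [NormedSpace 𝕜 E'] {H' : Type*} [TopologicalSpace H']
  {I' : ModelWithCorners 𝕜 E' H'} {M' : Type*} [TopologicalSpace M'] [ChartedSpace H' M']
  {E'' : Type*} [NormedAddCommGroup E''] [NormedSpace 𝕜 E''] {H'' : Type*} [TopologicalSpace H'']
  {I'' : ModelWithCorners 𝕜 E'' H''} {M'' : Type*} [TopologicalSpace M''] [ChartedSpace H'' M'']

theorem HasMFDerivAt.comp_hasMFDerivWithinAt_eq {g : M' → M''} {f : M → M'} {s : Set M} {x : M}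
    {y : M'} {g' : E' →L[𝕜] E''} {f' : E →L[𝕜] E'} (hg : HasMFDerivAt I' I'' g y g')
    (hf : HasMFDerivWithinAt I I' f s x f') (hy : f x = y) :
    HasMFDerivWithinAt I I'' (fun z => g (f z)) s x (g'.comp f' : E →L[𝕜] E'') := by
  subst hy
  exact HasMFDerivAt.comp_hasMFDerivWithinAt x hg hf

end

namespace HolLineBundle

variable {E : Type*} [NormedAddCommGroup E] [NormedSpace ℂ E]
  {B : Type*} [TopologicalSpace B] [ChartedSpace E B] [IsManifold 𝓘(ℂ, E) ω B]
  {V : B → Type*} [∀ b, AddCommGroup (V b)] [∀ b, Module ℂ (V b)] {𝓛 : HolLineBundle E V}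

theorem exists_section_ne_zero [FiniteDimensional ℂ E] [T2Space B] (ε : 𝓛.Slit) :
    ∃ s : 𝓛.Sections, 𝓛.homogenize s.1 ε ≠ 0 := by
  obtain ⟨L, hL⟩ := exists_realFunctional_ne_zero (chartAt_slit_snd_ne_zero (mem_chart_source _ ε))
  obtain ⟨s, hs⟩ := exists_section_chart (mem_chart_source _ ε) (g := fun p => L p.2)
    (L.contDiff.comp contDiff_snd) (fun y c r => by
      have : (r : ℂ) * c = r • c := rfl
      rw [this, map_smul, smul_eq_mul])
  exact ⟨s, by rw [hs.self_of_nhds]; exact hL⟩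

/-- The differential of the homogeneous function of a section. -/
def dsection (s : 𝓛.Sections) (ε : 𝓛.Slit) : E × ℂ →L[ℝ] ℝ :=
  mfderiv 𝓘(ℝ, E × ℂ) 𝓘(ℝ, ℝ) (𝓛.homogenize s.1) ε

theorem hasMFDerivAt_dsection (s : 𝓛.Sections) (ε : 𝓛.Slit) :
    HasMFDerivAt 𝓘(ℝ, E × ℂ) 𝓘(ℝ, ℝ) (𝓛.homogenize s.1) ε (dsection s ε) :=
  hasMFDerivAt_homogenize s ε

theorem dsection_ext [FiniteDimensional ℂ E] [T2Space B] {ε : 𝓛.Slit} {v w : E × ℂ}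
    (h : ∀ s : 𝓛.Sections, dsection s ε v = dsection s ε w) : v = w := tangent_ext h

theorem pairing_eq_dsection [FiniteDimensional ℂ E] [T2Space B] (ε : 𝓛.Slit)
    (Δ : 𝓛.Gauge (𝓛.toProj ε)) (s : 𝓛.Sections) :
    𝓛.pairing ε (Δ.1 s) = dsection s ε (lift ε Δ) := isImage_lift ε Δ s

theorem exists_dsection_eq_of_dproj_eq_zero [FiniteDimensional ℂ E] [T2Space B] {ε : 𝓛.Slit}
    {v : E × ℂ} (hv : 𝓛.dproj ε v = 0) :
    ∃ k : ℝ, ∀ s : 𝓛.Sections, dsection s ε v = k * 𝓛.homogenize s.1 ε := by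
  have h1 := isImage_liftEquiv_symm ε v
  have h2 := isSymbol_dproj h1
  rw [hv] at h2
  obtain ⟨k, hk⟩ := exists_eq_mul_of_isSymbol_zero h2
  exact ⟨k, fun s => (h1 s).symm.trans (hk s)⟩

end HolLineBundle

namespace HolContactGroupoid

variable {E F G X : Type*}
  [NormedAddCommGroup E] [NormedSpace ℂ E] [NormedAddCommGroup F] [NormedSpace ℂ F]
  [TopologicalSpace G] [ChartedSpace E G] [IsManifold 𝓘(ℂ, E) ω G]
  [TopologicalSpace X] [ChartedSpace F X] [IsManifold 𝓘(ℂ, F) ω X]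
  [FiniteDimensional ℂ E] [FiniteDimensional ℂ F]
  {K : HolContactGroupoid E F G X}

open HolLineBundle

theorem exists_section_src (s : K.coreDual.Sections) : ∃ t : K.conormal.Sections,
    ∀ ε, K.conormal.homogenize t.1 ε = K.coreDual.homogenize s.1 (K.tilde.src ε) :=
  exists_section (fun ε r => by rw [tilde_src_rescale, homogenize_rescale])
    ((contMDiff_homogenize s).comp K.isLieGroupoid_tilde.complexToReal.contMDiff_src)

theorem exists_section_tgt (s : K.coreDual.Sections) : ∃ t : K.conormal.Sections,
    ∀ ε, K.conormal.homogenize t.1 ε = K.coreDual.homogenize s.1 (K.tilde.tgt ε) :=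
  exists_section (fun ε r => by rw [tilde_tgt_rescale, homogenize_rescale])
    ((contMDiff_homogenize s).comp K.isLieGroupoid_tilde.complexToReal.contMDiff_tgt)

theorem dsection_src {s : K.coreDual.Sections} {t : K.conormal.Sections}
    (h : ∀ ε, K.conormal.homogenize t.1 ε = K.coreDual.homogenize s.1 (K.tilde.src ε))
    (ε : K.conormal.Slit) (v : E × ℂ) :
    dsection t ε v = dsection s (K.tilde.src ε) (K.tilde.dsrc ℝ (E × ℂ) (F × ℂ) ε v) :=
  (hasMFDerivAt_dsection t ε).eq_apply ((hasMFDerivAt_dsection s _).comp_eq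
    (K.isLieGroupoid_tilde.complexToReal.hasMFDerivAt_src (by simp) ε) rfl)
    (Filter.Eventually.of_forall h) v

theorem dsection_tgt {s : K.coreDual.Sections} {t : K.conormal.Sections}
    (h : ∀ ε, K.conormal.homogenize t.1 ε = K.coreDual.homogenize s.1 (K.tilde.tgt ε))
    (ε : K.conormal.Slit) (v : E × ℂ) :
    dsection t ε v = dsection s (K.tilde.tgt ε) (K.tilde.dtgt ℝ (E × ℂ) (F × ℂ) ε v) :=
  (hasMFDerivAt_dsection t ε).eq_apply ((hasMFDerivAt_dsection s _).comp_eq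
    (K.isLieGroupoid_tilde.complexToReal.hasMFDerivAt_tgt (by simp) ε) rfl)
    (Filter.Eventually.of_forall h) v

omit [FiniteDimensional ℂ E] [FiniteDimensional ℂ F] in
theorem exists_pairSection_fst (s : K.conormal.Sections) : ∃ Φ : K.PairSections,
    ∀ p, Φ.1 p = K.conormal.homogenize s.1 p.1 :=
  ⟨⟨fun p => K.conormal.homogenize s.1 p.1,
    ((contMDiff_homogenize s).comp contMDiff_fst).contMDiffOn,
    fun ε₁ _ _ r => homogenize_rescale s.1 r ε₁⟩, fun _ => rfl⟩

omit [FiniteDimensional ℂ E] [FiniteDimensional ℂ F] in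
theorem exists_pairSection_snd (s : K.conormal.Sections) : ∃ Φ : K.PairSections,
    ∀ p, Φ.1 p = K.conormal.homogenize s.1 p.2 :=
  ⟨⟨fun p => K.conormal.homogenize s.1 p.2,
    ((contMDiff_homogenize s).comp contMDiff_snd).contMDiffOn,
    fun _ ε₂ _ r => homogenize_rescale s.1 r ε₂⟩, fun _ => rfl⟩

theorem exists_pairSection_mul (s : K.conormal.Sections) : ∃ Φ : K.PairSections,
    ∀ p, Φ.1 p = K.conormal.homogenize s.1 (K.tilde.mul p.1 p.2) :=
  ⟨⟨fun p => K.conormal.homogenize s.1 (K.tilde.mul p.1 p.2),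
    (contMDiff_homogenize s).comp_contMDiffOn
      K.isLieGroupoid_tilde.complexToReal.contMDiffOn_mul,
    fun ε₁ ε₂ h r => by
      change K.conormal.homogenize s.1 (K.tilde.mul _ _) = r * K.conormal.homogenize s.1 _
      rw [tilde_mul_rescale r h, homogenize_rescale]⟩, fun _ => rfl⟩

/-- Two derivatives on the composable pairs of `K.tilde` of functions which agree there coincide on
composable pairs of tangent vectors. -/
theorem tilde_derivWithin_eq {a b : K.conormal.Slit} (hab : K.tilde.src a = K.tilde.tgt b)
    {D : Type*} [NormedAddCommGroup D] [NormedSpace ℝ D] {M : Type*} [TopologicalSpace M]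
    [ChartedSpace D M] {f g : K.conormal.Slit × K.conormal.Slit → M}
    {A A' : (E × ℂ) × (E × ℂ) →L[ℝ] D}
    (hf : HasMFDerivWithinAt (𝓘(ℝ, E × ℂ).prod 𝓘(ℝ, E × ℂ)) 𝓘(ℝ, D) f K.tilde.composable (a, b) A)
    (hg : HasMFDerivWithinAt (𝓘(ℝ, E × ℂ).prod 𝓘(ℝ, E × ℂ)) 𝓘(ℝ, D) g K.tilde.composable (a, b) A')
    (hfg : ∀ p ∈ K.tilde.composable, f p = g p) {v w : E × ℂ}
    (hvw : K.tilde.dsrc ℝ (E × ℂ) (F × ℂ) a v = K.tilde.dtgt ℝ (E × ℂ) (F × ℂ) b w) :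
    A (v, w) = A' (v, w) := by
  have : FiniteDimensional ℝ E := FiniteDimensional.complexToReal E
  have : FiniteDimensional ℝ F := FiniteDimensional.complexToReal F
  refine K.isLieGroupoid_tilde.complexToReal.derivWithin_eq (by simp) hab hf
    (hg.congr_of_eventuallyEq (Filter.eventually_of_mem self_mem_nhdsWithin hfg) (hfg _ hab)) hvw

theorem hat_derivWithin_eq {a b : K.conormal.Slit} (hab : K.tilde.src a = K.tilde.tgt b)
    {f : K.conormal.RProj × K.conormal.RProj → ℝ} {A A' : (E × ℝ) × (E × ℝ) →L[ℝ] ℝ}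
    (hf : HasMFDerivWithinAt (𝓘(ℝ, E × ℝ).prod 𝓘(ℝ, E × ℝ)) 𝓘(ℝ, ℝ) f K.hat.composable
      (K.conormal.toProj a, K.conormal.toProj b) A)
    (hg : HasMFDerivWithinAt (𝓘(ℝ, E × ℝ).prod 𝓘(ℝ, E × ℝ)) 𝓘(ℝ, ℝ) f K.hat.composable
      (K.conormal.toProj a, K.conormal.toProj b) A') {v w : E × ℝ}
    (hvw : K.hat.dsrc ℝ (E × ℝ) (F × ℝ) (K.conormal.toProj a) v =
      K.hat.dtgt ℝ (E × ℝ) (F × ℝ) (K.conormal.toProj b) w) :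
    A (v, w) = A' (v, w) := by
  have : FiniteDimensional ℝ E := FiniteDimensional.complexToReal E
  have : FiniteDimensional ℝ F := FiniteDimensional.complexToReal F
  exact K.isLieGroupoid_hat.derivWithin_eq (by simp) (hat_src_eq_tgt hab) hf hg hvw

omit [FiniteDimensional ℂ E] [FiniteDimensional ℂ F] in
theorem hasMFDerivAt_toProj_prod (a b : K.conormal.Slit) :
    HasMFDerivAt (𝓘(ℝ, E × ℂ).prod 𝓘(ℝ, E × ℂ)) (𝓘(ℝ, E × ℝ).prod 𝓘(ℝ, E × ℝ))
      (fun p : K.conormal.Slit × K.conormal.Slit => (K.conormal.toProj p.1, K.conormal.toProj p.2))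
      (a, b) (((K.conormal.dproj a).comp (ContinuousLinearMap.fst ℝ (E × ℂ) (E × ℂ))).prod
        ((K.conormal.dproj b).comp (ContinuousLinearMap.snd ℝ (E × ℂ) (E × ℂ))) :
        (E × ℂ) × (E × ℂ) →L[ℝ] (E × ℝ) × (E × ℝ)) :=
  ((hasMFDerivAt_toProj a).comp_eq (f := Prod.fst) (hasMFDerivAt_fst _) rfl).prodMk
    ((hasMFDerivAt_toProj b).comp_eq (f := Prod.snd) (hasMFDerivAt_snd _) rfl)

theorem mapsTo_toProj : MapsTo (fun p : K.conormal.Slit × K.conormal.Slit =>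
    (K.conormal.toProj p.1, K.conormal.toProj p.2)) K.tilde.composable K.hat.composable :=
  fun _ hp => hat_src_eq_tgt hp

theorem hat_dsrc_dproj_eq {a b : K.conormal.Slit} (hab : K.tilde.src a = K.tilde.tgt b)
    {v w : E × ℂ}
    (hvw : K.tilde.dsrc ℝ (E × ℂ) (F × ℂ) a v = K.tilde.dtgt ℝ (E × ℂ) (F × ℂ) b w) :
    K.hat.dsrc ℝ (E × ℝ) (F × ℝ) (K.conormal.toProj a) (K.conormal.dproj a v) =
      K.hat.dtgt ℝ (E × ℝ) (F × ℝ) (K.conormal.toProj b) (K.conormal.dproj b w) := by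
  rw [hat_dsrc_dproj, hat_dtgt_dproj, hvw, hab]

theorem hat_dmul_dproj {a b : K.conormal.Slit} (hab : K.tilde.src a = K.tilde.tgt b) {v w : E × ℂ}
    (hvw : K.tilde.dsrc ℝ (E × ℂ) (F × ℂ) a v = K.tilde.dtgt ℝ (E × ℂ) (F × ℂ) b w) :
    K.hat.dmul ℝ (E × ℝ) (K.conormal.toProj a) (K.conormal.toProj b)
      (K.conormal.dproj a v, K.conormal.dproj b w) =
        K.conormal.dproj (K.tilde.mul a b) (K.tilde.dmul ℝ (E × ℂ) a b (v, w)) := by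
  have h1 := (hasMFDerivAt_toProj (K.tilde.mul a b)).comp_hasMFDerivWithinAt_eq
    (K.isLieGroupoid_tilde.complexToReal.hasMFDerivWithinAt_mul (by simp) hab) rfl
  have h2 := (K.isLieGroupoid_hat.hasMFDerivWithinAt_mul (by simp) (hat_src_eq_tgt hab)).comp (a, b)
    (hasMFDerivAt_toProj_prod a b).hasMFDerivWithinAt mapsTo_toProj
  exact (tilde_derivWithin_eq hab h1 h2 (fun p hp => (hat_mul_toProj hp).symm) hvw).symm

/-- The tangent vector `v` of the total space is the only one over `dproj v` with the same target. -/
theorem eq_of_dproj_eq [T2Space G] [T2Space X] {ε : K.conormal.Slit} {v w : E × ℂ}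
    (h : K.conormal.dproj ε v = K.conormal.dproj ε w)
    (h' : K.tilde.dtgt ℝ (E × ℂ) (F × ℂ) ε v = K.tilde.dtgt ℝ (E × ℂ) (F × ℂ) ε w) : v = w := by
  obtain ⟨k, hk⟩ := exists_dsection_eq_of_dproj_eq_zero (ε := ε) (v := v - w)
    (by rw [map_sub, h, sub_self])
  obtain ⟨s, hs⟩ := exists_section_ne_zero (K.tilde.tgt ε)
  obtain ⟨t, ht⟩ := exists_section_tgt s
  have h1 := hk t
  rw [dsection_tgt ht, map_sub, h', sub_self, map_zero, ht] at h1
  have h2 : k = 0 := (mul_eq_zero.1 h1.symm).resolve_right hs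
  refine sub_eq_zero.1 (dsection_ext (𝓛 := K.conormal) (ε := ε) fun s => ?_)
  rw [hk s, h2, zero_mul, map_zero]

end HolContactGroupoid
end

noncomputable section

attribute [local instance] isManifold_complexToReal

namespace HolContactGroupoid

variable {E F G X : Type*}
  [NormedAddCommGroup E] [NormedSpace ℂ E] [NormedAddCommGroup F] [NormedSpace ℂ F]
  [TopologicalSpace G] [ChartedSpace E G] [IsManifold 𝓘(ℂ, E) ω G]
  [TopologicalSpace X] [ChartedSpace F X] [IsManifold 𝓘(ℂ, F) ω X]
  [FiniteDimensional ℂ E] [FiniteDimensional ℂ F]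
  {K : HolContactGroupoid E F G X}

open HolLineBundle

theorem IsPairDerivation.exists_symbol {ε₁ ε₂ : K.conormal.Slit} {D : K.PairSections →ₗ[ℝ] ℝ}
    (hε : K.tilde.src ε₁ = K.tilde.tgt ε₂) (hD : K.IsPairDerivation ε₁ ε₂ D) :
    ∃ v₁ v₂ : E × ℝ, K.hat.dsrc ℝ (E × ℝ) (F × ℝ) (K.conormal.toProj ε₁) v₁ =
        K.hat.dtgt ℝ (E × ℝ) (F × ℝ) (K.conormal.toProj ε₂) v₂ ∧
      ∀ (f : K.conormal.RProj × K.conormal.RProj → ℝ) (A : (E × ℝ) × (E × ℝ) →L[ℝ] ℝ),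
        ContMDiffOn (𝓘(ℝ, E × ℝ).prod 𝓘(ℝ, E × ℝ)) 𝓘(ℝ, ℝ) ∞ f K.hat.composable →
        HasMFDerivWithinAt (𝓘(ℝ, E × ℝ).prod 𝓘(ℝ, E × ℝ)) 𝓘(ℝ, ℝ) f K.hat.composable
          (K.conormal.toProj ε₁, K.conormal.toProj ε₂) A →
        ∀ Φ Ψ : K.PairSections, (∀ p ∈ K.tilde.composable,
          Ψ.1 p = f (K.conormal.toProj p.1, K.conormal.toProj p.2) * Φ.1 p) →
        D Ψ = A (v₁, v₂) * Φ.1 (ε₁, ε₂) +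
          f (K.conormal.toProj ε₁, K.conormal.toProj ε₂) * D Φ := by
  obtain ⟨v₁, v₂, hv, h⟩ := hD
  have hv' := (tangentBundle_eq_iff.1 hv).2
  refine ⟨v₁, v₂, hv', fun f A hf hA Φ Ψ hΨ => ?_⟩
  refine (h f hf Φ Ψ hΨ).trans ?_
  have h1 := ((hf (K.conormal.toProj ε₁, K.conormal.toProj ε₂) (hat_src_eq_tgt hε)).mdifferentiableWithinAt (by simp)).hasMFDerivWithinAt
  exact congrArg (fun z => z * Φ.1 (ε₁, ε₂) + f (K.conormal.toProj ε₁, K.conormal.toProj ε₂) * D Φ)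
    (hat_derivWithin_eq hε h1 hA hv')

variable [T2Space G] [T2Space X]

theorem GaugeMul.lift_eq {ε₁ ε₂ : K.conormal.Slit} (hε : K.tilde.src ε₁ = K.tilde.tgt ε₂)
    {Δ₁ : K.conormal.Gauge (K.conormal.toProj ε₁)} {Δ₂ : K.conormal.Gauge (K.conormal.toProj ε₂)}
    {Δ : K.conormal.Gauge (K.conormal.toProj (K.tilde.mul ε₁ ε₂))}
    (h : K.GaugeMul ε₁ ε₂ Δ₁ Δ₂ Δ) :
    K.tilde.dsrc ℝ (E × ℂ) (F × ℂ) ε₁ (lift ε₁ Δ₁) =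
        K.tilde.dtgt ℝ (E × ℂ) (F × ℂ) ε₂ (lift ε₂ Δ₂) ∧
      lift (K.tilde.mul ε₁ ε₂) Δ = K.tilde.dmul ℝ (E × ℂ) ε₁ ε₂ (lift ε₁ Δ₁, lift ε₂ Δ₂) := by
  have hT := K.isLieGroupoid_tilde.complexToReal
  have hH := K.isLieGroupoid_hat
  have hfd : FiniteDimensional ℝ E := FiniteDimensional.complexToReal E
  have hfd' : FiniteDimensional ℝ F := FiniteDimensional.complexToReal F
  obtain ⟨D, hD, hs⟩ := h
  obtain ⟨v₁, v₂, hv, hD⟩ := hD.exists_symbol hε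
  have hmem : (ε₁, ε₂) ∈ K.tilde.composable := hε
  have smul_sec : ∀ {f : K.conormal.RProj → ℝ} {s s' : K.conormal.Sections},
      (∀ y, s'.1 y = f y • s.1 y) → ∀ ε, K.conormal.homogenize s'.1 ε =
        f (K.conormal.toProj ε) * K.conormal.homogenize s.1 ε := by
    intro f s s' h ε
    refine (congrArg (K.conormal.pairing ε) (h _)).trans ?_
    exact map_smul (K.conormal.pairing ε) _ _
  have hD₁ : ∀ s Φ, (∀ p, Φ.1 p = K.conormal.homogenize s.1 p.1) →
      D Φ = K.conormal.pairing ε₁ (Δ₁.1 s) := fun s Φ h => (hs s Φ).1 fun p _ => h p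
  have hD₂ : ∀ s Φ, (∀ p, Φ.1 p = K.conormal.homogenize s.1 p.2) →
      D Φ = K.conormal.pairing ε₂ (Δ₂.1 s) := fun s Φ h => (hs s Φ).2.1 fun p _ => h p
  have hD₃ : ∀ s Φ, (∀ p, Φ.1 p = K.conormal.homogenize s.1 (K.tilde.mul p.1 p.2)) →
      D Φ = K.conormal.pairing (K.tilde.mul ε₁ ε₂) (Δ.1 s) := fun s Φ h => (hs s Φ).2.2 fun p _ => h p
  -- the symbols
  have sym : ∀ {ε : K.conormal.Slit} {Ξ : K.conormal.Gauge (K.conormal.toProj ε)} (v : E × ℝ),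
      (∀ (f : K.conormal.RProj → ℝ) (L : E × ℝ →L[ℝ] ℝ), ContMDiff 𝓘(ℝ, E × ℝ) 𝓘(ℝ, ℝ) ∞ f →
        HasMFDerivAt 𝓘(ℝ, E × ℝ) 𝓘(ℝ, ℝ) f (K.conormal.toProj ε) L →
        ∀ s s' : K.conormal.Sections, (∀ ε, K.conormal.homogenize s'.1 ε =
          f (K.conormal.toProj ε) * K.conormal.homogenize s.1 ε) →
        K.conormal.pairing ε (Ξ.1 s') = L v * K.conormal.homogenize s.1 ε +
          f (K.conormal.toProj ε) * K.conormal.pairing ε (Ξ.1 s)) →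
      K.conormal.dproj ε (lift ε Ξ) = v := by
    intro ε Ξ v h
    refine symbol_unique (isSymbol_dproj (isImage_lift ε Ξ)) (fun f hf s s' hss' => ?_)
    refine pairing_injective ε ?_
    have hL : HasMFDerivAt 𝓘(ℝ, E × ℝ) 𝓘(ℝ, ℝ) f (K.conormal.toProj ε)
        (mfderiv 𝓘(ℝ, E × ℝ) 𝓘(ℝ, ℝ) f (K.conormal.toProj ε) : E × ℝ →L[ℝ] ℝ) :=
      ((hf (K.conormal.toProj ε)).mdifferentiableAt (by simp)).hasMFDerivAt
    rw [h f _ hf hL s s' (smul_sec hss'), map_add, map_smul, map_smul]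
    rfl
  have e₁ : K.conormal.dproj ε₁ (lift ε₁ Δ₁) = v₁ := by
    refine sym v₁ fun f L hf hL s s' hss' => ?_
    obtain ⟨Φ, hΦ⟩ := exists_pairSection_fst s
    obtain ⟨Ψ, hΨ⟩ := exists_pairSection_fst s'
    have hA := (hL.comp_eq (f := Prod.fst) (hasMFDerivAt_fst
      (I := 𝓘(ℝ, E × ℝ)) (I' := 𝓘(ℝ, E × ℝ)) (K.conormal.toProj ε₁, K.conormal.toProj ε₂))
        rfl).hasMFDerivWithinAt (s := K.hat.composable)
    have h1 := hD (fun p => f p.1) _ (hf.comp contMDiff_fst).contMDiffOn hA Φ Ψ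
      (fun p _ => by rw [hΨ, hΦ, hss'])
    rw [hD₁ s Φ hΦ, hD₁ s' Ψ hΨ, hΦ] at h1
    exact h1
  have e₂ : K.conormal.dproj ε₂ (lift ε₂ Δ₂) = v₂ := by
    refine sym v₂ fun f L hf hL s s' hss' => ?_
    obtain ⟨Φ, hΦ⟩ := exists_pairSection_snd s
    obtain ⟨Ψ, hΨ⟩ := exists_pairSection_snd s'
    have hA := (hL.comp_eq (f := Prod.snd) (hasMFDerivAt_snd
      (I := 𝓘(ℝ, E × ℝ)) (I' := 𝓘(ℝ, E × ℝ)) (K.conormal.toProj ε₁, K.conormal.toProj ε₂))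
        rfl).hasMFDerivWithinAt (s := K.hat.composable)
    have h1 := hD (fun p => f p.2) _ (hf.comp contMDiff_snd).contMDiffOn hA Φ Ψ
      (fun p _ => by rw [hΨ, hΦ, hss'])
    rw [hD₂ s Φ hΦ, hD₂ s' Ψ hΨ, hΦ] at h1
    exact h1
  have e₃ : K.conormal.dproj (K.tilde.mul ε₁ ε₂) (lift (K.tilde.mul ε₁ ε₂) Δ) =
      K.hat.dmul ℝ (E × ℝ) (K.conormal.toProj ε₁) (K.conormal.toProj ε₂) (v₁, v₂) := by
    refine sym _ fun f L hf hL s s' hss' => ?_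
    obtain ⟨Φ, hΦ⟩ := exists_pairSection_mul s
    obtain ⟨Ψ, hΨ⟩ := exists_pairSection_mul s'
    have hA := hL.comp_hasMFDerivWithinAt_eq
      (hH.hasMFDerivWithinAt_mul (by simp) (hat_src_eq_tgt hε)) (hat_mul_toProj hε)
    have h1 := hD (fun p => f (K.hat.mul p.1 p.2)) _ (hf.comp_contMDiffOn hH.contMDiffOn_mul) hA Φ Ψ
      (fun p hp => by rw [hΨ, hΦ, hss', hat_mul_toProj hp])
    rw [hD₃ s Φ hΦ, hD₃ s' Ψ hΨ, hΦ, hat_mul_toProj hε] at h1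
    exact h1
  have hw : K.tilde.dsrc ℝ (E × ℂ) (F × ℂ) ε₁ (lift ε₁ Δ₁) =
      K.tilde.dtgt ℝ (E × ℂ) (F × ℂ) ε₂ (lift ε₂ Δ₂) := by
    refine dsection_ext (𝓛 := K.coreDual) (ε := K.tilde.src ε₁) fun s => ?_
    obtain ⟨t, ht⟩ := exists_section_src s
    obtain ⟨t', ht'⟩ := exists_section_tgt s
    obtain ⟨Φ, hΦ⟩ := exists_pairSection_fst t
    have h1 := hD₁ t Φ hΦ
    have h2 := (hs t' Φ).2.1 fun p hp => by rw [hΦ, ht, ht', hp]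
    rw [h1, pairing_eq_dsection, pairing_eq_dsection, dsection_src ht, dsection_tgt ht', ← hε] at h2
    exact h2
  refine ⟨hw, ?_⟩
  apply eq_of_dproj_eq (K := K)
  · rw [e₃, ← hat_dmul_dproj hε hw, e₁, e₂]
  · rw [hT.dtgt_dmul (by simp) hε hw]
    refine dsection_ext (𝓛 := K.coreDual) (ε := K.tilde.tgt ε₁) fun s => ?_
    obtain ⟨t, ht⟩ := exists_section_tgt s
    obtain ⟨Φ, hΦ⟩ := exists_pairSection_fst t
    have h1 := hD₁ t Φ hΦ
    have h2 := (hs t Φ).2.2 fun p hp => by rw [hΦ, ht, ht, hT.isGroupoid.tgt_mul _ _ hp]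
    rw [h1, pairing_eq_dsection, pairing_eq_dsection, dsection_tgt ht, dsection_tgt ht,
      hT.isGroupoid.tgt_mul _ _ hε] at h2
    exact h2.symm

/-- The differential at a composable pair of a section of the pulled back line bundle. -/
def pairDeriv (ε₁ ε₂ : K.conormal.Slit) (Φ : K.PairSections) : (E × ℂ) × (E × ℂ) →L[ℝ] ℝ :=
  mfderivWithin (𝓘(ℝ, E × ℂ).prod 𝓘(ℝ, E × ℂ)) 𝓘(ℝ, ℝ) Φ.1 K.tilde.composable (ε₁, ε₂)

omit [FiniteDimensional ℂ E] [FiniteDimensional ℂ F] [T2Space G] [T2Space X] in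
theorem hasMFDerivWithinAt_pairDeriv {ε₁ ε₂ : K.conormal.Slit}
    (hε : K.tilde.src ε₁ = K.tilde.tgt ε₂) (Φ : K.PairSections) :
    HasMFDerivWithinAt (𝓘(ℝ, E × ℂ).prod 𝓘(ℝ, E × ℂ)) 𝓘(ℝ, ℝ) Φ.1 K.tilde.composable (ε₁, ε₂)
      (pairDeriv ε₁ ε₂ Φ) :=
  ((Φ.2.1 (ε₁, ε₂) hε).mdifferentiableWithinAt (by simp)).hasMFDerivWithinAt

omit [T2Space X] in
theorem gaugeMul_of_lift_eq {ε₁ ε₂ : K.conormal.Slit} (hε : K.tilde.src ε₁ = K.tilde.tgt ε₂)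
    {Δ₁ : K.conormal.Gauge (K.conormal.toProj ε₁)} {Δ₂ : K.conormal.Gauge (K.conormal.toProj ε₂)}
    {Δ : K.conormal.Gauge (K.conormal.toProj (K.tilde.mul ε₁ ε₂))}
    (h : K.tilde.dsrc ℝ (E × ℂ) (F × ℂ) ε₁ (lift ε₁ Δ₁) =
        K.tilde.dtgt ℝ (E × ℂ) (F × ℂ) ε₂ (lift ε₂ Δ₂))
    (h' : lift (K.tilde.mul ε₁ ε₂) Δ = K.tilde.dmul ℝ (E × ℂ) ε₁ ε₂ (lift ε₁ Δ₁, lift ε₂ Δ₂)) :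
    K.GaugeMul ε₁ ε₂ Δ₁ Δ₂ Δ := by
  have hT := K.isLieGroupoid_tilde.complexToReal
  set w₁ := lift ε₁ Δ₁
  set w₂ := lift ε₂ Δ₂
  let D : K.PairSections →ₗ[ℝ] ℝ := {
    toFun := fun Φ => pairDeriv ε₁ ε₂ Φ (w₁, w₂)
    map_add' := fun Φ Ψ => tilde_derivWithin_eq hε (hasMFDerivWithinAt_pairDeriv hε (Φ + Ψ))
      ((hasMFDerivWithinAt_pairDeriv hε Φ).add (hasMFDerivWithinAt_pairDeriv hε Ψ))
      (fun _ _ => rfl) h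
    map_smul' := fun r Φ => tilde_derivWithin_eq hε (hasMFDerivWithinAt_pairDeriv hε (r • Φ))
      ((hasMFDerivWithinAt_pairDeriv hε Φ).const_smul r) (fun _ _ => rfl) h }
  refine ⟨D, ⟨K.conormal.dproj ε₁ w₁, K.conormal.dproj ε₂ w₂, ?_, ?_⟩, ?_⟩
  · exact tangentBundle_eq_iff.2 ⟨hat_src_eq_tgt hε, hat_dsrc_dproj_eq hε h⟩
  · intro f hf Φ Ψ hΨ
    have h1 := ((hf (K.conormal.toProj ε₁, K.conormal.toProj ε₂) (hat_src_eq_tgt hε)).mdifferentiableWithinAt (by simp)).hasMFDerivWithinAt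
    set A : (E × ℝ) × (E × ℝ) →L[ℝ] ℝ := mfderivWithin (𝓘(ℝ, E × ℝ).prod 𝓘(ℝ, E × ℝ)) 𝓘(ℝ, ℝ) f
      K.hat.composable (K.conormal.toProj ε₁, K.conormal.toProj ε₂)
    have h2 := h1.comp (ε₁, ε₂) (hasMFDerivAt_toProj_prod ε₁ ε₂).hasMFDerivWithinAt mapsTo_toProj
    have h3 := h2.mul' (hasMFDerivWithinAt_pairDeriv hε Φ)
    have h4 := tilde_derivWithin_eq hε (hasMFDerivWithinAt_pairDeriv hε Ψ) h3 hΨ h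
    refine h4.trans ?_
    rw [add_comm]
    rfl
  · intro s Φ
    refine ⟨fun hΦ => ?_, fun hΦ => ?_, fun hΦ => ?_⟩
    · rw [pairing_eq_dsection]
      exact tilde_derivWithin_eq hε (hasMFDerivWithinAt_pairDeriv hε Φ)
        ((hasMFDerivAt_dsection s ε₁).comp_eq (f := Prod.fst) (hasMFDerivAt_fst (ε₁, ε₂))
          rfl).hasMFDerivWithinAt hΦ h
    · rw [pairing_eq_dsection]
      exact tilde_derivWithin_eq hε (hasMFDerivWithinAt_pairDeriv hε Φ)
        ((hasMFDerivAt_dsection s ε₂).comp_eq (f := Prod.snd) (hasMFDerivAt_snd (ε₁, ε₂))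
          rfl).hasMFDerivWithinAt hΦ h
    · rw [pairing_eq_dsection, h']
      exact tilde_derivWithin_eq hε (hasMFDerivWithinAt_pairDeriv hε Φ)
        ((hasMFDerivAt_dsection s _).comp_hasMFDerivWithinAt_eq
          (hT.hasMFDerivWithinAt_mul (by simp) hε) rfl) hΦ h

theorem GaugeMul.complexStructure {N : K.conormal.AtiyahTensor}
    (hN : K.conormal.IsGaugeComplexStructure N) {ε₁ ε₂ : K.conormal.Slit}
    (hε : K.tilde.src ε₁ = K.tilde.tgt ε₂)
    {Δ₁ : K.conormal.Gauge (K.conormal.toProj ε₁)} {Δ₂ : K.conormal.Gauge (K.conormal.toProj ε₂)}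
    {Δ : K.conormal.Gauge (K.conormal.toProj (K.tilde.mul ε₁ ε₂))}
    (h : K.GaugeMul ε₁ ε₂ Δ₁ Δ₂ Δ) :
    K.GaugeMul ε₁ ε₂ (N.toFun _ Δ₁) (N.toFun _ Δ₂) (N.toFun _ Δ) := by
  have hT := K.isLieGroupoid_tilde
  obtain ⟨h1, h2⟩ := h.lift_eq hε
  have h1' := h1
  rw [hT.dsrc_complexToReal, hT.dtgt_complexToReal] at h1'
  have h3 : K.tilde.dsrc ℂ (E × ℂ) (F × ℂ) ε₁ (Complex.I • lift ε₁ Δ₁ : E × ℂ) =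
      K.tilde.dtgt ℂ (E × ℂ) (F × ℂ) ε₂ (Complex.I • lift ε₂ Δ₂ : E × ℂ) := by
    rw [map_smul, map_smul, h1']
  refine gaugeMul_of_lift_eq hε ?_ ?_
  · rw [hN.lift_eq, hN.lift_eq, hT.dsrc_complexToReal, hT.dtgt_complexToReal, h3]
  · rw [hN.lift_eq, hN.lift_eq, hN.lift_eq, h2, hT.dmul_complexToReal hε h1',
      hT.dmul_complexToReal hε h3, ← map_smul]
    rfl

theorem isMultiplicativeTensor {N : K.conormal.AtiyahTensor}
    (hN : K.conormal.IsGaugeComplexStructure N) : K.IsMultiplicativeTensor N :=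
  fun _ _ hε _ _ _ hΔ _ _ _ hψ => hψ _ _ _ (hΔ.complexStructure hN hε)

end HolContactGroupoid
end

noncomputable section

theorem mainTheorem11 {E F G X : Type*}
    [NormedAddCommGroup E] [NormedSpace ℂ E] [FiniteDimensional ℂ E]
    [NormedAddCommGroup F] [NormedSpace ℂ F] [FiniteDimensional ℂ F]
    [TopologicalSpace G] [ChartedSpace E G] [IsManifold 𝓘(ℂ, E) ω G]
    [TopologicalSpace X] [ChartedSpace F X] [IsManifold 𝓘(ℂ, F) ω X]
    (K : HolContactGroupoid E F G X) :
    (∃! j : K.conormal.AtiyahTensor, K.conormal.IsGaugeComplexStructure j) ∧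
      ∀ j : K.conormal.AtiyahTensor, K.conormal.IsGaugeComplexStructure j →
        (∀ x Δ, j.toFun x (j.toFun x Δ) = -Δ) ∧ K.IsMultiplicativeTensor j ∧
          K.IsContactNijenhuisGroupoid j := by
  have := K.isLieGroupoid.t2_arrows
  have := K.isLieGroupoid.t2_objects
  exact ⟨HolLineBundle.existsUnique_gaugeComplexStructure, fun j hj => ⟨hj.apply_apply,
    HolContactGroupoid.isMultiplicativeTensor hj,
    { isLieGroupoid := K.isLieGroupoid_hat
      isContactNijenhuis := K.isContactNijenhuis hj
      isMultiplicative := K.isMultiplicative_hatH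
      isMultiplicativeTensor := HolContactGroupoid.isMultiplicativeTensor hj }⟩⟩

end
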